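/- **Setting.** Let $t=q^{1/2}\in\mathbb C^\times$ not be a root of unity, put $[n]=\dfrac{q^{-n/2}-(-1)^nq^{n/2}}{q^{-1/2}+q^{1/2}}$, and fix square roots $\kappa_1=\sqrt{[4]/(q[2])}$, $\kappa_2=\sqrt{q^{-1}[3]}$, $\nu=\sqrt{-(q-q^{-1})/(q^4-q^{-4})}$; $\kappa_3=\kappa_1\kappa_2$. Tensor products of superalgebras are $\mathbb Z_2$-graded. *$\mathcal U=U_q[osp(1|2)]$* has even generators $K^{\pm1}$ and odd generators $v_\pm$ with $Kv_\pm=q^{\pm1/2}v_\pm K$, $\{v_+,v_-\}=-\frac{K^2-K^{-2}}{q^4-q^{-4}}$, $\Delta(K)=K\otimes K$, $\Delta(v_\pm)=v_\pm\otimes K^{-1}+K\otimes v_\pm$. Its representation $D^1$ on $V^{(1)}=\langle e_1,e_0,e_{-1}\rangle$ ($e_m$ of parity $1-m$) is $Ke_m=q^{m/2}e_m$, $v_+e_0=\nu e_1$, $v_+e_{-1}=\nu e_0$, $v_-e_1=\nu e_0$, $v_-e_0=-\nu e_{-1}$, $v_+e_1=v_-e_{-1}=0$. Its adjoint representation $D^2$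 on $V^{(2)}=\langle Y_2,\dots,Y_{-2}\rangle$ ($Y_m$ of parity $m$) is $KY_m=q^{m/2}Y_m$; $v_+$ sends $Y_1,Y_0,Y_{-1},Y_{-2}$ to $\nu t\kappa_1Y_2$, $\nu t\kappa_2Y_1$, $\nu t\kappa_2Y_0$, $\nu t\kappa_1Y_{-1}$ and $Y_2$ to $0$; $v_-$ sends $Y_2,Y_1,Y_0,Y_{-1}$ to $\nu t\kappa_1Y_1$, $-\nu t\kappa_2Y_0$, $\nu t\kappa_2Y_{-1}$, $-\nu t\kappa_1Y_{-2}$ and $Y_{-2}$ to $0$. *$\mathcal A=OSp_q(1|2)$* is generated by the entries of $T^{(1)}(0)=(T_{ij})=\begin{pmatrix}a&\alpha&b\\ \gamma&e&\beta\\ c&\delta&d\end{pmatrix}$, indices $i,j\in\{0,1,2\}$, $T_{ij}$ of parity $i+j$, subject to the product law for the couplings of $V^{(1)}\otimes V^{(1)}$ to $\ell=0,1$. Writing $e_0',e_1',e_2'$ for $e_1,e_0,e_{-1}$, the coupled vectors $\sum c_{ij}e_i'\otimes e_j'$ are $$t\,e_{-1}\otimes e_1+e_0\otimes e_0-t^{-1}e_1\otimes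 e_{-1}\qquad(\ell=0,\text{ coefficients }c_{ij}),$$ $$t^{-1}e_1\otimes e_0-t\,e_0\otimes e_1,\quad e_{-1}\otimes e_1+(t+t^{-1})e_0\otimes e_0-e_1\otimes e_{-1},\quad t\,e_{-1}\otimes e_0-t^{-1}e_0\otimes e_{-1}\qquad(\ell=1,\text{ coefficients }c^M_{ij},\ M=0,1,2).$$ With $\mathbb T_{kl,ij}=(-1)^{(k+i)l}T_{ki}T_{lj}$, $c'_{ij}=(-1)^{ij}c_{ij}$, $c'^M_{ij}=(-1)^{ij+M}c^M_{ij}$, the defining relations are, for all $i,j,k,l,M$, $$\sum_{i,j}c_{ij}\mathbb T_{kl,ij}=c_{kl},\quad \sum_{k,l}c'_{kl}\mathbb T_{kl,ij}=c'_{ij},\quad \sum_{i,j}c^M_{ij}\mathbb T_{kl,ij}=\sum_N(-1)^{N+M}c^N_{kl}T_{NM},\quad \sum_{k,l}c'^M_{kl}\mathbb T_{kl,ij}=\sum_N(-1)^{N+M}c'^N_{ij}T_{MN}.$$ The coproduct and counit are $\Delta(T_{ij})=\sum_kT_{ik}\otimes T_{kj}$, $\varepsilon(T_{ij})=\delta_{ij}$.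 For $u=xv_++yv_-$ the pairings $\langle u,\cdot\rangle,\langle K^{\pm1},\cdot\rangle:\mathcal A\to\mathbb C$ are determined by $\langle X,T_{ij}\rangle=(-1)^{|X|i}D^1(X)_{ij}$, by $\langle K^{\pm1},\cdot\rangle$ being algebra homomorphisms, and by $\langle u,fg\rangle=\langle u,f\rangle\langle K^{-1},g\rangle+\langle K,f\rangle\langle u,g\rangle$, $\langle u,1\rangle=0$. Put $f\odot u=(-1)^{|f|}(\langle u,\cdot\rangle\otimes\mathrm{id})\Delta(f)$ (extended linearly), let $\rho$ be the algebra automorphism of $\mathcal A$ that changes the sign of the first and third rows of $T^{(1)}(0)$ and fixes the middle row, and let $$T^{(2)}(0)=\begin{pmatrix} a^2&\kappa_1a\alpha&\kappa_3ab&\kappa_1\alpha b&b^2\\ \kappa_1a\gamma&ae+q^{-1}\gamma\alpha&\kappa_2(a\beta+q^{-1}\gamma b)&-\alpha\beta+q^{-1}eb&\kappa_1b\beta\\ \kappa_3ac&\kappa_2(a\delta+c\alpha)&ad+q^{-1}[2]\alpha\delta+q^{-2}bc&\kappa_2(\alpha d+\delta b)&\kappa_3bd\\ \kappa_1\gamma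 c&\gamma\delta+q^{-1}ce&\kappa_2(\gamma d+q^{-1}c\beta)&ed+q^{-1}\beta\delta&\kappa_1\beta d\\ c^2&\kappa_1c\delta&\kappa_3cd&\kappa_1\delta d&d^2\end{pmatrix},$$ with rows and columns indexed by $m=2,1,0,-1,-2$. *Covariant relations.* In the free algebra on $Y_2,\dots,Y_{-2}$ let $$\begin{aligned}E^0_0&=q^{-1}Y_2Y_{-2}-q^{-1/2}Y_1Y_{-1}-Y_0^2+q^{1/2}Y_{-1}Y_1+qY_{-2}Y_2,\\ E^1_1&=\kappa_1Y_2Y_{-1}-q\kappa_2Y_1Y_0-q^2\kappa_2Y_0Y_1+q^3\kappa_1Y_{-1}Y_2,\\ E^2_2&=-\kappa_1Y_2Y_0+q^{3/2}\kappa_2Y_1^2+q^3\kappa_1Y_0Y_2,\\ E^3_3&=-Y_2Y_1+q^2Y_1Y_2\end{aligned}$$ (the images of highest weight vectors of $V^{(2)}\otimes V^{(2)}$) and $E^L_{L-k}=v_-^k\cdot E^L_L$, where $v_-$ acts on products of two coordinates through $\Delta(v_-)$. For $\xi,r\in\mathbb C$ let $S(\xi,r)$ be the algebra generated by the $Y_m$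 with the sixteen relations $$E^0_0=r,\qquad E^1_M=0,\qquad v_-^k\cdot E^2_2=\xi\,v_-^k\cdot Y_2\ (0\le k\le4),\qquad E^3_M=0 .$$ **Theorem.** 1. $T^{(2)}(0)$ is a corepresentation matrix, $\Delta(T^{(2)}_{mn})=\sum_kT^{(2)}_{mk}\otimes T^{(2)}_{kn}$, $\varepsilon(T^{(2)}_{mn})=\delta_{mn}$, and it is dual to $D^2$: $\langle X,T^{(2)}_{mn}\rangle=(-1)^{|X|m}D^2(X)_{mn}$ for $X=K^{\pm1}$ and $X=xv_++yv_-$ with $x,y\in\mathbb C$. For all $\xi,r$ the formula $Y_m\mapsto\sum_nY_n\otimes T^{(2)}_{nm}$ extends to an algebra homomorphism $S(\xi,r)\to S(\xi,r)\otimes\mathcal A$. 2. For all $\xi,r$ the sixteen relations are linearly independent, and with $\chi=\xi/(\kappa_1q^2(q^2+q+1))$ their linear span is also spanned by the radius relation $E^0_0=r$, the ten commutation relations $$\begin{aligned} Y_1Y_2&=q^{-2}Y_2Y_1,\qquad Y_{-2}Y_{-1}=q^{-2}Y_{-1}Y_{-2},\\ Y_0Y_2&=q^{-4}Y_2Y_0+\chi\kappa_1^2(q+1)Y_2,\qquad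 Y_{-2}Y_0=q^{-4}Y_0Y_{-2}+\chi\kappa_1^2(q+1)Y_{-2},\\ Y_{-1}Y_2&=q^{-6}Y_2Y_{-1}+\chi\kappa_3(1+q^{-1})Y_1,\qquad Y_{-2}Y_1=q^{-6}Y_1Y_{-2}+\chi\kappa_3(1+q^{-1})Y_{-1},\\ Y_0Y_1&=q^{-2}Y_1Y_0+\chi(q+1)Y_1,\qquad Y_{-1}Y_0=q^{-2}Y_0Y_{-1}+\chi(q+1)Y_{-1},\\ Y_{-1}Y_1&=-q^{-1}Y_1Y_{-1}+q^{-3/2}(q^2-1)Y_0^2-\chi q^{1/2}(q+1)Y_0,\\ Y_{-2}Y_2&=-q^{-4}(q^5-q-1)Y_2Y_{-2}+q^{-9/2}(q^5-1)(q+1)Y_1Y_{-1}+\chi q^{-2}(q^2-q+1)(q+1)^2Y_0, \end{aligned}$$ the two relations $$Y_1^2=\tfrac{\kappa_1}{\kappa_2}\big(q^{-5/2}(q-1)Y_2Y_0-\chi q^{-1/2}Y_2\big),\qquad Y_{-1}^2=\tfrac{\kappa_1}{\kappa_2}\big(q^{-5/2}(q-1)Y_0Y_{-2}-\chi q^{-1/2}Y_{-2}\big),$$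 and the three constraints $$\begin{aligned}Y_1Y_0&=\kappa_3q^{-1}Y_2Y_{-1}+\chi Y_1,\qquad Y_0Y_{-1}=\kappa_3q^{-1}Y_1Y_{-2}+\chi Y_{-1},\\ Y_0^2&=\kappa_1^2Y_2Y_{-2}-q^{-5/2}(q^3+q^2+1)Y_1Y_{-1}+\chi Y_0.\end{aligned}$$ 3. (Consistency.) In the algebra defined by the $L=1,2,3$ relations alone, $E^0_0$ commutes with every $Y_m$. The normally ordered monomials $Y_2^iY_1^{\epsilon}Y_0^j$ and $Y_0^jY_{-1}^{\epsilon}Y_{-2}^i$ ($i,j\ge0$, $\epsilon\in\{0,1\}$, those common to both families counted once) form a basis of $S(\xi,r)$ if and only if $$r=r(\xi):=\frac{q\,\xi^2}{(q^2+1)(q^2+q+1)^2}.$$ Thus the consistent algebras form the one-parameter family $S(\xi):=S(\xi,r(\xi))$, $\xi\in\mathbb C$, of noncommutative superspheres. 4. (Realization.) Let $\sqrt{g_1},\sqrt{g_3}\in\mathbb C$ be not both zero, $\mathcal P_R=-\sqrt{g_3}\,v_++\sqrt{g_1}\,v_-$, and $$X_k=g_1T^{(2)}_{2,k}-\tfrac{\kappa_1}{\kappa_2}\sqrt{g_1}\sqrt{g_3}\,T^{(2)}_{0,k}+g_3T^{(2)}_{-2,k},\qquad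 \xi=\tfrac{\kappa_1^2}{\kappa_2}(1-q^3)\sqrt{g_1}\sqrt{g_3}.$$ Then $X_k\odot\mathcal P_R=0$ for $k=\pm2,\pm1,0$; the set $\{f\in\mathcal A: f\odot\mathcal P_R=0\}$ contains $1$ and is closed under products; and $Y_k\mapsto X_k$ defines an injective algebra homomorphism $S(\xi)\to\mathcal A$ whose image is $\{f\in\mathcal A: f\odot\mathcal P_R=0 \text{ and } \rho(f)=f\}$. Every $\xi\in\mathbb C$ arises in this way. -/

import Mathlib

open scoped TensorProduct DirectSum

noncomputable section

namespace QSphere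

/-- A complex superalgebra, encoded by its parity involution: `par` is the algebra automorphism
that fixes the even elements and changes the sign of the odd ones. -/
class SuperAlg (A : Type) [Ring A] [Algebra ℂ A] where
  par : A →ₐ[ℂ] A
  par_par : ∀ a, par (par a) = a

open SuperAlg

/-- The sign `(-1)^n`. -/
def sg (n : ℕ) : ℂ := (-1) ^ n

section Grading

variable (A : Type) [Ring A] [Algebra ℂ A] [SuperAlg A]

/-- The homogeneous components: `gr A 0` is the even part and `gr A 1` the odd part. -/
def gr (i : ZMod 2) : Submodule ℂ A :=
  LinearMap.ker (par.toLinearMap - (if i = 0 then (1 : ℂ) else -1) • LinearMap.id (M := A))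

variable {A}

lemma mem_gr {i : ZMod 2} {a : A} : a ∈ gr A i ↔ par a = (if i = 0 then (1 : ℂ) else -1) • a := by
  simp only [gr, LinearMap.mem_ker, LinearMap.sub_apply, LinearMap.smul_apply, LinearMap.id_apply,
    AlgHom.toLinearMap_apply, sub_eq_zero]

lemma mem_gr_zero {a : A} : a ∈ gr A 0 ↔ par a = a := by
  rw [mem_gr, if_pos rfl, one_smul]

lemma mem_gr_one {a : A} : a ∈ gr A 1 ↔ par a = -a := by
  rw [mem_gr, if_neg one_ne_zero, neg_one_smul]

lemma mem_gr_cast {n : ℕ} {a : A} (h : par a = sg n • a) : a ∈ gr A (n : ZMod 2) := by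
  rcases Nat.even_or_odd n with hn | hn
  · rw [(ZMod.natCast_eq_zero_iff_even).2 hn, mem_gr_zero, h, sg, hn.neg_one_pow, one_smul]
  · rw [(ZMod.natCast_eq_one_iff_odd).2 hn, mem_gr_one, h, sg, hn.neg_one_pow, neg_one_smul]

/-- The even component of an element. -/
def evenPart : A →ₗ[ℂ] gr A 0 :=
  LinearMap.codRestrict _ ((1 / 2 : ℂ) • (LinearMap.id + par.toLinearMap)) (by
    intro a
    rw [mem_gr_zero]
    simp only [LinearMap.smul_apply, LinearMap.add_apply, LinearMap.id_apply,
      AlgHom.toLinearMap_apply, map_smul, map_add, par_par]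
    rw [add_comm])

/-- The odd component of an element. -/
def oddPart : A →ₗ[ℂ] gr A 1 :=
  LinearMap.codRestrict _ ((1 / 2 : ℂ) • (LinearMap.id - par.toLinearMap)) (by
    intro a
    rw [mem_gr_one]
    simp only [LinearMap.smul_apply, LinearMap.sub_apply, LinearMap.id_apply,
      AlgHom.toLinearMap_apply, map_smul, map_sub, par_par]
    rw [← smul_neg, neg_sub])

lemma coe_evenPart (a : A) : (evenPart a : A) = (1 / 2 : ℂ) • (a + par a) := rfl

lemma coe_oddPart (a : A) : (oddPart a : A) = (1 / 2 : ℂ) • (a - par a) := rfl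

instance : SetLike.GradedMonoid (gr A) where
  one_mem := by rw [mem_gr_zero, map_one]
  mul_mem := by
    intro i j a b ha hb
    fin_cases i <;> fin_cases j
    · have h1 := mem_gr_zero.1 ha
      have h2 := mem_gr_zero.1 hb
      exact mem_gr_zero.2 (by rw [map_mul, h1, h2])
    · have h1 := mem_gr_zero.1 ha
      have h2 := mem_gr_one.1 hb
      exact mem_gr_one.2 (by rw [map_mul, h1, h2, mul_neg])
    · have h1 := mem_gr_one.1 ha
      have h2 := mem_gr_zero.1 hb
      exact mem_gr_one.2 (by rw [map_mul, h1, h2, neg_mul])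
    · have h1 := mem_gr_one.1 ha
      have h2 := mem_gr_one.1 hb
      exact mem_gr_zero.2 (by rw [map_mul, h1, h2, neg_mul_neg])

instance : GradedAlgebra (gr A) where
  decompose' a := DirectSum.of (fun i => gr A i) 0 (evenPart a) +
    DirectSum.of (fun i => gr A i) 1 (oddPart a)
  left_inv a := by
    simp only [map_add, DirectSum.coeAddMonoidHom_of]
    rw [coe_evenPart, coe_oddPart, ← smul_add, add_add_sub_cancel, ← two_smul ℂ, smul_smul]
    norm_num
  right_inv x := by
    induction x using DirectSum.induction_on with
    | zero => simp only [map_zero, add_zero]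
    | of i a =>
      obtain ⟨a, ha⟩ := a
      rw [DirectSum.coeAddMonoidHom_of]
      fin_cases i
      · have h : par a = a := mem_gr_zero.1 ha
        have h0 : oddPart a = 0 := by ext; simp [coe_oddPart, h]
        have h1 : evenPart a = ⟨a, ha⟩ := by
          ext; simp only [coe_evenPart, h]; rw [← two_smul ℂ, smul_smul]; norm_num
        simp only [h0, h1, map_zero, add_zero]; rfl
      · have h : par a = -a := mem_gr_one.1 ha
        have h0 : evenPart a = 0 := by ext; simp [coe_evenPart, h]
        have h1 : oddPart a = ⟨a, ha⟩ := by
          ext; simp only [coe_oddPart, h, sub_neg_eq_add]; rw [← two_smul ℂ, smul_smul]; norm_num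
        simp only [h0, h1, map_zero, zero_add]; rfl
    | add x y hx hy =>
      beta_reduce at *
      rw [map_add, map_add, map_add, map_add, map_add, add_add_add_comm, hx, hy]

/-- The product of pure tensors in the graded tensor product, with the sign given by parities. -/
lemma tmul_mul_tmul {B : Type} [Ring B] [Algebra ℂ B] [SuperAlg B] (a : A) {b : B} {a' : A}
    (b' : B) {m n : ℕ} (hb : par b = sg m • b) (ha : par a' = sg n • a') :
    ((a ᵍ⊗ₜ[ℂ] b) * (a' ᵍ⊗ₜ[ℂ] b') : gr A ᵍ⊗[ℂ] gr B) =
      sg (m * n) • ((a * a') ᵍ⊗ₜ[ℂ] (b * b')) := by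
  have := GradedTensorProduct.tmul_coe_mul_coe_tmul (R := ℂ) (gr A) (gr B) a
    ⟨b, mem_gr_cast hb⟩ ⟨a', mem_gr_cast ha⟩ b'
  simp only at this
  rw [this, ← Nat.cast_mul]
  rcases Nat.even_or_odd (m * n) with h | h
  · rw [(ZMod.natCast_eq_zero_iff_even).2 h, uzpow_zero, one_smul, sg, h.neg_one_pow, one_smul]
  · rw [(ZMod.natCast_eq_one_iff_odd).2 h, uzpow_one, sg, h.neg_one_pow, neg_one_smul,
      Units.neg_smul, one_smul]

end Grading

/-- The super-analogue of the `q`-number `[n]`, written in terms of `t = q^{1/2}`. -/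
def qnum (t : ℂ) (n : ℕ) : ℂ := ((t⁻¹) ^ n - (-1) ^ n * t ^ n) / (t⁻¹ + t)

/-- The parameters: `t = q^{1/2}` with `q` nonzero and not a root of unity, together with the
choices of the square roots `κ₁ = √([4]/(q[2]))`, `κ₂ = √(q⁻¹[3])` and of the normalisation `nu`
of the odd generators in the fundamental representation. -/
structure Param where
  t : ℂ
  k1 : ℂ
  k2 : ℂ
  nu : ℂ
  t_ne : t ≠ 0
  generic : ∀ n : ℕ, 0 < n → t ^ n ≠ 1
  k1_sq : k1 ^ 2 = qnum t 4 / (t ^ 2 * qnum t 2)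
  k2_sq : k2 ^ 2 = (t ^ 2)⁻¹ * qnum t 3
  nu_sq : nu ^ 2 = -((t ^ 2 - (t ^ 2)⁻¹) / ((t ^ 2) ^ 4 - ((t ^ 2) ^ 4)⁻¹))

namespace Param

variable (P : Param)

/-- The deformation parameter. -/
def q : ℂ := P.t ^ 2

/-- `κ₃ = κ₁ κ₂`. -/
def k3 : ℂ := P.k1 * P.k2

lemma t_pow_ne (n : ℕ) (hn : 0 < n) : P.t ^ n - 1 ≠ 0 := sub_ne_zero.2 (P.generic n hn)

lemma t2_add : P.t ^ 2 + 1 ≠ 0 := by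
  intro h
  apply P.t_pow_ne 4 (by norm_num)
  linear_combination (P.t ^ 2 - 1) * h

lemma t4_add : P.t ^ 4 + 1 ≠ 0 := by
  intro h
  apply P.t_pow_ne 8 (by norm_num)
  linear_combination (P.t ^ 4 - 1) * h

lemma t8_add : P.t ^ 8 + 1 ≠ 0 := by
  intro h
  apply P.t_pow_ne 16 (by norm_num)
  linear_combination (P.t ^ 8 - 1) * h

lemma t_inv_add : P.t⁻¹ + P.t ≠ 0 := by
  have h0 := P.t_ne
  intro h
  apply P.t2_add
  field_simp at h
  linear_combination h

lemma k1_sq' : P.t ^ 4 * P.k1 ^ 2 = P.t ^ 4 + 1 := by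
  have h0 := P.t_ne
  have h2 := P.t_pow_ne 2 (by norm_num)
  have e2 : qnum P.t 2 = P.t⁻¹ - P.t := by
    rw [qnum, div_eq_iff P.t_inv_add]; ring
  have e4 : qnum P.t 4 = (P.t⁻¹ - P.t) * ((P.t⁻¹) ^ 2 + P.t ^ 2) := by
    rw [qnum, div_eq_iff P.t_inv_add]; ring
  have h3 : P.t⁻¹ - P.t ≠ 0 := by
    intro h; apply h2; field_simp at h; linear_combination -h
  rw [P.k1_sq, e2, e4, mul_comm (P.t ^ 2), mul_div_mul_left _ _ h3]
  field_simp
  ring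

lemma k2_sq' : P.t ^ 4 * P.k2 ^ 2 = P.t ^ 4 - P.t ^ 2 + 1 := by
  have h0 := P.t_ne
  have e3 : qnum P.t 3 = (P.t⁻¹) ^ 2 - 1 + P.t ^ 2 := by
    rw [qnum, div_eq_iff P.t_inv_add]; field_simp; ring
  rw [P.k2_sq, e3]
  field_simp
  ring

lemma nu_sq' : P.nu ^ 2 * ((P.t ^ 4 + 1) * (P.t ^ 8 + 1)) = -P.t ^ 6 := by
  have h0 := P.t_ne
  have h2 := P.t_pow_ne 4 (by norm_num)
  have h3 := P.t_pow_ne 16 (by norm_num)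
  have h4 := P.t4_add
  have h5 := P.t8_add
  rw [P.nu_sq]
  have h6 : (P.t ^ 2) ^ 4 - ((P.t ^ 2) ^ 4)⁻¹ ≠ 0 := by
    intro h; apply h3; field_simp at h; linear_combination h
  field_simp
  ring

end Param

/-! ### The quantum superalgebra `U_q[osp(1|2)]` and its representations -/

/-- Generators of `U_q[osp(1|2)]`. -/
inductive UGen | K | Kinv | vp | vm

open FreeAlgebra in
/-- Defining relations of `U_q[osp(1|2)]`. -/
inductive URel (P : Param) : FreeAlgebra ℂ UGen → FreeAlgebra ℂ UGen → Prop
  | K_Kinv : URel P (ι ℂ .K * ι ℂ .Kinv) 1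
  | Kinv_K : URel P (ι ℂ .Kinv * ι ℂ .K) 1
  | K_vp : URel P (ι ℂ .K * ι ℂ .vp) (P.t • (ι ℂ .vp * ι ℂ .K))
  | K_vm : URel P (ι ℂ .K * ι ℂ .vm) (P.t⁻¹ • (ι ℂ .vm * ι ℂ .K))
  | anticomm : URel P (ι ℂ .vp * ι ℂ .vm + ι ℂ .vm * ι ℂ .vp)
      (-(P.q ^ 4 - (P.q ^ 4)⁻¹)⁻¹ • (ι ℂ .K ^ 2 - ι ℂ .Kinv ^ 2))

/-- The quantum superalgebra `U_q[osp(1|2)]`; `K` is even, `vp = v₊` and `vm = v₋` are odd. -/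
abbrev Uq (P : Param) : Type := RingQuot (URel P)

/-- The class of a generator in `U_q[osp(1|2)]`. -/
def ugen (P : Param) (g : UGen) : Uq P := RingQuot.mkAlgHom ℂ (URel P) (FreeAlgebra.ι ℂ g)

/-- An algebra homomorphism out of `U_q[osp(1|2)]` from the images of the generators. -/
def Uq.lift {P : Param} {B : Type} [Ring B] [Algebra ℂ B] (K Ki vp vm : B)
    (h1 : K * Ki = 1) (h2 : Ki * K = 1) (h3 : K * vp = P.t • (vp * K))
    (h4 : K * vm = P.t⁻¹ • (vm * K))
    (h5 : vp * vm + vm * vp = -(P.q ^ 4 - (P.q ^ 4)⁻¹)⁻¹ • (K ^ 2 - Ki ^ 2)) : Uq P →ₐ[ℂ] B :=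
  RingQuot.liftAlgHom ℂ ⟨FreeAlgebra.lift ℂ (fun g : UGen => match g with
    | .K => K | .Kinv => Ki | .vp => vp | .vm => vm), by
      intro x y h
      cases h <;> simpa only [map_mul, map_add, map_sub, map_smul, map_neg, map_pow, map_one,
        FreeAlgebra.lift_ι_apply]⟩

/-- The `3`-dimensional representation `ℓ = 1` on the basis `e₁, e₀, e₋₁` (indexed by `0, 1, 2`,
so that the index `i` has weight `m = 1 - i`); column `j` is the image of the `j`-th vector. -/
def rep1 (P : Param) : Uq P →ₐ[ℂ] Matrix (Fin 3) (Fin 3) ℂ :=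
  Uq.lift
    !![P.t, 0, 0; 0, 1, 0; 0, 0, P.t⁻¹]
    !![P.t⁻¹, 0, 0; 0, 1, 0; 0, 0, P.t]
    !![0, P.nu, 0; 0, 0, P.nu; 0, 0, 0]
    !![0, 0, 0; P.nu, 0, 0; 0, -P.nu, 0]
    (by have := P.t_ne; ext i j; fin_cases i <;> fin_cases j <;> simp [this])
    (by have := P.t_ne; ext i j; fin_cases i <;> fin_cases j <;> simp [this])
    (by have := P.t_ne; ext i j; fin_cases i <;> fin_cases j <;> (simp; try field_simp))
    (by have := P.t_ne; ext i j; fin_cases i <;> fin_cases j <;> (simp; try field_simp))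
    (by
      have h0 := P.t_ne
      have h1 := P.nu_sq
      have h2 : P.q = P.t ^ 2 := rfl
      have h3 : P.nu * P.nu = -((P.q ^ 4 - (P.q ^ 4)⁻¹)⁻¹ * (P.t * P.t - P.t⁻¹ * P.t⁻¹)) := by
        rw [← pow_two, h1, h2, div_eq_inv_mul]; ring
      ext i j
      fin_cases i <;> fin_cases j <;>
        simp [pow_two, h3] <;> ring)

/-- The `5`-dimensional adjoint representation `ℓ = 2` on the basis `e₂, e₁, e₀, e₋₁, e₋₂`
(indexed by `0, …, 4`, so that the index `i` has weight `m = 2 - i`). -/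
def rep2 (P : Param) : Uq P →ₐ[ℂ] Matrix (Fin 5) (Fin 5) ℂ :=
  Uq.lift
    (Matrix.diagonal ![P.t ^ 2, P.t, 1, P.t⁻¹, (P.t ^ 2)⁻¹])
    (Matrix.diagonal ![(P.t ^ 2)⁻¹, P.t⁻¹, 1, P.t, P.t ^ 2])
    ((P.nu * P.t) • !![0, P.k1, 0, 0, 0; 0, 0, P.k2, 0, 0; 0, 0, 0, P.k2, 0; 0, 0, 0, 0, P.k1;
      0, 0, 0, 0, 0])
    ((P.nu * P.t) • !![0, 0, 0, 0, 0; P.k1, 0, 0, 0, 0; 0, -P.k2, 0, 0, 0; 0, 0, P.k2, 0, 0;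
      0, 0, 0, -P.k1, 0])
    (by
      have := P.t_ne
      rw [Matrix.diagonal_mul_diagonal, ← Matrix.diagonal_one]
      congr 1; funext i; fin_cases i <;> simp [this])
    (by
      have := P.t_ne
      rw [Matrix.diagonal_mul_diagonal, ← Matrix.diagonal_one]
      congr 1; funext i; fin_cases i <;> simp [this])
    (by
      have := P.t_ne
      ext i j
      simp only [Matrix.diagonal_mul, Matrix.mul_diagonal, Matrix.smul_apply]
      fin_cases i <;> fin_cases j <;> (simp; try field_simp))
    (by
      have := P.t_ne
      ext i j
      simp only [Matrix.diagonal_mul, Matrix.mul_diagonal, Matrix.smul_apply]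
      fin_cases i <;> fin_cases j <;> (simp; try field_simp))
    (by
      have h0 := P.t_ne
      have h2 : P.q = P.t ^ 2 := rfl
      have hk1 : P.k1 ^ 2 = 1 + (P.t⁻¹) ^ 4 := by
        have := P.k1_sq'; field_simp; linear_combination this
      have hk2 : P.k2 ^ 2 = 1 - (P.t⁻¹) ^ 2 + (P.t⁻¹) ^ 4 := by
        have := P.k2_sq'; field_simp; linear_combination this
      obtain ⟨C, hC⟩ : ∃ C : ℂ, C = -(P.q ^ 4 - (P.q ^ 4)⁻¹)⁻¹ := ⟨_, rfl⟩
      have hnu : P.nu ^ 2 = C * (P.t ^ 2 - (P.t⁻¹) ^ 2) := by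
        rw [P.nu_sq, hC, h2, div_eq_inv_mul, inv_pow]; ring
      have hi : P.t * P.t⁻¹ = 1 := mul_inv_cancel₀ h0
      have e1 : (P.nu * P.t) * (P.nu * P.t) * (P.k1 * P.k1) =
          C * (P.t ^ 2 * P.t ^ 2 - (P.t ^ 2)⁻¹ * (P.t ^ 2)⁻¹) := by
        have : (P.nu * P.t) * (P.nu * P.t) * (P.k1 * P.k1) =
          P.nu ^ 2 * P.t ^ 2 * P.k1 ^ 2 := by ring
        rw [this, hnu, hk1]; field_simp; ring
      have e2 : (P.nu * P.t) * (P.nu * P.t) * (P.k1 * P.k1 - P.k2 * P.k2) =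
          C * (P.t * P.t - P.t⁻¹ * P.t⁻¹) := by
        have : (P.nu * P.t) * (P.nu * P.t) * (P.k1 * P.k1 - P.k2 * P.k2) =
          P.nu ^ 2 * P.t ^ 2 * (P.k1 ^ 2 - P.k2 ^ 2) := by ring
        rw [this, hnu, hk1, hk2]; field_simp; ring
      rw [← hC, pow_two (Matrix.diagonal _), pow_two (Matrix.diagonal _), Matrix.diagonal_mul_diagonal, Matrix.diagonal_mul_diagonal,
        Matrix.smul_mul, Matrix.mul_smul, Matrix.smul_mul, Matrix.mul_smul]
      ext i j
      fin_cases i <;> fin_cases j <;>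
        simp [-neg_mul, -mul_neg, -mul_eq_mul_left_iff] <;>
        first
          | linear_combination e1
          | linear_combination e2
          | linear_combination -e1
          | linear_combination -e2
          | ring)


/-! ### The quantum supergroup `OSp_q(1|2)` -/

/-- Clebsch-Gordan coefficients `V¹ ⊗ V¹ → V⁰`: the invariant is `∑ cg0 i j eᵢ ⊗ eⱼ`. -/
def cg0 (P : Param) (i j : Fin 3) : ℂ :=
  !![0, 0, -P.t⁻¹; 0, 1, 0; P.t, 0, 0] i j

/-- Clebsch-Gordan coefficients `V¹ ⊗ V¹ → V¹`: the `M`-th vector of the `ℓ = 1` component is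
`∑ cg1 M i j eᵢ ⊗ eⱼ`. -/
def cg1 (P : Param) (M i j : Fin 3) : ℂ :=
  (![!![0, P.t⁻¹, 0; -P.t, 0, 0; 0, 0, 0],
    !![0, 0, -1; 0, P.t + P.t⁻¹, 0; 1, 0, 0],
    !![0, 0, 0; 0, 0, -P.t⁻¹; 0, P.t, 0]] M) i j

/-- The inverse coefficients for `ℓ = 0`. -/
def cg0' (P : Param) (i j : Fin 3) : ℂ := sg (i * j) * cg0 P i j

/-- The inverse coefficients for `ℓ = 1`. -/
def cg1' (P : Param) (M i j : Fin 3) : ℂ := sg (i * j + M) * cg1 P M i j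

lemma sg_add (m n : ℕ) : sg (m + n) = sg m * sg n := pow_add _ _ _

lemma sg_mul_self (m : ℕ) : sg m * sg m = 1 := by
  rw [← sg_add, sg, Even.neg_one_pow ⟨m, rfl⟩]

lemma sg_two_mul (m : ℕ) : sg (2 * m) = 1 := by rw [two_mul, sg_add, sg_mul_self]

lemma cg0_hom (P : Param) (i j : Fin 3) : sg (i + j) * cg0 P i j = cg0 P i j := by
  fin_cases i <;> fin_cases j <;> simp [cg0, sg]

lemma cg1_hom (P : Param) (M i j : Fin 3) :
    sg (i + j) * cg1 P M i j = sg (M + 1) * cg1 P M i j := by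
  fin_cases M <;> fin_cases i <;> fin_cases j <;> simp [cg1, sg]

/-- The coefficient `(-1)^{(k+i) l} T_{ki} T_{lj}` of `e_k e_l` in the coaction on `e_i e_j`. -/
def TT {B : Type} [Ring B] [Algebra ℂ B] (T : Fin 3 → Fin 3 → B) (k l i j : Fin 3) : B :=
  sg ((k + i) * l) • (T k i * T l j)

/-- The product law: the couplings of two fundamental corepresentations to `ℓ = 0` and to `ℓ = 1`
intertwine `T ⊗ T` with the trivial corepresentation and with the parity-shifted fundamental
corepresentation `((-1)^{i+j} T_{ij})`, respectively; the inverse couplings do so as well. -/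
structure ProductLaw (P : Param) {B : Type} [Ring B] [Algebra ℂ B] (T : Fin 3 → Fin 3 → B) :
    Prop where
  col0 : ∀ k l, ∑ i, ∑ j, cg0 P i j • TT T k l i j = cg0 P k l • (1 : B)
  row0 : ∀ i j, ∑ k, ∑ l, cg0' P k l • TT T k l i j = cg0' P i j • (1 : B)
  col1 : ∀ k l M, ∑ i, ∑ j, cg1 P M i j • TT T k l i j =
    ∑ N, cg1 P N k l • (sg (N + M) • T N M)
  row1 : ∀ i j M, ∑ k, ∑ l, cg1' P M k l • TT T k l i j =
    ∑ N, cg1' P N i j • (sg (M + N) • T M N)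

/-- The free generators of `OSp_q(1|2)`. -/
def freeT (i j : Fin 3) : FreeAlgebra ℂ (Fin 3 × Fin 3) := FreeAlgebra.ι ℂ (i, j)

/-- Defining relations of `OSp_q(1|2)`: exactly the equations of the product law. -/
inductive ARel (P : Param) :
    FreeAlgebra ℂ (Fin 3 × Fin 3) → FreeAlgebra ℂ (Fin 3 × Fin 3) → Prop
  | col0 (k l : Fin 3) : ARel P (∑ i, ∑ j, cg0 P i j • TT freeT k l i j) (cg0 P k l • 1)
  | row0 (i j : Fin 3) : ARel P (∑ k, ∑ l, cg0' P k l • TT freeT k l i j) (cg0' P i j • 1)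
  | col1 (k l M : Fin 3) : ARel P (∑ i, ∑ j, cg1 P M i j • TT freeT k l i j)
      (∑ N, cg1 P N k l • (sg (N + M) • freeT N M))
  | row1 (i j M : Fin 3) : ARel P (∑ k, ∑ l, cg1' P M k l • TT freeT k l i j)
      (∑ N, cg1' P N i j • (sg (M + N) • freeT M N))

/-- The algebra `OSp_q(1|2)`, generated by the entries of the fundamental corepresentation matrix
subject to the product law. -/
abbrev OSp (P : Param) : Type := RingQuot (ARel P)

/-- The fundamental corepresentation matrix `T⁽¹⁾(0)`, with rows
`(a, α, b)`, `(γ, e, β)`, `(c, δ, d)`. -/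
def T1 (P : Param) (i j : Fin 3) : OSp P := RingQuot.mkAlgHom ℂ (ARel P) (freeT i j)

lemma map_TT {B C : Type} [Ring B] [Algebra ℂ B] [Ring C] [Algebra ℂ C] (F : B →ₐ[ℂ] C)
    (T : Fin 3 → Fin 3 → B) (k l i j : Fin 3) :
    F (TT T k l i j) = TT (fun a b => F (T a b)) k l i j := by
  simp only [TT, map_smul, map_mul]

lemma T1_law (P : Param) : ProductLaw P (T1 P) where
  col0 k l := by
    have := RingQuot.mkAlgHom_rel ℂ (ARel.col0 (P := P) k l)
    simpa only [map_sum, map_smul, map_TT, map_one] using! this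
  row0 i j := by
    have := RingQuot.mkAlgHom_rel ℂ (ARel.row0 (P := P) i j)
    simpa only [map_sum, map_smul, map_TT, map_one] using! this
  col1 k l M := by
    have := RingQuot.mkAlgHom_rel ℂ (ARel.col1 (P := P) k l M)
    simpa only [map_sum, map_smul, map_TT, map_one] using! this
  row1 i j M := by
    have := RingQuot.mkAlgHom_rel ℂ (ARel.row1 (P := P) i j M)
    simpa only [map_sum, map_smul, map_TT, map_one] using! this

/-- Algebra homomorphisms out of `OSp_q(1|2)` are the solutions of the product law. -/
def OSp.lift {P : Param} {B : Type} [Ring B] [Algebra ℂ B] (T : Fin 3 → Fin 3 → B)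
    (h : ProductLaw P T) : OSp P →ₐ[ℂ] B :=
  RingQuot.liftAlgHom ℂ ⟨FreeAlgebra.lift ℂ (fun p : Fin 3 × Fin 3 => T p.1 p.2), by
    have e : ∀ i j, FreeAlgebra.lift ℂ (fun p : Fin 3 × Fin 3 => T p.1 p.2) (freeT i j) = T i j :=
      fun i j => FreeAlgebra.lift_ι_apply _ _
    intro x y r
    cases r with
    | col0 k l => simpa only [map_sum, map_smul, map_TT, map_one, e] using h.col0 k l
    | row0 i j => simpa only [map_sum, map_smul, map_TT, map_one, e] using h.row0 i j
    | col1 k l M => simpa only [map_sum, map_smul, map_TT, map_one, e] using h.col1 k l M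
    | row1 i j M => simpa only [map_sum, map_smul, map_TT, map_one, e] using h.row1 i j M⟩

lemma OSp.lift_T1 {P : Param} {B : Type} [Ring B] [Algebra ℂ B] (T : Fin 3 → Fin 3 → B)
    (h : ProductLaw P T) (i j : Fin 3) : OSp.lift T h (T1 P i j) = T i j := by
  rw [OSp.lift, T1, RingQuot.liftAlgHom_mkAlgHom_apply]
  exact FreeAlgebra.lift_ι_apply _ _

lemma OSp.hom_ext {P : Param} {B : Type} [Ring B] [Algebra ℂ B] {F G : OSp P →ₐ[ℂ] B}
    (h : ∀ i j, F (T1 P i j) = G (T1 P i j)) : F = G := by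
  apply RingQuot.ringQuot_ext'
  apply FreeAlgebra.hom_ext
  funext p
  exact h p.1 p.2

lemma cg0'_hom (P : Param) (i j : Fin 3) : sg (i + j) * cg0' P i j = cg0' P i j := by
  rw [cg0', mul_left_comm, cg0_hom]

lemma cg1'_hom (P : Param) (M i j : Fin 3) :
    sg (i + j) * cg1' P M i j = sg (M + 1) * cg1' P M i j := by
  rw [cg1', mul_left_comm, cg1_hom, mul_left_comm]

/-- Rescaling rows by `(-1)^{i+1}` preserves the product law. -/
lemma law_row {P : Param} {B : Type} [Ring B] [Algebra ℂ B] {T : Fin 3 → Fin 3 → B}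
    (h : ProductLaw P T) : ProductLaw P (fun i j => sg (i + 1) • T i j) := by
  have e : ∀ k l i j, TT (fun i j => sg (i + 1) • T i j) k l i j = sg (k + l) • TT T k l i j := by
    intro k l i j
    simp only [TT, smul_mul_smul_comm, smul_smul]
    congr 1
    simp only [sg_add]
    linear_combination (sg ((k + i) * l) * sg k * sg l) * sg_mul_self 1
  constructor
  · intro k l
    simp only [e, smul_comm (cg0 P _ _) (sg _), ← Finset.smul_sum]
    rw [h.col0, smul_smul, cg0_hom]
  · intro i j
    simp only [e, smul_smul, mul_comm (cg0' P _ _) (sg _), cg0'_hom]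
    exact h.row0 i j
  · intro k l M
    simp only [e, smul_comm (cg1 P M _ _) (sg (k + l)), ← Finset.smul_sum]
    rw [h.col1, Finset.smul_sum]
    refine Finset.sum_congr rfl fun N _ => ?_
    simp only [smul_smul]
    congr 1
    linear_combination (sg (N + M)) * cg1_hom P N k l
  · intro i j M
    simp only [e, smul_smul, mul_comm (cg1' P M _ _) (sg _), cg1'_hom]
    simp only [mul_smul, ← Finset.smul_sum]
    rw [h.row1, Finset.smul_sum]
    refine Finset.sum_congr rfl fun N _ => ?_
    simp only [smul_smul]
    congr 1
    ring

/-- Rescaling columns by `(-1)^{j+1}` preserves the product law. -/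
lemma law_col {P : Param} {B : Type} [Ring B] [Algebra ℂ B] {T : Fin 3 → Fin 3 → B}
    (h : ProductLaw P T) : ProductLaw P (fun i j => sg (j + 1) • T i j) := by
  have e : ∀ k l i j, TT (fun i j => sg (j + 1) • T i j) k l i j = sg (i + j) • TT T k l i j := by
    intro k l i j
    simp only [TT, smul_mul_smul_comm, smul_smul]
    congr 1
    simp only [sg_add]
    linear_combination (sg ((k + i) * l) * sg i * sg j) * sg_mul_self 1
  constructor
  · intro k l
    simp only [e, smul_smul, mul_comm (cg0 P _ _) (sg _), cg0_hom]
    exact h.col0 k l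
  · intro i j
    simp only [e, smul_comm (cg0' P _ _) (sg _), ← Finset.smul_sum]
    rw [h.row0, smul_smul, cg0'_hom]
  · intro k l M
    simp only [e, smul_smul, mul_comm (cg1 P M _ _) (sg _), cg1_hom]
    simp only [mul_smul, ← Finset.smul_sum]
    rw [h.col1, Finset.smul_sum]
    refine Finset.sum_congr rfl fun N _ => ?_
    simp only [smul_smul]
    congr 1
    ring
  · intro i j M
    simp only [e, smul_comm (cg1' P M _ _) (sg (i + j)), ← Finset.smul_sum]
    rw [h.row1, Finset.smul_sum]
    refine Finset.sum_congr rfl fun N _ => ?_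
    simp only [smul_smul]
    congr 1
    linear_combination (sg (M + N)) * cg1'_hom P N i j

/-- The algebra automorphism of `OSp_q(1|2)` that changes the sign of the two outer rows of the
fundamental corepresentation matrix and fixes the middle row. -/
def rowFlip (P : Param) : OSp P →ₐ[ℂ] OSp P :=
  OSp.lift (fun i j => sg (i + 1) • T1 P i j) (law_row (T1_law P))

/-- The algebra automorphism of `OSp_q(1|2)` that changes the sign of the two outer columns. -/
def colFlip (P : Param) : OSp P →ₐ[ℂ] OSp P :=
  OSp.lift (fun i j => sg (j + 1) • T1 P i j) (law_col (T1_law P))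

lemma rowFlip_T1 (P : Param) (i j : Fin 3) : rowFlip P (T1 P i j) = sg (i + 1) • T1 P i j :=
  OSp.lift_T1 _ _ _ _

lemma colFlip_T1 (P : Param) (i j : Fin 3) : colFlip P (T1 P i j) = sg (j + 1) • T1 P i j :=
  OSp.lift_T1 _ _ _ _

/-- The parity of `OSp_q(1|2)`: the entry `T_{ij}` has parity `i + j`. -/
instance (P : Param) : SuperAlg (OSp P) where
  par := (rowFlip P).comp (colFlip P)
  par_par a := by
    have : ((rowFlip P).comp (colFlip P)).comp ((rowFlip P).comp (colFlip P)) =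
        AlgHom.id ℂ (OSp P) := by
      apply OSp.hom_ext
      intro i j
      simp only [AlgHom.comp_apply, AlgHom.id_apply, colFlip_T1, rowFlip_T1, map_smul, smul_smul]
      have h1 := sg_mul_self (i + 1)
      have h2 := sg_mul_self (j + 1)
      rw [show sg (j + 1) * sg (i + 1) * (sg (j + 1) * sg (i + 1)) = 1 by
        linear_combination (sg (j + 1) * sg (j + 1)) * h1 + h2, one_smul]
    exact DFunLike.congr_fun this a

lemma par_T1 (P : Param) (i j : Fin 3) : par (T1 P i j) = sg (i + j) • T1 P i j := by
  change rowFlip P (colFlip P (T1 P i j)) = _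
  rw [colFlip_T1, map_smul, rowFlip_T1, smul_smul]
  congr 1
  simp only [sg_add]
  linear_combination (sg i * sg j) * sg_mul_self 1


/-- The pure tensor map into the graded tensor product, as a bilinear map. -/
def tm (A B : Type) [Ring A] [Algebra ℂ A] [SuperAlg A] [Ring B] [Algebra ℂ B] [SuperAlg B] :
    A →ₗ[ℂ] B →ₗ[ℂ] (gr A ᵍ⊗[ℂ] gr B) :=
  (TensorProduct.mk ℂ A B).compr₂ (GradedTensorProduct.of ℂ (gr A) (gr B)).toLinearMap

lemma tm_apply {A B : Type} [Ring A] [Algebra ℂ A] [SuperAlg A] [Ring B] [Algebra ℂ B]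
    [SuperAlg B] (a : A) (b : B) : tm A B a b = a ᵍ⊗ₜ[ℂ] b := rfl

/-- The matrix `∑_k T_{ik} ⊗ T_{kj}`. -/
def coT (P : Param) (i j : Fin 3) : gr (OSp P) ᵍ⊗[ℂ] gr (OSp P) :=
  ∑ k, T1 P i k ᵍ⊗ₜ[ℂ] T1 P k j

lemma TT_coT (P : Param) (k l i j : Fin 3) :
    TT (coT P) k l i j =
      ∑ m, ∑ n, tm (OSp P) (OSp P) (TT (T1 P) k l m n) (TT (T1 P) m n i j) := by
  simp only [TT, coT, Finset.sum_mul_sum, Finset.smul_sum]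
  refine Finset.sum_congr rfl fun m _ => Finset.sum_congr rfl fun n _ => ?_
  rw [tmul_mul_tmul _ _ (par_T1 P m i) (par_T1 P l n)]
  simp only [map_smul, LinearMap.smul_apply, tm_apply, smul_smul]
  congr 1
  have e : (k + i : ℕ) * l + (m + i) * (l + n) = (k + m) * l + (m + i) * n + 2 * (i * l) := by
    ring
  have e := congrArg sg e
  simp only [sg_add, sg_two_mul, mul_one] at e
  rw [e, mul_comm]

lemma sum_swap4 {G : Type} [AddCommMonoid G] (F : Fin 3 → Fin 3 → Fin 3 → Fin 3 → G) :
    ∑ i, ∑ j, ∑ m, ∑ n, F i j m n = ∑ m, ∑ n, ∑ i, ∑ j, F i j m n := by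
  have h1 : ∀ i, ∑ j, ∑ m, ∑ n, F i j m n = ∑ m, ∑ n, ∑ j, F i j m n := by
    intro i
    rw [Finset.sum_comm]
    exact Finset.sum_congr rfl fun m _ => Finset.sum_comm
  simp only [h1]
  rw [Finset.sum_comm]
  exact Finset.sum_congr rfl fun m _ => Finset.sum_comm

lemma coT_col (P : Param) (c : Fin 3 → Fin 3 → ℂ) (k l : Fin 3) :
    ∑ i, ∑ j, c i j • TT (coT P) k l i j = ∑ m, ∑ n, tm (OSp P) (OSp P) (TT (T1 P) k l m n)
      (∑ i, ∑ j, c i j • TT (T1 P) m n i j) := by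
  simp only [TT_coT, Finset.smul_sum, map_sum, map_smul]
  exact sum_swap4 _

lemma coT_row (P : Param) (c : Fin 3 → Fin 3 → ℂ) (i j : Fin 3) :
    ∑ k, ∑ l, c k l • TT (coT P) k l i j = ∑ m, ∑ n, tm (OSp P) (OSp P)
      (∑ k, ∑ l, c k l • TT (T1 P) k l m n) (TT (T1 P) m n i j) := by
  simp only [TT_coT, Finset.smul_sum, map_sum, map_smul, LinearMap.sum_apply, LinearMap.smul_apply]
  exact sum_swap4 _

lemma tm_left (P : Param) (c : Fin 3 → Fin 3 → ℂ) (X : Fin 3 → Fin 3 → OSp P) (y : OSp P) :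
    ∑ m, ∑ n, c m n • tm (OSp P) (OSp P) (X m n) y =
      tm (OSp P) (OSp P) (∑ m, ∑ n, c m n • X m n) y := by
  simp only [map_sum, map_smul, LinearMap.sum_apply, LinearMap.smul_apply]

lemma tm_right (P : Param) (c : Fin 3 → Fin 3 → ℂ) (X : Fin 3 → Fin 3 → OSp P) (y : OSp P) :
    ∑ m, ∑ n, c m n • tm (OSp P) (OSp P) y (X m n) =
      tm (OSp P) (OSp P) y (∑ m, ∑ n, c m n • X m n) := by
  simp only [map_sum, map_smul]

lemma sum_rot {G : Type} [AddCommMonoid G] (F : Fin 3 → Fin 3 → Fin 3 → G) :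
    ∑ m, ∑ n, ∑ N, F m n N = ∑ N, ∑ m, ∑ n, F m n N := by
  have h1 : ∀ m, ∑ n, ∑ N, F m n N = ∑ N, ∑ n, F m n N := fun m => Finset.sum_comm
  simp only [h1]
  exact Finset.sum_comm

lemma coT_law (P : Param) : ProductLaw P (coT P) where
  col0 k l := by
    rw [coT_col]
    simp only [(T1_law P).col0, map_smul]
    rw [tm_left, (T1_law P).col0, map_smul]
    rfl
  row0 i j := by
    rw [coT_row]
    simp only [(T1_law P).row0, map_smul, LinearMap.smul_apply]
    rw [tm_right, (T1_law P).row0, map_smul]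
    rfl
  col1 k l M := by
    rw [coT_col]
    simp only [(T1_law P).col1, map_sum, map_smul]
    rw [sum_rot]
    simp only [smul_comm (cg1 P _ _ _) (sg _), ← Finset.smul_sum]
    simp only [tm_left, (T1_law P).col1, map_sum, map_smul, LinearMap.sum_apply,
      LinearMap.smul_apply]
    simp only [Finset.smul_sum]
    rw [Finset.sum_comm]
    refine Finset.sum_congr rfl fun N _ => ?_
    rw [coT, Finset.smul_sum, Finset.smul_sum]
    refine Finset.sum_congr rfl fun R _ => ?_
    rw [← tm_apply]
    simp only [smul_smul]
    congr 1
    simp only [sg_add]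
    linear_combination (cg1 P N k l * sg N * sg M) * sg_mul_self R
  row1 i j M := by
    rw [coT_row]
    simp only [(T1_law P).row1, map_sum, map_smul, LinearMap.sum_apply, LinearMap.smul_apply]
    rw [sum_rot]
    simp only [smul_comm (cg1' P _ _ _) (sg _), ← Finset.smul_sum]
    simp only [tm_right, (T1_law P).row1, map_sum, map_smul]
    simp only [Finset.smul_sum]
    rw [Finset.sum_comm]
    refine Finset.sum_congr rfl fun N _ => ?_
    rw [coT, Finset.smul_sum, Finset.smul_sum]
    refine Finset.sum_congr rfl fun R _ => ?_
    rw [← tm_apply]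
    simp only [smul_smul]
    congr 1
    simp only [sg_add]
    linear_combination (cg1' P N i j * sg N * sg M) * sg_mul_self R

/-- The coproduct of `OSp_q(1|2)`, with values in the graded tensor product. -/
def coprod (P : Param) : OSp P →ₐ[ℂ] (gr (OSp P) ᵍ⊗[ℂ] gr (OSp P)) :=
  OSp.lift (coT P) (coT_law P)

lemma counit_law (P : Param) : ProductLaw P (fun i j => if i = j then (1 : ℂ) else 0) where
  col0 k l := by
    fin_cases k <;> fin_cases l <;> simp [TT, cg0, sg]
  row0 i j := by
    fin_cases i <;> fin_cases j <;> simp [TT, cg0', cg0, sg]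
  col1 k l M := by
    fin_cases k <;> fin_cases l <;> fin_cases M <;> simp [TT, cg1, sg] <;> norm_num
  row1 i j M := by
    fin_cases i <;> fin_cases j <;> fin_cases M <;> simp [TT, cg1', cg1, sg] <;> norm_num

/-- The counit of `OSp_q(1|2)`. -/
def counit (P : Param) : OSp P →ₐ[ℂ] ℂ :=
  OSp.lift (fun i j => if i = j then (1 : ℂ) else 0) (counit_law P)

/-- The odd twisted-primitive element `x v₊ + y v₋` of `U_q[osp(1|2)]`. -/
def oddPrim (P : Param) (x y : ℂ) : Uq P := x • ugen P .vp + y • ugen P .vm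

lemma rep1_K (P : Param) : rep1 P (ugen P .K) = !![P.t, 0, 0; 0, 1, 0; 0, 0, P.t⁻¹] := by
  rw [rep1, Uq.lift, ugen, RingQuot.liftAlgHom_mkAlgHom_apply, FreeAlgebra.lift_ι_apply]

lemma rep1_Kinv (P : Param) : rep1 P (ugen P .Kinv) = !![P.t⁻¹, 0, 0; 0, 1, 0; 0, 0, P.t] := by
  rw [rep1, Uq.lift, ugen, RingQuot.liftAlgHom_mkAlgHom_apply, FreeAlgebra.lift_ι_apply]

lemma rep1_vp (P : Param) : rep1 P (ugen P .vp) = !![0, P.nu, 0; 0, 0, P.nu; 0, 0, 0] := by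
  rw [rep1, Uq.lift, ugen, RingQuot.liftAlgHom_mkAlgHom_apply, FreeAlgebra.lift_ι_apply]

lemma rep1_vm (P : Param) : rep1 P (ugen P .vm) = !![0, 0, 0; P.nu, 0, 0; 0, -P.nu, 0] := by
  rw [rep1, Uq.lift, ugen, RingQuot.liftAlgHom_mkAlgHom_apply, FreeAlgebra.lift_ι_apply]

lemma rep1_oddPrim (P : Param) (x y : ℂ) : rep1 P (oddPrim P x y) =
    !![0, x * P.nu, 0; y * P.nu, 0, x * P.nu; 0, -(y * P.nu), 0] := by
  rw [oddPrim, map_add, map_smul, map_smul, rep1_vp, rep1_vm]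
  ext i j
  fin_cases i <;> fin_cases j <;> simp

/-- The values on the generators `T_{ij}` of the pairings with `K`, `x v₊ + y v₋` and `K⁻¹`
(where `⟨X, T_{ij}⟩ = (-1)^{|X| i} D(X)_{ij}`), arranged in an upper triangular matrix. -/
def pairGen (P : Param) (x y : ℂ) (i j : Fin 3) : Matrix (Fin 2) (Fin 2) ℂ :=
  !![rep1 P (ugen P .K) i j, sg i * rep1 P (oddPrim P x y) i j; 0, rep1 P (ugen P .Kinv) i j]

lemma TT_upper (A B D : Fin 3 → Fin 3 → ℂ) (k l i j : Fin 3) :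
    TT (fun i j => (!![A i j, B i j; 0, D i j] : Matrix (Fin 2) (Fin 2) ℂ)) k l i j =
      !![TT A k l i j, sg ((k + i) * l) * (A k i * B l j + B k i * D l j); 0, TT D k l i j] := by
  ext a b
  fin_cases a <;> fin_cases b <;> simp [TT]

lemma sum_upper {ι : Type} (s : Finset ι) (a b d : ι → ℂ) :
    ∑ x ∈ s, (!![a x, b x; 0, d x] : Matrix (Fin 2) (Fin 2) ℂ) =
      !![∑ x ∈ s, a x, ∑ x ∈ s, b x; 0, ∑ x ∈ s, d x] := by
  ext i j
  rw [Matrix.sum_apply]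
  fin_cases i <;> fin_cases j <;> simp

lemma smul_upper (c a b d : ℂ) : c • (!![a, b; 0, d] : Matrix (Fin 2) (Fin 2) ℂ) =
    !![c * a, c * b; 0, c * d] := by
  ext i j
  fin_cases i <;> fin_cases j <;> simp

lemma one_upper : (1 : Matrix (Fin 2) (Fin 2) ℂ) = !![1, 0; 0, 1] := by
  ext i j
  fin_cases i <;> fin_cases j <;> simp

lemma torus_law (P : Param) (w : Fin 3 → ℂ) (h1 : w 1 = 1) (h : w 0 * w 2 = 1) :
    ProductLaw P (fun i j => if i = j then w i else 0) := by
  have e0 : ∀ k l, cg0 P k l * (w k * w l) = cg0 P k l := by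
    intro k l
    fin_cases k <;> fin_cases l <;> simp [cg0, h1, h, mul_comm (w 2)]
  have e1 : ∀ M k l, cg1 P M k l * (w k * w l) = cg1 P M k l * w M := by
    intro M k l
    fin_cases M <;> fin_cases k <;> fin_cases l <;> simp [cg1, h1, h, mul_comm (w 2)]
  have eT : ∀ k l i j, TT (fun i j => if i = j then w i else 0) k l i j =
      if k = i then (if l = j then w k * w l else 0) else 0 := by
    intro k l i j
    by_cases hk : k = i
    · by_cases hl : l = j
      · subst hk; subst hl
        simp [TT, ← two_mul, mul_assoc, sg_two_mul]
      · simp [TT, hl]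
    · simp [TT, hk]
  constructor
  · intro k l
    simp [eT, e0]
  · intro i j
    simp [eT, cg0', mul_assoc, e0]
  · intro k l M
    simp [eT, e1, ← two_mul, sg_two_mul]
  · intro i j M
    simp [eT, cg1', mul_assoc, e1, ← two_mul, sg_two_mul]

/-- The product law for upper triangular matrices, reduced to scalar identities. -/
lemma upper_law (P : Param) (A B D : Fin 3 → Fin 3 → ℂ) (hA : ProductLaw P A)
    (hD : ProductLaw P D)
    (c0 : ∀ k l : Fin 3, ∑ i, ∑ j, cg0 P i j * (sg ((k + i) * l) * (A k i * B l j + B k i * D l j)) = 0)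
    (r0 : ∀ i j : Fin 3, ∑ k, ∑ l, cg0' P k l * (sg ((k + i) * l) * (A k i * B l j + B k i * D l j)) = 0)
    (c1 : ∀ k l M : Fin 3, ∑ i, ∑ j, cg1 P M i j *
      (sg ((k + i) * l) * (A k i * B l j + B k i * D l j)) =
      ∑ N, cg1 P N k l * (sg (N + M) * B N M))
    (r1 : ∀ i j M : Fin 3, ∑ k, ∑ l, cg1' P M k l *
      (sg ((k + i) * l) * (A k i * B l j + B k i * D l j)) =
      ∑ N, cg1' P N i j * (sg (M + N) * B M N)) :
    ProductLaw P (fun i j => (!![A i j, B i j; 0, D i j] : Matrix (Fin 2) (Fin 2) ℂ)) := by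
  constructor
  · intro k l
    have h1 := hA.col0 k l
    have h2 := hD.col0 k l
    simp only [smul_eq_mul] at h1 h2
    simp only [TT_upper, smul_upper, sum_upper, one_upper, h1, h2, c0, mul_zero]
  · intro i j
    have h1 := hA.row0 i j
    have h2 := hD.row0 i j
    simp only [smul_eq_mul] at h1 h2
    simp only [TT_upper, smul_upper, sum_upper, one_upper, h1, h2, r0, mul_zero]
  · intro k l M
    have h1 := hA.col1 k l M
    have h2 := hD.col1 k l M
    simp only [smul_eq_mul] at h1 h2
    simp only [TT_upper, smul_upper, sum_upper, h1, h2, c1]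
  · intro i j M
    have h1 := hA.row1 i j M
    have h2 := hD.row1 i j M
    simp only [smul_eq_mul] at h1 h2
    simp only [TT_upper, smul_upper, sum_upper, h1, h2, r1]

/-- The values of the pairing with `x v₊ + y v₋`. -/
def pairOdd (P : Param) (x y : ℂ) (i j : Fin 3) : ℂ :=
  !![0, x * P.nu, 0; -(y * P.nu), 0, -(x * P.nu); 0, -(y * P.nu), 0] i j

lemma pairGen_eq (P : Param) (x y : ℂ) (i j : Fin 3) : pairGen P x y i j =
    !![if i = j then ![P.t, 1, P.t⁻¹] i else 0, pairOdd P x y i j;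
      0, if i = j then ![P.t⁻¹, 1, P.t] i else 0] := by
  have h1 : rep1 P (ugen P .K) i j = if i = j then ![P.t, 1, P.t⁻¹] i else 0 := by
    rw [rep1_K]; fin_cases i <;> fin_cases j <;> simp
  have h2 : rep1 P (ugen P .Kinv) i j = if i = j then ![P.t⁻¹, 1, P.t] i else 0 := by
    rw [rep1_Kinv]; fin_cases i <;> fin_cases j <;> simp
  have h3 : sg i * rep1 P (oddPrim P x y) i j = pairOdd P x y i j := by
    rw [rep1_oddPrim]; fin_cases i <;> fin_cases j <;> simp [sg, pairOdd]
  rw [pairGen, h1, h2, h3]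

set_option maxHeartbeats 2000000 in
lemma pairGen_law (P : Param) (x y : ℂ) : ProductLaw P (pairGen P x y) := by
  have h0 := P.t_ne
  have h1 : P.t * P.t⁻¹ = 1 := mul_inv_cancel₀ h0
  have hK := torus_law P ![P.t, 1, P.t⁻¹] rfl (by simp [h0])
  have hKi := torus_law P ![P.t⁻¹, 1, P.t] rfl (by simp [h0])
  rw [show pairGen P x y = _ from funext fun i => funext fun j => pairGen_eq P x y i j]
  apply upper_law P _ _ _ hK hKi
  · intro k l
    fin_cases k <;> fin_cases l <;> simp [Fin.sum_univ_three, cg0, sg, pairOdd] <;> grind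
  · intro i j
    fin_cases i <;> fin_cases j <;> simp [Fin.sum_univ_three, cg0', cg0, sg, pairOdd] <;> grind
  · intro k l M
    fin_cases k <;> fin_cases l <;> fin_cases M <;>
      simp [Fin.sum_univ_three, cg1, sg, pairOdd] <;> grind
  · intro i j M
    fin_cases i <;> fin_cases j <;> fin_cases M <;>
      simp [Fin.sum_univ_three, cg1', cg1, sg, pairOdd] <;> grind


/-- The algebra homomorphism whose diagonal entries are the pairings with `K` and `K⁻¹` and whose
upper right entry is the pairing with `u = x v₊ + y v₋`. Its multiplicativity is the rule
`⟨u, ab⟩ = ⟨u, a⟩⟨K⁻¹, b⟩ + ⟨K, a⟩⟨u, b⟩`, dual to `Δ(u) = u ⊗ K⁻¹ + K ⊗ u`. -/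
def pairHom (P : Param) (x y : ℂ) : OSp P →ₐ[ℂ] Matrix (Fin 2) (Fin 2) ℂ :=
  OSp.lift (pairGen P x y) (pairGen_law P x y)

/-- The duality pairing `⟨x v₊ + y v₋, a⟩` as a linear functional of `a`. -/
def pair (P : Param) (x y : ℂ) : OSp P →ₗ[ℂ] ℂ :=
  Matrix.entryLinearMap ℂ ℂ 0 1 ∘ₗ (pairHom P x y).toLinearMap

/-- The action `a ⊙ u = (-1)^{|a||u|} (u ⊗ id)(Δ(a))` of the odd element `u = x v₊ + y v₋`. -/
def odot (P : Param) (x y : ℂ) : OSp P →ₗ[ℂ] OSp P :=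
  (TensorProduct.lid ℂ (OSp P)).toLinearMap ∘ₗ LinearMap.rTensor (OSp P) (pair P x y) ∘ₗ
    (GradedTensorProduct.of ℂ (gr (OSp P)) (gr (OSp P))).symm.toLinearMap ∘ₗ
      (coprod P).toLinearMap ∘ₗ par.toLinearMap

/-- The action of `P_R = -√g₃ v₊ + √g₁ v₋`, where `s₁ = √g₁` and `s₃ = √g₃`. -/
def actPR (P : Param) (s₁ s₃ : ℂ) : OSp P →ₗ[ℂ] OSp P := odot P (-s₃) s₁

/-- The adjoint corepresentation matrix `T⁽²⁾(0)`, with rows and columns indexed by the weights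
`2, 1, 0, -1, -2`. -/
def T2 (P : Param) (i j : Fin 5) : OSp P :=
  let a := T1 P 0 0
  let α := T1 P 0 1
  let b := T1 P 0 2
  let γ := T1 P 1 0
  let e := T1 P 1 1
  let β := T1 P 1 2
  let c := T1 P 2 0
  let δ := T1 P 2 1
  let d := T1 P 2 2
  let p := P.q⁻¹
  !![a * a, P.k1 • (a * α), P.k3 • (a * b), P.k1 • (α * b), b * b;
    P.k1 • (a * γ), a * e + p • (γ * α), P.k2 • (a * β + p • (γ * b)), -(α * β) + p • (e * b),
      P.k1 • (b * β);
    P.k3 • (a * c), P.k2 • (a * δ + c * α), a * d + (p * qnum P.t 2) • (α * δ) + p ^ 2 • (b * c),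
      P.k2 • (α * d + δ * b), P.k3 • (b * d);
    P.k1 • (γ * c), γ * δ + p • (c * e), P.k2 • (γ * d + p • (c * β)), e * d + p • (β * δ),
      P.k1 • (β * d);
    c * c, P.k1 • (c * δ), P.k3 • (c * d), P.k1 • (δ * d), d * d] i j

/-! ### The quantum supersphere -/

/-- The free algebra on the coordinates `Y₂, Y₁, Y₀, Y₋₁, Y₋₂` (indexed by `0, …, 4`). -/
abbrev FreeY : Type := FreeAlgebra ℂ (Fin 5)

/-- The free coordinates. -/
def fy (i : Fin 5) : FreeY := FreeAlgebra.ι ℂ i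

/-- The image of `∑ W i j eᵢ ⊗ eⱼ ∈ V² ⊗ V²` under the product. -/
def quad (W : Matrix (Fin 5) (Fin 5) ℂ) : FreeY := ∑ i, ∑ j, W i j • (fy i * fy j)

/-- The element `∑ v i Yᵢ`. -/
def lin (v : Fin 5 → ℂ) : FreeY := ∑ i, v i • fy i

/-- The parity operator of `V²`. -/
def gam : Matrix (Fin 5) (Fin 5) ℂ := Matrix.diagonal fun i => sg i

/-- The action of an odd generator `v = v_±` on `V² ⊗ V²` through `Δ(v) = v ⊗ K⁻¹ + K ⊗ v`, that is
`v (x ⊗ y) = v x ⊗ K⁻¹ y + (-1)^{|x|} K x ⊗ v y`, in terms of coefficient matrices. -/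
def oddAct (P : Param) (v : UGen) (W : Matrix (Fin 5) (Fin 5) ℂ) : Matrix (Fin 5) (Fin 5) ℂ :=
  rep2 P (ugen P v) * W * (rep2 P (ugen P .Kinv)).transpose +
    gam * rep2 P (ugen P .K) * W * (rep2 P (ugen P v)).transpose

/-- The highest weight vector of the component `L` of `V² ⊗ V²`, for `L = 0, 1, 2, 3` (the unique
vector of weight `L` annihilated by `v₊`, up to normalisation). -/
def hwv (P : Param) : Fin 4 → Matrix (Fin 5) (Fin 5) ℂ :=
  ![!![0, 0, 0, 0, P.q⁻¹; 0, 0, 0, -P.t⁻¹, 0; 0, 0, -1, 0, 0; 0, P.t, 0, 0, 0; P.q, 0, 0, 0, 0],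
    !![0, 0, 0, P.k1, 0; 0, 0, -(P.q * P.k2), 0, 0; 0, -(P.q ^ 2 * P.k2), 0, 0, 0;
      P.q ^ 3 * P.k1, 0, 0, 0, 0; 0, 0, 0, 0, 0],
    !![0, 0, -P.k1, 0, 0; 0, P.t ^ 3 * P.k2, 0, 0, 0; P.q ^ 3 * P.k1, 0, 0, 0, 0;
      0, 0, 0, 0, 0; 0, 0, 0, 0, 0],
    !![0, -1, 0, 0, 0; P.q ^ 2, 0, 0, 0, 0; 0, 0, 0, 0, 0; 0, 0, 0, 0, 0; 0, 0, 0, 0, 0]]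

/-- The vector of weight `M = L - k` of the component `L`: the composite object `E^L_M`, with the
Clebsch-Gordan coefficients normalised by `E^L_{L-k} = v₋^k E^L_L`. -/
def EL (P : Param) (L : Fin 4) (k : ℕ) : FreeY := quad ((oddAct P .vm)^[k] (hwv P L))

/-- The vector `v₋^k Y₂` of weight `2 - k`. -/
def Yk (P : Param) (k : ℕ) : FreeY := lin ((rep2 P (ugen P .vm) ^ k).mulVec (Pi.single 0 1))

/-- The covariant relations for `L = 1, 2, 3`: `E^L_M = 0` for `L = 1, 3` and `E²_M = ξ Y_M`. -/
inductive CovRel (P : Param) (ξ : ℂ) : FreeY → FreeY → Prop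
  | L1 (k : Fin 3) : CovRel P ξ (EL P 1 k) 0
  | L2 (k : Fin 5) : CovRel P ξ (EL P 2 k) (ξ • Yk P k)
  | L3 (k : Fin 7) : CovRel P ξ (EL P 3 k) 0

/-- The covariant relations for `L = 1, 2, 3` together with the radius relation `E⁰₀ = r`. -/
inductive SphereRel (P : Param) (ξ r : ℂ) : FreeY → FreeY → Prop
  | radius : SphereRel P ξ r (EL P 0 0) (r • 1)
  | cov {x y : FreeY} (h : CovRel P ξ x y) : SphereRel P ξ r x y

/-- The algebra defined by the `L = 1, 2, 3` covariant relations alone. -/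
abbrev PreSphere (P : Param) (ξ : ℂ) : Type := RingQuot (CovRel P ξ)

/-- The covariant algebra with parameters `ξ` and `r`. -/
abbrev Sphere (P : Param) (ξ r : ℂ) : Type := RingQuot (SphereRel P ξ r)

/-- The coordinates `Y₂, Y₁, Y₀, Y₋₁, Y₋₂` of the covariant algebra (indexed by `0, …, 4`). -/
def Y (P : Param) (ξ r : ℂ) (i : Fin 5) : Sphere P ξ r :=
  RingQuot.mkAlgHom ℂ (SphereRel P ξ r) (fy i)

/-- The sign change of the odd coordinates on the free algebra. -/
def freePar : FreeY →ₐ[ℂ] FreeY := FreeAlgebra.lift ℂ fun i : Fin 5 => sg i • fy i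

lemma freePar_fy (i : Fin 5) : freePar (fy i) = sg i • fy i := FreeAlgebra.lift_ι_apply _ _

lemma freePar_quad {W : Matrix (Fin 5) (Fin 5) ℂ} {s : ℂ} (h : gam * W * gam = s • W) :
    freePar (quad W) = s • quad W := by
  simp only [quad, map_sum, map_smul, map_mul, freePar_fy, Finset.smul_sum]
  refine Finset.sum_congr rfl fun i _ => Finset.sum_congr rfl fun j _ => ?_
  have := congrFun (congrFun h i) j
  simp only [gam, Matrix.diagonal_mul, Matrix.mul_diagonal, Matrix.smul_apply, smul_eq_mul] at this
  rw [smul_mul_smul_comm, smul_smul, smul_smul, ← this]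
  congr 1
  ring

lemma freePar_lin {v : Fin 5 → ℂ} {s : ℂ} (h : gam.mulVec v = s • v) :
    freePar (lin v) = s • lin v := by
  simp only [lin, map_sum, map_smul, freePar_fy, Finset.smul_sum]
  refine Finset.sum_congr rfl fun i _ => ?_
  have := congrFun h i
  simp only [gam, Matrix.mulVec_diagonal, Pi.smul_apply, smul_eq_mul] at this
  rw [smul_smul, smul_smul, ← this, mul_comm]

lemma gam_sq : gam * gam = 1 := by
  rw [gam, Matrix.diagonal_mul_diagonal, ← Matrix.diagonal_one]
  congr 1
  funext i
  exact sg_mul_self i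

lemma rep2_K (P : Param) : rep2 P (ugen P .K) =
    Matrix.diagonal ![P.t ^ 2, P.t, 1, P.t⁻¹, (P.t ^ 2)⁻¹] := by
  rw [rep2, Uq.lift, ugen, RingQuot.liftAlgHom_mkAlgHom_apply, FreeAlgebra.lift_ι_apply]

lemma rep2_Kinv (P : Param) : rep2 P (ugen P .Kinv) =
    Matrix.diagonal ![(P.t ^ 2)⁻¹, P.t⁻¹, 1, P.t, P.t ^ 2] := by
  rw [rep2, Uq.lift, ugen, RingQuot.liftAlgHom_mkAlgHom_apply, FreeAlgebra.lift_ι_apply]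

lemma rep2_vm (P : Param) : rep2 P (ugen P .vm) = (P.nu * P.t) •
    !![0, 0, 0, 0, 0; P.k1, 0, 0, 0, 0; 0, -P.k2, 0, 0, 0; 0, 0, P.k2, 0, 0;
      0, 0, 0, -P.k1, 0] := by
  rw [rep2, Uq.lift, ugen, RingQuot.liftAlgHom_mkAlgHom_apply, FreeAlgebra.lift_ι_apply]

lemma rep2_vp (P : Param) : rep2 P (ugen P .vp) = (P.nu * P.t) •
    !![0, P.k1, 0, 0, 0; 0, 0, P.k2, 0, 0; 0, 0, 0, P.k2, 0; 0, 0, 0, 0, P.k1; 0, 0, 0, 0, 0] := by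
  rw [rep2, Uq.lift, ugen, RingQuot.liftAlgHom_mkAlgHom_apply, FreeAlgebra.lift_ι_apply]

set_option maxHeartbeats 4000000 in
/-- The vectors `hwv` are indeed annihilated by `v₊`. -/
lemma hwv_highest (P : Param) (L : Fin 4) : oddAct P .vp (hwv P L) = 0 := by
  have h0 := P.t_ne
  have h1 := P.k1_sq'
  have h2 := P.k2_sq'
  have hq : P.q = P.t ^ 2 := rfl
  have hi : P.t * P.t⁻¹ = 1 := mul_inv_cancel₀ h0
  have hn : (P.t ^ 2)⁻¹ = P.t⁻¹ ^ 2 := (inv_pow _ _).symm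
  rw [oddAct, rep2_vp, rep2_K, rep2_Kinv, gam]
  ext i j
  rw [Matrix.add_apply, Matrix.diagonal_transpose, Matrix.diagonal_mul_diagonal,
    Matrix.mul_diagonal, Matrix.mul_apply, Matrix.mul_apply]
  simp only [Matrix.diagonal_mul, Fin.sum_univ_five, hq, hwv, hn]
  fin_cases L <;> fin_cases i <;> fin_cases j <;> simp [sg, -inv_pow] <;> grind

lemma gam_vm (P : Param) : gam * rep2 P (ugen P .vm) = -(rep2 P (ugen P .vm) * gam) := by
  rw [rep2_vm, gam]
  ext i j
  rw [Matrix.diagonal_mul, Matrix.neg_apply, Matrix.mul_diagonal, Matrix.smul_apply]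
  fin_cases i <;> fin_cases j <;> simp [sg] <;> ring

lemma vmT_gam (P : Param) : (rep2 P (ugen P .vm)).transpose * gam =
    -(gam * (rep2 P (ugen P .vm)).transpose) := by
  have h : gam.transpose = gam := Matrix.diagonal_transpose _
  have := congrArg Matrix.transpose (gam_vm P)
  rwa [Matrix.transpose_mul, Matrix.transpose_neg, Matrix.transpose_mul, h] at this

lemma gam_oddAct (P : Param) {W : Matrix (Fin 5) (Fin 5) ℂ} {s : ℂ} (h : gam * W * gam = s • W) :
    gam * oddAct P .vm W * gam = (-s) • oddAct P .vm W := by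
  have hK : gam * rep2 P (ugen P .K) = rep2 P (ugen P .K) * gam := by
    rw [rep2_K, gam, Matrix.diagonal_mul_diagonal, Matrix.diagonal_mul_diagonal]
    congr 1; funext i; exact mul_comm _ _
  have hKi : (rep2 P (ugen P .Kinv)).transpose * gam =
      gam * (rep2 P (ugen P .Kinv)).transpose := by
    rw [rep2_Kinv, gam, Matrix.diagonal_transpose, Matrix.diagonal_mul_diagonal,
      Matrix.diagonal_mul_diagonal]
    congr 1; funext i; exact mul_comm _ _
  have h1 : gam * (rep2 P (ugen P .vm) * W * (rep2 P (ugen P .Kinv)).transpose) * gam =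
      -(rep2 P (ugen P .vm) * (gam * W * gam) * (rep2 P (ugen P .Kinv)).transpose) := by
    have e : gam * (rep2 P (ugen P .vm) * W * (rep2 P (ugen P .Kinv)).transpose) * gam =
      gam * rep2 P (ugen P .vm) * W * ((rep2 P (ugen P .Kinv)).transpose * gam) := by
      simp only [mul_assoc]
    rw [e, gam_vm, hKi]
    simp only [mul_assoc, neg_mul]
  have h2 : gam * (gam * rep2 P (ugen P .K) * W * (rep2 P (ugen P .vm)).transpose) * gam =
      -(gam * rep2 P (ugen P .K) * (gam * W * gam) * (rep2 P (ugen P .vm)).transpose) := by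
    have e : gam * (gam * rep2 P (ugen P .K) * W * (rep2 P (ugen P .vm)).transpose) * gam =
      gam * (gam * rep2 P (ugen P .K)) * W * ((rep2 P (ugen P .vm)).transpose * gam) := by
      simp only [mul_assoc]
    have e2 : gam * (gam * rep2 P (ugen P .K)) = gam * rep2 P (ugen P .K) * gam := by
      rw [mul_assoc gam _ gam, ← hK]
    rw [e, vmT_gam, e2]
    simp only [mul_assoc, mul_neg]
  rw [oddAct, mul_add, add_mul, h1, h2, h]
  simp only [Matrix.mul_smul, Matrix.smul_mul, smul_add, neg_smul]

/-- The parities of the highest weight vectors. -/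
lemma gam_hwv (P : Param) (L : Fin 4) : gam * hwv P L * gam = sg L • hwv P L := by
  ext i j
  simp only [gam, Matrix.diagonal_mul, Matrix.mul_diagonal, Matrix.smul_apply, smul_eq_mul]
  fin_cases L <;> fin_cases i <;> fin_cases j <;> simp [hwv, sg] <;> norm_num

lemma freePar_EL (P : Param) (L : Fin 4) (k : ℕ) :
    freePar (EL P L k) = sg (L + k) • EL P L k := by
  apply freePar_quad
  induction k with
  | zero => exact gam_hwv P L
  | succ k ih =>
    rw [Function.iterate_succ_apply', gam_oddAct P ih, ← add_assoc, sg_add _ 1]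
    congr 1
    simp [sg]

lemma freePar_Yk (P : Param) (k : ℕ) : freePar (Yk P k) = sg k • Yk P k := by
  apply freePar_lin
  induction k with
  | zero =>
    ext i
    simp only [gam, Matrix.mulVec_diagonal, pow_zero, Matrix.one_mulVec]
    fin_cases i <;> simp [sg]
  | succ k ih =>
    rw [pow_succ', ← Matrix.mulVec_mulVec, Matrix.mulVec_mulVec, gam_vm, Matrix.neg_mulVec,
      ← Matrix.mulVec_mulVec, ih, Matrix.mulVec_smul, sg_add]
    simp [sg]

lemma freePar_rel (P : Param) (ξ r : ℂ) {x y : FreeY} (h : SphereRel P ξ r x y) :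
    RingQuot.mkAlgHom ℂ (SphereRel P ξ r) (freePar x) =
      RingQuot.mkAlgHom ℂ (SphereRel P ξ r) (freePar y) := by
  have e : ∀ s : ℂ, RingQuot.mkAlgHom ℂ (SphereRel P ξ r) (s • x) =
      RingQuot.mkAlgHom ℂ (SphereRel P ξ r) (s • y) := by
    intro s
    rw [map_smul, map_smul, RingQuot.mkAlgHom_rel ℂ h]
  cases h with
  | radius =>
    rw [freePar_EL, map_smul freePar, map_one freePar, e]
    simp [sg]
  | cov h =>
    cases h with
    | L1 k => rw [freePar_EL, map_zero freePar, e, smul_zero]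
    | L2 k =>
      rw [freePar_EL, map_smul freePar, freePar_Yk, e, smul_comm]
      congr 2
      rw [sg_add]
      simp [sg]
    | L3 k => rw [freePar_EL, map_zero freePar, e, smul_zero]

/-- The sign change of the odd coordinates on the covariant algebra. -/
def spherePar (P : Param) (ξ r : ℂ) : Sphere P ξ r →ₐ[ℂ] Sphere P ξ r :=
  RingQuot.liftAlgHom ℂ ⟨(RingQuot.mkAlgHom ℂ (SphereRel P ξ r)).comp freePar,
    fun _ _ h => freePar_rel P ξ r h⟩

lemma spherePar_mk (P : Param) (ξ r : ℂ) (x : FreeY) :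
    spherePar P ξ r (RingQuot.mkAlgHom ℂ (SphereRel P ξ r) x) =
      RingQuot.mkAlgHom ℂ (SphereRel P ξ r) (freePar x) :=
  RingQuot.liftAlgHom_mkAlgHom_apply ℂ ((RingQuot.mkAlgHom ℂ (SphereRel P ξ r)).comp freePar)
    (fun _ _ h => freePar_rel P ξ r h) x

/-- The parity of the covariant algebra: `Y_{±1}` are odd, `Y_0` and `Y_{±2}` are even. -/
instance (P : Param) (ξ r : ℂ) : SuperAlg (Sphere P ξ r) where
  par := spherePar P ξ r
  par_par a := by
    obtain ⟨x, rfl⟩ := RingQuot.mkAlgHom_surjective ℂ (SphereRel P ξ r) a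
    rw [spherePar_mk, spherePar_mk]
    have : freePar.comp freePar = AlgHom.id ℂ FreeY := by
      apply FreeAlgebra.hom_ext
      funext i
      change freePar (freePar (fy i)) = fy i
      rw [freePar_fy, map_smul, freePar_fy, smul_smul, sg_mul_self, one_smul]
    congr 1
    exact DFunLike.congr_fun this x

/-- The rescaled parameter `χ = ξ / (κ₁ q² (q² + q + 1))`. -/
def chi (P : Param) (ξ : ℂ) : ℂ := ξ / (P.k1 * P.q ^ 2 * (P.q ^ 2 + P.q + 1))

/-- The ten commutation relations (each element is set equal to zero): they express `Y_j Y_i`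
for `j < i` through the products `Y_a Y_b` with `a ≥ b` and the coordinates. -/
def commRel (P : Param) (ξ : ℂ) : Fin 10 → FreeY :=
  let q := P.q
  let t := P.t
  let χ := chi P ξ
  ![fy 1 * fy 0 - (q⁻¹ ^ 2) • (fy 0 * fy 1),
    fy 2 * fy 0 - (q⁻¹ ^ 4) • (fy 0 * fy 2) - (χ * P.k1 ^ 2 * (q + 1)) • fy 0,
    fy 3 * fy 0 - (q⁻¹ ^ 6) • (fy 0 * fy 3) - (χ * P.k3 * (q + 1) * q⁻¹) • fy 1,
    fy 4 * fy 0 + ((q ^ 5 - q - 1) * q⁻¹ ^ 4) • (fy 0 * fy 4)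
      - ((q ^ 5 - 1) * (q + 1) * t⁻¹ ^ 9) • (fy 1 * fy 3)
      - (χ * (q ^ 2 - q + 1) * (q + 1) ^ 2 * q⁻¹ ^ 2) • fy 2,
    fy 2 * fy 1 - (q⁻¹ ^ 2) • (fy 1 * fy 2) - (χ * (q + 1)) • fy 1,
    fy 3 * fy 1 + q⁻¹ • (fy 1 * fy 3) - ((q ^ 2 - 1) * t⁻¹ ^ 3) • (fy 2 * fy 2)
      + (χ * (q + 1) * t) • fy 2,
    fy 4 * fy 1 - (q⁻¹ ^ 6) • (fy 1 * fy 4) - (χ * P.k3 * (q + 1) * q⁻¹) • fy 3,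
    fy 3 * fy 2 - (q⁻¹ ^ 2) • (fy 2 * fy 3) - (χ * (q + 1)) • fy 3,
    fy 4 * fy 2 - (q⁻¹ ^ 4) • (fy 2 * fy 4) - (χ * P.k1 ^ 2 * (q + 1)) • fy 4,
    fy 4 * fy 3 - (q⁻¹ ^ 2) • (fy 3 * fy 4)]

/-- The two relations for `Y₁²` and `Y₋₁²`. -/
def sqRel (P : Param) (ξ : ℂ) : Fin 2 → FreeY :=
  let q := P.q
  let t := P.t
  let χ := chi P ξ
  ![fy 1 * fy 1 - (P.k1 / P.k2 * (q - 1) * t⁻¹ ^ 5) • (fy 0 * fy 2)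
      + (P.k1 / P.k2 * χ * t⁻¹) • fy 0,
    fy 3 * fy 3 - (P.k1 / P.k2 * (q - 1) * t⁻¹ ^ 5) • (fy 2 * fy 4)
      + (P.k1 / P.k2 * χ * t⁻¹) • fy 4]

/-- The three constraints, which relate ordered products of coordinates to each other. -/
def constrRel (P : Param) (ξ : ℂ) : Fin 3 → FreeY :=
  let q := P.q
  let t := P.t
  let χ := chi P ξ
  ![fy 1 * fy 2 - (P.k3 * q⁻¹) • (fy 0 * fy 3) - χ • fy 1,
    fy 2 * fy 2 - (P.k1 ^ 2) • (fy 0 * fy 4) + ((q ^ 3 + q ^ 2 + 1) * t⁻¹ ^ 5) • (fy 1 * fy 3)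
      - χ • fy 2,
    fy 2 * fy 3 - (P.k3 * q⁻¹) • (fy 1 * fy 4) - χ • fy 3]

/-- The radius relation. -/
def radiusRel (P : Param) (r : ℂ) : FreeY := EL P 0 0 - r • 1

/-- The normally ordered monomials
`Y₂^a Y₁^ε Y₀^b` and `Y₀^b Y₋₁^ε Y₋₂^a` with `ε ∈ {0, 1}`, indexed by `b` and by the total weight
`w = ±(2a + ε)` of the factors other than `Y₀`. -/
def normalMon (P : Param) (ξ r : ℂ) (p : ℤ × ℕ) : Sphere P ξ r :=
  Y P ξ r 0 ^ (p.1.toNat / 2) * Y P ξ r 1 ^ (p.1.toNat % 2) * Y P ξ r 2 ^ p.2 *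
    Y P ξ r 3 ^ ((-p.1).toNat % 2) * Y P ξ r 4 ^ ((-p.1).toNat / 2)

/-- Consistency: the normally ordered monomials form a basis of the covariant algebra. Equivalently,
reordering products by means of the defining relations has a unique result. -/
def Consistent (P : Param) (ξ r : ℂ) : Prop :=
  LinearIndependent ℂ (normalMon P ξ r) ∧ Submodule.span ℂ (Set.range (normalMon P ξ r)) = ⊤

/-- The squared radius attached to the parameter `ξ`. -/
def radiusOf (P : Param) (ξ : ℂ) : ℂ :=
  P.q * ξ ^ 2 / ((P.q ^ 2 + 1) * (P.q ^ 2 + P.q + 1) ^ 2)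

/-- The element `X_k = g₁ T_{2,k} - (κ₁/κ₂) √g₁ √g₃ T_{0,k} + g₃ T_{-2,k}` of `OSp_q(1|2)`, a linear
combination of the entries of the `k`-th column of `T⁽²⁾(0)`; here `s₁ = √g₁` and `s₃ = √g₃`. -/
def coordX (P : Param) (s₁ s₃ : ℂ) (k : Fin 5) : OSp P :=
  s₁ ^ 2 • T2 P 0 k - (P.k1 / P.k2 * s₁ * s₃) • T2 P 2 k + s₃ ^ 2 • T2 P 4 k

/-- The parameter `ξ = (κ₁²/κ₂)(1 - q³) √g₁ √g₃` of the realization. -/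
def xiOf (P : Param) (s₁ s₃ : ℂ) : ℂ := P.k1 ^ 2 / P.k2 * (1 - P.q ^ 3) * s₁ * s₃

end QSphere

end

open QSphere
open scoped TensorProduct

set_option linter.unusedSimpArgs false

noncomputable section

namespace QSphere
open SuperAlg

/-! ### The row action as an algebra homomorphism into `2 × 2` matrices -/

section RowAction
variable (P : Param)

/-! Everything rests on the row action of `U_q[osp(1|2)]` on 𝒜. Because v± are twisted primitive, f
↦ f ⊙ u is the corner of an algebra homomorphism from 𝒜 to upper triangular 2×2 matrices over 𝒜
(`rowHom`). Hence the actions `Dp` of v₊ and `Dm` of v₋ are skew derivations with twists `sig` and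
`tau`. They are locally nilpotent and satisfy the anticommutation relation (`anticomm_row`). `Dm`
raises the row weight and `Dp` lowers it, so a highest weight vector is a weight vector killed by
`Dm`. Since t is not a root of unity, a nonzero one has weight n ≥ 0 and is killed by v₊^(2n+1)
(`highest_weight`).

The central fact is that a highest weight vector f with ε(v₊^k f) = 0 for all k is zero
(`eq_zero_of_phi`). No basis of 𝒜 is known beforehand. Instead a = T₀₀ is shown not to be a left
zero divisor (`corner_regular`); a power of a moves any element into the span of the monomials a^i
α^m γ^k; and there the highest weight vectors of weight w are combinations of the a^i α^m with i + m
= w, which the functionals ε ∘ v₊^k separate. There are two consequences. A subspace of 𝒜 that is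
stable under the row action and the weight projections and is killed by the counit is zero
(`eq_zero_of_stable`). Highest weight vectors of weight n with orders 0, …, 2n span all those of
weight n (`mem_span_of_highest`).

Corepresentation and covariance. `T2` is the ℓ = 2 block of the tensor square of `T1` (`T2_eq`),
which gives its coproduct. For covariance the transformed relations are not computed. The matrix
coefficients of the coaction between a relation and a functional vanishing on all relations span a
stable subspace killed by ε, hence they vanish (`rTensor_coaction_eq_zero`).

Regrouping. The sixteen relations are v₋-strings over four vectors killed by v₊, and are independent
by the action of v₊. The span of the regrouped relations is stable under v₋ and contains the four
vectors, so a dimension count identifies the two spans (`span_relations`).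

Consistency. With u = Y₀ - θ and rescaled Y_{±2}, the L = 1, 2, 3 relations reduce every product of
a coordinate of positive weight and one of negative weight, up to a multiple of W = E⁰₀ - r(ξ), to a
polynomial in u, possibly times one odd coordinate (`Reorder`). Computing triple products in two
ways shows that W commutes with u and that all other coordinates annihilate it. So E⁰₀ is central,
and in S(ξ, r), where W is the scalar r - r(ξ), either r = r(ξ) or Y₂ = 0. If W = 0, the rules
reduce every product to normally ordered monomials. Their independence comes from the realization.

Realization. S(ξ) has a character, a classical point; composed with the coaction it gives the
homomorphism `orbit` with Y_k ↦ X_k. If √g₁ ≠ 0, the component of weight 2n of the image of a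
normally ordered monomial of degree n is its highest one. It is a highest weight vector, and its
order runs exactly once through 0, …, 4n as the monomial varies in degree n. This gives
independence, and, by removing top components one after the other, shows that these images span the
invariants; ρ-invariance excludes odd weights. If √g₁ = 0, the half-turn anti-automorphism of 𝒜,
which exchanges v₊ and v₋, reduces to the case √g₃ = 0. -/

/-- Two algebra homomorphisms that supercommute on homogeneous elements induce a homomorphism
from the graded tensor product. -/
lemma anticommutes_of_par {A B C : Type} [Ring A] [Algebra ℂ A] [SuperAlg A] [Ring B] [Algebra ℂ B]
    [SuperAlg B] [Ring C] [Algebra ℂ C] (f : A →ₐ[ℂ] C) (g : B →ₐ[ℂ] C)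
    (h0 : ∀ a b, par a = a → f a * g b = g b * f a)
    (h1 : ∀ a b, par a = -a → f a * g b = g (par b) * f a)
    ⦃i j : ZMod 2⦄ (a : gr A i) (b : gr B j) :
    f a * g b = (-1 : ℤˣ) ^ (j * i) • (g b * f a) := by
  obtain ⟨a, ha⟩ := a
  obtain ⟨b, hb⟩ := b
  have key : ∀ k : ZMod 2, k = 0 ∨ k = 1 := by decide
  rcases key i with rfl | rfl
  · simp only [h0 a b (mem_gr_zero.1 ha), mul_zero, uzpow_zero, one_smul]
  · have ha' := mem_gr_one.1 ha
    rcases key j with rfl | rfl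
    · simp only [h1 a b ha', mem_gr_zero.1 hb, zero_mul, uzpow_zero, one_smul]
    · simp only [h1 a b ha', mem_gr_one.1 hb, map_neg, neg_mul, mul_one, uzpow_one, Units.neg_smul,
        one_smul]

/-- The algebra homomorphism `f ↦ diag(par f, f)`. -/
def diagPar : OSp P →ₐ[ℂ] Matrix (Fin 2) (Fin 2) (OSp P) where
  toFun f := Matrix.diagonal ![par f, f]
  map_one' := by
    rw [map_one, ← Matrix.diagonal_one]; congr 1; funext i; fin_cases i <;> rfl
  map_mul' f g := by
    rw [map_mul, Matrix.diagonal_mul_diagonal]; congr 1; funext i; fin_cases i <;> rfl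
  map_zero' := by
    rw [map_zero, ← Matrix.diagonal_zero]; congr 1; funext i; fin_cases i <;> rfl
  map_add' f g := by
    rw [map_add, Matrix.diagonal_add]; congr 1; funext i; fin_cases i <;> rfl
  commutes' r := by
    rw [Matrix.algebraMap_eq_diagonal]
    congr 1; funext i; fin_cases i <;> simp

/-- The pairing matrix with entries regarded as scalars of `OSp_q(1|2)`. -/
def pairScalar (x y : ℂ) : OSp P →ₐ[ℂ] Matrix (Fin 2) (Fin 2) (OSp P) :=
  (Algebra.ofId ℂ (OSp P)).mapMatrix.comp (pairHom P x y)

lemma OSp.adjoin_T1 : Algebra.adjoin ℂ (Set.range fun p : Fin 3 × Fin 3 => T1 P p.1 p.2) = ⊤ := by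
  set S := Algebra.adjoin ℂ (Set.range fun p : Fin 3 × Fin 3 => T1 P p.1 p.2) with hS
  have hmem : ∀ i j, T1 P i j ∈ S := fun i j => Algebra.subset_adjoin ⟨(i, j), rfl⟩
  rw [eq_top_iff]
  rintro a -
  obtain ⟨x, rfl⟩ := RingQuot.mkAlgHom_surjective ℂ (ARel P) a
  induction x using FreeAlgebra.induction with
  | grade0 r => rw [AlgHom.commutes]; exact S.algebraMap_mem r
  | grade1 p => exact hmem p.1 p.2
  | mul x y hx hy => rw [map_mul]; exact S.mul_mem hx hy
  | add x y hx hy => rw [map_add]; exact S.add_mem hx hy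

variable {P} in
/-- Induction on words in the entries of the fundamental corepresentation matrix. -/
lemma OSp.induction_mul {M : Submodule ℂ (OSp P)} (h1 : 1 ∈ M)
    (hmul : ∀ i j, ∀ f ∈ M, T1 P i j * f ∈ M) : M = ⊤ := by
  rw [eq_top_iff]
  rintro a -
  have ha : a ∈ Algebra.adjoin ℂ (Set.range fun p : Fin 3 × Fin 3 => T1 P p.1 p.2) := by
    rw [OSp.adjoin_T1]; trivial
  suffices ∀ f ∈ M, a * f ∈ M by simpa using this 1 h1
  induction ha using Algebra.adjoin_induction with
  | mem x hx => obtain ⟨p, rfl⟩ := hx; exact hmul p.1 p.2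
  | algebraMap r =>
    intro f hf; rw [← Algebra.smul_def]; exact M.smul_mem r hf
  | add x y _ _ hx hy => intro f hf; rw [add_mul]; exact M.add_mem (hx f hf) (hy f hf)
  | mul x y _ _ hx hy => intro f hf; rw [mul_assoc]; exact hx _ (hy f hf)

variable {P} in
lemma OSp.subalgebra_eq_top {S : Subalgebra ℂ (OSp P)} (h : ∀ i j, T1 P i j ∈ S) : S = ⊤ := by
  rw [eq_top_iff, ← OSp.adjoin_T1, Algebra.adjoin_le_iff]
  rintro _ ⟨p, rfl⟩
  exact h p.1 p.2

variable {P} in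
lemma OSp.submodule_induction {M : Submodule ℂ (OSp P)} (h1 : 1 ∈ M)
    (hmul : ∀ i j, ∀ f ∈ M, T1 P i j * f ∈ M) (f : OSp P) : f ∈ M := by
  rw [OSp.induction_mul h1 hmul]; trivial

lemma pairHom_T1 (x y : ℂ) (i j : Fin 3) : pairHom P x y (T1 P i j) = pairGen P x y i j :=
  OSp.lift_T1 _ _ _ _

/-- Both sides are algebra homomorphisms, so the generators suffice. Conjugation by diag(1, -1)
changes the sign of the off-diagonal entries only; hence the pairings with `K` and `K⁻¹` vanish on
odd elements and the pairing with `u` vanishes on even ones. -/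
lemma pairHom_par (x y : ℂ) (f : OSp P) :
    pairHom P x y (par f) =
      Matrix.diagonal ![1, -1] * pairHom P x y f * Matrix.diagonal ![1, -1] := by
  have hd : (Matrix.diagonal ![1, -1] : Matrix (Fin 2) (Fin 2) ℂ) * Matrix.diagonal ![1, -1] = 1 := by
    rw [Matrix.diagonal_mul_diagonal, ← Matrix.diagonal_one]
    congr 1; funext i; fin_cases i <;> simp
  let F : OSp P →ₐ[ℂ] Matrix (Fin 2) (Fin 2) ℂ :=
    { toFun := fun f => Matrix.diagonal ![1, -1] * pairHom P x y f * Matrix.diagonal ![1, -1]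
      map_one' := by rw [map_one, mul_one, hd]
      map_mul' := fun f g => by
        rw [map_mul]
        simp only [mul_assoc]
        rw [← mul_assoc (Matrix.diagonal ![1, -1]) (Matrix.diagonal ![1, -1]), hd, one_mul]
      map_zero' := by rw [map_zero, mul_zero, zero_mul]
      map_add' := fun f g => by rw [map_add, mul_add, add_mul]
      commutes' := fun r => by
        rw [AlgHom.commutes, ← Algebra.commutes, mul_assoc, hd, mul_one] }
  have : (pairHom P x y).comp par = F := by
    apply OSp.hom_ext
    intro i j
    rw [AlgHom.comp_apply, par_T1, map_smul]
    change _ = Matrix.diagonal ![1, -1] * pairHom P x y (T1 P i j) * Matrix.diagonal ![1, -1]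
    rw [pairHom_T1, pairGen_eq]
    ext k l
    rw [Matrix.mul_diagonal, Matrix.diagonal_mul]
    fin_cases i <;> fin_cases j <;> fin_cases k <;> fin_cases l <;> norm_num [sg, pairOdd]
  exact DFunLike.congr_fun this f

lemma pairHom_lower (x y : ℂ) (f : OSp P) : pairHom P x y f 1 0 = 0 := by
  let S : Subalgebra ℂ (OSp P) :=
    { carrier := {f | pairHom P x y f 1 0 = 0}
      mul_mem' := by
        intro f g hf hg
        simp only [Set.mem_ofPred_eq] at *
        rw [map_mul, Matrix.mul_apply, Fin.sum_univ_two, hf, hg]; simp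
      add_mem' := by
        intro f g hf hg
        simp only [Set.mem_ofPred_eq] at *
        rw [map_add, Matrix.add_apply, hf, hg, add_zero]
      algebraMap_mem' := by
        intro r
        simp [Matrix.algebraMap_matrix_apply] }
  have : f ∈ S := by
    rw [OSp.subalgebra_eq_top (S := S)]; · trivial
    intro i j
    change pairHom P x y (T1 P i j) 1 0 = 0
    rw [pairHom_T1]; rfl
  exact this

lemma pairHom_even {x y : ℂ} {f : OSp P} (h : par f = f) : pairHom P x y f 0 1 = 0 := by
  have := congrFun (congrFun (pairHom_par P x y f) 0) 1
  rw [Matrix.mul_diagonal, Matrix.diagonal_mul, h] at this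
  simp only [Matrix.cons_val_zero, Matrix.cons_val_one] at this
  linear_combination (1 / 2) * this

lemma pairHom_odd {x y : ℂ} {f : OSp P} (h : par f = -f) :
    pairHom P x y f 0 0 = 0 ∧ pairHom P x y f 1 1 = 0 := by
  have h0 := congrFun (congrFun (pairHom_par P x y f) 0) 0
  have h1 := congrFun (congrFun (pairHom_par P x y f) 1) 1
  rw [Matrix.mul_diagonal, Matrix.diagonal_mul, h, map_neg] at h0 h1
  simp only [Matrix.cons_val_zero, Matrix.cons_val_one, Matrix.neg_apply] at h0 h1
  exact ⟨by linear_combination (-1 / 2) * h0, by linear_combination (-1 / 2) * h1⟩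

lemma pairScalar_apply (x y : ℂ) (f : OSp P) (i j : Fin 2) :
    pairScalar P x y f i j = algebraMap ℂ (OSp P) (pairHom P x y f i j) := rfl

/-- The algebra homomorphism on the graded tensor square given by `f ⊗ g ↦ ⟨·, f⟩ diag(par g, g)`. -/
def rowTensor (x y : ℂ) : (gr (OSp P) ᵍ⊗[ℂ] gr (OSp P)) →ₐ[ℂ] Matrix (Fin 2) (Fin 2) (OSp P) :=
  GradedTensorProduct.lift (gr (OSp P)) (gr (OSp P)) (pairScalar P x y) (diagPar P) (by
    -- For even a the scalar matrix of pairings is diagonal and commutes with diag(par b, b). For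
    -- odd a only its corner survives, and moving the corner past diag(par b, b) exchanges the two
    -- diagonal entries, which amounts to replacing b by par b. This is why the two entries of
    -- `diagPar` differ by the parity.
    apply anticommutes_of_par
    · intro a b h
      change _ * Matrix.diagonal ![par b, b] = Matrix.diagonal ![par b, b] * _
      ext i j
      rw [Matrix.mul_diagonal, Matrix.diagonal_mul, pairScalar_apply]
      fin_cases i <;> fin_cases j <;>
        simp [pairHom_even P h, pairHom_lower, ← Algebra.commutes]
    · intro a b h
      change _ * Matrix.diagonal ![par b, b] = Matrix.diagonal ![par (par b), par b] * _
      ext i j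
      rw [Matrix.mul_diagonal, Matrix.diagonal_mul, pairScalar_apply]
      fin_cases i <;> fin_cases j <;>
        simp [pairHom_odd P h, pairHom_lower, ← Algebra.commutes, par_par])

/-- The matrix of the operators `σ`, `· ⊙ u` and `τ` of the row action. -/
def rowHom (x y : ℂ) : OSp P →ₐ[ℂ] Matrix (Fin 2) (Fin 2) (OSp P) :=
  ((rowTensor P x y).comp (coprod P)).comp par

lemma rowTensor_tmul (x y : ℂ) (f g : OSp P) :
    rowTensor P x y (f ᵍ⊗ₜ[ℂ] g) = pairScalar P x y f * diagPar P g :=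
  GradedTensorProduct.lift_tmul _ _ _ _ _ _ _

/-- In the product of an upper triangular scalar matrix with diag(par g, g) the corner picks up the
last entry g without a sign, so it is the contraction of the first tensor factor with `u`. The sign
in the definition of ⊙ comes from the parity that precedes the coproduct. -/
lemma rowTensor_entry (x y : ℂ) (z : gr (OSp P) ᵍ⊗[ℂ] gr (OSp P)) :
    rowTensor P x y z 0 1 = TensorProduct.lid ℂ (OSp P) (LinearMap.rTensor (OSp P) (pair P x y)
      ((GradedTensorProduct.of ℂ (gr (OSp P)) (gr (OSp P))).symm z)) := by
  let L : (gr (OSp P) ᵍ⊗[ℂ] gr (OSp P)) →ₗ[ℂ] OSp P :=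
    Matrix.entryLinearMap ℂ (OSp P) 0 1 ∘ₗ (rowTensor P x y).toLinearMap
  let L' : (gr (OSp P) ᵍ⊗[ℂ] gr (OSp P)) →ₗ[ℂ] OSp P :=
    (TensorProduct.lid ℂ (OSp P)).toLinearMap ∘ₗ LinearMap.rTensor (OSp P) (pair P x y) ∘ₗ
    (GradedTensorProduct.of ℂ (gr (OSp P)) (gr (OSp P))).symm.toLinearMap
  have : L = L' := by
    apply GradedTensorProduct.hom_ext
    apply TensorProduct.ext'
    intro f g
    change rowTensor P x y (f ᵍ⊗ₜ[ℂ] g) 0 1 =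
      TensorProduct.lid ℂ (OSp P) (LinearMap.rTensor (OSp P) (pair P x y) (f ⊗ₜ g))
    rw [rowTensor_tmul, LinearMap.rTensor_tmul, TensorProduct.lid_tmul]
    change (pairScalar P x y f * Matrix.diagonal ![par g, g]) 0 1 = _
    rw [Matrix.mul_diagonal, pairScalar_apply, Algebra.smul_def]
    rfl
  exact LinearMap.congr_fun this z

lemma odot_eq_rowHom (x y : ℂ) (f : OSp P) : odot P x y f = rowHom P x y f 0 1 :=
  (rowTensor_entry P x y _).symm

lemma rowHom_T1 (x y : ℂ) (i j : Fin 3) : rowHom P x y (T1 P i j) =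
    !![![P.t, 1, P.t⁻¹] i • T1 P i j, sg (i + j) • ∑ k, pairOdd P x y i k • T1 P k j;
      0, (sg (i + j) * ![P.t⁻¹, 1, P.t] i) • T1 P i j] := by
  have hc : coprod P (T1 P i j) = coT P i j := OSp.lift_T1 _ _ _ _
  rw [rowHom, AlgHom.comp_apply, AlgHom.comp_apply, par_T1, map_smul, map_smul, hc, coT, map_sum]
  simp only [rowTensor_tmul]
  have : ∀ k, pairScalar P x y (T1 P i k) * diagPar P (T1 P k j) =
      !![(if i = k then ![P.t, 1, P.t⁻¹] i * sg (k + j) else 0) • T1 P k j,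
        pairOdd P x y i k • T1 P k j; 0, (if i = k then ![P.t⁻¹, 1, P.t] i else 0) • T1 P k j] := by
    intro k
    change pairScalar P x y (T1 P i k) * Matrix.diagonal ![par (T1 P k j), T1 P k j] = _
    ext r s
    rw [Matrix.mul_diagonal, pairScalar_apply, pairHom_T1, pairGen_eq, ← Algebra.smul_def, par_T1]
    fin_cases r <;> fin_cases s <;> simp [smul_smul]
  simp only [this]
  ext r s
  rw [Matrix.smul_apply, Matrix.sum_apply]
  have h2 := sg_mul_self (i + j)
  fin_cases r <;> fin_cases s <;> simp [smul_smul]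
  rw [mul_left_comm, h2, mul_one]

end RowAction

end QSphere

namespace QSphere
open SuperAlg

/-! ### Twisted derivations -/

section Derivations
variable (P : Param)

lemma rowHom_lower (x y : ℂ) (f : OSp P) : rowHom P x y f 1 0 = 0 := by
  change (rowTensor P x y) (coprod P (par f)) 1 0 = 0
  let L : (gr (OSp P) ᵍ⊗[ℂ] gr (OSp P)) →ₗ[ℂ] OSp P :=
    Matrix.entryLinearMap ℂ (OSp P) 1 0 ∘ₗ (rowTensor P x y).toLinearMap
  have : L = 0 := by
    apply GradedTensorProduct.hom_ext
    apply TensorProduct.ext'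
    intro f g
    change rowTensor P x y (f ᵍ⊗ₜ[ℂ] g) 1 0 = 0
    rw [rowTensor_tmul]
    change (pairScalar P x y f * Matrix.diagonal ![par g, g]) 1 0 = _
    rw [Matrix.mul_diagonal, pairScalar_apply, pairHom_lower, map_zero, zero_mul]
  exact LinearMap.congr_fun this _

/-- The diagonal entries of `rowHom` are algebra endomorphisms. -/
def rowDiag (k : Fin 2) : OSp P →ₐ[ℂ] OSp P where
  toFun f := rowHom P 0 0 f k k
  map_one' := by rw [map_one, Matrix.one_apply_eq]
  map_mul' f g := by
    have h1 := rowHom_lower P 0 0 f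
    have h2 := rowHom_lower P 0 0 g
    rw [map_mul, Matrix.mul_apply, Fin.sum_univ_two]
    fin_cases k <;> simp [h1, h2]
  map_zero' := by rw [map_zero, Matrix.zero_apply]
  map_add' f g := by rw [map_add, Matrix.add_apply]
  commutes' r := by rw [AlgHom.commutes, Matrix.algebraMap_matrix_apply, if_pos rfl]

/-- The row action of `K`. -/
def sig : OSp P →ₐ[ℂ] OSp P := rowDiag P 0

/-- The row action of `K⁻¹`, composed with the parity. -/
def tau : OSp P →ₐ[ℂ] OSp P := rowDiag P 1

lemma sig_T1 (i j : Fin 3) : sig P (T1 P i j) = ![P.t, 1, P.t⁻¹] i • T1 P i j := by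
  change rowHom P 0 0 (T1 P i j) 0 0 = _
  rw [rowHom_T1]; rfl

lemma tau_T1 (i j : Fin 3) : tau P (T1 P i j) = (sg (i + j) * ![P.t⁻¹, 1, P.t] i) • T1 P i j := by
  change rowHom P 0 0 (T1 P i j) 1 1 = _
  rw [rowHom_T1]; rfl

/-- The diagonal entries of an upper triangular homomorphism are multiplicative, and on generators
they do not involve x and y. Hence one pair of twists `sig`, `tau` serves all odd elements `u`. -/
lemma rowHom_diag (x y : ℂ) (f : OSp P) :
    rowHom P x y f 0 0 = sig P f ∧ rowHom P x y f 1 1 = tau P f := by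
  have h1 := rowHom_lower P x y
  let S : Subalgebra ℂ (OSp P) :=
    { carrier := {f | rowHom P x y f 0 0 = sig P f ∧ rowHom P x y f 1 1 = tau P f}
      mul_mem' := by
        rintro f g ⟨hf, hf'⟩ ⟨hg, hg'⟩
        refine ⟨?_, ?_⟩ <;>
        rw [map_mul, map_mul, Matrix.mul_apply, Fin.sum_univ_two, h1]
        · rw [hf, hg, mul_zero, add_zero]
        · rw [hf', hg', zero_mul, zero_add]
      add_mem' := by
        rintro f g ⟨hf, hf'⟩ ⟨hg, hg'⟩
        refine ⟨?_, ?_⟩ <;> rw [map_add, map_add, Matrix.add_apply]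
        · rw [hf, hg]
        · rw [hf', hg']
      algebraMap_mem' := by
        intro r
        refine ⟨?_, ?_⟩ <;>
        rw [AlgHom.commutes, AlgHom.commutes, Matrix.algebraMap_matrix_apply, if_pos rfl] }
  have : f ∈ S := by
    rw [OSp.subalgebra_eq_top (S := S)]; · trivial
    intro i j
    change _ ∧ _
    rw [rowHom_T1, sig_T1, tau_T1]
    exact ⟨rfl, rfl⟩
  exact this

/-- The twisted Leibniz rule of the row action. -/
lemma odot_mul (x y : ℂ) (f g : OSp P) :
    odot P x y (f * g) = odot P x y f * tau P g + sig P f * odot P x y g := by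
  simp only [odot_eq_rowHom]
  rw [map_mul, Matrix.mul_apply, Fin.sum_univ_two, (rowHom_diag P x y f).1,
    (rowHom_diag P x y g).2, add_comm]

lemma odot_one (x y : ℂ) : odot P x y 1 = 0 := by
  rw [odot_eq_rowHom, map_one]; rfl

lemma odot_T1 (x y : ℂ) (i j : Fin 3) :
    odot P x y (T1 P i j) = sg (i + j) • ∑ k, pairOdd P x y i k • T1 P k j := by
  rw [odot_eq_rowHom, rowHom_T1]; rfl

lemma sg_one_add (n : ℕ) : sg (1 + n) = -sg n := by rw [sg_add]; simp [sg]

lemma sg_two_add (n : ℕ) : sg (2 + n) = sg n := by rw [sg_add]; simp [sg]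

/-- The row action of `v₊`. -/
def Dp : OSp P →ₗ[ℂ] OSp P := odot P 1 0

/-- The row action of `v₋`. -/
def Dm : OSp P →ₗ[ℂ] OSp P := odot P 0 1

lemma Dp_mul (f g : OSp P) : Dp P (f * g) = Dp P f * tau P g + sig P f * Dp P g :=
  odot_mul P _ _ f g

lemma Dm_mul (f g : OSp P) : Dm P (f * g) = Dm P f * tau P g + sig P f * Dm P g :=
  odot_mul P _ _ f g

lemma Dp_one : Dp P 1 = 0 := odot_one P _ _

lemma Dm_one : Dm P 1 = 0 := odot_one P _ _

lemma Dp_T1_zero (j : Fin 3) : Dp P (T1 P 0 j) = (sg j * P.nu) • T1 P 1 j := by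
  rw [Dp, odot_T1, Fin.sum_univ_three]; simp [pairOdd, smul_smul]

lemma Dp_T1_one (j : Fin 3) : Dp P (T1 P 1 j) = (sg j * P.nu) • T1 P 2 j := by
  rw [Dp, odot_T1, Fin.sum_univ_three]; simp [pairOdd, smul_smul, sg_one_add, sg_two_add]

lemma Dp_T1_two (j : Fin 3) : Dp P (T1 P 2 j) = 0 := by
  rw [Dp, odot_T1, Fin.sum_univ_three]; simp [pairOdd]

lemma Dm_T1_zero (j : Fin 3) : Dm P (T1 P 0 j) = 0 := by
  rw [Dm, odot_T1, Fin.sum_univ_three]; simp [pairOdd]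

lemma Dm_T1_one (j : Fin 3) : Dm P (T1 P 1 j) = (sg j * P.nu) • T1 P 0 j := by
  rw [Dm, odot_T1, Fin.sum_univ_three]; simp [pairOdd, smul_smul, sg_one_add, sg_two_add]

lemma Dm_T1_two (j : Fin 3) : Dm P (T1 P 2 j) = (-(sg j * P.nu)) • T1 P 1 j := by
  rw [Dm, odot_T1, Fin.sum_univ_three]; simp [pairOdd, smul_smul, sg_one_add, sg_two_add]
  exact (neg_smul _ _).symm

lemma sig_T1_zero (j : Fin 3) : sig P (T1 P 0 j) = P.t • T1 P 0 j := sig_T1 P 0 j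

lemma sig_T1_one (j : Fin 3) : sig P (T1 P 1 j) = T1 P 1 j := (sig_T1 P 1 j).trans (one_smul _ _)

lemma sig_T1_two (j : Fin 3) : sig P (T1 P 2 j) = P.t⁻¹ • T1 P 2 j := sig_T1 P 2 j

lemma tau_T1_zero (j : Fin 3) : tau P (T1 P 0 j) = (sg j * P.t⁻¹) • T1 P 0 j := by
  rw [tau_T1]; simp

lemma tau_T1_one (j : Fin 3) : tau P (T1 P 1 j) = (-sg j) • T1 P 1 j := by
  rw [tau_T1]; simp [sg_one_add, sg_two_add]

lemma tau_T1_two (j : Fin 3) : tau P (T1 P 2 j) = (sg j * P.t) • T1 P 2 j := by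
  rw [tau_T1]; simp [sg_one_add, sg_two_add]

/-- Linearity in `u` is not immediate, because `pairHom` is constructed separately for each pair (x,
y). Both sides are skew derivations with the same twists, so agreement on the entries of `T1` is
enough. -/
lemma actPR_eq (s₁ s₃ : ℂ) (f : OSp P) : actPR P s₁ s₃ f = s₁ • Dm P f - s₃ • Dp P f := by
  let M : Submodule ℂ (OSp P) :=
    LinearMap.ker (actPR P s₁ s₃ - (s₁ • Dm P - s₃ • Dp P))
  have hM : ∀ f, f ∈ M ↔ actPR P s₁ s₃ f = s₁ • Dm P f - s₃ • Dp P f := by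
    intro f
    simp only [M, LinearMap.mem_ker, LinearMap.sub_apply, LinearMap.smul_apply, sub_eq_zero]
  rw [← hM]
  refine OSp.submodule_induction ?_ ?_ f
  · rw [hM, actPR, odot_one, Dm_one, Dp_one]; simp
  · intro i j f hf
    rw [hM] at *
    have : actPR P s₁ s₃ (T1 P i j) = s₁ • Dm P (T1 P i j) - s₃ • Dp P (T1 P i j) := by
      rw [actPR, Dm, Dp, odot_T1, odot_T1, odot_T1]
      simp only [Fin.sum_univ_three]
      fin_cases i <;> simp [pairOdd] <;> module
    rw [Dm_mul, Dp_mul, actPR, odot_mul]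
    rw [actPR] at this hf
    rw [this, hf]
    simp only [sub_mul, mul_sub, smul_add, smul_mul_assoc, mul_smul_comm]
    abel

lemma sig_tau (f : OSp P) : sig P (tau P f) = tau P (sig P f) := by
  have : (sig P).comp (tau P) = (tau P).comp (sig P) := by
    apply OSp.hom_ext
    intro i j
    simp only [AlgHom.comp_apply, tau_T1, sig_T1, map_smul, smul_smul]
    rw [mul_comm]
  exact DFunLike.congr_fun this f

/-- This and the three analogous rules are the relations between K and v± carried over to the row
action. The rules for `tau` contain an extra minus sign because `tau` includes the parity and the
operators `Dp`, `Dm` are odd. -/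
lemma Dp_sig (f : OSp P) : Dp P (sig P f) = P.t • sig P (Dp P f) := by
  have h0 := P.t_ne
  let M : Submodule ℂ (OSp P) :=
    LinearMap.ker (Dp P ∘ₗ (sig P).toLinearMap - P.t • (sig P).toLinearMap ∘ₗ Dp P)
  have hM : ∀ f, f ∈ M ↔ Dp P (sig P f) = P.t • sig P (Dp P f) := by
    intro f; simp [M, sub_eq_zero]
  rw [← hM]
  refine OSp.submodule_induction ?_ ?_ f
  · rw [hM, map_one, Dp_one, map_zero, smul_zero]
  · intro i j f hf
    rw [hM] at *
    have : Dp P (sig P (T1 P i j)) = P.t • sig P (Dp P (T1 P i j)) := by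
      fin_cases i <;> simp [sig_T1_zero, sig_T1_one, sig_T1_two, Dp_T1_zero, Dp_T1_one, Dp_T1_two,
        smul_smul, h0]
      congr 1; field_simp
    rw [map_mul, Dp_mul, Dp_mul, map_add, map_mul, map_mul, hf, this, sig_tau]
    simp only [smul_add, smul_mul_assoc, mul_smul_comm]

lemma Dm_sig (f : OSp P) : Dm P (sig P f) = P.t⁻¹ • sig P (Dm P f) := by
  have h0 := P.t_ne
  let M : Submodule ℂ (OSp P) :=
    LinearMap.ker (Dm P ∘ₗ (sig P).toLinearMap - P.t⁻¹ • (sig P).toLinearMap ∘ₗ Dm P)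
  have hM : ∀ f, f ∈ M ↔ Dm P (sig P f) = P.t⁻¹ • sig P (Dm P f) := by
    intro f; simp [M, sub_eq_zero]
  rw [← hM]
  refine OSp.submodule_induction ?_ ?_ f
  · rw [hM, map_one, Dm_one, map_zero, smul_zero]
  · intro i j f hf
    rw [hM] at *
    have : Dm P (sig P (T1 P i j)) = P.t⁻¹ • sig P (Dm P (T1 P i j)) := by
      fin_cases i <;> simp [sig_T1_zero, sig_T1_one, sig_T1_two, Dm_T1_zero, Dm_T1_one, Dm_T1_two,
        smul_smul, h0]
      congr 1; field_simp
    rw [map_mul, Dm_mul, Dm_mul, map_add, map_mul, map_mul, hf, this, sig_tau]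
    simp only [smul_add, smul_mul_assoc, mul_smul_comm]

lemma Dp_tau (f : OSp P) : Dp P (tau P f) = (-P.t⁻¹) • tau P (Dp P f) := by
  have h0 := P.t_ne
  let M : Submodule ℂ (OSp P) :=
    LinearMap.ker (Dp P ∘ₗ (tau P).toLinearMap - (-P.t⁻¹) • (tau P).toLinearMap ∘ₗ Dp P)
  have hM : ∀ f, f ∈ M ↔ Dp P (tau P f) = (-P.t⁻¹) • tau P (Dp P f) := by
    intro f; simp [-neg_smul, M, sub_eq_zero]
  rw [← hM]
  refine OSp.submodule_induction ?_ ?_ f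
  · rw [hM, map_one, Dp_one, map_zero, smul_zero]
  · intro i j f hf
    rw [hM] at *
    have : Dp P (tau P (T1 P i j)) = (-P.t⁻¹) • tau P (Dp P (T1 P i j)) := by
      have h1 := sg_mul_self j
      fin_cases i
      · simp only [Fin.zero_eta, tau_T1_zero, tau_T1_one, Dp_T1_zero, map_smul, smul_smul]
        congr 1; ring
      · simp only [Fin.mk_one, tau_T1_two, tau_T1_one, Dp_T1_one, map_smul, smul_smul]
        congr 1; field_simp
      · simp [tau_T1_two, Dp_T1_two]
    rw [map_mul, Dp_mul, Dp_mul, map_add, map_mul, map_mul, hf, this, sig_tau]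
    simp only [smul_add, smul_mul_assoc, mul_smul_comm]

lemma Dm_tau (f : OSp P) : Dm P (tau P f) = (-P.t) • tau P (Dm P f) := by
  have h0 := P.t_ne
  let M : Submodule ℂ (OSp P) :=
    LinearMap.ker (Dm P ∘ₗ (tau P).toLinearMap - (-P.t) • (tau P).toLinearMap ∘ₗ Dm P)
  have hM : ∀ f, f ∈ M ↔ Dm P (tau P f) = (-P.t) • tau P (Dm P f) := by
    intro f; simp [-neg_smul, M, sub_eq_zero]
  rw [← hM]
  refine OSp.submodule_induction ?_ ?_ f
  · rw [hM, map_one, Dm_one, map_zero, smul_zero]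
  · intro i j f hf
    rw [hM] at *
    have : Dm P (tau P (T1 P i j)) = (-P.t) • tau P (Dm P (T1 P i j)) := by
      fin_cases i
      · simp [tau_T1_zero, Dm_T1_zero]
      · simp only [Fin.mk_one, tau_T1_zero, tau_T1_one, Dm_T1_one, map_smul, smul_smul]
        congr 1; field_simp
      · simp only [tau_T1_two, tau_T1_one, Dm_T1_two, map_smul, smul_smul, Fin.reduceFinMk]
        congr 1; ring
    rw [map_mul, Dm_mul, Dm_mul, map_add, map_mul, map_mul, hf, this, sig_tau]
    simp only [smul_add, smul_mul_assoc, mul_smul_comm]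

end Derivations

/-! ### Quadratic relations of the product law -/

namespace ProductLaw
variable {P : Param} {B : Type} [Ring B] [Algebra ℂ B] {T : Fin 3 → Fin 3 → B}

/-- The relations in this group make it possible to divide by a = `T 0 0`: it q-commutes with the
other entries of its row and column, and its product with an entry outside them reduces to products
of entries of the first row and column, and to entries that can be treated earlier. -/
lemma rel_00_10 (h : ProductLaw P T) : T 0 0 * T 1 0 = P.t ^ 2 • (T 1 0 * T 0 0) := by
  have h0 := P.t_ne
  have h1 := h.row1 0 0 0
  simp [Fin.sum_univ_three, cg0, cg1, cg0', cg1', TT, sg] at h1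
  linear_combination (norm := (match_scalars <;> field_simp <;> ring)) (P.t) • h1

lemma rel_10_20 (h : ProductLaw P T) : T 1 0 * T 2 0 = P.t ^ 2 • (T 2 0 * T 1 0) := by
  have h0 := P.t_ne
  have h1 := h.row1 0 0 2
  simp [Fin.sum_univ_three, cg0, cg1, cg0', cg1', TT, sg] at h1
  linear_combination (norm := (match_scalars <;> field_simp <;> ring)) (-P.t) • h1

lemma rel_00_20 (h : ProductLaw P T) : T 0 0 * T 2 0 = P.t ^ 4 • (T 2 0 * T 0 0) := by
  have h0 := P.t_ne
  have h1 := h.row0 0 0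
  have h2 := h.row1 0 0 1
  simp [Fin.sum_univ_three, cg0, cg1, cg0', cg1', TT, sg] at h1 h2
  linear_combination (norm := (match_scalars <;> field_simp <;> ring)) (-P.t - P.t ^ 3) • h1 + (-P.t ^ 2) • h2

lemma rel_10_10 (h : ProductLaw P T) : T 1 0 * T 1 0 = (P.t ^ 3 - P.t) • (T 2 0 * T 0 0) := by
  have h0 := P.t_ne
  have h1 := h.row0 0 0
  have h2 := h.row1 0 0 1
  simp [Fin.sum_univ_three, cg0, cg1, cg0', cg1', TT, sg] at h1 h2
  linear_combination (norm := (match_scalars <;> field_simp <;> ring)) (-P.t ^ 2) • h1 + (-P.t) • h2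

lemma rel_00_01 (h : ProductLaw P T) : T 0 0 * T 0 1 = P.t ^ 2 • (T 0 1 * T 0 0) := by
  have h0 := P.t_ne
  have h1 := h.col1 0 0 0
  simp [Fin.sum_univ_three, cg0, cg1, cg0', cg1', TT, sg] at h1
  linear_combination (norm := (match_scalars <;> field_simp <;> ring)) (P.t) • h1

lemma rel_00_02 (h : ProductLaw P T) : T 0 0 * T 0 2 = P.t ^ 4 • (T 0 2 * T 0 0) := by
  have h0 := P.t_ne
  have h1 := h.col0 0 0
  have h2 := h.col1 0 0 1
  simp [Fin.sum_univ_three, cg0, cg1, cg0', cg1', TT, sg] at h1 h2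
  linear_combination (norm := (match_scalars <;> field_simp <;> ring)) (-P.t - P.t ^ 3) • h1 + (P.t ^ 2) • h2

lemma rel_01_01 (h : ProductLaw P T) : T 0 1 * T 0 1 = (P.t ^ 3 - P.t) • (T 0 2 * T 0 0) := by
  have h0 := P.t_ne
  have h1 := h.col0 0 0
  have h2 := h.col1 0 0 1
  simp [Fin.sum_univ_three, cg0, cg1, cg0', cg1', TT, sg] at h1 h2
  linear_combination (norm := (match_scalars <;> field_simp <;> ring)) (-P.t ^ 2) • h1 + (P.t) • h2

lemma rel_01_10 (h : ProductLaw P T) : T 0 1 * T 1 0 = -(T 1 0 * T 0 1) := by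
  have h0 := P.t_ne
  have h1 := h.col1 0 1 0
  have h2 := h.row1 0 1 0
  simp [Fin.sum_univ_three, cg0, cg1, cg0', cg1', TT, sg] at h1 h2
  linear_combination (norm := (match_scalars <;> field_simp <;> ring)) (P.t⁻¹) • h1 + (-P.t⁻¹) • h2

lemma rel_00_11 (h : ProductLaw P T) : T 0 0 * T 1 1 = T 0 0 + P.t ^ 2 • (T 1 0 * T 0 1) := by
  have h0 := P.t_ne
  have h1 := h.row1 0 1 0
  simp [Fin.sum_univ_three, cg0, cg1, cg0', cg1', TT, sg] at h1
  linear_combination (norm := (match_scalars <;> field_simp <;> ring)) (P.t) • h1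

lemma rel_00_12 (h : ProductLaw P T) : T 0 0 * T 1 2 = -(P.t • T 0 1) + P.t ^ 2 • (T 1 0 * T 0 2) := by
  have h0 := P.t_ne
  have h1 := h.row1 0 2 0
  simp [Fin.sum_univ_three, cg0, cg1, cg0', cg1', TT, sg] at h1
  linear_combination (norm := (match_scalars <;> field_simp <;> ring)) (P.t) • h1

lemma rel_00_21 (h : ProductLaw P T) : T 0 0 * T 2 1 = P.t • T 1 0 + P.t ^ 2 • (T 0 1 * T 2 0) := by
  have h0 := P.t_ne
  have h1 := h.col1 0 2 0
  simp [Fin.sum_univ_three, cg0, cg1, cg0', cg1', TT, sg] at h1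
  linear_combination (norm := (match_scalars <;> field_simp <;> ring)) (P.t) • h1

lemma rel_00_22 (h : ProductLaw P T) : T 0 0 * T 2 2 = (1 + P.t ^ 2) • 1 - P.t ^ 2 • T 1 1 + P.t ^ 4 • (T 2 0 * T 0 2) := by
  have h0 := P.t_ne
  have h1 := h.row0 0 2
  have h2 := h.row1 0 2 1
  simp [Fin.sum_univ_three, cg0, cg1, cg0', cg1', TT, sg] at h1 h2
  linear_combination (norm := (match_scalars <;> field_simp <;> ring)) (-P.t - P.t ^ 3) • h1 + (-P.t ^ 2) • h2

/-- This is one component of the invariance of the ℓ = 0 coupling. All right factors lie in the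
first column, so an element annihilated from the left by the three entries of that column is zero.
-/
lemma unit_col_zero (h : ProductLaw P T) : (1 : B) = T 2 2 * T 0 0 + P.t⁻¹ • (T 1 2 * T 1 0) - P.t⁻¹ ^ 2 • (T 0 2 * T 2 0) := by
  have h0 := P.t_ne
  have h1 := h.row0 2 0
  simp [Fin.sum_univ_three, cg0, cg1, cg0', cg1', TT, sg] at h1
  linear_combination (norm := (match_scalars <;> field_simp <;> ring)) (-P.t⁻¹) • h1

end ProductLaw
end QSphere

namespace QSphere
open SuperAlg

/-! ### Powers of q-commuting elements -/

section QCommute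
variable {A : Type} [Ring A] [Algebra ℂ A]

lemma qcomm_pow_left {x y : A} {s : ℂ} (h : x * y = s • (y * x)) (n : ℕ) :
    x ^ n * y = s ^ n • (y * x ^ n) := by
  induction n with
  | zero => simp
  | succ n ih =>
    rw [pow_succ', mul_assoc, ih, mul_smul_comm, ← mul_assoc, h, smul_mul_assoc, smul_smul,
      mul_assoc, pow_succ]

lemma qcomm_pow_right {x y : A} {s : ℂ} (h : x * y = s • (y * x)) (n : ℕ) :
    x * y ^ n = s ^ n • (y ^ n * x) := by
  induction n with
  | zero => simp
  | succ n ih =>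
    rw [pow_succ, ← mul_assoc, ih, smul_mul_assoc, mul_assoc, h, mul_smul_comm, smul_smul,
      ← mul_assoc, pow_succ]

lemma qcomm_symm {x y : A} {s : ℂ} (hs : s ≠ 0) (h : x * y = s • (y * x)) :
    y * x = s⁻¹ • (x * y) := by
  rw [h, smul_smul, inv_mul_cancel₀ hs, one_smul]

end QCommute

/-! ### Local nilpotency of the row action -/

section Nilpotency
variable (P : Param)

/-- The elements annihilated by a power of an operator. -/
def nilSub {A : Type} [Ring A] [Algebra ℂ A] (D : A →ₗ[ℂ] A) : Submodule ℂ A where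
  carrier := {f | ∃ k, (D ^ k) f = 0}
  zero_mem' := ⟨0, by simp⟩
  add_mem' := by
    rintro f g ⟨k, hk⟩ ⟨l, hl⟩
    refine ⟨k + l, ?_⟩
    have h1 : (D ^ (k + l)) f = 0 := by
      rw [add_comm, pow_add, Module.End.mul_apply, hk, map_zero]
    have h2 : (D ^ (k + l)) g = 0 := by rw [pow_add, Module.End.mul_apply, hl, map_zero]
    rw [map_add, h1, h2, add_zero]
  smul_mem' := by
    rintro c f ⟨k, hk⟩
    exact ⟨k, by rw [map_smul, hk, smul_zero]⟩

variable {P}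

lemma nilSub_of_apply {A : Type} [Ring A] [Algebra ℂ A] {D : A →ₗ[ℂ] A} {f : A}
    (h : D f ∈ nilSub D) : f ∈ nilSub D := by
  obtain ⟨k, hk⟩ := h
  exact ⟨k + 1, by rw [pow_succ, Module.End.mul_apply, hk]⟩

/-- Induction on the exponent that kills f: in D(x f) = (D x)(τ f) + w x (D f) the first summand is
covered by the hypothesis and D f has a smaller exponent. Multiplication by x is thereby reduced to
multiplication by D x. -/
lemma nilSub_mul {D : OSp P →ₗ[ℂ] OSp P}
    (hD : ∀ f g, D (f * g) = D f * tau P g + sig P f * D g) {x : OSp P} {w : ℂ}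
    (hx : sig P x = w • x) (h : ∀ f ∈ nilSub D, D x * tau P f ∈ nilSub D) :
    ∀ f ∈ nilSub D, x * f ∈ nilSub D := by
  rintro f ⟨k, hk⟩
  induction k generalizing f with
  | zero =>
    rw [pow_zero, Module.End.one_apply] at hk
    rw [hk, mul_zero]; exact zero_mem _
  | succ k ih =>
    apply nilSub_of_apply
    rw [hD, hx, smul_mul_assoc]
    refine add_mem (h f ⟨_, hk⟩) (Submodule.smul_mem _ _ (ih (D f) ?_))
    rwa [pow_succ, Module.End.mul_apply] at hk

lemma nilSub_tau {D : OSp P →ₗ[ℂ] OSp P} {c : ℂ} (hD : ∀ f, D (tau P f) = c • tau P (D f))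
    {f : OSp P} (hf : f ∈ nilSub D) : tau P f ∈ nilSub D := by
  obtain ⟨k, hk⟩ := hf
  refine ⟨k, ?_⟩
  have : ∀ k f, (D ^ k) (tau P f) = c ^ k • tau P ((D ^ k) f) := by
    intro k
    induction k with
    | zero => intro f; simp
    | succ k ih =>
      intro f
      rw [pow_succ, Module.End.mul_apply, hD, map_smul, ih, Module.End.mul_apply, smul_smul,
        pow_succ, mul_comm]
  rw [this, hk, map_zero, smul_zero]

/-- v₊ carries row 0 to row 1, row 1 to row 2 and kills row 2. So left multiplication by entries of
rows 2, 1 and 0, taken in this order, preserves the nilpotent part. For v₋ the order is reversed. -/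
lemma Dp_nilpotent (f : OSp P) : ∃ k, (Dp P ^ k) f = 0 := by
  have ht : ∀ f ∈ nilSub (Dp P), tau P f ∈ nilSub (Dp P) := fun f hf => nilSub_tau (Dp_tau P) hf
  have h2 : ∀ j, ∀ f ∈ nilSub (Dp P), T1 P 2 j * f ∈ nilSub (Dp P) := fun j =>
    nilSub_mul (Dp_mul P) (sig_T1 P 2 j) fun f _ => by
      rw [Dp_T1_two, zero_mul]; exact zero_mem _
  have h1 : ∀ j, ∀ f ∈ nilSub (Dp P), T1 P 1 j * f ∈ nilSub (Dp P) := fun j =>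
    nilSub_mul (Dp_mul P) (sig_T1 P 1 j) fun f hf => by
      rw [Dp_T1_one, smul_mul_assoc]; exact Submodule.smul_mem _ _ (h2 j _ (ht f hf))
  have h0 : ∀ j, ∀ f ∈ nilSub (Dp P), T1 P 0 j * f ∈ nilSub (Dp P) := fun j =>
    nilSub_mul (Dp_mul P) (sig_T1 P 0 j) fun f hf => by
      rw [Dp_T1_zero, smul_mul_assoc]; exact Submodule.smul_mem _ _ (h1 j _ (ht f hf))
  refine OSp.submodule_induction (M := nilSub (Dp P)) ⟨1, by rw [pow_one, Dp_one]⟩ ?_ f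
  intro i j
  fin_cases i
  exacts [h0 j, h1 j, h2 j]

lemma Dm_nilpotent (f : OSp P) : ∃ k, (Dm P ^ k) f = 0 := by
  have ht : ∀ f ∈ nilSub (Dm P), tau P f ∈ nilSub (Dm P) := fun f hf => nilSub_tau (Dm_tau P) hf
  have h0 : ∀ j, ∀ f ∈ nilSub (Dm P), T1 P 0 j * f ∈ nilSub (Dm P) := fun j =>
    nilSub_mul (Dm_mul P) (sig_T1 P 0 j) fun f _ => by
      rw [Dm_T1_zero, zero_mul]; exact zero_mem _
  have h1 : ∀ j, ∀ f ∈ nilSub (Dm P), T1 P 1 j * f ∈ nilSub (Dm P) := fun j =>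
    nilSub_mul (Dm_mul P) (sig_T1 P 1 j) fun f hf => by
      rw [Dm_T1_one, smul_mul_assoc]; exact Submodule.smul_mem _ _ (h0 j _ (ht f hf))
  have h2 : ∀ j, ∀ f ∈ nilSub (Dm P), T1 P 2 j * f ∈ nilSub (Dm P) := fun j =>
    nilSub_mul (Dm_mul P) (sig_T1 P 2 j) fun f hf => by
      rw [Dm_T1_two, smul_mul_assoc]; exact Submodule.smul_mem _ _ (h1 j _ (ht f hf))
  refine OSp.submodule_induction (M := nilSub (Dm P)) ⟨1, by rw [pow_one, Dm_one]⟩ ?_ f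
  intro i j
  fin_cases i
  exacts [h0 j, h1 j, h2 j]

end Nilpotency

/-! ### The corner entry is not a zero divisor -/

section Regular
variable (P : Param)

namespace Param

lemma nu_ne : P.nu ≠ 0 := by
  intro h
  have := P.nu_sq'
  rw [h] at this
  exact pow_ne_zero 6 P.t_ne (by linear_combination this)

lemma t_pow_add_one_ne {n : ℕ} (hn : 0 < n) : P.t ^ n + 1 ≠ 0 := by
  intro h
  apply P.t_pow_ne (2 * n) (by omega)
  rw [pow_mul']
  linear_combination (P.t ^ n - 1) * h

end Param

/-- `tau` is the inverse of `sig` up to the parity, and the parity is an involution. -/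
lemma sig_sig_tau_tau (f : OSp P) : sig P (sig P (tau P (tau P f))) = f := by
  have h0 := P.t_ne
  have : ((sig P).comp (sig P)).comp ((tau P).comp (tau P)) = AlgHom.id ℂ _ := by
    apply OSp.hom_ext
    intro i j
    simp only [AlgHom.comp_apply, AlgHom.id_apply, tau_T1, sig_T1, map_smul, smul_smul]
    have h1 := sg_mul_self (i + j)
    have h2 : ![P.t⁻¹, 1, P.t] i * ![P.t, 1, P.t⁻¹] i = 1 := by fin_cases i <;> simp [h0]
    rw [show ∀ s x y : ℂ, s * x * (s * x) * (y * y) = (s * s) * (x * y) * (x * y) by intros; ring,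
      h1, h2, one_mul, one_mul, one_smul]
  exact DFunLike.congr_fun this f

lemma tau_injective : Function.Injective (tau P) := by
  intro f g h
  rw [← sig_sig_tau_tau P f, h, sig_sig_tau_tau]

/-- The coefficients of `v₊` acting on powers of the corner entry. -/
def cornerCoef : ℕ → ℂ
  | 0 => 0
  | n + 1 => (P.t⁻¹) ^ (3 * n) + P.t * cornerCoef n

lemma cornerCoef_eq (n : ℕ) :
    cornerCoef P n * ((P.t ^ 4 - 1) * P.t ^ (3 * n)) = P.t ^ 3 * (P.t ^ (4 * n) - 1) := by
  have h0 := P.t_ne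
  induction n with
  | zero => simp [cornerCoef]
  | succ n ih =>
    have h1 : (P.t⁻¹) ^ (3 * n) * P.t ^ (3 * n) = 1 := by rw [← mul_pow, inv_mul_cancel₀ h0, one_pow]
    rw [cornerCoef]
    simp only [mul_add, pow_add, mul_one]
    linear_combination (P.t ^ 4) * ih + (P.t ^ 3 * (P.t ^ 4 - 1)) * h1

lemma cornerCoef_ne (n : ℕ) : cornerCoef P (n + 1) ≠ 0 := by
  intro h
  have h1 := cornerCoef_eq P (n + 1)
  rw [h, zero_mul] at h1
  exact mul_ne_zero (pow_ne_zero 3 P.t_ne) (P.t_pow_ne _ (by omega)) h1.symm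

/-- After multiplication by t^(3n)(t⁴ - 1) the expression becomes (t² - 1)(t^(4n+2) + 1), which is
nonzero because t is not a root of unity. -/
lemma cornerCoef_ne' (n : ℕ) : P.t ^ n - cornerCoef P n * (P.t⁻¹ - P.t⁻¹ ^ 3) ≠ 0 := by
  intro h
  have h0 := P.t_ne
  have h1 := cornerCoef_eq P n
  have h2 : (P.t ^ 2 - 1) * (P.t ^ (4 * n + 2) + 1) = 0 := by
    have h3 : P.t ^ n * P.t ^ (3 * n) = P.t ^ (4 * n) := by rw [← pow_add]; congr 1; ring
    have h4 : P.t ^ 3 * (P.t⁻¹ - P.t⁻¹ ^ 3) = P.t ^ 2 - 1 := by field_simp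
    have h5 : (P.t ^ n - cornerCoef P n * (P.t⁻¹ - P.t⁻¹ ^ 3)) *
        (P.t ^ (3 * n) * (P.t ^ 4 - 1)) = 0 := by rw [h, zero_mul]
    rw [pow_add]
    linear_combination h5 - (P.t ^ 4 - 1) * h3 + (P.t⁻¹ - P.t⁻¹ ^ 3) * h1 +
      (P.t ^ (4 * n) - 1) * h4
  exact mul_ne_zero (P.t_pow_ne 2 (by norm_num)) (P.t_pow_add_one_ne (by omega)) h2

lemma tau_pow_zero (j : Fin 3) (n : ℕ) :
    tau P (T1 P 0 j ^ n) = (sg j * P.t⁻¹) ^ n • T1 P 0 j ^ n := by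
  rw [map_pow, tau_T1_zero, smul_pow]

lemma tau_pow_two (j : Fin 3) (n : ℕ) :
    tau P (T1 P 2 j ^ n) = (sg j * P.t) ^ n • T1 P 2 j ^ n := by
  rw [map_pow, tau_T1_two, smul_pow]

lemma sg_zero : sg 0 = 1 := by simp [sg]

lemma sig_pow_zero (j : Fin 3) (n : ℕ) : sig P (T1 P 0 j ^ n) = P.t ^ n • T1 P 0 j ^ n := by
  rw [map_pow, sig_T1_zero, smul_pow]

lemma Dp_pow_two (j : Fin 3) (n : ℕ) : Dp P (T1 P 2 j ^ n) = 0 := by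
  induction n with
  | zero => rw [pow_zero, Dp_one]
  | succ n ih => rw [pow_succ, Dp_mul, ih, Dp_T1_two, zero_mul, mul_zero, add_zero]

lemma Dm_pow_zero (j : Fin 3) (n : ℕ) : Dm P (T1 P 0 j ^ n) = 0 := by
  induction n with
  | zero => rw [pow_zero, Dm_one]
  | succ n ih => rw [pow_succ, Dm_mul, ih, Dm_T1_zero, zero_mul, mul_zero, add_zero]

lemma Dp_corner_pow (n : ℕ) : Dp P (T1 P 0 0 ^ (n + 1)) =
    (P.nu * cornerCoef P (n + 1)) • (T1 P 0 0 ^ n * T1 P 1 0) := by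
  have h0 := P.t_ne
  induction n with
  | zero => simp [cornerCoef, Dp_T1_zero, sg_zero]
  | succ n ih =>
    have hc := qcomm_symm (pow_ne_zero (n + 1) (pow_ne_zero 2 h0))
      (qcomm_pow_left (T1_law P).rel_00_10 (n + 1))
    rw [pow_succ', Dp_mul, ih, Dp_T1_zero, tau_pow_zero, sig_T1_zero, smul_mul_smul_comm,
      smul_mul_smul_comm, ← mul_assoc (T1 P 0 0), ← pow_succ', hc, smul_smul, ← add_smul,
      show cornerCoef P (n + 1 + 1) = (P.t⁻¹) ^ (3 * (n + 1)) + P.t * cornerCoef P (n + 1) from rfl]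
    congr 1
    simp only [Fin.val_zero, sg_zero, ← inv_pow]
    ring

lemma rel_10_10' : T1 P 1 0 * T1 P 1 0 = (P.t⁻¹ - P.t⁻¹ ^ 3) • (T1 P 0 0 * T1 P 2 0) := by
  have h0 := P.t_ne
  rw [(T1_law P).rel_10_10, (T1_law P).rel_00_20, smul_smul]
  congr 1
  field_simp

lemma Dp_mono_even (i j : ℕ) : Dp P (T1 P 0 0 ^ (i + 1) * T1 P 2 0 ^ j) =
    (P.nu * cornerCoef P (i + 1) * P.t ^ j) • (T1 P 0 0 ^ i * T1 P 1 0 * T1 P 2 0 ^ j) := by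
  rw [Dp_mul, Dp_pow_two, mul_zero, add_zero, tau_pow_two, Dp_corner_pow, smul_mul_smul_comm]
  simp [sg_zero]

lemma Dp_mono_odd (i j : ℕ) : Dp P (T1 P 0 0 ^ i * T1 P 1 0 * T1 P 2 0 ^ j) =
    (P.nu * (P.t ^ i - cornerCoef P i * (P.t⁻¹ - P.t⁻¹ ^ 3)) * P.t ^ j) •
      (T1 P 0 0 ^ i * T1 P 2 0 ^ (j + 1)) := by
  have h1 : Dp P (T1 P 0 0 ^ i) * T1 P 1 0 =
      (P.nu * cornerCoef P i * (P.t⁻¹ - P.t⁻¹ ^ 3)) • (T1 P 0 0 ^ i * T1 P 2 0) := by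
    cases i with
    | zero => simp [Dp_one, cornerCoef]
    | succ i =>
      rw [Dp_corner_pow, smul_mul_assoc, mul_assoc, rel_10_10', mul_smul_comm, smul_smul,
        ← mul_assoc, ← pow_succ]
  rw [Dp_mul, Dp_pow_two, mul_zero, add_zero, tau_pow_two, Dp_mul, tau_T1_one, Dp_T1_one,
    sig_pow_zero, mul_smul_comm (-sg _), h1, smul_mul_smul_comm, smul_smul, ← add_smul,
    smul_mul_assoc, mul_smul_comm, smul_smul, mul_assoc (_ ^ i), ← pow_succ']
  congr 1
  simp only [Fin.val_zero, sg_zero]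
  ring

/-- An element annihilated by `v₊` and by a power of the corner entry is annihilated by all
monomials of the same degree in the first column. -/
lemma column_kills {g : OSp P} (hD : Dp P g = 0) {N : ℕ} (hN : T1 P 0 0 ^ N * g = 0) (j : ℕ) :
    (∀ i, i + j = N → T1 P 0 0 ^ i * T1 P 2 0 ^ j * g = 0) ∧
      (∀ i, i + j + 1 = N → T1 P 0 0 ^ i * T1 P 1 0 * T1 P 2 0 ^ j * g = 0) := by
  -- Since v₊ kills g, applying it to x g = 0 gives y (τ g) = 0. As y is an eigenvector of τ, this
  -- says τ(y g) = 0, and τ is injective. The monomials of degree N in the first column are reached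
  -- from a^N by v₊ one after the other, with nonzero coefficients.
  have step : ∀ {x y : OSp P} {c c' : ℂ}, Dp P x = c • y → c ≠ 0 → tau P y = c' • y →
      x * g = 0 → y * g = 0 := by
    intro x y c c' hx hc hy h
    have h1 : Dp P (x * g) = 0 := by rw [h, map_zero]
    rw [Dp_mul, hD, mul_zero, add_zero, hx, smul_mul_assoc, smul_eq_zero] at h1
    apply tau_injective P
    rw [map_mul, hy, smul_mul_assoc, h1.resolve_left hc, smul_zero, map_zero]
  have hn := P.nu_ne
  have he : ∀ i j, T1 P 0 0 ^ (i + 1) * T1 P 2 0 ^ j * g = 0 →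
      T1 P 0 0 ^ i * T1 P 1 0 * T1 P 2 0 ^ j * g = 0 := by
    intro i j h
    refine step (c' := (sg (0 : Fin 3) * P.t⁻¹) ^ i * (-sg (0 : Fin 3)) * (sg (0 : Fin 3) * P.t) ^ j)
      (Dp_mono_even P i j) (mul_ne_zero (mul_ne_zero hn (cornerCoef_ne P i))
      (pow_ne_zero _ P.t_ne)) ?_ h
    · rw [map_mul, map_mul, tau_pow_two, tau_pow_zero, tau_T1_one, smul_mul_smul_comm,
        smul_mul_smul_comm]
  have ho : ∀ i j, T1 P 0 0 ^ i * T1 P 1 0 * T1 P 2 0 ^ j * g = 0 →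
      T1 P 0 0 ^ i * T1 P 2 0 ^ (j + 1) * g = 0 := by
    intro i j h
    refine step (c' := (sg (0 : Fin 3) * P.t⁻¹) ^ i * (sg (0 : Fin 3) * P.t) ^ (j + 1))
      (Dp_mono_odd P i j) (mul_ne_zero (mul_ne_zero hn (cornerCoef_ne' P i))
      (pow_ne_zero _ P.t_ne)) ?_ h
    · rw [map_mul, tau_pow_two, tau_pow_zero, smul_mul_smul_comm]
  induction j with
  | zero =>
    have h : ∀ i, i + 0 = N → T1 P 0 0 ^ i * T1 P 2 0 ^ 0 * g = 0 := by
      rintro i rfl; rw [pow_zero, mul_one]; exact hN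
    exact ⟨h, fun i hi => he i 0 (h (i + 1) (by omega))⟩
  | succ j ih =>
    have h : ∀ i, i + (j + 1) = N → T1 P 0 0 ^ i * T1 P 2 0 ^ (j + 1) * g = 0 := by
      intro i hi
      exact ho i j (ih.2 i (by omega))
    exact ⟨h, fun i hi => he i (j + 1) (h (i + 1) (by omega))⟩

/-- Let m be a monomial of degree N in a, γ, c, at most linear in γ. Its left multiples by a, γ and
c are multiples of such monomials of degree N + 1, because γ² is proportional to a c. They all kill
g, so m g = 0 by `unit_col_zero`. Descending to degree zero leaves g = 0. -/
lemma eq_zero_of_column_kills {g : OSp P} (N : ℕ)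
    (h0 : ∀ i j, i + j = N → T1 P 0 0 ^ i * T1 P 2 0 ^ j * g = 0)
    (h1 : ∀ i j, i + j + 1 = N → T1 P 0 0 ^ i * T1 P 1 0 * T1 P 2 0 ^ j * g = 0) : g = 0 := by
  have ht := P.t_ne
  induction N with
  | zero => simpa using h0 0 0 rfl
  | succ N ih =>
    have unit : ∀ x : OSp P, T1 P 0 0 * x = 0 → T1 P 1 0 * x = 0 → T1 P 2 0 * x = 0 → x = 0 := by
      intro x ha hb hc
      have := congrArg (· * x) (T1_law P).unit_col_zero
      simpa only [one_mul, sub_mul, add_mul, smul_mul_assoc, mul_assoc, ha, hb, hc, mul_zero,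
        smul_zero, add_zero, sub_zero] using! this
    have c10 : ∀ i, T1 P 1 0 * T1 P 0 0 ^ i =
        ((P.t ^ 2) ^ i)⁻¹ • (T1 P 0 0 ^ i * T1 P 1 0) := fun i =>
      qcomm_symm (pow_ne_zero i (pow_ne_zero 2 ht)) (qcomm_pow_left (T1_law P).rel_00_10 i)
    have c20 : ∀ i, T1 P 2 0 * T1 P 0 0 ^ i =
        ((P.t ^ 4) ^ i)⁻¹ • (T1 P 0 0 ^ i * T1 P 2 0) := fun i =>
      qcomm_symm (pow_ne_zero i (pow_ne_zero 4 ht)) (qcomm_pow_left (T1_law P).rel_00_20 i)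
    have c21 : T1 P 2 0 * T1 P 1 0 = (P.t ^ 2)⁻¹ • (T1 P 1 0 * T1 P 2 0) :=
      qcomm_symm (pow_ne_zero 2 ht) (T1_law P).rel_10_20
    apply ih
    · intro i j hij
      apply unit
      · have := h0 (i + 1) j (by omega)
        rwa [pow_succ', mul_assoc, mul_assoc, ← mul_assoc _ _ g] at this
      · rw [← mul_assoc, ← mul_assoc, c10, smul_mul_assoc, smul_mul_assoc, h1 i j (by omega),
          smul_zero]
      · rw [← mul_assoc, ← mul_assoc, c20, smul_mul_assoc, smul_mul_assoc, mul_assoc (_ ^ i),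
          ← pow_succ', h0 i (j + 1) (by omega), smul_zero]
    · intro i j hij
      apply unit
      · have := h1 (i + 1) j (by omega)
        simpa only [pow_succ', mul_assoc] using! this
      · rw [← mul_assoc, ← mul_assoc, ← mul_assoc, c10, smul_mul_assoc, smul_mul_assoc,
          smul_mul_assoc, mul_assoc (_ ^ i), rel_10_10', mul_smul_comm, smul_mul_assoc,
          smul_mul_assoc, ← mul_assoc, ← pow_succ, mul_assoc (_ ^ (i + 1)), ← pow_succ',
          h0 (i + 1) (j + 1) (by omega), smul_zero, smul_zero]
      · rw [← mul_assoc, ← mul_assoc, ← mul_assoc, c20, smul_mul_assoc, smul_mul_assoc,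
          smul_mul_assoc, mul_assoc (_ ^ i), c21, mul_smul_comm, smul_mul_assoc,
          smul_mul_assoc, ← mul_assoc, mul_assoc (_ * _) (T1 P 2 0) (T1 P 2 0 ^ j), ← pow_succ',
          h1 i (j + 1) (by omega), smul_zero, smul_zero]

/-- In v₊(a^N f) the term where v₊ hits a^N is a multiple of a^(N-1) γ (τ f). One further factor a
turns it into a multiple of γ a^N (τ f), which vanishes because a^N also kills τ f. -/
lemma torsion_Dp {f : OSp P} {N : ℕ} (h : T1 P 0 0 ^ N * f = 0) :
    T1 P 0 0 ^ (N + 1) * Dp P f = 0 := by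
  have ht := P.t_ne
  have h1 : Dp P (T1 P 0 0 ^ N * f) = 0 := by rw [h, map_zero]
  have h2 : T1 P 0 0 ^ N * tau P f = 0 := by
    have : tau P (T1 P 0 0 ^ N * f) = 0 := by rw [h, map_zero]
    rw [map_mul, tau_pow_zero, smul_mul_assoc, smul_eq_zero] at this
    exact this.resolve_left (pow_ne_zero _ (by simp [sg_zero, ht]))
  have h3 : T1 P 0 0 * (Dp P (T1 P 0 0 ^ N) * tau P f) = 0 := by
    cases N with
    | zero => rw [pow_zero, Dp_one, zero_mul, mul_zero]
    | succ N =>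
      rw [Dp_corner_pow, smul_mul_assoc, mul_smul_comm, ← mul_assoc, ← mul_assoc, ← pow_succ',
        qcomm_pow_left (T1_law P).rel_00_10, smul_mul_assoc, mul_assoc, h2, mul_zero, smul_zero,
        smul_zero]
  rw [Dp_mul, sig_pow_zero, smul_mul_assoc] at h1
  have h4 := congrArg (T1 P 0 0 * ·) h1
  simp only [mul_add, h3, zero_add, mul_zero, mul_smul_comm, ← mul_assoc, ← pow_succ'] at h4
  exact (smul_eq_zero.1 h4).resolve_left (pow_ne_zero _ ht)

/-- The corner entry of the fundamental matrix is not a left zero divisor. -/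
lemma corner_regular {f : OSp P} {N : ℕ} (h : T1 P 0 0 ^ N * f = 0) : f = 0 := by
  obtain ⟨k, hk⟩ := Dp_nilpotent f
  -- Induction on the exponent of v₊ that kills f. The element v₊ f is again a-torsion and has a
  -- smaller exponent, so it is zero; then the argument with the first column applies to f.
  induction k generalizing f N with
  | zero => simpa using hk
  | succ k ih =>
    rw [pow_succ, Module.End.mul_apply] at hk
    have hD := ih (torsion_Dp P h) hk
    exact eq_zero_of_column_kills P N (fun i j hij => (column_kills P hD h j).1 i hij)
      (fun i j hij => (column_kills P hD h j).2 i hij)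

end Regular
end QSphere

namespace QSphere
open SuperAlg

/-! ### Anticommutator of the row operators and highest weight vectors -/

section HighestWeight
variable (P : Param)

/-- In the anticommutator applied to a product, the mixed terms cancel by the commutation rules of
`Dp`, `Dm` with `sig`, `tau`. What remains is a skew derivation with twists σ² and τ², as is the
right-hand side, so the generators decide. -/
lemma anticomm_row (f : OSp P) : Dm P (Dp P f) + Dp P (Dm P f) =
    (P.nu ^ 2 / (P.t ^ 2 - P.t⁻¹ ^ 2)) • (sig P (sig P f) - tau P (tau P f)) := by
  have h0 := P.t_ne
  have h4 : P.t ^ 2 - P.t⁻¹ ^ 2 ≠ 0 := by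
    intro h; apply P.t_pow_ne 4 (by norm_num); field_simp at h; linear_combination h
  set κ := P.nu ^ 2 / (P.t ^ 2 - P.t⁻¹ ^ 2) with hκ
  have hκ' : κ * (P.t ^ 2 - P.t⁻¹ ^ 2) = P.nu ^ 2 := div_mul_cancel₀ _ h4
  let M : Submodule ℂ (OSp P) := LinearMap.ker (Dm P ∘ₗ Dp P + Dp P ∘ₗ Dm P -
    κ • ((sig P).toLinearMap ∘ₗ (sig P).toLinearMap - (tau P).toLinearMap ∘ₗ (tau P).toLinearMap))
  have hM : ∀ f, f ∈ M ↔ Dm P (Dp P f) + Dp P (Dm P f) =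
      κ • (sig P (sig P f) - tau P (tau P f)) := by
    intro f; simp [M, sub_eq_zero]
  rw [← hM]
  refine OSp.submodule_induction ?_ ?_ f
  · rw [hM]; simp [Dp_one, Dm_one]
  · intro i j f hf
    rw [hM] at *
    have hs := sg_mul_self j
    have hT : Dm P (Dp P (T1 P i j)) + Dp P (Dm P (T1 P i j)) =
        κ • (sig P (sig P (T1 P i j)) - tau P (tau P (T1 P i j))) := by
      fin_cases i
      · simp only [Fin.zero_eta, Dp_T1_zero, Dm_T1_zero, map_smul, map_zero, Dm_T1_one, sig_T1_zero,
          tau_T1_zero, smul_smul, ← sub_smul, add_zero]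
        congr 1
        linear_combination (P.nu ^ 2 - κ * P.t⁻¹ ^ 2 * -1) * hs - hκ'
      · simp only [Fin.mk_one, Dp_T1_one, Dm_T1_one, map_smul, Dm_T1_two, Dp_T1_zero, sig_T1_one,
          tau_T1_one, smul_smul, ← sub_smul, ← add_smul]
        rw [show -sg j * -sg j = 1 by linear_combination hs, one_smul, sub_self, smul_zero,
          show sg j * P.nu * -(sg j * P.nu) + sg j * P.nu * (sg j * P.nu) = 0 by ring, zero_smul]
      · simp only [Fin.reduceFinMk, Dp_T1_two, Dm_T1_two, map_smul, map_zero, Dp_T1_one, sig_T1_two,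
          tau_T1_two, smul_smul, ← sub_smul, zero_add]
        congr 1
        linear_combination (-P.nu ^ 2 + κ * P.t ^ 2) * hs + hκ'
    have e : Dm P (Dp P (T1 P i j * f)) + Dp P (Dm P (T1 P i j * f)) =
        (Dm P (Dp P (T1 P i j)) + Dp P (Dm P (T1 P i j))) * tau P (tau P f) +
          sig P (sig P (T1 P i j)) * (Dm P (Dp P f) + Dp P (Dm P f)) := by
      simp only [Dp_mul, Dm_mul, map_add, Dm_sig, Dp_sig, Dm_tau, Dp_tau, smul_mul_assoc,
        mul_smul_comm, add_mul, mul_add]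
      module
    rw [e, hT, hf, map_mul, map_mul, map_mul, map_mul]
    simp only [smul_mul_assoc, mul_smul_comm, ← smul_add, sub_mul, mul_sub]
    congr 1
    abel

/-- The row weight spaces. -/
def wt (n : ℤ) : Submodule ℂ (OSp P) := Module.End.eigenspace (sig P).toLinearMap (P.t ^ n)

variable {P}

lemma mem_wt {n : ℤ} {f : OSp P} : f ∈ wt P n ↔ sig P f = P.t ^ n • f :=
  Module.End.mem_eigenspace_iff

namespace Param
variable (P)

lemma zpow_inj {m n : ℤ} (h : P.t ^ m = P.t ^ n) : m = n := by
  have key : ∀ m n : ℤ, m < n → P.t ^ m ≠ P.t ^ n := by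
    intro m n hmn h
    obtain ⟨k, hk⟩ := Int.eq_ofNat_of_zero_le (sub_nonneg.2 hmn.le)
    apply P.generic k (by omega)
    rw [← zpow_natCast, ← hk, zpow_sub₀ P.t_ne, ← h, div_self (zpow_ne_zero _ P.t_ne)]
  rcases lt_trichotomy m n with h1 | h1 | h1
  · exact absurd h (key _ _ h1)
  · exact h1
  · exact absurd h.symm (key _ _ h1)

lemma zpow_ne_neg_one (m : ℤ) : P.t ^ m ≠ -1 := by
  intro h
  have h2 : P.t ^ (2 * m) = P.t ^ (0 : ℤ) := by
    rw [two_mul, zpow_add₀ P.t_ne, h, zpow_zero]; norm_num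
  have := P.zpow_inj h2
  rw [show m = 0 by omega, zpow_zero] at h
  norm_num at h

end Param

lemma T1_mul_mem_wt {n : ℤ} {f : OSp P} (hf : f ∈ wt P n) (i j : Fin 3) :
    T1 P i j * f ∈ wt P (n + 1 - (i : ℕ)) := by
  have h0 := P.t_ne
  rw [mem_wt] at *
  rw [map_mul, hf, sig_T1, smul_mul_smul_comm]
  congr 1
  fin_cases i
  · simp [zpow_add₀ h0, mul_comm]
  · simp
  · simp only [Fin.reduceFinMk, Matrix.cons_val]
    rw [show n + 1 - ((2 : ℕ) : ℤ) = n + (-1) by push_cast; ring, zpow_add₀ h0, zpow_neg_one,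
      mul_comm]

lemma mul_mem_wt {m n : ℤ} {f g : OSp P} (hf : f ∈ wt P m) (hg : g ∈ wt P n) :
    f * g ∈ wt P (m + n) := by
  rw [mem_wt] at *
  rw [map_mul, hf, hg, smul_mul_smul_comm, zpow_add₀ P.t_ne]

lemma one_mem_wt : (1 : OSp P) ∈ wt P 0 := by rw [mem_wt]; simp

lemma T1_mem_wt (i j : Fin 3) : T1 P i j ∈ wt P (1 - (i : ℕ)) := by
  have := T1_mul_mem_wt (one_mem_wt (P := P)) i j
  rwa [mul_one, zero_add] at this

lemma pow_mem_wt {m : ℤ} {f : OSp P} (hf : f ∈ wt P m) (k : ℕ) : f ^ k ∈ wt P (k * m) := by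
  induction k with
  | zero => simpa using one_mem_wt
  | succ k ih =>
    rw [pow_succ]
    have := mul_mem_wt ih hf
    rwa [show (k : ℤ) * m + m = ((k + 1 : ℕ) : ℤ) * m by push_cast; ring] at this

lemma Dp_mem_wt {n : ℤ} {f : OSp P} (hf : f ∈ wt P n) : Dp P f ∈ wt P (n - 1) := by
  have h0 := P.t_ne
  rw [mem_wt] at *
  have := Dp_sig P f
  rw [hf, map_smul] at this
  rw [zpow_sub_one₀ h0, mul_comm, mul_smul, this, smul_smul, inv_mul_cancel₀ h0, one_smul]

lemma Dm_mem_wt {n : ℤ} {f : OSp P} (hf : f ∈ wt P n) : Dm P f ∈ wt P (n + 1) := by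
  have h0 := P.t_ne
  rw [mem_wt] at *
  have := Dm_sig P f
  rw [hf, map_smul] at this
  rw [zpow_add_one₀ h0, mul_comm, mul_smul, this, smul_smul, mul_inv_cancel₀ h0, one_smul]

lemma tau_tau_of_wt {n : ℤ} {f : OSp P} (hf : f ∈ wt P n) :
    tau P (tau P f) = P.t ^ (-2 * n) • f := by
  have h0 := P.t_ne
  rw [mem_wt] at hf
  have h := sig_sig_tau_tau P f
  rw [sig_tau, sig_tau, sig_tau, sig_tau, hf, map_smul, hf, smul_smul, map_smul, map_smul] at h
  rw [show -2 * n = -n + -n by ring, zpow_add₀ h0]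
  conv_rhs => rw [← h, smul_smul]
  rw [zpow_neg, show (P.t ^ n)⁻¹ * (P.t ^ n)⁻¹ * (P.t ^ n * P.t ^ n) = 1 by
    have := zpow_ne_zero n h0; field_simp, one_smul]

lemma Dp_pow_mem_wt {n : ℤ} {f : OSp P} (hf : f ∈ wt P n) (k : ℕ) :
    (Dp P ^ k) f ∈ wt P (n - k) := by
  induction k with
  | zero => simpa using hf
  | succ k ih =>
    rw [pow_succ', Module.End.mul_apply]
    have := Dp_mem_wt ih
    rwa [show n - k - 1 = n - (k + 1 : ℕ) by push_cast; ring] at this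

/-- The action of `v₋ v₊^{k+1}` on a highest weight vector. -/
lemma Dm_Dp_pow {n : ℤ} {f : OSp P} (hf : f ∈ wt P n) (h : Dm P f = 0) (k : ℕ) :
    Dm P ((Dp P ^ (k + 1)) f) = (P.nu ^ 2 / (P.t ^ 2 - P.t⁻¹ ^ 2) / (1 + P.t ^ 2) *
      ((1 + (-1) ^ k * P.t ^ (2 * k + 2)) *
        (P.t ^ (2 * n - 2 * k) - (-1) ^ k * P.t ^ (-2 * n)))) • (Dp P ^ k) f := by
  have h0 := P.t_ne
  have h2 : 1 + P.t ^ 2 ≠ 0 := by rw [add_comm]; exact P.t2_add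
  -- The anticommutator is a scalar on each weight space, so v₋ can be moved past one v₊ at a time.
  -- The stated product is the solution of the resulting alternating recursion.
  have key : ∀ k : ℕ, Dm P (Dp P ((Dp P ^ k) f)) = (P.nu ^ 2 / (P.t ^ 2 - P.t⁻¹ ^ 2)) •
      ((P.t ^ (2 * (n - k)) - P.t ^ (-2 * (n - k))) • (Dp P ^ k) f) -
        Dp P (Dm P ((Dp P ^ k) f)) := by
    intro k
    have hk := Dp_pow_mem_wt hf k
    have hk' := mem_wt.1 hk
    rw [eq_sub_iff_add_eq, anticomm_row, tau_tau_of_wt hk, hk', map_smul, hk', smul_smul, ← sub_smul,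
      ← zpow_add₀ h0, ← two_mul]
  have hn : P.t ^ n ≠ 0 := zpow_ne_zero _ h0
  induction k with
  | zero =>
    rw [zero_add, pow_one]
    have := key 0
    rw [pow_zero, Module.End.one_apply, h, map_zero, sub_zero] at this
    rw [this, pow_zero (Dp P), Module.End.one_apply, smul_smul]
    congr 1
    simp only [pow_zero, one_mul, mul_zero, zero_add, Nat.cast_zero, sub_zero]
    field_simp
  | succ k ih =>
    rw [pow_succ', Module.End.mul_apply, key (k + 1), ih, map_smul, ← Module.End.mul_apply,
      ← pow_succ', smul_smul, ← sub_smul]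
    congr 1
    have e1 : P.t ^ (2 * (n - (k + 1 : ℕ))) = P.t ^ (2 * n - 2 * k) * P.t⁻¹ ^ 2 := by
      rw [show (2 * (n - (k + 1 : ℕ)) : ℤ) = (2 * n - 2 * k) + (-2) by push_cast; ring,
        zpow_add₀ h0]; congr 1
      rw [inv_pow]; rfl
    have e2 : P.t ^ (-2 * (n - (k + 1 : ℕ))) = P.t ^ (-2 * n) * P.t ^ (2 * k + 2) := by
      rw [show (-2 * (n - (k + 1 : ℕ)) : ℤ) = (-2 * n) + ((2 * k + 2 : ℕ) : ℤ) by push_cast; ring,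
        zpow_add₀ h0, zpow_natCast]
    have e3 : P.t ^ (2 * n - 2 * ((k + 1 : ℕ) : ℤ)) = P.t ^ (2 * n - 2 * k) * P.t⁻¹ ^ 2 := by
      rw [← e1]; congr 1; ring
    have e4 : P.t ^ (2 * (k + 1) + 2) = P.t ^ (2 * k + 2) * P.t ^ 2 := by ring
    have e5 : ((-1 : ℂ) ^ k) * (-1) ^ k = 1 := sg_mul_self k
    rw [e1, e2, e3, e4, pow_succ (-1 : ℂ) k]
    generalize P.nu ^ 2 / (P.t ^ 2 - P.t⁻¹ ^ 2) = κ
    generalize P.t ^ (2 * n - 2 * (k : ℤ)) = X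
    generalize P.t ^ (-2 * n) = Y
    generalize P.t ^ (2 * k + 2) = Z
    generalize (-1 : ℂ) ^ k = s at *
    have e6 : P.t⁻¹ ^ 2 * P.t ^ 2 = 1 := by rw [← mul_pow, inv_mul_cancel₀ h0, one_pow]
    rw [sub_eq_iff_eq_add, div_mul_eq_mul_div, div_mul_eq_mul_div, ← add_div, eq_div_iff h2]
    linear_combination (κ * s * X * Z) * e6 + (κ * X) * e6 + (κ * Y * Z * (1 + P.t ^ 2)) * e5

/-- A nonzero highest weight vector has a nonnegative weight `n`, and `v₊^{2n+1}` kills it. -/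
lemma highest_weight {n : ℤ} {f : OSp P} (hf : f ∈ wt P n) (h : Dm P f = 0) (h0 : f ≠ 0) :
    0 ≤ n ∧ ∀ k : ℕ, 2 * n < k → (Dp P ^ k) f = 0 := by
  have ht := P.t_ne
  classical
  have hex := Dp_nilpotent f
  have hk := Nat.find_spec hex
  obtain ⟨k, hk'⟩ : ∃ k, Nat.find hex = k + 1 := by
    apply Nat.exists_eq_succ_of_ne_zero
    intro h1
    rw [h1, pow_zero, Module.End.one_apply] at hk
    exact h0 hk
  have hlt : (Dp P ^ k) f ≠ 0 := Nat.find_min hex (by omega)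
  rw [hk'] at hk
  -- Here k + 1 is the least exponent killing f, so the coefficient of v₊^k f must vanish. For t not
  -- a root of unity this forces t^(4n-2k) = (-1)^k, where the sign -1 is impossible; hence k = 2n.
  have h1 := Dm_Dp_pow hf h k
  rw [hk, map_zero, eq_comm, smul_eq_zero, or_iff_left hlt] at h1
  have h2 : 1 + P.t ^ 2 ≠ 0 := by rw [add_comm]; exact P.t2_add
  have h4 : P.t ^ 2 - P.t⁻¹ ^ 2 ≠ 0 := by
    intro h; apply P.t_pow_ne 4 (by norm_num); field_simp at h; linear_combination h
  rw [mul_eq_zero, or_iff_right (div_ne_zero (div_ne_zero (pow_ne_zero 2 P.nu_ne) h4) h2),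
    mul_eq_zero] at h1
  have h3 : (k : ℤ) = 2 * n := by
    rcases h1 with h1 | h1
    · exfalso
      rcases neg_one_pow_eq_or ℂ k with e | e <;> rw [e] at h1
      · exact P.t_pow_add_one_ne (n := 2 * k + 2) (by omega) (by linear_combination h1)
      · exact P.t_pow_ne (2 * k + 2) (by omega) (by linear_combination -h1)
    · have h5 : P.t ^ (4 * n - 2 * k) = (-1) ^ k := by
        rw [show 4 * n - 2 * (k : ℤ) = (2 * n - 2 * k) + 2 * n by ring, zpow_add₀ ht]
        have : P.t ^ (-2 * n) * P.t ^ (2 * n) = 1 := by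
          rw [← zpow_add₀ ht]; simp
        linear_combination (P.t ^ (2 * n)) * h1 + (-1) ^ k * this
      rcases neg_one_pow_eq_or ℂ k with e | e <;> rw [e] at h5
      · have := P.zpow_inj (h5.trans (zpow_zero _).symm)
        omega
      · exact absurd h5 (P.zpow_ne_neg_one _)
  refine ⟨by omega, fun m hm => ?_⟩
  have : m = (m - (k + 1)) + (k + 1) := by omega
  rw [this, pow_add, Module.End.mul_apply, hk, map_zero]

end HighestWeight

/-! ### The functionals `ε ∘ v₊^k` -/

section Phi
variable (P : Param)

lemma counit_T1 (i j : Fin 3) : counit P (T1 P i j) = if i = j then 1 else 0 := OSp.lift_T1 _ _ _ _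

/-- The functional `f ↦ ε(f ⊙ v₊^k)`. -/
def phi (k : ℕ) : OSp P →ₗ[ℂ] ℂ := (counit P).toLinearMap ∘ₗ (Dp P ^ k)

variable {P}

lemma phi_zero (f : OSp P) : phi P 0 f = counit P f := rfl

lemma phi_succ (k : ℕ) (f : OSp P) : phi P (k + 1) f = phi P k (Dp P f) := by
  simp [phi, pow_succ]

/-- v₊ kills row 2 and ε kills its off-diagonal entries, so no power of v₊ can make such a left
factor contribute. The same holds for γ, which v₊ sends into row 2. -/
lemma phi_two_mul (j : Fin 3) (hj : j ≠ 2) (k : ℕ) (f : OSp P) :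
    phi P k (T1 P 2 j * f) = 0 := by
  induction k generalizing f with
  | zero => rw [phi_zero, map_mul, counit_T1, if_neg (Ne.symm hj), zero_mul]
  | succ k ih =>
    rw [phi_succ, Dp_mul, Dp_T1_two, zero_mul, zero_add, sig_T1_two, smul_mul_assoc, map_smul, ih,
      smul_zero]

lemma phi_10_mul (k : ℕ) (f : OSp P) : phi P k (T1 P 1 0 * f) = 0 := by
  induction k generalizing f with
  | zero => rw [phi_zero, map_mul, counit_T1]; simp
  | succ k ih =>
    rw [phi_succ, Dp_mul, Dp_T1_one, smul_mul_assoc, map_add, map_smul,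
      phi_two_mul 0 (by decide), sig_T1_one, ih, smul_zero, zero_add]

lemma phi_00_mul (k : ℕ) (f : OSp P) : phi P k (T1 P 0 0 * f) = P.t ^ k * phi P k f := by
  induction k generalizing f with
  | zero => rw [phi_zero, phi_zero, map_mul, counit_T1]; simp
  | succ k ih =>
    rw [phi_succ, Dp_mul, Dp_T1_zero, smul_mul_assoc, map_add, map_smul, phi_10_mul, sig_T1_zero,
      smul_mul_assoc, map_smul, ih, phi_succ, smul_eq_mul, smul_eq_mul]
    ring

lemma phi_11_mul (k : ℕ) (f : OSp P) : phi P k (T1 P 1 1 * f) = phi P k f := by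
  induction k generalizing f with
  | zero => rw [phi_zero, phi_zero, map_mul, counit_T1]; simp
  | succ k ih =>
    rw [phi_succ, Dp_mul, Dp_T1_one, smul_mul_assoc, map_add, map_smul,
      phi_two_mul 1 (by decide), sig_T1_one, ih, smul_zero, zero_add, phi_succ]

lemma phi_01_mul_zero (f : OSp P) : phi P 0 (T1 P 0 1 * f) = 0 := by
  rw [phi_zero, map_mul, counit_T1]; simp

/-- ε kills α, so exactly one v₊ has to turn α into the middle entry, on which ε is 1. Summing over
its position, with the commutation of v₊ and τ taken into account, gives the geometric sum of the
powers of -t². -/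
lemma phi_01_mul (k : ℕ) (f : OSp P) : phi P (k + 1) (T1 P 0 1 * f) =
    -(P.nu * ((1 - (-P.t ^ 2) ^ (k + 1)) / (1 + P.t ^ 2))) * phi P k (tau P f) := by
  have h0 := P.t_ne
  have h2 : 1 + P.t ^ 2 ≠ 0 := by rw [add_comm]; exact P.t2_add
  have h1 : (sg (1 : Fin 3) : ℂ) = -1 := by simp [sg]
  induction k generalizing f with
  | zero =>
    rw [phi_succ, Dp_mul, Dp_T1_zero, h1, smul_mul_assoc, map_add, map_smul, phi_11_mul,
      sig_T1_zero, smul_mul_assoc, map_smul, phi_01_mul_zero, smul_zero, add_zero, smul_eq_mul]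
    field_simp
    ring
  | succ k ih =>
    rw [phi_succ, Dp_mul, Dp_T1_zero, h1, smul_mul_assoc, map_add, map_smul, phi_11_mul,
      sig_T1_zero, smul_mul_assoc, map_smul, ih, phi_succ, Dp_tau, map_smul, smul_eq_mul,
      smul_eq_mul, smul_eq_mul]
    field_simp
    ring

/-- The element is an eigenvector of `τ` and only the `k`-th functional does not kill it. -/
def HasOrder (f : OSp P) (k : ℕ) : Prop :=
  (∃ c : ℂ, c ≠ 0 ∧ tau P f = c • f) ∧ ∀ l, phi P l f ≠ 0 ↔ l = k

lemma hasOrder_one : HasOrder (1 : OSp P) 0 := by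
  refine ⟨⟨1, one_ne_zero, by simp⟩, fun l => ?_⟩
  cases l with
  | zero => simp [phi_zero]
  | succ l => simp [phi_succ, Dp_one]

lemma HasOrder.smul {f : OSp P} {k : ℕ} (h : HasOrder f k) {c : ℂ} (hc : c ≠ 0) :
    HasOrder (c • f) k := by
  obtain ⟨⟨d, hd, h1⟩, h2⟩ := h
  refine ⟨⟨d, hd, by rw [map_smul, h1, smul_comm]⟩, fun l => ?_⟩
  rw [map_smul, smul_eq_mul, mul_ne_zero_iff, and_iff_right hc, h2]

lemma HasOrder.tau_mul {f : OSp P} {k : ℕ} (h : HasOrder f k) (j : Fin 3) :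
    ∃ c : ℂ, c ≠ 0 ∧ tau P (T1 P 0 j * f) = c • (T1 P 0 j * f) := by
  obtain ⟨⟨d, hd, h1⟩, -⟩ := h
  refine ⟨sg j * P.t⁻¹ * d, mul_ne_zero (mul_ne_zero ?_ (inv_ne_zero P.t_ne)) hd, ?_⟩
  · intro h; have := sg_mul_self j; rw [h, zero_mul] at this; exact zero_ne_one this
  · rw [map_mul, tau_T1_zero, h1, smul_mul_smul_comm]

lemma HasOrder.mul_00 {f : OSp P} {k : ℕ} (h : HasOrder f k) : HasOrder (T1 P 0 0 * f) k := by
  refine ⟨h.tau_mul 0, fun l => ?_⟩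
  rw [phi_00_mul, mul_ne_zero_iff, and_iff_right (pow_ne_zero _ P.t_ne), h.2]

lemma HasOrder.mul_01 {f : OSp P} {k : ℕ} (h : HasOrder f k) :
    HasOrder (T1 P 0 1 * f) (k + 1) := by
  have h2 : 1 + P.t ^ 2 ≠ 0 := by rw [add_comm]; exact P.t2_add
  refine ⟨h.tau_mul 1, fun l => ?_⟩
  obtain ⟨⟨d, hd, h1⟩, h3⟩ := h
  cases l with
  | zero => simp [phi_01_mul_zero]
  | succ l =>
    have h5 : 1 - (-P.t ^ 2) ^ (l + 1) ≠ 0 := by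
      rw [neg_pow, ← pow_mul]
      intro h
      rcases neg_one_pow_eq_or ℂ (l + 1) with e | e <;> rw [e] at h
      · exact P.t_pow_ne (2 * (l + 1)) (by omega) (by linear_combination -h)
      · exact P.t_pow_add_one_ne (n := 2 * (l + 1)) (by omega) (by linear_combination h)
    rw [phi_01_mul, mul_ne_zero_iff, and_iff_right, h1, map_smul, smul_eq_mul, mul_ne_zero_iff,
      and_iff_right hd, h3, add_left_inj]
    exact neg_ne_zero.2 (mul_ne_zero P.nu_ne (div_ne_zero h5 h2))

/-- On values of the functionals a acts by a nonzero scalar; the eigenvector equation for τ can be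
divided by a because a is not a left zero divisor. -/
lemma HasOrder.of_mul_00 {f : OSp P} {k : ℕ} (h : HasOrder (T1 P 0 0 * f) k) : HasOrder f k := by
  obtain ⟨⟨d, hd, h1⟩, h2⟩ := h
  refine ⟨⟨d * P.t, mul_ne_zero hd P.t_ne, ?_⟩, fun l => ?_⟩
  · have h3 : T1 P 0 0 ^ 1 * (P.t⁻¹ • tau P f - d • f) = 0 := by
      rw [map_mul, tau_T1_zero] at h1
      simp only [Fin.val_zero, sg_zero, one_mul] at h1
      rw [pow_one, mul_sub, mul_smul_comm, mul_smul_comm, ← h1, smul_mul_assoc, sub_self]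
    have h4 := sub_eq_zero.1 (corner_regular P h3)
    rw [mul_comm, mul_smul, ← h4, smul_smul, mul_inv_cancel₀ P.t_ne, one_smul]
  · rw [← h2, phi_00_mul, mul_ne_zero_iff, and_iff_right (pow_ne_zero _ P.t_ne)]

lemma rel_00_02' : T1 P 0 0 * T1 P 0 2 =
    (P.t ^ 4 / (P.t ^ 3 - P.t)) • (T1 P 0 1 * T1 P 0 1) := by
  have h0 := P.t_ne
  have h1 : P.t ^ 3 - P.t ≠ 0 := by
    rw [show P.t ^ 3 - P.t = P.t * (P.t ^ 2 - 1) by ring]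
    exact mul_ne_zero h0 (P.t_pow_ne 2 (by norm_num))
  rw [(T1_law P).rel_00_02, (T1_law P).rel_01_01, smul_smul, div_mul_cancel₀ _ h1]

/-- a b is a nonzero multiple of α², so b raises the order by two once a is cancelled. -/
lemma HasOrder.mul_02 {f : OSp P} {k : ℕ} (h : HasOrder f k) :
    HasOrder (T1 P 0 2 * f) (k + 2) := by
  have h0 := P.t_ne
  have h1 : P.t ^ 3 - P.t ≠ 0 := by
    rw [show P.t ^ 3 - P.t = P.t * (P.t ^ 2 - 1) by ring]
    exact mul_ne_zero h0 (P.t_pow_ne 2 (by norm_num))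
  apply HasOrder.of_mul_00
  rw [← mul_assoc, rel_00_02', smul_mul_assoc, mul_assoc]
  exact h.mul_01.mul_01.smul (div_ne_zero (pow_ne_zero 4 h0) h1)

lemma HasOrder.mul_zero {f : OSp P} {k : ℕ} (h : HasOrder f k) (j : Fin 3) :
    HasOrder (T1 P 0 j * f) (k + j) := by
  fin_cases j
  exacts [h.mul_00, h.mul_01, h.mul_02]

end Phi
end QSphere

namespace QSphere
open SuperAlg

/-! ### Decomposition into row weights -/

section Weights
variable (P : Param)

lemma iSup_wt : ⨆ n, wt P n = ⊤ := by
  rw [eq_top_iff]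
  rintro f -
  refine OSp.submodule_induction (Submodule.mem_iSup_of_mem 0 one_mem_wt) ?_ f
  intro i j f hf
  induction hf using Submodule.iSup_induction' with
  | mem n f hf => exact Submodule.mem_iSup_of_mem _ (T1_mul_mem_wt hf i j)
  | zero => rw [mul_zero]; exact zero_mem _
  | add x y _ _ hx hy => rw [mul_add]; exact add_mem hx hy

/-- Eigenspaces of `sig` for distinct eigenvalues are independent, and n ↦ t^n is injective because
t is not a root of unity. -/
lemma isInternal_wt : DirectSum.IsInternal (wt P) := by
  rw [DirectSum.isInternal_submodule_iff_iSupIndep_and_iSup_eq_top]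
  refine ⟨?_, iSup_wt P⟩
  exact (Module.End.eigenspaces_iSupIndep (sig P).toLinearMap).comp
    (f := fun n : ℤ => P.t ^ n) fun m n h => P.zpow_inj h

instance : DirectSum.Decomposition (wt P) := (isInternal_wt P).chooseDecomposition

/-- The component of row weight `n`. -/
def comp (n : ℤ) : OSp P →ₗ[ℂ] OSp P :=
  (wt P n).subtype ∘ₗ DirectSum.component ℂ ℤ (fun n => wt P n) n ∘ₗ
    (DirectSum.decomposeLinearEquiv (wt P)).toLinearMap

variable {P}

lemma comp_apply (n : ℤ) (f : OSp P) : comp P n f = DirectSum.decompose (wt P) f n := rfl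

lemma comp_mem (n : ℤ) (f : OSp P) : comp P n f ∈ wt P n := Subtype.coe_prop _

lemma comp_of_mem {n : ℤ} {f : OSp P} (h : f ∈ wt P n) : comp P n f = f := by
  rw [comp_apply, DirectSum.decompose_of_mem_same _ h]

lemma comp_of_mem_ne {m n : ℤ} {f : OSp P} (h : f ∈ wt P m) (hmn : m ≠ n) : comp P n f = 0 := by
  rw [comp_apply, DirectSum.decompose_of_mem_ne _ h hmn]

lemma wt_induction {p : OSp P → Prop} (h0 : p 0) (hadd : ∀ f g, p f → p g → p (f + g))
    (h : ∀ n, ∀ f ∈ wt P n, p f) (f : OSp P) : p f := by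
  have hf : f ∈ ⨆ n, wt P n := by rw [iSup_wt]; trivial
  induction hf using Submodule.iSup_induction' with
  | mem n f hf => exact h n f hf
  | zero => exact h0
  | add x y _ _ hx hy => exact hadd x y hx hy

lemma eq_zero_of_comp {f : OSp P} (h : ∀ n, comp P n f = 0) : f = 0 := by
  classical
  rw [← DirectSum.sum_support_decompose (wt P) f]
  exact Finset.sum_eq_zero fun n _ => h n

lemma comp_map {L : OSp P →ₗ[ℂ] OSp P} {s : ℤ} (hL : ∀ n, ∀ f ∈ wt P n, L f ∈ wt P (n + s))
    (n : ℤ) (f : OSp P) : comp P (n + s) (L f) = L (comp P n f) := by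
  induction f using wt_induction with
  | h0 => simp
  | hadd f g hf hg => rw [map_add, map_add, map_add, map_add, hf, hg]
  | h m f hf =>
    rcases eq_or_ne m n with rfl | hmn
    · rw [comp_of_mem hf, comp_of_mem (hL _ _ hf)]
    · rw [comp_of_mem_ne hf hmn, map_zero, comp_of_mem_ne (hL _ _ hf) (by omega)]

end Weights

/-! ### Localization at the corner entry -/

section Localization
variable (P : Param)

/-- The span of the ordered monomials `a^i α^m γ^k`. -/
def cornerSpan : Submodule ℂ (OSp P) :=
  Submodule.span ℂ (Set.range fun p : ℕ × ℕ × ℕ =>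
    T1 P 0 0 ^ p.1 * T1 P 0 1 ^ p.2.1 * T1 P 1 0 ^ p.2.2)

variable {P}

lemma mono_mem_cornerSpan (i m k : ℕ) :
    T1 P 0 0 ^ i * T1 P 0 1 ^ m * T1 P 1 0 ^ k ∈ cornerSpan P :=
  Submodule.subset_span ⟨(i, m, k), rfl⟩

lemma mul_cornerSpan {x : OSp P} (h : ∀ i m k : ℕ,
    x * (T1 P 0 0 ^ i * T1 P 0 1 ^ m * T1 P 1 0 ^ k) ∈ cornerSpan P) {f : OSp P}
    (hf : f ∈ cornerSpan P) : x * f ∈ cornerSpan P := by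
  have : cornerSpan P ≤ (cornerSpan P).comap (LinearMap.mulLeft ℂ x) := by
    conv_lhs => rw [cornerSpan]
    rw [Submodule.span_le]
    rintro _ ⟨p, rfl⟩
    exact h p.1 p.2.1 p.2.2
  exact this hf

lemma rel_01_00_pow (i : ℕ) :
    T1 P 0 1 * T1 P 0 0 ^ i = ((P.t ^ 2) ^ i)⁻¹ • (T1 P 0 0 ^ i * T1 P 0 1) :=
  qcomm_symm (pow_ne_zero i (pow_ne_zero 2 P.t_ne)) (qcomm_pow_left (T1_law P).rel_00_01 i)

lemma rel_10_00_pow (i : ℕ) :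
    T1 P 1 0 * T1 P 0 0 ^ i = ((P.t ^ 2) ^ i)⁻¹ • (T1 P 0 0 ^ i * T1 P 1 0) :=
  qcomm_symm (pow_ne_zero i (pow_ne_zero 2 P.t_ne)) (qcomm_pow_left (T1_law P).rel_00_10 i)

lemma rel_10_01_pow (m : ℕ) :
    T1 P 1 0 * T1 P 0 1 ^ m = (-1 : ℂ) ^ m • (T1 P 0 1 ^ m * T1 P 1 0) := by
  apply qcomm_pow_right
  rw [(T1_law P).rel_01_10, smul_neg, neg_one_smul, neg_neg]

lemma a_mul_cornerSpan {f : OSp P} (hf : f ∈ cornerSpan P) : T1 P 0 0 * f ∈ cornerSpan P := by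
  refine mul_cornerSpan (fun i m k => ?_) hf
  rw [← mul_assoc, ← mul_assoc, ← pow_succ']
  exact mono_mem_cornerSpan _ _ _

lemma al_mul_cornerSpan {f : OSp P} (hf : f ∈ cornerSpan P) : T1 P 0 1 * f ∈ cornerSpan P := by
  refine mul_cornerSpan (fun i m k => ?_) hf
  rw [← mul_assoc, ← mul_assoc, rel_01_00_pow, smul_mul_assoc, smul_mul_assoc,
    mul_assoc (_ ^ i), ← pow_succ']
  exact Submodule.smul_mem _ _ (mono_mem_cornerSpan _ _ _)

lemma ga_mul_cornerSpan {f : OSp P} (hf : f ∈ cornerSpan P) : T1 P 1 0 * f ∈ cornerSpan P := by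
  refine mul_cornerSpan (fun i m k => ?_) hf
  rw [← mul_assoc, ← mul_assoc, rel_10_00_pow, smul_mul_assoc, smul_mul_assoc,
    mul_assoc (_ ^ i), rel_10_01_pow, mul_smul_comm, smul_mul_assoc, ← mul_assoc,
    mul_assoc (_ * _), ← pow_succ']
  exact Submodule.smul_mem _ _ (Submodule.smul_mem _ _ (mono_mem_cornerSpan _ _ _))

lemma pow_mul_cornerSpan (N : ℕ) {f : OSp P} (hf : f ∈ cornerSpan P) :
    T1 P 0 0 ^ N * f ∈ cornerSpan P := by
  induction N with
  | zero => simpa using hf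
  | succ N ih => rw [pow_succ', mul_assoc]; exact a_mul_cornerSpan ih

variable (P) in
/-- The elements that a power of the corner entry moves into `cornerSpan`. -/
def cornerLoc : Submodule ℂ (OSp P) where
  carrier := {f | ∃ N, T1 P 0 0 ^ N * f ∈ cornerSpan P}
  zero_mem' := ⟨0, by rw [mul_zero]; exact zero_mem _⟩
  add_mem' := by
    rintro f g ⟨M, hM⟩ ⟨N, hN⟩
    refine ⟨M + N, ?_⟩
    rw [mul_add]
    refine add_mem ?_ ?_
    · rw [add_comm, pow_add, mul_assoc]; exact pow_mul_cornerSpan _ hM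
    · rw [pow_add, mul_assoc]; exact pow_mul_cornerSpan _ hN
  smul_mem' := by
    rintro c f ⟨N, hN⟩
    exact ⟨N, by rw [mul_smul_comm]; exact Submodule.smul_mem _ _ hN⟩

lemma cornerLoc_of_mul {f : OSp P} (h : T1 P 0 0 * f ∈ cornerLoc P) : f ∈ cornerLoc P := by
  obtain ⟨N, hN⟩ := h
  exact ⟨N + 1, by rwa [pow_succ, mul_assoc]⟩

lemma mul_cornerLoc {x : OSp P} (hx : ∀ f ∈ cornerSpan P, x * f ∈ cornerSpan P) {s : ℂ}
    (h : T1 P 0 0 * x = s • (x * T1 P 0 0)) {f : OSp P} (hf : f ∈ cornerLoc P) :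
    x * f ∈ cornerLoc P := by
  obtain ⟨N, hN⟩ := hf
  refine ⟨N, ?_⟩
  rw [← mul_assoc, qcomm_pow_left h, smul_mul_assoc, mul_assoc]
  exact Submodule.smul_mem _ _ (hx _ hN)

/-- After inverting a the algebra is generated by a, α and γ: left multiplication by a turns each
remaining entry into a combination of products of entries treated before. Here a b and a c are
multiples of α² and γ², the middle entry comes next, and the lower right corner is last. -/
lemma mem_cornerLoc (f : OSp P) : f ∈ cornerLoc P := by
  have ha : ∀ f ∈ cornerLoc P, T1 P 0 0 * f ∈ cornerLoc P := fun f hf =>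
    mul_cornerLoc (fun _ => a_mul_cornerSpan) (one_smul ℂ _).symm hf
  have hal : ∀ f ∈ cornerLoc P, T1 P 0 1 * f ∈ cornerLoc P := fun f hf =>
    mul_cornerLoc (fun _ => al_mul_cornerSpan) (T1_law P).rel_00_01 hf
  have hga : ∀ f ∈ cornerLoc P, T1 P 1 0 * f ∈ cornerLoc P := fun f hf =>
    mul_cornerLoc (fun _ => ga_mul_cornerSpan) (T1_law P).rel_00_10 hf
  have hb : ∀ f ∈ cornerLoc P, T1 P 0 2 * f ∈ cornerLoc P := fun f hf => by
    apply cornerLoc_of_mul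
    rw [← mul_assoc, rel_00_02', smul_mul_assoc, mul_assoc]
    exact Submodule.smul_mem _ _ (hal _ (hal _ hf))
  have hc : ∀ f ∈ cornerLoc P, T1 P 2 0 * f ∈ cornerLoc P := fun f hf => by
    apply cornerLoc_of_mul
    have h0 := P.t_ne
    have e : T1 P 0 0 * T1 P 2 0 = (P.t ^ 4 / (P.t ^ 3 - P.t)) • (T1 P 1 0 * T1 P 1 0) := by
      have h1 : P.t ^ 3 - P.t ≠ 0 := by
        rw [show P.t ^ 3 - P.t = P.t * (P.t ^ 2 - 1) by ring]
        exact mul_ne_zero h0 (P.t_pow_ne 2 (by norm_num))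
      rw [(T1_law P).rel_00_20, (T1_law P).rel_10_10, smul_smul, div_mul_cancel₀ _ h1]
    rw [← mul_assoc, e, smul_mul_assoc, mul_assoc]
    exact Submodule.smul_mem _ _ (hga _ (hga _ hf))
  have he : ∀ f ∈ cornerLoc P, T1 P 1 1 * f ∈ cornerLoc P := fun f hf => by
    apply cornerLoc_of_mul
    rw [← mul_assoc, (T1_law P).rel_00_11, add_mul, smul_mul_assoc, mul_assoc]
    exact add_mem (ha _ hf) (Submodule.smul_mem _ _ (hga _ (hal _ hf)))
  have hβ : ∀ f ∈ cornerLoc P, T1 P 1 2 * f ∈ cornerLoc P := fun f hf => by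
    apply cornerLoc_of_mul
    have e : T1 P 0 0 * T1 P 1 2 = (-P.t) • T1 P 0 1 + P.t ^ 2 • (T1 P 1 0 * T1 P 0 2) := by
      rw [(T1_law P).rel_00_12]; congr 1; exact (neg_smul P.t (T1 P 0 1)).symm
    rw [← mul_assoc, e, add_mul, smul_mul_assoc, smul_mul_assoc, mul_assoc]
    exact add_mem (Submodule.smul_mem _ _ (hal _ hf))
      (Submodule.smul_mem _ _ (hga _ (hb _ hf)))
  have hδ : ∀ f ∈ cornerLoc P, T1 P 2 1 * f ∈ cornerLoc P := fun f hf => by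
    apply cornerLoc_of_mul
    rw [← mul_assoc, (T1_law P).rel_00_21, add_mul, smul_mul_assoc, smul_mul_assoc, mul_assoc]
    exact add_mem (Submodule.smul_mem _ _ (hga _ hf)) (Submodule.smul_mem _ _ (hal _ (hc _ hf)))
  have hd : ∀ f ∈ cornerLoc P, T1 P 2 2 * f ∈ cornerLoc P := fun f hf => by
    apply cornerLoc_of_mul
    rw [← mul_assoc, (T1_law P).rel_00_22, add_mul, sub_mul, smul_mul_assoc, smul_mul_assoc,
      smul_mul_assoc, mul_assoc, one_mul]
    exact add_mem (sub_mem (Submodule.smul_mem _ _ hf) (Submodule.smul_mem _ _ (he _ hf)))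
      (Submodule.smul_mem _ _ (hc _ (hb _ hf)))
  have h1 : (1 : OSp P) ∈ cornerLoc P := ⟨0, by simpa using mono_mem_cornerSpan (P := P) 0 0 0⟩
  refine OSp.submodule_induction h1 ?_ f
  intro i j
  fin_cases i <;> fin_cases j
  exacts [ha, hal, hb, hga, he, hβ, hc, hδ, hd]

/-! ### Highest weight vectors are determined by the functionals -/

variable (P) in
/-- The combinations of `a^i α^m` of row weight `w`. -/
def topSpan (w : ℕ) : Submodule ℂ (OSp P) :=
  Submodule.span ℂ (Set.range fun m : Fin (w + 1) =>
    T1 P 0 0 ^ (w - m : ℕ) * T1 P 0 1 ^ (m : ℕ))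

lemma hasOrder_top (i m : ℕ) : HasOrder (T1 P 0 0 ^ i * T1 P 0 1 ^ m) m := by
  have h : HasOrder (T1 P 0 1 ^ m) m := by
    induction m with
    | zero => rw [pow_zero]; exact hasOrder_one
    | succ m ih => rw [pow_succ']; exact ih.mul_01
  induction i with
  | zero => rwa [pow_zero, one_mul]
  | succ i ih => rw [pow_succ', mul_assoc]; exact ih.mul_00

/-- Independence of elements with distinct orders. -/
lemma eq_zero_of_sum_hasOrder {ι : Type*} (s : Finset ι) (v : ι → OSp P) (o : ι → ℕ)
    (hv : ∀ i ∈ s, HasOrder (v i) (o i)) (ho : Set.InjOn o s) (c : ι → ℂ)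
    (h : ∀ k, phi P k (∑ i ∈ s, c i • v i) = 0) : ∀ i ∈ s, c i = 0 := by
  intro i hi
  have h1 := h (o i)
  rw [map_sum, Finset.sum_eq_single i] at h1
  · rw [map_smul, smul_eq_mul, mul_eq_zero] at h1
    exact h1.resolve_right (((hv i hi).2 _).2 rfl)
  · intro j hj hji
    rw [map_smul, not_not.1 (mt ((hv j hj).2 (o i)).1 fun e => hji (ho hj hi e.symm)), smul_zero]
  · intro h; exact absurd hi h

lemma eq_zero_of_topSpan {w : ℕ} {x : OSp P} (hx : x ∈ topSpan P w)
    (h : ∀ k, phi P k x = 0) : x = 0 := by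
  obtain ⟨c, rfl⟩ := (Submodule.mem_span_range_iff_exists_fun ℂ).1 hx
  refine Finset.sum_eq_zero fun i hi => ?_
  rw [eq_zero_of_sum_hasOrder Finset.univ
    (fun m : Fin (w + 1) => T1 P 0 0 ^ (w - m : ℕ) * T1 P 0 1 ^ (m : ℕ)) (fun m => (m : ℕ))
    (fun m _ => hasOrder_top _ _) Fin.val_injective.injOn c h i hi, zero_smul]

lemma rel_01_pow_00 (m : ℕ) :
    T1 P 0 1 ^ m * T1 P 0 0 = ((P.t ^ 2)⁻¹) ^ m • (T1 P 0 0 * T1 P 0 1 ^ m) :=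
  qcomm_pow_left (qcomm_symm (pow_ne_zero 2 P.t_ne) (T1_law P).rel_00_01) m

lemma topSpan_mul_a {w : ℕ} {x : OSp P} (hx : x ∈ topSpan P w) :
    x * T1 P 0 0 ∈ topSpan P (w + 1) := by
  have : topSpan P w ≤ (topSpan P (w + 1)).comap (LinearMap.mulRight ℂ (T1 P 0 0)) := by
    conv_lhs => rw [topSpan]
    rw [Submodule.span_le]
    rintro _ ⟨m, rfl⟩
    change T1 P 0 0 ^ (w - m : ℕ) * T1 P 0 1 ^ (m : ℕ) * T1 P 0 0 ∈ topSpan P (w + 1)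
    rw [mul_assoc, rel_01_pow_00, mul_smul_comm, ← mul_assoc, ← pow_succ]
    refine Submodule.smul_mem _ _ (Submodule.subset_span ⟨m.castSucc, ?_⟩)
    simp only [Fin.val_castSucc]
    rw [show w + 1 - (m : ℕ) = w - m + 1 by omega]
  exact this hx

lemma topSpan_le {w : ℕ} {x : OSp P} (hx : x ∈ topSpan P w) : x ∈ wt P w ∧ Dm P x = 0 := by
  have : topSpan P w ≤ wt P w ⊓ LinearMap.ker (Dm P) := by
    rw [topSpan, Submodule.span_le]
    rintro _ ⟨m, rfl⟩
    refine ⟨?_, ?_⟩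
    · have := mul_mem_wt (pow_mem_wt (T1_mem_wt (P := P) 0 0) (w - m)) (pow_mem_wt (T1_mem_wt 0 1) m)
      simp only [Fin.val_zero, Nat.cast_zero, sub_zero, mul_one] at this
      rwa [← Nat.cast_add, show w - (m : ℕ) + m = w by omega] at this
    · change Dm P _ = 0
      rw [Dm_mul, Dm_pow_zero, Dm_pow_zero, zero_mul, mul_zero, add_zero]
  exact this hx

/-- a q-commutes with α, so right multiplication by a preserves the orders of the spanning
monomials, which stay distinct. -/
lemma eq_zero_of_mul_a {w : ℕ} {x : OSp P} (hx : x ∈ topSpan P w) (h : x * T1 P 0 0 = 0) :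
    x = 0 := by
  obtain ⟨c, rfl⟩ := (Submodule.mem_span_range_iff_exists_fun ℂ).1 hx
  refine Finset.sum_eq_zero fun m hm => ?_
  rw [Finset.sum_mul] at h
  have h2 := eq_zero_of_sum_hasOrder Finset.univ
    (fun m : Fin (w + 1) => T1 P 0 0 ^ (w - m : ℕ) * T1 P 0 1 ^ (m : ℕ) * T1 P 0 0)
    (fun m => (m : ℕ)) (fun p _ => by
      rw [mul_assoc, rel_01_pow_00, mul_smul_comm, ← mul_assoc, ← pow_succ]
      exact (hasOrder_top _ _).smul (pow_ne_zero _ (inv_ne_zero (pow_ne_zero 2 P.t_ne))))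
    Fin.val_injective.injOn c (by
      simp only [smul_mul_assoc] at h
      intro k; rw [h, map_zero]) m hm
  rw [h2, zero_smul]

/-- The coefficients of `v₋` acting on powers of the entry `T_{10}`. -/
lemma Dm_ga_pow (k : ℕ) : Dm P (T1 P 1 0 ^ (k + 1)) =
    (P.nu * ((-1) ^ k * (1 - (-(P.t⁻¹ ^ 2)) ^ (k + 1)) / (1 + P.t⁻¹ ^ 2))) •
      (T1 P 0 0 * T1 P 1 0 ^ k) := by
  have h0 := P.t_ne
  have h2 : 1 + P.t⁻¹ ^ 2 ≠ 0 := by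
    intro h; apply P.t2_add; field_simp at h; linear_combination h
  induction k with
  | zero =>
    rw [zero_add, pow_one, pow_zero (T1 P 1 0), mul_one, Dm_T1_one]
    congr 1
    simp only [Fin.val_zero, sg_zero]
    generalize P.t⁻¹ ^ 2 = u at *
    field_simp
    ring
  | succ k ih =>
    have e : tau P (T1 P 1 0 ^ (k + 1)) = (-1 : ℂ) ^ (k + 1) • T1 P 1 0 ^ (k + 1) := by
      rw [map_pow, tau_T1_one, smul_pow]; simp [sg_zero]
    have e2 := qcomm_symm (pow_ne_zero 2 h0) (T1_law P).rel_00_10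
    rw [pow_succ', Dm_mul, ih, Dm_T1_one, sig_T1_one, e, mul_smul_comm _ (T1 P 1 0),
      ← mul_assoc (T1 P 1 0), e2, smul_mul_smul_comm, smul_mul_assoc, smul_smul,
      mul_assoc (T1 P 0 0), ← pow_succ', ← add_smul]
    congr 1
    simp only [Fin.val_zero, sg_zero, ← inv_pow]
    generalize P.t⁻¹ ^ 2 = u at *
    rw [neg_pow u, neg_pow u (k + 1 + 1)]
    have h3 : ((-1 : ℂ) ^ k) ^ 2 = 1 := by rw [← pow_mul, mul_comm, pow_mul]; simp
    field_simp
    ring_nf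
    try linear_combination 0 * h3

variable (P) in
/-- The combinations of `x γ^k` with `k < K` and `x ∈ topSpan w`. -/
def gaFilt (w : ℕ) : ℕ → Submodule ℂ (OSp P)
  | 0 => ⊥
  | K + 1 => gaFilt w K ⊔ (topSpan P w).map (LinearMap.mulRight ℂ (T1 P 1 0 ^ K))

lemma gaFilt_mono (w : ℕ) : Monotone (gaFilt P w) := monotone_nat_of_le_succ fun _ => le_sup_left

lemma mem_gaFilt_succ {w K : ℕ} {x : OSp P} :
    x ∈ gaFilt P w (K + 1) ↔ ∃ y ∈ gaFilt P w K, ∃ q ∈ topSpan P w, y + q * T1 P 1 0 ^ K = x := by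
  rw [gaFilt, Submodule.mem_sup]
  simp

/-- v₋ kills q and turns one γ into a, so it lowers the exponent of γ by one; genericity of t keeps
the coefficient nonzero. -/
lemma Dm_top_mul {w K : ℕ} {q : OSp P} (hq : q ∈ topSpan P w) :
    ∃ c : ℂ, c ≠ 0 ∧ Dm P (q * T1 P 1 0 ^ (K + 1)) = c • ((q * T1 P 0 0) * T1 P 1 0 ^ K) := by
  obtain ⟨h1, h2⟩ := topSpan_le hq
  have h0 := P.t_ne
  have h3 : 1 + P.t⁻¹ ^ 2 ≠ 0 := by
    intro h; apply P.t2_add; field_simp at h; linear_combination h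
  have h5 : 1 - (-(P.t⁻¹ ^ 2)) ^ (K + 1) ≠ 0 := by
    rw [neg_pow, ← pow_mul, inv_pow]
    intro h
    have h6 : P.t ^ (2 * (K + 1)) ≠ 0 := pow_ne_zero _ h0
    rcases neg_one_pow_eq_or ℂ (K + 1) with e | e <;> rw [e] at h <;> field_simp at h
    · exact P.t_pow_ne (2 * (K + 1)) (by omega) (by linear_combination h)
    · exact P.t_pow_add_one_ne (n := 2 * (K + 1)) (by omega) (by linear_combination h)
  refine ⟨_, ?_, by rw [Dm_mul, h2, zero_mul, zero_add, mem_wt.1 h1, Dm_ga_pow, smul_mul_smul_comm,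
    mul_assoc]⟩
  exact mul_ne_zero (zpow_ne_zero _ h0) (mul_ne_zero P.nu_ne (div_ne_zero (mul_ne_zero
    (pow_ne_zero _ (by norm_num)) h5) h3))

lemma Dm_gaFilt {w K : ℕ} {x : OSp P} (hx : x ∈ gaFilt P w (K + 1)) :
    Dm P x ∈ gaFilt P (w + 1) K := by
  induction K generalizing x with
  | zero =>
    obtain ⟨y, hy, q, hq, rfl⟩ := mem_gaFilt_succ.1 hx
    rw [show y = 0 from hy, zero_add, pow_zero, mul_one, (topSpan_le hq).2]
    exact zero_mem _
  | succ K ih =>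
    obtain ⟨y, hy, q, hq, rfl⟩ := mem_gaFilt_succ.1 hx
    obtain ⟨c, -, hc⟩ := Dm_top_mul (K := K) hq
    rw [map_add, hc, mem_gaFilt_succ]
    exact ⟨_, ih hy, _, Submodule.smul_mem _ c (topSpan_mul_a hq), by rw [smul_mul_assoc]⟩

lemma Dm_pow_gaFilt {w K : ℕ} {x : OSp P} (hx : x ∈ gaFilt P w K) : (Dm P ^ K) x = 0 := by
  induction K generalizing w x with
  | zero => rw [show x = 0 from hx, map_zero]
  | succ K ih => rw [pow_succ, Module.End.mul_apply]; exact ih (Dm_gaFilt hx)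

lemma eq_zero_of_Dm_pow {w K : ℕ} {q : OSp P} (hq : q ∈ topSpan P w)
    (h : (Dm P ^ K) (q * T1 P 1 0 ^ K) = 0) : q = 0 := by
  induction K generalizing w q with
  | zero => simpa using h
  | succ K ih =>
    obtain ⟨c, hc0, hc⟩ := Dm_top_mul (K := K) hq
    rw [pow_succ, Module.End.mul_apply, hc, map_smul, smul_eq_zero, or_iff_right hc0] at h
    exact eq_zero_of_mul_a hq (ih (topSpan_mul_a hq) h)

/-- Compare leading terms in γ. If the top exponent K is positive, v₋^K kills the lower terms of x
and turns q γ^K into a nonzero multiple of q a^K. Since v₋ x = 0, this forces q = 0, and K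
decreases. -/
lemma mem_topSpan_of_gaFilt {w K : ℕ} {x : OSp P} (hx : x ∈ gaFilt P w K) (h : Dm P x = 0) :
    x ∈ topSpan P w := by
  induction K generalizing x with
  | zero => rw [show x = 0 from hx]; exact zero_mem _
  | succ K ih =>
    obtain ⟨y, hy, q, hq, rfl⟩ := mem_gaFilt_succ.1 hx
    cases K with
    | zero => rwa [show y = 0 from hy, zero_add, pow_zero, mul_one]
    | succ K =>
      have h1 : (Dm P ^ (K + 1)) (y + q * T1 P 1 0 ^ (K + 1)) = 0 := by
        rw [pow_succ, Module.End.mul_apply, h, map_zero]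
      rw [map_add, Dm_pow_gaFilt hy, zero_add] at h1
      have h2 := eq_zero_of_Dm_pow hq h1
      rw [h2, zero_mul, add_zero] at h ⊢
      exact ih hy h

lemma comp_mem_gaFilt {x : OSp P} (hx : x ∈ cornerSpan P) (w : ℕ) :
    ∃ K, comp P w x ∈ gaFilt P w K := by
  have h : cornerSpan P ≤ (⨆ K, gaFilt P w K).comap (comp P w) := by
    conv_lhs =>
      rw [cornerSpan]
    rw [Submodule.span_le]
    rintro _ ⟨⟨i, m, k⟩, rfl⟩
    change comp P w (T1 P 0 0 ^ i * T1 P 0 1 ^ m * T1 P 1 0 ^ k) ∈ ⨆ K, gaFilt P w K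
    have h1 := mul_mem_wt (mul_mem_wt (pow_mem_wt (T1_mem_wt (P := P) 0 0) i)
      (pow_mem_wt (T1_mem_wt 0 1) m)) (pow_mem_wt (T1_mem_wt 1 0) k)
    by_cases hw : i + m = w
    · subst hw
      rw [comp_of_mem (by simpa using h1)]
      refine Submodule.mem_iSup_of_mem (k + 1) (mem_gaFilt_succ.2 ⟨0, Submodule.zero_mem _,
        T1 P 0 0 ^ i * T1 P 0 1 ^ m, ?_, zero_add _⟩)
      refine Submodule.subset_span ⟨⟨m, by omega⟩, ?_⟩
      simp
    · rw [comp_of_mem_ne h1 (by simp; omega)]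
      exact zero_mem _
  exact (Submodule.mem_iSup_of_directed _ (gaFilt_mono w).directed_le).1 (h hx)

/-- A highest weight vector killed by all the functionals `ε ∘ v₊^k` vanishes. -/
theorem eq_zero_of_phi {n : ℤ} {f : OSp P} (hf : f ∈ wt P n) (h : Dm P f = 0)
    (hphi : ∀ k, phi P k f = 0) : f = 0 := by
  by_contra hne
  obtain ⟨m, rfl⟩ := Int.eq_ofNat_of_zero_le (highest_weight hf h hne).1
  -- For large N the element a^N f lies in `cornerSpan`. It is again a highest weight vector killed
  -- by all the functionals, hence lies in `topSpan` and vanishes there; then a^N is cancelled.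
  obtain ⟨N, hN⟩ := mem_cornerLoc f
  obtain ⟨K, hK⟩ := comp_mem_gaFilt hN (N + m)
  have h1 := mul_mem_wt (pow_mem_wt (T1_mem_wt (P := P) 0 0) N) hf
  rw [comp_of_mem (by simpa using h1)] at hK
  have h2 := mem_topSpan_of_gaFilt hK (by rw [Dm_mul, Dm_pow_zero, h, zero_mul, mul_zero, add_zero])
  apply hne
  apply corner_regular P (N := N)
  apply eq_zero_of_topSpan h2
  intro k
  have : ∀ N, phi P k (T1 P 0 0 ^ N * f) = 0 := by
    intro N
    induction N with
    | zero => rw [pow_zero, one_mul, hphi]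
    | succ N ih => rw [pow_succ', mul_assoc, phi_00_mul, ih, mul_zero]
  exact this N

/-- A subspace stable under the row action and contained in the kernel of the counit vanishes. -/
theorem eq_zero_of_stable {M : Submodule ℂ (OSp P)} (hp : ∀ f ∈ M, Dp P f ∈ M)
    (hm : ∀ f ∈ M, Dm P f ∈ M) (hc : ∀ n, ∀ f ∈ M, comp P n f ∈ M) (h : ∀ f ∈ M, counit P f = 0)
    {f : OSp P} (hf : f ∈ M) : f = 0 := by
  have hphi : ∀ k, ∀ f ∈ M, phi P k f = 0 := by
    intro k
    induction k with
    | zero => exact h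
    | succ k ih => intro f hf; rw [phi_succ]; exact ih _ (hp f hf)
  -- Induction on the exponent of v₋: v₋ f lies in M and has a smaller exponent, so it is zero. Then
  -- f is a highest weight vector, and all functionals kill it because M is stable under v₊ and ε
  -- vanishes on M.
  have key : ∀ k n, ∀ f ∈ M, f ∈ wt P n → (Dm P ^ k) f = 0 → f = 0 := by
    intro k
    induction k with
    | zero => intro n f _ _ h0; simpa using h0
    | succ k ih =>
      intro n f hf hn h0
      rw [pow_succ, Module.End.mul_apply] at h0
      exact eq_zero_of_phi hn (ih _ _ (hm f hf) (Dm_mem_wt hn) h0) fun k => hphi k f hf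
  apply eq_zero_of_comp
  intro n
  obtain ⟨k, hk⟩ := Dm_nilpotent (comp P n f)
  exact key k n _ (hc n f hf) (comp_mem n f) hk

/-- Highest weight vectors of weight `n` are spanned by any family of highest weight vectors with
orders `0, …, 2n`. -/
theorem mem_span_of_highest {n : ℕ} {f : OSp P} (hf : f ∈ wt P n) (h : Dm P f = 0)
    (v : Fin (2 * n + 1) → OSp P) (hv : ∀ k, v k ∈ wt P n) (hv' : ∀ k, Dm P (v k) = 0)
    (ho : ∀ k, HasOrder (v k) k) : f ∈ Submodule.span ℂ (Set.range v) := by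
  rw [Submodule.mem_span_range_iff_exists_fun]
  -- The k-th functional sees only the k-th vector of the family, so these are the only possible
  -- coefficients. The difference of the two sides is a highest weight vector, to which
  -- `eq_zero_of_phi` applies.
  refine ⟨fun k => phi P k f / phi P k (v k), ?_⟩
  rw [eq_comm, ← sub_eq_zero]
  refine eq_zero_of_phi (n := n) (sub_mem hf (Submodule.sum_mem _ fun k _ =>
    Submodule.smul_mem _ _ (hv k))) (by simp [h, hv']) fun k => ?_
  rw [map_sub, map_sum, sub_eq_zero]
  by_cases hk : k < 2 * n + 1
  · rw [Finset.sum_eq_single ⟨k, hk⟩]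
    · rw [map_smul, smul_eq_mul, div_mul_cancel₀ _ (((ho ⟨k, hk⟩).2 k).2 rfl)]
    · intro j _ hj
      rw [map_smul, not_not.1 (mt ((ho j).2 k).1 fun e => hj (Fin.ext e.symm)), smul_zero]
    · intro h; exact absurd (Finset.mem_univ _) h
  -- For k > 2n both sides vanish: the value on f by `highest_weight`, the values on the family
  -- because its orders are at most 2n.
  · rw [Finset.sum_eq_zero]
    · by_cases hf0 : f = 0
      · rw [hf0, map_zero]
      · change counit P ((Dp P ^ k) f) = 0
        rw [(highest_weight hf h hf0).2 k (by omega), map_zero]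
    · intro j _
      rw [map_smul, not_not.1 (mt ((ho j).2 k).1 (by omega)), smul_zero]

end Localization
end QSphere

namespace QSphere
open SuperAlg

/-! ### The adjoint corepresentation -/

section Adjoint

namespace Param
variable (P : Param)

lemma k1_ne : P.k1 ≠ 0 := by
  intro h
  have := P.k1_sq'
  rw [h] at this
  exact P.t4_add (by linear_combination -this)

lemma k2_ne : P.k2 ≠ 0 := by
  intro h
  have h1 := P.k2_sq'
  rw [h] at h1
  -- If κ₂ = 0 then t⁴ - t² + 1 = 0, and this polynomial divides t¹² - 1.
  exact P.t_pow_ne 12 (by norm_num) (by linear_combination -(P.t ^ 2 + 1) * (P.t ^ 6 - 1) * h1)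

lemma k3_ne : P.k3 ≠ 0 := mul_ne_zero P.k1_ne P.k2_ne

lemma qnum_two : qnum P.t 2 = P.t⁻¹ - P.t := by
  rw [qnum, div_eq_iff P.t_inv_add]; ring

end Param

variable (P : Param)

/-- Clebsch-Gordan coefficients `V¹ ⊗ V¹ → V²`. -/
def cg2 (M : Fin 5) (i j : Fin 3) : ℂ :=
  (![!![1, 0, 0; 0, 0, 0; 0, 0, 0],
    !![0, P.k1⁻¹, 0; P.k1⁻¹ * P.t⁻¹ ^ 2, 0, 0; 0, 0, 0],
    !![0, 0, P.k3⁻¹; 0, P.k3⁻¹ * (P.t⁻¹ ^ 3 - P.t⁻¹), 0; P.k3⁻¹ * P.t⁻¹ ^ 4, 0, 0],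
    !![0, 0, 0; 0, 0, P.k1⁻¹; 0, P.k1⁻¹ * P.t⁻¹ ^ 2, 0],
    !![0, 0, 0; 0, 0, 0; 0, 0, 1]] M) i j

/-- The normalisation of the components of `V²`. -/
def cgw (M : Fin 5) : ℂ := ![1, P.k1, P.k3, P.k1, 1] M

/-- The leading indices of the components of `V²`. -/
def lead (M : Fin 5) : Fin 3 × Fin 3 := ![(0, 0), (0, 1), (0, 2), (1, 2), (2, 2)] M

/-- A 3×3 array killed by the inverse couplings to ℓ = 0 and ℓ = 1 satisfies 1 + 3 of the 9 possible
conditions. It therefore lies in the five-dimensional ℓ = 2 component and is determined by its five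
leading entries. -/
lemma cg2_expand {A : Type} [Ring A] [Algebra ℂ A] {X : Fin 3 → Fin 3 → A}
    (h0 : ∑ k, ∑ l, cg0' P k l • X k l = 0) (h1 : ∀ M, ∑ k, ∑ l, cg1' P M k l • X k l = 0)
    (k l : Fin 3) : X k l = ∑ N, cg2 P N k l • (cgw P N • X (lead N).1 (lead N).2) := by
  have ht := P.t_ne
  have hk1 := P.k1_ne
  have hk3 := P.k3_ne
  have h10 := h1 0
  have h11 := h1 1
  have h12 := h1 2
  simp [Fin.sum_univ_three, cg0', cg0, cg1', cg1, sg] at h0 h10 h11 h12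
  fin_cases k <;> fin_cases l <;> simp [Fin.sum_univ_five, cg2, cgw, lead, smul_smul, hk1, hk3]
  · linear_combination (norm := (match_scalars <;> field_simp <;> ring)) (-P.t⁻¹) • h10
  · linear_combination (norm := (match_scalars <;> field_simp <;> ring)) (P.t⁻¹ ^ 2) • h0 + P.t⁻¹ • h11
  · linear_combination (norm := (match_scalars <;> field_simp <;> ring)) (P.t⁻¹ ^ 3 + P.t⁻¹) • h0 + P.t⁻¹ ^ 2 • h11
  · linear_combination (norm := (match_scalars <;> field_simp <;> ring)) (P.t⁻¹) • h12

lemma Param.k1_eq : P.k1 = P.k1⁻¹ * (1 + P.t⁻¹ ^ 4) := by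
  have ht := P.t_ne
  have hk1 := P.k1_ne
  have h1 := P.k1_sq'
  field_simp
  linear_combination h1

lemma Param.k2_eq : P.k2 = P.k2⁻¹ * (1 - P.t⁻¹ ^ 2 + P.t⁻¹ ^ 4) := by
  have ht := P.t_ne
  have hk2 := P.k2_ne
  have h2 := P.k2_sq'
  field_simp
  linear_combination h2

set_option maxHeartbeats 1000000 in
-- This identifies the explicit matrix with the ℓ = 2 block of the tensor square of `T1`: the
-- columns are coupled by `cg2`, and of the rows only the leading pair of indices is needed. Where
-- the displayed entries are written differently, the product law converts one form into the other.
lemma T2_eq (N M : Fin 5) : T2 P N M =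
    cgw P N • ∑ i, ∑ j, cg2 P M i j • TT (T1 P) (lead N).1 (lead N).2 i j := by
  have ht := P.t_ne
  have hk1 := P.k1_ne
  have hk2 := P.k2_ne
  have hk3 := P.k3_ne
  have h := T1_law P
  have f1 : P.k1 * P.k1⁻¹ = 1 := mul_inv_cancel₀ hk1
  have f2 : P.k1 * P.k3⁻¹ = P.k2⁻¹ := by rw [Param.k3]; field_simp
  have f3 : P.k3 * P.k1⁻¹ = P.k2 := by rw [Param.k3]; field_simp
  have f4 : P.k3 * P.k3⁻¹ = 1 := mul_inv_cancel₀ hk3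
  have g1 : ∀ x, P.k1 * (P.k1⁻¹ * x) = x := fun x => by rw [← mul_assoc, f1, one_mul]
  have g2 : ∀ x, P.k1 * (P.k3⁻¹ * x) = P.k2⁻¹ * x := fun x => by rw [← mul_assoc, f2]
  have g3 : ∀ x, P.k3 * (P.k1⁻¹ * x) = P.k2 * x := fun x => by rw [← mul_assoc, f3]
  have g4 : ∀ x, P.k3 * (P.k3⁻¹ * x) = x := fun x => by rw [← mul_assoc, f4, one_mul]
  -- The squares of the κ's are polynomials in t⁻¹. Writing κ as κ⁻¹ κ² gives both sides the same
  -- irrational factor, so that only powers of t remain to be compared.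
  have e1 : ∀ x : OSp P, P.k1 • x = P.k1⁻¹ • (1 + P.t⁻¹ ^ 4) • x := fun x => by
    rw [smul_smul, ← P.k1_eq]
  have e2 : ∀ x : OSp P, P.k2 • x = P.k2⁻¹ • (1 - P.t⁻¹ ^ 2 + P.t⁻¹ ^ 4) • x := fun x => by
    rw [smul_smul, ← P.k2_eq]
  have e3 : ∀ x : OSp P, P.k3 • x =
      P.k3⁻¹ • ((1 + P.t⁻¹ ^ 4) * (1 - P.t⁻¹ ^ 2 + P.t⁻¹ ^ 4)) • x := fun x => by
    rw [smul_smul]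
    congr 1
    rw [Param.k3, mul_inv]
    linear_combination P.k2 * P.k1_eq + (P.k1⁻¹ * (1 + P.t⁻¹ ^ 4)) * P.k2_eq
  fin_cases N <;> fin_cases M <;>
    simp [T2, Fin.sum_univ_three, cg2, cgw, lead, TT, sg, smul_smul, f1, f2, f3, f4, g1, g2, g3, g4,
      Param.qnum_two, Param.q, mul_neg]
  · have h0 := h.col1 0 0 0
    simp [Fin.sum_univ_three, cg0, cg1, cg0', cg1', TT, sg] at h0
    rw [e1]
    linear_combination (norm := (match_scalars <;> field_simp <;> ring)) (P.k1⁻¹ * P.t⁻¹ ^ 3) • h0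
  · have h0 := h.col0 0 0
    have h1 := h.col1 0 0 1
    simp [Fin.sum_univ_three, cg0, cg1, cg0', cg1', TT, sg] at h0 h1
    rw [e3]
    linear_combination (norm := (match_scalars <;> field_simp <;> ring)) (P.k3⁻¹ * (-P.t⁻¹ ^ 7 - P.t⁻¹ ^ 3)) • h0 + (P.k3⁻¹ * (P.t⁻¹ ^ 6 - P.t⁻¹ ^ 4 + P.t⁻¹ ^ 2)) • h1
  · have h0 := h.col1 0 0 2
    simp [Fin.sum_univ_three, cg0, cg1, cg0', cg1', TT, sg] at h0
    rw [e1]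
    linear_combination (norm := (match_scalars <;> field_simp <;> ring)) (P.k1⁻¹ * (-P.t⁻¹ ^ 3)) • h0
  · have h0 := h.col1 0 1 0
    have h1 := h.row1 0 1 0
    simp [Fin.sum_univ_three, cg0, cg1, cg0', cg1', TT, sg] at h0 h1
    linear_combination (norm := (match_scalars <;> field_simp <;> ring)) (1 * P.t⁻¹ ^ 3) • h0 + (1 * (-P.t⁻¹ ^ 3)) • h1
  · have h0 := h.col0 0 1
    have h1 := h.col1 0 1 1
    have h2 := h.row1 0 2 0
    simp [Fin.sum_univ_three, cg0, cg1, cg0', cg1', TT, sg] at h0 h1 h2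
    rw [mul_smul P.k2, e2 (T1 P 0 0 * T1 P 1 2), e2 (_ • (T1 P 1 0 * T1 P 0 2))]
    linear_combination (norm := (match_scalars <;> field_simp <;> ring)) (P.k2⁻¹ * (-P.t⁻¹ ^ 7 - P.t⁻¹ ^ 3)) • h0 + (P.k2⁻¹ * (P.t⁻¹ ^ 6 - P.t⁻¹ ^ 4 + P.t⁻¹ ^ 2)) • h1 + (P.k2⁻¹ * (-(P.t⁻¹ ^ 7 - P.t⁻¹ ^ 5 + P.t⁻¹ ^ 3))) • h2
  · have h0 := h.col1 0 1 2
    have h1 := h.row1 1 2 0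
    simp [Fin.sum_univ_three, cg0, cg1, cg0', cg1', TT, sg] at h0 h1
    linear_combination (norm := (match_scalars <;> field_simp <;> ring)) (1 * (-P.t⁻¹ ^ 3)) • h0 + (1 * (-P.t⁻¹ ^ 3)) • h1
  · have h0 := h.row0 0 1
    have h1 := h.row1 0 1 1
    have h2 := h.col1 0 2 0
    simp [Fin.sum_univ_three, cg0, cg1, cg0', cg1', TT, sg] at h0 h1 h2
    linear_combination (norm := (match_scalars <;> field_simp <;> ring)) (P.k2 * (P.t⁻¹ ^ 3 + P.t⁻¹)) • h0 + (P.k2 * P.t⁻¹ ^ 2) • h1 + (P.k2 * P.t⁻¹ ^ 3) • h2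
  · linear_combination (norm := (match_scalars <;> field_simp <;> ring)) (0 : ℂ) • h.rel_01_10
  · have h0 := h.col1 0 2 2
    have h1 := h.row0 1 2
    have h2 := h.row1 1 2 1
    simp [Fin.sum_univ_three, cg0, cg1, cg0', cg1', TT, sg] at h0 h1 h2
    linear_combination (norm := (match_scalars <;> field_simp <;> ring)) (P.k2 * (-P.t⁻¹ ^ 3)) • h0 + (P.k2 * (P.t⁻¹ ^ 3 + P.t⁻¹)) • h1 + (P.k2 * P.t⁻¹ ^ 2) • h2
  · have h0 := h.row1 0 1 2
    have h1 := h.col1 1 2 0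
    simp [Fin.sum_univ_three, cg0, cg1, cg0', cg1', TT, sg] at h0 h1
    linear_combination (norm := (match_scalars <;> field_simp <;> ring)) (1 * P.t⁻¹ ^ 3) • h0 + (1 * P.t⁻¹ ^ 3) • h1
  · have h0 := h.row1 0 2 2
    have h1 := h.col0 1 2
    have h2 := h.col1 1 2 1
    simp [Fin.sum_univ_three, cg0, cg1, cg0', cg1', TT, sg] at h0 h1 h2
    rw [mul_smul P.k2, e2 (T1 P 1 0 * T1 P 2 2), e2 (_ • (T1 P 2 0 * T1 P 1 2))]
    linear_combination (norm := (match_scalars <;> field_simp <;> ring)) (P.k2⁻¹ * (P.t⁻¹ ^ 7 - P.t⁻¹ ^ 5 + P.t⁻¹ ^ 3)) • h0 + (P.k2⁻¹ * (-P.t⁻¹ ^ 7 - P.t⁻¹ ^ 3)) • h1 + (P.k2⁻¹ * (P.t⁻¹ ^ 6 - P.t⁻¹ ^ 4 + P.t⁻¹ ^ 2)) • h2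
  · have h0 := h.col1 2 2 0
    simp [Fin.sum_univ_three, cg0, cg1, cg0', cg1', TT, sg] at h0
    rw [e1]
    linear_combination (norm := (match_scalars <;> field_simp <;> ring)) (P.k1⁻¹ * P.t⁻¹ ^ 3) • h0
  · have h0 := h.col0 2 2
    have h1 := h.col1 2 2 1
    simp [Fin.sum_univ_three, cg0, cg1, cg0', cg1', TT, sg] at h0 h1
    rw [e3]
    linear_combination (norm := (match_scalars <;> field_simp <;> ring)) (P.k3⁻¹ * (-P.t⁻¹ ^ 7 - P.t⁻¹ ^ 3)) • h0 + (P.k3⁻¹ * (P.t⁻¹ ^ 6 - P.t⁻¹ ^ 4 + P.t⁻¹ ^ 2)) • h1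
  · have h0 := h.col1 2 2 2
    simp [Fin.sum_univ_three, cg0, cg1, cg0', cg1', TT, sg] at h0
    rw [e1]
    linear_combination (norm := (match_scalars <;> field_simp <;> ring)) (P.k1⁻¹ * (-P.t⁻¹ ^ 3)) • h0

end Adjoint
end QSphere

namespace QSphere
open SuperAlg

/-! ### Coproduct, counit, pairing and row action of the adjoint matrix -/

section AdjointCorep
variable (P : Param)

/-- The inverse couplings pass through the tensor square of `T1` by the row equations of the product
law and then meet `cg2`, to which they are orthogonal. So `cg2_expand` applies, and `T2_eq` names
its leading entries. -/
lemma T2_col (k l : Fin 3) (M : Fin 5) : ∑ i, ∑ j, cg2 P M i j • TT (T1 P) k l i j =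
    ∑ N, cg2 P N k l • T2 P N M := by
  simp only [T2_eq]
  refine cg2_expand P (X := fun k l => ∑ i, ∑ j, cg2 P M i j • TT (T1 P) k l i j) ?_ ?_ k l
  · simp only [Finset.smul_sum]
    rw [sum_swap4]
    simp only [smul_comm (cg0' P _ _) (cg2 P _ _ _), ← Finset.smul_sum, (T1_law P).row0]
    simp only [smul_smul, ← Finset.sum_smul]
    convert zero_smul ℂ (1 : OSp P)
    have ht := P.t_ne
    fin_cases M <;> simp [Fin.sum_univ_three, cg0', cg0, cg2, sg] <;> field_simp <;> ring
  · intro R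
    simp only [Finset.smul_sum (r := cg1' P _ _ _)]
    rw [sum_swap4]
    simp only [smul_comm (cg1' P _ _ _) (cg2 P _ _ _), ← Finset.smul_sum, (T1_law P).row1]
    simp only [Finset.smul_sum]
    rw [sum_rot]
    simp only [smul_smul, ← Finset.sum_smul]
    refine Finset.sum_eq_zero fun N _ => ?_
    convert zero_smul ℂ (T1 P R N)
    have ht := P.t_ne
    simp only [← mul_assoc, ← Finset.sum_mul]
    convert zero_mul (sg (R + N))
    fin_cases M <;> fin_cases N <;> simp [Fin.sum_univ_three, cg1', cg1, cg2, sg] <;> field_simp <;>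
      ring

lemma coprod_T1 (i j : Fin 3) : coprod P (T1 P i j) = coT P i j := OSp.lift_T1 _ _ _ _

lemma coprod_T2 (N M : Fin 5) : coprod P (T2 P N M) = ∑ R, T2 P N R ᵍ⊗ₜ[ℂ] T2 P R M := by
  rw [T2_eq]
  simp only [map_smul, map_sum, map_TT, coprod_T1]
  rw [coT_col]
  simp only [T2_col, map_sum, map_smul, Finset.smul_sum]
  have h : ∀ F : Fin 3 → Fin 3 → Fin 5 → gr (OSp P) ᵍ⊗[ℂ] gr (OSp P),
      ∑ m, ∑ n, ∑ R, F m n R = ∑ R, ∑ m, ∑ n, F m n R := by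
    intro F
    exact (Finset.sum_congr rfl fun m _ => Finset.sum_comm).trans Finset.sum_comm
  rw [h]
  refine Finset.sum_congr rfl fun R _ => ?_
  rw [← tm_apply, T2_eq P N R]
  simp only [map_sum, map_smul, LinearMap.sum_apply, LinearMap.smul_apply, Finset.smul_sum]

lemma counit_T2 (N M : Fin 5) : counit P (T2 P N M) = if N = M then 1 else 0 := by
  fin_cases N <;> fin_cases M <;> simp [T2, counit_T1]

lemma rep2_oddPrim (x y : ℂ) : rep2 P (oddPrim P x y) = (P.nu * P.t) •
    !![0, x * P.k1, 0, 0, 0; y * P.k1, 0, x * P.k2, 0, 0; 0, -(y * P.k2), 0, x * P.k2, 0;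
      0, 0, y * P.k2, 0, x * P.k1; 0, 0, 0, -(y * P.k1), 0] := by
  rw [oddPrim, map_add, map_smul, map_smul, rep2_vp, rep2_vm]
  ext i j
  fin_cases i <;> fin_cases j <;> simp <;> ring

set_option maxHeartbeats 2000000 in
lemma pairHom_T2 (x y : ℂ) (i j : Fin 5) : pairHom P x y (T2 P i j) =
    !![rep2 P (ugen P .K) i j, sg i * rep2 P (oddPrim P x y) i j;
      0, rep2 P (ugen P .Kinv) i j] := by
  have ht := P.t_ne
  rw [rep2_oddPrim, rep2_K, rep2_Kinv]
  fin_cases i <;> fin_cases j <;>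
    simp [T2, pairHom_T1, pairGen_eq, pairOdd, Param.q, Param.qnum_two, sg]
  all_goals try refine ⟨?_, ?_⟩
  all_goals first
    | (funext r; fin_cases r <;> rfl)
    | ring1
    | (field_simp; done)

lemma cg2_hom (M : Fin 5) (i j : Fin 3) : sg (i + j) * cg2 P M i j = sg M * cg2 P M i j := by
  fin_cases M <;> fin_cases i <;> fin_cases j <;> simp [cg2, sg]

lemma par_TT (k l i j : Fin 3) :
    par (TT (T1 P) k l i j) = (sg (k + l) * sg (i + j)) • TT (T1 P) k l i j := by
  simp only [TT, map_smul, map_mul, par_T1, smul_mul_smul_comm, smul_smul, sg_add]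
  congr 1
  ring

lemma par_T2 (i j : Fin 5) : par (T2 P i j) = sg (i + j) • T2 P i j := by
  have h : ∀ N : Fin 5, sg ((lead N).1 + (lead N).2) = sg N := by
    intro N; fin_cases N <;> simp [lead, sg]
  simp only [T2_eq, map_smul, map_sum, par_TT, h, Finset.smul_sum, smul_smul]
  refine Finset.sum_congr rfl fun k _ => Finset.sum_congr rfl fun l _ => ?_
  congr 1
  have h2 := cg2_hom P j k l
  rw [sg_add] at h2
  rw [sg_add, sg_add i]
  linear_combination (cgw P i * sg i) * h2

/-- The weights of `K` on `V²`. -/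
def kap (i : Fin 5) : ℂ := ![P.t ^ 2, P.t, 1, P.t⁻¹, (P.t ^ 2)⁻¹] i

/-- The weights of `K⁻¹` on `V²`. -/
def kapi (i : Fin 5) : ℂ := ![(P.t ^ 2)⁻¹, P.t⁻¹, 1, P.t, P.t ^ 2] i

/-- A formal consequence of the coproduct, the pairing and the parity of the adjoint matrix:
U_q[osp(1|2)] acts on its row index through the adjoint representation, up to a sign depending on
the column. -/
lemma rowHom_T2 (x y : ℂ) (m i : Fin 5) : rowHom P x y (T2 P m i) =
    !![kap P m • T2 P m i, sg i • ∑ k, rep2 P (oddPrim P x y) m k • T2 P k i;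
      0, (sg (m + i) * kapi P m) • T2 P m i] := by
  rw [rowHom, AlgHom.comp_apply, AlgHom.comp_apply, par_T2, map_smul, map_smul, coprod_T2, map_sum]
  simp only [rowTensor_tmul]
  have : ∀ k, pairScalar P x y (T2 P m k) * diagPar P (T2 P k i) =
      !![(if m = k then kap P m * sg (k + i) else 0) • T2 P k i,
        (sg m * rep2 P (oddPrim P x y) m k) • T2 P k i;
        0, (if m = k then kapi P m else 0) • T2 P k i] := by
    intro k
    change pairScalar P x y (T2 P m k) * Matrix.diagonal ![par (T2 P k i), T2 P k i] = _
    ext r s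
    rw [Matrix.mul_diagonal, pairScalar_apply, pairHom_T2, ← Algebra.smul_def, par_T2, rep2_K,
      rep2_Kinv]
    fin_cases r <;> fin_cases s <;> simp [smul_smul, Matrix.diagonal_apply, kap, kapi]
  simp only [this]
  ext r s
  rw [Matrix.smul_apply, Matrix.sum_apply]
  have h2 := sg_mul_self (m + i)
  fin_cases r <;> fin_cases s <;> simp [smul_smul, ite_smul]
  · rw [mul_left_comm, h2, mul_one]
  · simp only [Finset.smul_sum, smul_smul]
    refine Finset.sum_congr rfl fun k _ => ?_
    congr 1
    rw [sg_add]
    linear_combination (sg i * rep2 P (oddPrim P x y) m k) * sg_mul_self m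

lemma sig_T2 (m i : Fin 5) : sig P (T2 P m i) = kap P m • T2 P m i := by
  rw [← (rowHom_diag P 0 0 _).1, rowHom_T2]; rfl

lemma tau_T2 (m i : Fin 5) : tau P (T2 P m i) = (sg (m + i) * kapi P m) • T2 P m i := by
  rw [← (rowHom_diag P 0 0 _).2, rowHom_T2]; rfl

lemma odot_T2 (x y : ℂ) (m i : Fin 5) : odot P x y (T2 P m i) =
    sg i • ∑ k, rep2 P (oddPrim P x y) m k • T2 P k i := by
  rw [odot_eq_rowHom, rowHom_T2]; rfl

lemma Dp_T2 (m i : Fin 5) : Dp P (T2 P m i) =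
    sg i • ∑ k, rep2 P (ugen P .vp) m k • T2 P k i := by
  rw [Dp, odot_T2, oddPrim, one_smul, zero_smul, add_zero]

lemma Dm_T2 (m i : Fin 5) : Dm P (T2 P m i) =
    sg i • ∑ k, rep2 P (ugen P .vm) m k • T2 P k i := by
  rw [Dm, odot_T2, oddPrim, one_smul, zero_smul, zero_add]

end AdjointCorep
end QSphere

namespace QSphere
open SuperAlg

/-! ### Slice maps on tensor products -/

section Slice
variable {X S R : Type} [AddCommGroup X] [Module ℂ X] [AddCommGroup S] [Module ℂ S]
  [AddCommGroup R] [Module ℂ R]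

/-- The slice map `f ⊗ id`. -/
def slice (f : X →ₗ[ℂ] ℂ) : X ⊗[ℂ] R →ₗ[ℂ] R :=
  (TensorProduct.lid ℂ R).toLinearMap ∘ₗ LinearMap.rTensor R f

lemma slice_tmul (f : X →ₗ[ℂ] ℂ) (x : X) (a : R) : slice f (x ⊗ₜ[ℂ] a) = f x • a := rfl

lemma slice_lTensor (f : X →ₗ[ℂ] ℂ) (D : R →ₗ[ℂ] R) (z : X ⊗[ℂ] R) :
    slice f (LinearMap.lTensor X D z) = D (slice f z) := by
  have : slice f ∘ₗ LinearMap.lTensor X D = D ∘ₗ slice f :=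
    TensorProduct.ext' fun x a => by simp [slice_tmul]
  exact LinearMap.congr_fun this z

lemma slice_rTensor (f : S →ₗ[ℂ] ℂ) (A : X →ₗ[ℂ] S) (z : X ⊗[ℂ] R) :
    slice f (LinearMap.rTensor R A z) = slice (f ∘ₗ A) z := by
  have : slice (R := R) f ∘ₗ LinearMap.rTensor R A = slice (f ∘ₗ A) :=
    TensorProduct.ext' fun x a => by simp [slice_tmul]
  exact LinearMap.congr_fun this z

lemma map_slice (f : X →ₗ[ℂ] ℂ) (g : R →ₗ[ℂ] ℂ) (z : X ⊗[ℂ] R) :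
    g (slice f z) = f (TensorProduct.rid ℂ X (LinearMap.lTensor X g z)) := by
  have : g ∘ₗ slice f = f ∘ₗ (TensorProduct.rid ℂ X).toLinearMap ∘ₗ LinearMap.lTensor X g :=
    TensorProduct.ext' fun x a => by simp [slice_tmul, mul_comm]
  exact LinearMap.congr_fun this z

open scoped Classical in
lemma eq_zero_of_slice {z : S ⊗[ℂ] R} (h : ∀ f : S →ₗ[ℂ] ℂ, slice f z = 0) : z = 0 := by
  let b := Module.Basis.ofVectorSpace ℂ S
  apply (TensorProduct.equivFinsuppOfBasisLeft (N := R) b).injective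
  rw [map_zero]
  ext i
  rw [TensorProduct.equivFinsuppOfBasisLeft_apply]
  exact h _

end Slice

/-! ### Equivariant coactions descend to quotients by stable subspaces -/

section Descent
variable (P : Param) {X S : Type} [AddCommGroup X] [Module ℂ X] [AddCommGroup S] [Module ℂ S]

/-- A map into `X ⊗ OSp_q(1|2)` that is equivariant for the action of `v_±`, compatible with the
weights and with the counit descends to every quotient by a stable subspace. -/
theorem rTensor_coaction_eq_zero (co : X →ₗ[ℂ] X ⊗[ℂ] OSp P) (g Ap Am : X →ₗ[ℂ] X)
    (p : ℤ → X →ₗ[ℂ] X)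
    (hp : ∀ x, LinearMap.lTensor X (Dp P) (co x) = LinearMap.rTensor (OSp P) Ap (co (g x)))
    (hm : ∀ x, LinearMap.lTensor X (Dm P) (co x) = LinearMap.rTensor (OSp P) Am (co (g x)))
    (hc : ∀ n x, LinearMap.lTensor X (comp P n) (co x) = LinearMap.rTensor (OSp P) (p n) (co x))
    (hε : ∀ x, TensorProduct.rid ℂ X (LinearMap.lTensor X (counit P).toLinearMap (co x)) = x)
    {G : Submodule ℂ X} (hg : ∀ x ∈ G, g x ∈ G) (hAp : ∀ x ∈ G, Ap x ∈ G)
    (hAm : ∀ x ∈ G, Am x ∈ G) (hpn : ∀ n, ∀ x ∈ G, p n x ∈ G)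
    (μ : X →ₗ[ℂ] S) (hμ : ∀ x ∈ G, μ x = 0) {x : X} (hx : x ∈ G) :
    LinearMap.rTensor (OSp P) μ (co x) = 0 := by
  -- T consists of the matrix coefficients of the coaction between elements of G and functionals
  -- vanishing on G. Equivariance makes its span stable under v± and under the weight projections,
  -- and ε sends the coefficient of f and x to f(x) = 0. So `eq_zero_of_stable` annihilates it.
  let T : Set (OSp P) := {a | ∃ f : X →ₗ[ℂ] ℂ, (∀ x ∈ G, f x = 0) ∧ ∃ x ∈ G, a = slice f (co x)}
  have stable : ∀ L : OSp P →ₗ[ℂ] OSp P, (∀ a ∈ T, L a ∈ T) →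
      ∀ a ∈ Submodule.span ℂ T, L a ∈ Submodule.span ℂ T := by
    intro L hL a ha
    have : Submodule.span ℂ T ≤ (Submodule.span ℂ T).comap L :=
      Submodule.span_le.2 fun a ha => Submodule.subset_span (hL a ha)
    exact this ha
  have hT : ∀ f : X →ₗ[ℂ] ℂ, (∀ x ∈ G, f x = 0) → ∀ x ∈ G, slice f (co x) = 0 := by
    intro f hf x hx
    refine eq_zero_of_stable (P := P) (M := Submodule.span ℂ T) (stable _ ?_) (stable _ ?_)
      (fun n => stable _ ?_) ?_ (Submodule.subset_span ⟨f, hf, x, hx, rfl⟩)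
    · rintro _ ⟨f, hf, x, hx, rfl⟩
      refine ⟨f ∘ₗ Ap, fun y hy => hf _ (hAp y hy), g x, hg x hx, ?_⟩
      rw [← slice_lTensor, hp, slice_rTensor]
    · rintro _ ⟨f, hf, x, hx, rfl⟩
      refine ⟨f ∘ₗ Am, fun y hy => hf _ (hAm y hy), g x, hg x hx, ?_⟩
      rw [← slice_lTensor, hm, slice_rTensor]
    · rintro _ ⟨f, hf, x, hx, rfl⟩
      refine ⟨f ∘ₗ p n, fun y hy => hf _ (hpn n y hy), x, hx, ?_⟩
      rw [← slice_lTensor, hc, slice_rTensor]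
    · intro a ha
      have : Submodule.span ℂ T ≤ LinearMap.ker (counit P).toLinearMap := by
        refine Submodule.span_le.2 ?_
        rintro _ ⟨f, hf, x, hx, rfl⟩
        change (counit P).toLinearMap _ = 0
        rw [map_slice, hε, hf x hx]
      exact this ha
  refine eq_zero_of_slice fun f => ?_
  rw [slice_rTensor]
  exact hT _ (fun y hy => by rw [LinearMap.comp_apply, hμ y hy, map_zero]) x hx

end Descent

/-! ### Polynomials of degree at most two in the coordinates -/

/-- Coefficients of noncommutative polynomials of degree at most two in the coordinates. -/
abbrev Deg2 : Type := Matrix (Fin 5) (Fin 5) ℂ × (Fin 5 → ℂ) × ℂ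

namespace Deg2

/-- The noncommutative polynomial with given coefficients. -/
def toFree : Deg2 →ₗ[ℂ] FreeY where
  toFun x := quad x.1 + lin x.2.1 + x.2.2 • 1
  map_add' x y := by
    simp only [quad, lin, Prod.fst_add, Prod.snd_add, Matrix.add_apply, Pi.add_apply, add_smul,
      Finset.sum_add_distrib]
    abel
  map_smul' c x := by
    simp only [quad, lin, Prod.smul_fst, Prod.smul_snd, Matrix.smul_apply, Pi.smul_apply,
      smul_eq_mul, mul_smul, Finset.smul_sum, smul_add, RingHom.id_apply]

lemma toFree_apply (x : Deg2) : toFree x = quad x.1 + lin x.2.1 + x.2.2 • 1 := rfl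

variable (P : Param)

/-- The monomial `Y_i Y_j`. -/
def e2 (i j : Fin 5) : Deg2 := (Matrix.single i j 1, 0, 0)

/-- The coordinate `Y_i`. -/
def e1 (i : Fin 5) : Deg2 := (0, Pi.single i 1, 0)

/-- The constant `1`. -/
def e0 : Deg2 := (0, 0, 1)

lemma eq_sum (x : Deg2) : x = ∑ i, ∑ j, x.1 i j • e2 i j + ∑ i, x.2.1 i • e1 i + x.2.2 • e0 := by
  refine Prod.ext ?_ (Prod.ext ?_ ?_)
  · simp only [e2, e1, e0, Prod.fst_add, Prod.fst_sum, Prod.smul_fst, smul_zero,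
      Finset.sum_const_zero, add_zero, Matrix.smul_single, smul_eq_mul, mul_one]
    exact Matrix.matrix_eq_sum_single x.1
  · simp only [e2, e1, e0, Prod.fst_add, Prod.fst_sum, Prod.smul_fst, smul_zero, Prod.snd_add,
      Prod.snd_sum, Prod.smul_snd, Finset.sum_const_zero, add_zero, zero_add]
    exact (pi_eq_sum_univ' x.2.1)
  · simp only [e2, e1, e0, Prod.snd_add, Prod.snd_sum, Prod.smul_snd, smul_eq_mul, mul_zero,
      Finset.sum_const_zero, add_zero, zero_add, mul_one]

lemma toFree_e2 (i j : Fin 5) : toFree (e2 i j) = fy i * fy j := by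
  rw [toFree_apply, e2, quad, lin]
  simp [Matrix.single_apply, ite_and, ite_smul, Finset.sum_ite_eq]

lemma toFree_e1 (i : Fin 5) : toFree (e1 i) = fy i := by
  rw [toFree_apply, e1, quad, lin]
  simp [Pi.single_apply, ite_smul]

lemma toFree_e0 : toFree e0 = 1 := by
  rw [toFree_apply, e0, quad, lin]
  simp

/-- The linear map with given values on the monomials. -/
def extend {Z : Type} [AddCommGroup Z] [Module ℂ Z] (z2 : Fin 5 → Fin 5 → Z) (z1 : Fin 5 → Z)
    (z0 : Z) : Deg2 →ₗ[ℂ] Z where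
  toFun x := ∑ i, ∑ j, x.1 i j • z2 i j + ∑ i, x.2.1 i • z1 i + x.2.2 • z0
  map_add' x y := by
    simp only [Prod.fst_add, Prod.snd_add, Matrix.add_apply, Pi.add_apply, add_smul,
      Finset.sum_add_distrib]
    abel
  map_smul' c x := by
    simp only [Prod.smul_fst, Prod.smul_snd, Matrix.smul_apply, Pi.smul_apply,
      smul_eq_mul, mul_smul, Finset.smul_sum, smul_add, RingHom.id_apply]

section
variable {Z : Type} [AddCommGroup Z] [Module ℂ Z] (z2 : Fin 5 → Fin 5 → Z) (z1 : Fin 5 → Z) (z0 : Z)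

lemma extend_apply (x : Deg2) : extend z2 z1 z0 x =
    ∑ i, ∑ j, x.1 i j • z2 i j + ∑ i, x.2.1 i • z1 i + x.2.2 • z0 := rfl

lemma extend_e2 (i j : Fin 5) : extend z2 z1 z0 (e2 i j) = z2 i j := by
  rw [extend_apply]
  simp [e2, Matrix.single_apply, ite_and, ite_smul, Finset.sum_ite_eq]

lemma extend_e1 (i : Fin 5) : extend z2 z1 z0 (e1 i) = z1 i := by
  rw [extend_apply]
  simp [e1, Pi.single_apply, ite_smul]

lemma extend_e0 : extend z2 z1 z0 e0 = z0 := by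
  rw [extend_apply]
  simp [e0]

end

lemma ext_hom {Z : Type} [AddCommGroup Z] [Module ℂ Z] {f g : Deg2 →ₗ[ℂ] Z}
    (h2 : ∀ i j, f (e2 i j) = g (e2 i j)) (h1 : ∀ i, f (e1 i) = g (e1 i)) (h0 : f e0 = g e0) :
    f = g := by
  refine LinearMap.ext fun x => ?_
  rw [eq_sum x]
  simp only [map_add, map_sum, map_smul, h2, h1, h0]

/-- The action of an odd generator. -/
def act (v : UGen) : Deg2 →ₗ[ℂ] Deg2 where
  toFun x := (oddAct P v x.1, (rep2 P (ugen P v)).mulVec x.2.1, 0)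
  map_add' x y := by
    simp only [oddAct, Prod.fst_add, Prod.snd_add, mul_add, add_mul, Matrix.mulVec_add,
      Prod.mk_add_mk, add_zero]
    rw [add_add_add_comm]
  map_smul' c x := by
    simp only [oddAct, Prod.smul_fst, Prod.smul_snd, Matrix.mul_smul, Matrix.smul_mul,
      Matrix.mulVec_smul, Prod.smul_mk, smul_add, smul_zero, RingHom.id_apply]

lemma act_apply (v : UGen) (x : Deg2) :
    act P v x = (oddAct P v x.1, (rep2 P (ugen P v)).mulVec x.2.1, 0) := rfl

/-- The parity operator. -/
def grade : Deg2 →ₗ[ℂ] Deg2 :=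
  extend (fun i j => sg (i + j) • e2 i j) (fun i => sg i • e1 i) e0

/-- The projection to the vectors of weight `n`. -/
def proj (n : ℤ) : Deg2 →ₗ[ℂ] Deg2 :=
  extend (fun i j => if 4 - (i : ℕ) - (j : ℕ) = n then e2 i j else 0)
    (fun i => if 2 - (i : ℕ) = n then e1 i else 0) (if 0 = n then e0 else 0)

lemma act_e1 (v : UGen) (m : Fin 5) : act P v (e1 m) = ∑ k, rep2 P (ugen P v) k m • e1 k := by
  have : act P v (e1 m) = (0, (rep2 P (ugen P v)).mulVec (Pi.single m 1), 0) := by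
    rw [act_apply, e1]; simp [oddAct]
  rw [this, Matrix.mulVec_single_one, eq_sum (0, _, 0)]
  simp [Matrix.col_apply]

lemma act_e0 (v : UGen) : act P v e0 = 0 := by
  rw [act_apply, e0]; simp [oddAct]

lemma rep2_K_apply (i j : Fin 5) : rep2 P (ugen P .K) i j = if i = j then kap P i else 0 := by
  rw [rep2_K, Matrix.diagonal_apply]; rfl

lemma rep2_Kinv_apply (i j : Fin 5) : rep2 P (ugen P .Kinv) i j = if i = j then kapi P i else 0 := by
  rw [rep2_Kinv, Matrix.diagonal_apply]; rfl

lemma act_e2 (v : UGen) (m n : Fin 5) : act P v (e2 m n) =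
    ∑ k, (rep2 P (ugen P v) k m * kapi P n) • e2 k n +
      ∑ k, (sg m * kap P m * rep2 P (ugen P v) k n) • e2 m k := by
  have h : act P v (e2 m n) = (oddAct P v (Matrix.single m n 1), 0, 0) := by
    rw [act_apply, e2]; simp
  have e : ∀ i j, oddAct P v (Matrix.single m n 1) i j =
      (if n = j then rep2 P (ugen P v) i m * kapi P n else 0) +
        (if m = i then sg m * kap P m * rep2 P (ugen P v) j n else 0) := by
    intro i j
    rw [oddAct, Matrix.add_apply, Matrix.mul_apply, Matrix.mul_apply]
    congr 1
    · simp only [Matrix.transpose_apply, rep2_Kinv_apply, Matrix.mul_apply, Matrix.single_apply,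
        ite_and, mul_ite, mul_one, mul_zero, Finset.sum_ite_eq, Finset.mem_univ, if_true, ite_mul,
        zero_mul, Finset.sum_ite_irrel, Finset.sum_const_zero]
      by_cases hn : n = j <;> simp [hn, eq_comm]
    · simp only [gam, Matrix.transpose_apply, rep2_K_apply, Matrix.mul_apply, Matrix.single_apply,
        Matrix.diagonal_apply,
        ite_and, mul_ite, mul_one, mul_zero, Finset.sum_ite_eq, Finset.mem_univ, if_true, ite_mul,
        zero_mul, Finset.sum_ite_irrel, Finset.sum_const_zero]
      by_cases hm : m = i <;> simp [hm, eq_comm]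
  rw [h, eq_sum (oddAct P v _, 0, 0)]
  simp only [e, add_smul, ite_smul, zero_smul, Finset.sum_add_distrib, Pi.zero_apply, 
    Finset.sum_const_zero, add_zero, Finset.sum_ite_eq, Finset.mem_univ, if_true]
  congr 1
  rw [Finset.sum_comm]
  simp only [Finset.sum_ite_eq, Finset.mem_univ, if_true]

attribute [irreducible] e2 e1 e0

end Deg2
end QSphere

namespace QSphere
open SuperAlg

/-! ### The coaction on polynomials of degree at most two and its equivariance -/

section Equivariance
variable (P : Param)

/-- The coefficient of `Y_m Y_n` in the coaction on `Y_i Y_j`. -/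
def TT2 (m n i j : Fin 5) : OSp P := sg ((m + i) * n) • (T2 P m i * T2 P n j)

lemma rep2_odd {v : UGen} (hv : v = .vp ∨ v = .vm) (m k : Fin 5) :
    rep2 P (ugen P v) m k = 0 ∨ (m : ℕ) = k + 1 ∨ (k : ℕ) = m + 1 := by
  rcases hv with rfl | rfl
  · rw [rep2_vp]; fin_cases m <;> fin_cases k <;> simp
  · rw [rep2_vm]; fin_cases m <;> fin_cases k <;> simp

lemma sg_one : sg 1 = -1 := pow_one _

/-- A skew derivation that acts on the rows of `T⁽²⁾` through an odd generator acts on products of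
two entries through its coproduct. -/
lemma skew_TT2 {v : UGen} (hv : v = .vp ∨ v = .vm) {D : OSp P →ₗ[ℂ] OSp P}
    (hD : ∀ f g, D (f * g) = D f * tau P g + sig P f * D g)
    (hT : ∀ m i, D (T2 P m i) = sg i • ∑ k, rep2 P (ugen P v) m k • T2 P k i) (m n i j : Fin 5) :
    D (TT2 P m n i j) = sg (i + j) •
      (∑ k, (rep2 P (ugen P v) m k * kapi P n) • TT2 P k n i j +
        ∑ k, (sg m * kap P m * rep2 P (ugen P v) n k) • TT2 P m k i j) := by
  rw [TT2, map_smul, hD, hT, hT, sig_T2, tau_T2, smul_add, smul_add]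
  simp only [smul_mul_smul_comm, smul_mul_assoc, mul_smul_comm, Finset.sum_mul, Finset.mul_sum,
    Finset.smul_sum, smul_smul, TT2]
  congr 1
  · refine Finset.sum_congr rfl fun k _ => ?_
    congr 1
    -- A nonzero matrix entry of v± shifts the index by exactly one, so the parity of k is opposite
    -- to that of m. This is what makes the signs agree.
    rcases rep2_odd P hv m k with h | h | h
    · simp [h]
    · simp only [h, add_mul, one_mul, sg_add, sg_one]
      linear_combination (rep2 P (ugen P v) m k * kapi P n * sg (k * n) * sg (i * n) * sg i * sg j) *
        sg_mul_self n
    · simp only [h, add_mul, one_mul, sg_add, sg_one]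
      ring
  · refine Finset.sum_congr rfl fun k _ => ?_
    congr 1
    rcases rep2_odd P hv n k with h | h | h
    · simp [h]
    · simp only [h, mul_add, add_mul, mul_one, sg_add, sg_one]
      ring
    · simp only [h, mul_add, add_mul, mul_one, sg_add, sg_one]
      linear_combination (-rep2 P (ugen P v) n k * kap P m * sg (m * n) * sg (i * n) * sg j) *
        ((sg i * sg i) * sg_mul_self m + sg_mul_self i)

/-- The coaction on polynomials of degree at most two. -/
def coact : Deg2 →ₗ[ℂ] Deg2 ⊗[ℂ] OSp P :=
  Deg2.extend (fun i j => ∑ m, ∑ n, Deg2.e2 m n ⊗ₜ[ℂ] TT2 P m n i j)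
    (fun i => ∑ m, Deg2.e1 m ⊗ₜ[ℂ] T2 P m i) (Deg2.e0 ⊗ₜ[ℂ] 1)

lemma coact_e2 (i j : Fin 5) :
    coact P (Deg2.e2 i j) = ∑ m, ∑ n, Deg2.e2 m n ⊗ₜ[ℂ] TT2 P m n i j := Deg2.extend_e2 _ _ _ _ _

lemma coact_e1 (i : Fin 5) : coact P (Deg2.e1 i) = ∑ m, Deg2.e1 m ⊗ₜ[ℂ] T2 P m i :=
  Deg2.extend_e1 _ _ _ _

lemma coact_e0 : coact P Deg2.e0 = Deg2.e0 ⊗ₜ[ℂ] 1 := Deg2.extend_e0 _ _ _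

lemma sum_tensor_act {ι Z R : Type} [Fintype ι] [AddCommGroup Z] [Module ℂ Z] [AddCommGroup R]
    [Module ℂ R] (c : ι → ι → ℂ) (e : ι → Z) (f : ι → R) :
    ∑ m, e m ⊗ₜ[ℂ] (∑ k, c m k • f k) = ∑ m, (∑ k, c k m • e k) ⊗ₜ[ℂ] f m := by
  simp only [TensorProduct.tmul_sum, TensorProduct.sum_tmul, TensorProduct.tmul_smul,
    ← TensorProduct.smul_tmul']
  exact Finset.sum_comm

attribute [irreducible] coact

/-- Acting on the row index of the matrix coefficients is the same as acting on the vectors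
contracted with that index. The sign left over depends only on the column indices, that is, on the
parity of the argument; `Deg2.grade` supplies it. -/
lemma skew_coact {v : UGen} (hv : v = .vp ∨ v = .vm) {D : OSp P →ₗ[ℂ] OSp P}
    (hD : ∀ f g, D (f * g) = D f * tau P g + sig P f * D g)
    (hT : ∀ m i, D (T2 P m i) = sg i • ∑ k, rep2 P (ugen P v) m k • T2 P k i) (h1 : D 1 = 0)
    (x : Deg2) : LinearMap.lTensor Deg2 D (coact P x) =
      LinearMap.rTensor (OSp P) (Deg2.act P v) (coact P (Deg2.grade x)) := by
  have : LinearMap.lTensor Deg2 D ∘ₗ coact P =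
      LinearMap.rTensor (OSp P) (Deg2.act P v) ∘ₗ coact P ∘ₗ Deg2.grade := by
    refine Deg2.ext_hom (fun i j => ?_) (fun i => ?_) ?_
    · have h1 : ∀ n, ∑ m, Deg2.e2 m n ⊗ₜ[ℂ] (∑ k, (rep2 P (ugen P v) m k * kapi P n) •
          TT2 P k n i j) = _ := fun n => sum_tensor_act _ (fun m => Deg2.e2 m n) _
      have h2 : ∀ m, ∑ n, Deg2.e2 m n ⊗ₜ[ℂ] (∑ k, (sg m * kap P m * rep2 P (ugen P v) n k) •
          TT2 P m k i j) = _ := fun m => sum_tensor_act _ (fun n => Deg2.e2 m n) _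
      rw [LinearMap.comp_apply, LinearMap.comp_apply, LinearMap.comp_apply, Deg2.grade,
        Deg2.extend_e2, map_smul, map_smul, coact_e2]
      simp only [map_sum, LinearMap.lTensor_tmul, LinearMap.rTensor_tmul, skew_TT2 P hv hD hT,
        Deg2.act_e2, TensorProduct.add_tmul, TensorProduct.tmul_add, TensorProduct.tmul_smul,
        ← Finset.smul_sum, Finset.sum_add_distrib, h2]
      rw [Finset.sum_comm, Finset.sum_congr rfl fun n _ => h1 n, Finset.sum_comm]
    · rw [LinearMap.comp_apply, LinearMap.comp_apply, LinearMap.comp_apply, Deg2.grade,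
        Deg2.extend_e1, map_smul, map_smul, coact_e1]
      simp only [map_sum, LinearMap.lTensor_tmul, LinearMap.rTensor_tmul, hT, Deg2.act_e1,
        TensorProduct.tmul_smul, ← Finset.smul_sum]
      exact congrArg _ (sum_tensor_act (rep2 P (ugen P v)) Deg2.e1 fun k => T2 P k i)
    · rw [LinearMap.comp_apply, LinearMap.comp_apply, LinearMap.comp_apply, Deg2.grade,
        Deg2.extend_e0, coact_e0, LinearMap.lTensor_tmul, LinearMap.rTensor_tmul, h1, Deg2.act_e0,
        TensorProduct.tmul_zero, TensorProduct.zero_tmul]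
  exact LinearMap.congr_fun this x

lemma T2_mem_wt (m i : Fin 5) : T2 P m i ∈ wt P (2 - (m : ℕ)) := by
  rw [mem_wt, sig_T2]
  congr 1
  have := P.t_ne
  fin_cases m <;> simp [kap] <;> norm_num <;> simp [zpow_ofNat]

lemma TT2_mem_wt (m n i j : Fin 5) : TT2 P m n i j ∈ wt P (4 - (m : ℕ) - (n : ℕ)) := by
  have := mul_mem_wt (T2_mem_wt P m i) (T2_mem_wt P n j)
  rw [show (2 - (m : ℕ) + (2 - (n : ℕ)) : ℤ) = 4 - (m : ℕ) - (n : ℕ) by ring] at this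
  exact Submodule.smul_mem _ _ this

lemma comp_eq_ite {n m : ℤ} {f : OSp P} (h : f ∈ wt P n) :
    comp P m f = if n = m then f else 0 := by
  split_ifs with hn
  · subst hn; exact comp_of_mem h
  · exact comp_of_mem_ne h hn

lemma comp_coact (n : ℤ) (x : Deg2) : LinearMap.lTensor Deg2 (comp P n) (coact P x) =
    LinearMap.rTensor (OSp P) (Deg2.proj n) (coact P x) := by
  have : LinearMap.lTensor Deg2 (comp P n) ∘ₗ coact P =
      LinearMap.rTensor (OSp P) (Deg2.proj n) ∘ₗ coact P := by
    refine Deg2.ext_hom (fun i j => ?_) (fun i => ?_) ?_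
    · simp only [LinearMap.comp_apply, coact_e2, Deg2.proj, Deg2.extend_e2, map_sum,
        LinearMap.lTensor_tmul, LinearMap.rTensor_tmul, comp_eq_ite P (TT2_mem_wt P _ _ _ _)]
      refine Finset.sum_congr rfl fun m _ => Finset.sum_congr rfl fun k _ => ?_
      split_ifs <;> simp
    · simp only [LinearMap.comp_apply, coact_e1, Deg2.proj, Deg2.extend_e1, map_sum,
        LinearMap.lTensor_tmul, LinearMap.rTensor_tmul, comp_eq_ite P (T2_mem_wt P _ _)]
      refine Finset.sum_congr rfl fun m _ => ?_
      split_ifs <;> simp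
    · simp only [LinearMap.comp_apply, coact_e0, Deg2.proj, Deg2.extend_e0,
        LinearMap.lTensor_tmul, LinearMap.rTensor_tmul, comp_eq_ite P (one_mem_wt (P := P))]
      split_ifs <;> simp
  exact LinearMap.congr_fun this x

lemma counit_coact (x : Deg2) :
    TensorProduct.rid ℂ Deg2 (LinearMap.lTensor Deg2 (counit P).toLinearMap (coact P x)) = x := by
  have : (TensorProduct.rid ℂ Deg2).toLinearMap ∘ₗ
      LinearMap.lTensor Deg2 (counit P).toLinearMap ∘ₗ coact P = LinearMap.id := by
    refine Deg2.ext_hom (fun i j => ?_) (fun i => ?_) ?_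
    · simp [coact_e2, TT2, counit_T2, ite_smul]
      rw [← two_mul, mul_assoc, sg_two_mul, one_smul]
    · simp [coact_e1, counit_T2, ite_smul]
    · simp [coact_e0]
  exact LinearMap.congr_fun this x

/-- The coaction preserves every space of relations that is stable under the quantum
superalgebra. -/
theorem rTensor_coact_eq_zero {S : Type} [AddCommGroup S] [Module ℂ S] {G : Submodule ℂ Deg2}
    (hg : ∀ x ∈ G, Deg2.grade x ∈ G) (hp : ∀ x ∈ G, Deg2.act P .vp x ∈ G)
    (hm : ∀ x ∈ G, Deg2.act P .vm x ∈ G) (hn : ∀ n, ∀ x ∈ G, Deg2.proj n x ∈ G)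
    (μ : Deg2 →ₗ[ℂ] S) (hμ : ∀ x ∈ G, μ x = 0) {x : Deg2} (hx : x ∈ G) :
    LinearMap.rTensor (OSp P) μ (coact P x) = 0 :=
  rTensor_coaction_eq_zero P (coact P) Deg2.grade (Deg2.act P .vp) (Deg2.act P .vm) Deg2.proj
    (skew_coact P (.inl rfl) (Dp_mul P) (Dp_T2 P) (Dp_one P))
    (skew_coact P (.inr rfl) (Dm_mul P) (Dm_T2 P) (Dm_one P))
    (comp_coact P) (counit_coact P) hg hp hm hn μ hμ hx

end Equivariance

/-! ### The coaction on the coordinates and the free algebra -/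

section Extension
variable (P : Param) {ξ r : ℂ}

/-- The images of the coordinates under the coaction. -/
def coY (ξ r : ℂ) (i : Fin 5) : gr (Sphere P ξ r) ᵍ⊗[ℂ] gr (OSp P) :=
  ∑ m, Y P ξ r m ᵍ⊗ₜ[ℂ] T2 P m i

lemma par_Y (i : Fin 5) : par (Y P ξ r i) = sg i • Y P ξ r i := by
  change spherePar P ξ r (RingQuot.mkAlgHom ℂ _ (fy i)) = _
  rw [spherePar_mk, freePar_fy, map_smul]; rfl

/-- The class of a polynomial of degree at most two. -/
def sphereMk (ξ r : ℂ) : Deg2 →ₗ[ℂ] Sphere P ξ r :=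
  (RingQuot.mkAlgHom ℂ (SphereRel P ξ r)).toLinearMap ∘ₗ Deg2.toFree

/-- In degree two the multiplication of the graded tensor product produces precisely the sign
contained in `TT2`. So the multiplicative extension agrees with the linear coaction on every
polynomial that occurs in a relation. -/
lemma lift_coY (x : Deg2) : FreeAlgebra.lift ℂ (coY P ξ r) (Deg2.toFree x) =
    GradedTensorProduct.of ℂ (gr (Sphere P ξ r)) (gr (OSp P))
      (LinearMap.rTensor (OSp P) (sphereMk P ξ r) (coact P x)) := by
  have : (FreeAlgebra.lift ℂ (coY P ξ r)).toLinearMap ∘ₗ Deg2.toFree =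
      (GradedTensorProduct.of ℂ (gr (Sphere P ξ r)) (gr (OSp P))).toLinearMap ∘ₗ
      LinearMap.rTensor (OSp P) (sphereMk P ξ r) ∘ₗ coact P := by
    refine Deg2.ext_hom (fun i j => ?_) (fun i => ?_) ?_
    · simp only [LinearMap.comp_apply, AlgHom.toLinearMap_apply, Deg2.toFree_e2, map_mul, fy,
        FreeAlgebra.lift_ι_apply, coact_e2, map_sum, LinearMap.rTensor_tmul, coY,
        Finset.sum_mul_sum]
      refine Finset.sum_congr rfl fun m _ => Finset.sum_congr rfl fun n _ => ?_
      rw [tmul_mul_tmul _ _ (par_T2 P m i) (par_Y P n), sphereMk, LinearMap.comp_apply,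
        Deg2.toFree_e2, AlgHom.toLinearMap_apply, map_mul, TT2, TensorProduct.tmul_smul, map_smul]
      rfl
    · simp only [LinearMap.comp_apply, AlgHom.toLinearMap_apply, Deg2.toFree_e1, fy,
        FreeAlgebra.lift_ι_apply, coact_e1, map_sum, LinearMap.rTensor_tmul, coY]
      refine Finset.sum_congr rfl fun m _ => ?_
      rw [sphereMk, LinearMap.comp_apply, Deg2.toFree_e1]
      rfl
    · simp only [LinearMap.comp_apply, AlgHom.toLinearMap_apply, Deg2.toFree_e0, map_one,
        coact_e0, LinearMap.rTensor_tmul]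
      rw [sphereMk, LinearMap.comp_apply, Deg2.toFree_e0, AlgHom.toLinearMap_apply, map_one]
      rfl
  exact LinearMap.congr_fun this x

end Extension
end QSphere

namespace QSphere
open SuperAlg

/-! ### Parity, weights and anticommutator on polynomials of degree at most two -/

lemma kap_eq (P : Param) (i : Fin 5) : kap P i = P.t ^ (2 - (i : ℕ) : ℤ) := by
  have := P.t_ne
  fin_cases i <;> simp [kap] <;> norm_num <;> simp [zpow_ofNat]

lemma kapi_eq (P : Param) (i : Fin 5) : kapi P i = P.t ^ (-(2 - (i : ℕ)) : ℤ) := by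
  have := P.t_ne
  fin_cases i <;> simp [kapi] <;> norm_num <;> simp [zpow_ofNat]

namespace Deg2
variable (P : Param)

lemma grade_e2 (i j : Fin 5) : grade (e2 i j) = sg (i + j) • e2 i j := extend_e2 _ _ _ _ _
lemma grade_e1 (i : Fin 5) : grade (e1 i) = sg i • e1 i := extend_e1 _ _ _ _
lemma grade_e0 : grade e0 = e0 := extend_e0 _ _ _

lemma proj_e2 (n : ℤ) (i j : Fin 5) :
    proj n (e2 i j) = if 4 - (i : ℕ) - (j : ℕ) = n then e2 i j else 0 := extend_e2 _ _ _ _ _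
lemma proj_e1 (n : ℤ) (i : Fin 5) : proj n (e1 i) = if 2 - (i : ℕ) = n then e1 i else 0 :=
  extend_e1 _ _ _ _
lemma proj_e0 (n : ℤ) : proj n e0 = if 0 = n then e0 else 0 := extend_e0 _ _ _

lemma proj_proj (m n : ℤ) (x : Deg2) : proj m (proj n x) = if n = m then proj n x else 0 := by
  have : proj m ∘ₗ proj n = if n = m then proj n else 0 := by
    refine ext_hom (fun i j => ?_) (fun i => ?_) ?_
    · rw [LinearMap.comp_apply]
      split_ifs with h
      · rw [proj_e2]; subst h; split_ifs with h1 <;> simp [proj_e2, h1]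
      · rw [proj_e2]; split_ifs with h1 <;> simp [proj_e2]; omega
    · rw [LinearMap.comp_apply]
      split_ifs with h
      · rw [proj_e1]; subst h; split_ifs with h1 <;> simp [proj_e1, h1]
      · rw [proj_e1]; split_ifs with h1 <;> simp [proj_e1]; omega
    · rw [LinearMap.comp_apply]
      split_ifs with h
      · rw [proj_e0]; subst h; split_ifs with h1 <;> simp [proj_e0, h1]
      · rw [proj_e0]; split_ifs with h1 <;> simp [proj_e0]; omega
  have h := LinearMap.congr_fun this x
  rw [LinearMap.comp_apply] at h
  rw [h]
  split_ifs <;> rfl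

lemma grade_act {v : UGen} (hv : v = .vp ∨ v = .vm) (x : Deg2) :
    grade (act P v x) = -act P v (grade x) := by
  have : grade ∘ₗ act P v = -(act P v ∘ₗ grade) := by
    refine ext_hom (fun i j => ?_) (fun i => ?_) ?_
    · simp only [LinearMap.comp_apply, LinearMap.neg_apply, grade_e2, map_smul, act_e2, map_add,
        map_sum, smul_add, Finset.smul_sum, neg_add, smul_smul, ← Finset.sum_neg_distrib]
      congr 1
      · refine Finset.sum_congr rfl fun k _ => ?_
        rw [← neg_smul]
        congr 1
        rcases rep2_odd P hv k i with h | h | h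
        · simp [h]
        · simp only [h, sg_add, sg_one]; ring
        · simp only [h, sg_add, sg_one]; ring
      · refine Finset.sum_congr rfl fun k _ => ?_
        rw [← neg_smul]
        congr 1
        rcases rep2_odd P hv k j with h | h | h
        · simp [h]
        · simp only [h, sg_add, sg_one]; ring
        · simp only [h, sg_add, sg_one]; ring
    · simp only [LinearMap.comp_apply, LinearMap.neg_apply, grade_e1, map_smul, act_e1,
        map_sum, Finset.smul_sum, smul_smul, ← Finset.sum_neg_distrib]
      refine Finset.sum_congr rfl fun k _ => ?_
      rw [← neg_smul]
      congr 1
      rcases rep2_odd P hv k i with h | h | h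
      · simp [h]
      · simp only [h, sg_add, sg_one]; ring
      · simp only [h, sg_add, sg_one]; ring
    · simp only [LinearMap.comp_apply, LinearMap.neg_apply, grade_e0, act_e0, map_zero, neg_zero]
  exact LinearMap.congr_fun this x

/-- The change of weight under a generator. -/
def shift : UGen → ℤ
  | .vp => 1
  | .vm => -1
  | _ => 0

lemma rep2_shift {v : UGen} (hv : v = .vp ∨ v = .vm) (m k : Fin 5) :
    rep2 P (ugen P v) k m = 0 ∨ (m : ℤ) = k + shift v := by
  rcases hv with rfl | rfl
  · rw [rep2_vp]; fin_cases m <;> fin_cases k <;> simp [shift]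
  · rw [rep2_vm]; fin_cases m <;> fin_cases k <;> simp [shift]

lemma proj_act {v : UGen} (hv : v = .vp ∨ v = .vm) (n : ℤ) (x : Deg2) :
    proj (n + shift v) (act P v x) = act P v (proj n x) := by
  have : proj (n + shift v) ∘ₗ act P v = act P v ∘ₗ proj n := by
    refine ext_hom (fun i j => ?_) (fun i => ?_) ?_
    · have h : act P v (proj n (e2 i j)) =
          if 4 - (i : ℕ) - (j : ℕ) = n then act P v (e2 i j) else 0 := by
        rw [proj_e2]; split_ifs <;> simp
      rw [LinearMap.comp_apply, LinearMap.comp_apply, h]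
      simp only [act_e2, map_add, map_sum, map_smul, proj_e2]
      have h1 : ∀ k, (rep2 P (ugen P v) k i * kapi P j) •
          (if 4 - (k : ℕ) - (j : ℕ) = n + shift v then e2 k j else 0) =
          if 4 - (i : ℕ) - (j : ℕ) = n then (rep2 P (ugen P v) k i * kapi P j) • e2 k j else 0 := by
        intro k
        rcases rep2_shift P hv i k with h | h
        · simp [h]
        · have : (4 - (k : ℕ) - (j : ℕ) = n + shift v) ↔ (4 - (i : ℕ) - (j : ℕ) = n) := by omega
          simp only [this, smul_ite, smul_zero]
      have h2 : ∀ k, (sg i * kap P i * rep2 P (ugen P v) k j) •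
          (if 4 - (i : ℕ) - (k : ℕ) = n + shift v then e2 i k else 0) =
          if 4 - (i : ℕ) - (j : ℕ) = n then
            (sg i * kap P i * rep2 P (ugen P v) k j) • e2 i k else 0 := by
        intro k
        rcases rep2_shift P hv j k with h | h
        · simp [h]
        · have : (4 - (i : ℕ) - (k : ℕ) = n + shift v) ↔ (4 - (i : ℕ) - (j : ℕ) = n) := by omega
          simp only [this, smul_ite, smul_zero]
      simp only [h1, h2]
      split_ifs <;> simp
    · have h : act P v (proj n (e1 i)) = if 2 - (i : ℕ) = n then act P v (e1 i) else 0 := by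
        rw [proj_e1]; split_ifs <;> simp
      rw [LinearMap.comp_apply, LinearMap.comp_apply, h]
      simp only [act_e1, map_sum, map_smul, proj_e1]
      have h1 : ∀ k, rep2 P (ugen P v) k i •
          (if 2 - (k : ℕ) = n + shift v then e1 k else 0) =
          if 2 - (i : ℕ) = n then rep2 P (ugen P v) k i • e1 k else 0 := by
        intro k
        rcases rep2_shift P hv i k with h | h
        · simp [h]
        · have : (2 - (k : ℕ) = n + shift v) ↔ (2 - (i : ℕ) = n) := by omega
          simp only [this, smul_ite, smul_zero]
      simp only [h1]
      split_ifs <;> simp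
    · rw [LinearMap.comp_apply, LinearMap.comp_apply, act_e0, map_zero, proj_e0]
      split_ifs <;> simp [act_e0]
  exact LinearMap.congr_fun this x

/-- The value of `{v₊, v₋}` on vectors of weight `n`. -/
def cartan (n : ℤ) : ℂ := -(P.q ^ 4 - (P.q ^ 4)⁻¹)⁻¹ * (P.t ^ (2 * n) - P.t ^ (-(2 * n)))

/-- This is the computation of Δ{v₊, v₋} in matrix form: g is the parity, K and k act on the two
sides, and the primed letters are the transposed generators acting on the second factor. The mixed
terms cancel because g anticommutes with v± and the factors s and s⁻¹ compensate; the other two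
pairs telescope. -/
lemma anticomm_mul {R : Type} [Ring R] [Algebra ℂ R] (c s : ℂ) (hs : s ≠ 0)
    {e f g K k : R} {e' f' : R} (he : e * g = -(g * e)) (hf : f * g = -(g * f))
    (heK : e * K = s⁻¹ • (K * e)) (hfK : f * K = s • (K * f)) (hgK : g * K = K * g)
    (hgg : g * g = 1) (hek : e' * k = s⁻¹ • (k * e')) (hfk : f' * k = s • (k * f'))
    (h : e * f + f * e = c • (K ^ 2 - k ^ 2)) (h' : e' * f' + f' * e' = c • (K ^ 2 - k ^ 2)) (W : R) :
    e * (f * W * k + g * K * W * f') * k + g * K * (f * W * k + g * K * W * f') * e' +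
      (f * (e * W * k + g * K * W * e') * k + g * K * (e * W * k + g * K * W * e') * f') =
      c • (K ^ 2 * W * K ^ 2 - k ^ 2 * W * k ^ 2) := by
  have e1 : e * (g * K * W * f') * k = -(g * K * (e * W * k) * f') := by
    calc e * (g * K * W * f') * k = (e * g) * K * W * (f' * k) := by simp only [mul_assoc]
      _ = -(g * (e * K) * W * (f' * k)) := by rw [he]; simp only [mul_assoc, neg_mul]
      _ = _ := by
        rw [heK, hfk]
        simp only [mul_smul_comm, smul_mul_assoc, smul_smul, mul_inv_cancel₀ hs, one_smul, mul_assoc]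
  have e2 : f * (g * K * W * e') * k = -(g * K * (f * W * k) * e') := by
    calc f * (g * K * W * e') * k = (f * g) * K * W * (e' * k) := by simp only [mul_assoc]
      _ = -(g * (f * K) * W * (e' * k)) := by rw [hf]; simp only [mul_assoc, neg_mul]
      _ = _ := by
        rw [hfK, hek]
        simp only [mul_smul_comm, smul_mul_assoc, smul_smul, inv_mul_cancel₀ hs, one_smul, mul_assoc]
  have e3 : ∀ Z, g * K * (g * K * Z) = K ^ 2 * Z := by
    intro Z
    calc g * K * (g * K * Z) = g * (K * g) * K * Z := by simp only [mul_assoc]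
      _ = _ := by rw [← hgK, ← mul_assoc g g, hgg, one_mul, pow_two]
  have e4 : g * K * (g * K * W * f') * e' + g * K * (g * K * W * e') * f' =
      K ^ 2 * W * (e' * f' + f' * e') := by
    rw [mul_assoc (g * K) W, mul_assoc (g * K) W, e3, e3]
    simp only [mul_add, mul_assoc]
    exact add_comm _ _
  have e5 : e * (f * W * k) * k + f * (e * W * k) * k = (e * f + f * e) * W * k ^ 2 := by
    simp only [add_mul, mul_assoc, pow_two]
  have e6 : c • (K ^ 2 * W * K ^ 2 - k ^ 2 * W * k ^ 2) =
      (e * f + f * e) * W * k ^ 2 + K ^ 2 * W * (e' * f' + f' * e') := by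
    rw [h, h']
    simp only [smul_mul_assoc, mul_smul_comm, ← smul_add, sub_mul, mul_sub]
    congr 1
    abel
  rw [e6, ← e4, ← e5]
  simp only [mul_add, add_mul, e1, e2]
  abel

lemma rep2_rel {x y : FreeAlgebra ℂ UGen} (h : URel P x y) :
    rep2 P (RingQuot.mkAlgHom ℂ _ x) = rep2 P (RingQuot.mkAlgHom ℂ _ y) := by
  rw [RingQuot.mkAlgHom_rel ℂ h]

lemma rep2_anticomm : rep2 P (ugen P .vp) * rep2 P (ugen P .vm) +
    rep2 P (ugen P .vm) * rep2 P (ugen P .vp) =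
    (-(P.q ^ 4 - (P.q ^ 4)⁻¹)⁻¹) • (rep2 P (ugen P .K) ^ 2 - rep2 P (ugen P .Kinv) ^ 2) := by
  have := rep2_rel P .anticomm
  simpa only [map_add, map_mul, map_smul, map_sub, map_pow, ugen] using this

lemma rep2_K_vp : rep2 P (ugen P .K) * rep2 P (ugen P .vp) =
    P.t • (rep2 P (ugen P .vp) * rep2 P (ugen P .K)) := by
  have := rep2_rel P .K_vp
  simpa only [map_add, map_mul, map_smul, map_sub, map_pow, ugen] using this

lemma rep2_K_vm : rep2 P (ugen P .K) * rep2 P (ugen P .vm) =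
    P.t⁻¹ • (rep2 P (ugen P .vm) * rep2 P (ugen P .K)) := by
  have := rep2_rel P .K_vm
  simpa only [map_add, map_mul, map_smul, map_sub, map_pow, ugen] using this

lemma rep2_K_Kinv : rep2 P (ugen P .K) * rep2 P (ugen P .Kinv) = 1 := by
  have := rep2_rel P .K_Kinv
  simpa only [map_mul, map_one, ugen] using this

lemma rep2_Kinv_K : rep2 P (ugen P .Kinv) * rep2 P (ugen P .K) = 1 := by
  have := rep2_rel P .Kinv_K
  simpa only [map_mul, map_one, ugen] using this

lemma gam_vp : rep2 P (ugen P .vp) * gam = -(gam * rep2 P (ugen P .vp)) := by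
  rw [rep2_vp, gam]
  ext i j
  rw [Matrix.mul_diagonal, Matrix.neg_apply, Matrix.diagonal_mul, Matrix.smul_apply]
  fin_cases i <;> fin_cases j <;> simp [sg] <;> ring

lemma oddAct_anticomm (W : Matrix (Fin 5) (Fin 5) ℂ) :
    oddAct P .vp (oddAct P .vm W) + oddAct P .vm (oddAct P .vp W) =
    (-(P.q ^ 4 - (P.q ^ 4)⁻¹)⁻¹) • (rep2 P (ugen P .K) ^ 2 * W * rep2 P (ugen P .K) ^ 2 -
      rep2 P (ugen P .Kinv) ^ 2 * W * rep2 P (ugen P .Kinv) ^ 2) := by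
  have hKT : (rep2 P (ugen P .K)).transpose = rep2 P (ugen P .K) := by
    rw [rep2_K]; exact Matrix.diagonal_transpose _
  have hkT : (rep2 P (ugen P .Kinv)).transpose = rep2 P (ugen P .Kinv) := by
    rw [rep2_Kinv]; exact Matrix.diagonal_transpose _
  have ht := P.t_ne
  have h1 := rep2_K_vp P
  have h2 := rep2_K_vm P
  have h3 := rep2_K_Kinv P
  have h4 := rep2_Kinv_K P
  have h5 := rep2_anticomm P
  have hek : rep2 P (ugen P .Kinv) * rep2 P (ugen P .vp) =
      P.t⁻¹ • (rep2 P (ugen P .vp) * rep2 P (ugen P .Kinv)) := by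
    calc _ = P.t⁻¹ • (rep2 P (ugen P .Kinv) * (P.t • (rep2 P (ugen P .vp) * rep2 P (ugen P .K))) *
          rep2 P (ugen P .Kinv)) := by
          rw [mul_smul_comm, smul_mul_assoc, smul_smul, inv_mul_cancel₀ ht, one_smul, mul_assoc,
            mul_assoc, h3, mul_one]
      _ = _ := by rw [← h1, ← mul_assoc (rep2 P (ugen P .Kinv)), h4, one_mul]
  have hfk : rep2 P (ugen P .Kinv) * rep2 P (ugen P .vm) =
      P.t • (rep2 P (ugen P .vm) * rep2 P (ugen P .Kinv)) := by
    calc _ = P.t • (rep2 P (ugen P .Kinv) * (P.t⁻¹ • (rep2 P (ugen P .vm) * rep2 P (ugen P .K))) *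
          rep2 P (ugen P .Kinv)) := by
          rw [mul_smul_comm, smul_mul_assoc, smul_smul, mul_inv_cancel₀ ht, one_smul, mul_assoc,
            mul_assoc, h3, mul_one]
      _ = _ := by rw [← h2, ← mul_assoc (rep2 P (ugen P .Kinv)), h4, one_mul]
  simp only [oddAct, hkT]
  refine anticomm_mul _ P.t ht (gam_vp P) ?_ ?_ ?_ ?_ gam_sq ?_ ?_ h5 ?_ W
  · rw [gam_vm, neg_neg]
  · rw [h1, smul_smul, inv_mul_cancel₀ ht, one_smul]
  · rw [h2, smul_smul, mul_inv_cancel₀ ht, one_smul]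
  · rw [gam, rep2_K, Matrix.diagonal_mul_diagonal, Matrix.diagonal_mul_diagonal]
    congr 1; funext i; exact mul_comm _ _
  · have := congrArg Matrix.transpose hek
    rw [Matrix.transpose_mul, Matrix.transpose_smul, Matrix.transpose_mul, hkT] at this
    exact this
  · have := congrArg Matrix.transpose hfk
    rw [Matrix.transpose_mul, Matrix.transpose_smul, Matrix.transpose_mul, hkT] at this
    exact this
  · have := congrArg Matrix.transpose h5
    rw [Matrix.transpose_add, Matrix.transpose_smul, Matrix.transpose_mul, Matrix.transpose_mul,
      Matrix.transpose_sub, Matrix.transpose_pow, Matrix.transpose_pow, hkT, hKT] at this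
    rw [← this, add_comm]

/-- `{v₊, v₋}` acts on vectors of weight `n` by `cartan n`. -/
lemma act_anticomm {n : ℤ} {x : Deg2} (hx : proj n x = x) :
    act P .vp (act P .vm x) + act P .vm (act P .vp x) = cartan P n • x := by
  have key : (act P .vp ∘ₗ act P .vm + act P .vm ∘ₗ act P .vp) ∘ₗ proj n =
      cartan P n • proj n := by
    refine ext_hom (fun i j => ?_) (fun i => ?_) ?_
    · rw [LinearMap.comp_apply, LinearMap.smul_apply, proj_e2]
      split_ifs with h
      · rw [LinearMap.add_apply, LinearMap.comp_apply, LinearMap.comp_apply]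
        refine Prod.ext ?_ (Prod.ext ?_ ?_)
        · change oddAct P .vp (oddAct P .vm (e2 i j).1) + oddAct P .vm (oddAct P .vp (e2 i j).1) =
            cartan P n • (e2 i j).1
          rw [oddAct_anticomm, rep2_K, rep2_Kinv, Matrix.diagonal_pow, Matrix.diagonal_pow, e2]
          ext a b
          simp only [Matrix.smul_apply, Matrix.sub_apply, Matrix.mul_diagonal, Matrix.diagonal_mul,
            smul_eq_mul, Matrix.single_apply, Pi.pow_apply]
          by_cases hab : i = a ∧ j = b
          · obtain ⟨rfl, rfl⟩ := hab
            have h1 : P.t ^ (2 * n) = kap P i ^ 2 * kap P j ^ 2 := by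
              rw [kap_eq, kap_eq, ← zpow_natCast, ← zpow_natCast, ← zpow_mul, ← zpow_mul,
                ← zpow_add₀ P.t_ne]
              congr 1; push_cast; omega
            have h2 : P.t ^ (-(2 * n)) = kapi P i ^ 2 * kapi P j ^ 2 := by
              rw [kapi_eq, kapi_eq, ← zpow_natCast, ← zpow_natCast, ← zpow_mul, ← zpow_mul,
                ← zpow_add₀ P.t_ne]
              congr 1; push_cast; omega
            rw [if_pos ⟨rfl, rfl⟩, cartan, h1, h2, kap, kap, kapi, kapi]
            ring
          · simp [hab]
        · change (rep2 P (ugen P .vp)).mulVec ((rep2 P (ugen P .vm)).mulVec (e2 i j).2.1) +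
            (rep2 P (ugen P .vm)).mulVec ((rep2 P (ugen P .vp)).mulVec (e2 i j).2.1) =
            cartan P n • (e2 i j).2.1
          simp [e2]
        · change 0 + 0 = cartan P n • (e2 i j).2.2
          simp [e2]
      · simp
    · rw [LinearMap.comp_apply, LinearMap.smul_apply, proj_e1]
      split_ifs with h
      · rw [LinearMap.add_apply, LinearMap.comp_apply, LinearMap.comp_apply]
        refine Prod.ext ?_ (Prod.ext ?_ ?_)
        · change oddAct P .vp (oddAct P .vm (e1 i).1) + oddAct P .vm (oddAct P .vp (e1 i).1) =
            cartan P n • (e1 i).1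
          simp [oddAct_anticomm, e1]
        · change (rep2 P (ugen P .vp)).mulVec ((rep2 P (ugen P .vm)).mulVec (e1 i).2.1) +
            (rep2 P (ugen P .vm)).mulVec ((rep2 P (ugen P .vp)).mulVec (e1 i).2.1) =
            cartan P n • (e1 i).2.1
          rw [Matrix.mulVec_mulVec, Matrix.mulVec_mulVec, ← Matrix.add_mulVec, rep2_anticomm,
            rep2_K, rep2_Kinv, Matrix.diagonal_pow, Matrix.diagonal_pow, e1]
          ext a
          simp only [Matrix.smul_mulVec, Matrix.sub_mulVec, Matrix.mulVec_diagonal, Pi.smul_apply,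
            Pi.sub_apply, smul_eq_mul, Pi.single_apply, Pi.pow_apply]
          by_cases ha : a = i
          · subst ha
            have h1 : P.t ^ (2 * n) = kap P a ^ 2 := by
              rw [kap_eq, ← zpow_natCast, ← zpow_mul]
              congr 1; push_cast; omega
            have h2 : P.t ^ (-(2 * n)) = kapi P a ^ 2 := by
              rw [kapi_eq, ← zpow_natCast, ← zpow_mul]
              congr 1; push_cast; omega
            rw [if_pos rfl, cartan, h1, h2, kap, kapi]
            ring
          · simp [ha]
        · change 0 + 0 = cartan P n • (e1 i).2.2
          simp [e1]
      · simp
    · rw [LinearMap.comp_apply, LinearMap.smul_apply, proj_e0]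
      split_ifs with h
      · subst h; simp [act_e0, cartan]
      · simp
  have := LinearMap.congr_fun key x
  rwa [LinearMap.comp_apply, LinearMap.smul_apply, hx] at this

end Deg2
end QSphere

namespace QSphere
open SuperAlg

/-! ### The sixteen relations as v₋-strings -/

namespace Deg2
variable (P : Param) (ξ r : ℂ)

/-- The highest weight vectors of the spaces of relations. -/
def hw : Fin 4 → Deg2 :=
  ![(hwv P 0, 0, -r), (hwv P 1, 0, 0), (hwv P 2, -ξ • Pi.single 0 1, 0), (hwv P 3, 0, 0)]

/-- The relation of weight `L - k` in the component `L`. -/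
def rel (L : Fin 4) (k : ℕ) : Deg2 := (act P .vm)^[k] (hw P ξ r L)

lemma rel_succ (L : Fin 4) (k : ℕ) : rel P ξ r L (k + 1) = act P .vm (rel P ξ r L k) :=
  Function.iterate_succ_apply' _ _ _

lemma hw_fst (L : Fin 4) : (hw P ξ r L).1 = hwv P L := by fin_cases L <;> rfl

lemma rel_eq (L : Fin 4) (k : ℕ) : rel P ξ r L k = ((oddAct P .vm)^[k] (hwv P L),
    (rep2 P (ugen P .vm) ^ k).mulVec (hw P ξ r L).2.1, if k = 0 then (hw P ξ r L).2.2 else 0) := by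
  induction k with
  | zero => simp [rel, ← hw_fst P ξ r L]
  | succ k ih =>
    rw [rel_succ, ih, act_apply, Function.iterate_succ_apply', pow_succ', ← Matrix.mulVec_mulVec,
      if_neg k.succ_ne_zero]

lemma toFree_rel_zero : toFree (rel P ξ r 0 0) = radiusRel P r := by
  rw [rel_eq, toFree_apply, radiusRel, EL]
  simp [hw, lin, sub_eq_add_neg]

lemma toFree_rel_one (k : ℕ) : toFree (rel P ξ r 1 k) = EL P 1 k := by
  rw [rel_eq, toFree_apply, EL]
  simp [hw, lin]

lemma toFree_rel_two (k : ℕ) : toFree (rel P ξ r 2 k) = EL P 2 k - ξ • Yk P k := by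
  have h : lin ((rep2 P (ugen P .vm) ^ k).mulVec (-ξ • Pi.single 0 1)) = -(ξ • Yk P k) := by
    rw [Matrix.mulVec_smul, Yk, lin, lin]
    simp only [Pi.smul_apply, smul_eq_mul, mul_smul, Finset.smul_sum, ← Finset.sum_neg_distrib,
      neg_smul]
  rw [rel_eq, toFree_apply, EL, sub_eq_add_neg, ← h]
  simp [hw]

lemma toFree_rel_three (k : ℕ) : toFree (rel P ξ r 3 k) = EL P 3 k := by
  rw [rel_eq, toFree_apply, EL]
  simp [hw, lin]

/-- The index set of the sixteen relations. -/
abbrev RelIdx : Type := Σ L : Fin 4, Fin (2 * L + 1)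

lemma relations_eq : {z : FreeY | ∃ x y, SphereRel P ξ r x y ∧ z = x - y} =
    Set.range fun p : RelIdx => toFree (rel P ξ r p.1 p.2) := by
  ext z
  constructor
  · rintro ⟨x, y, h, rfl⟩
    cases h with
    | radius => exact ⟨⟨0, 0⟩, toFree_rel_zero P ξ r⟩
    | cov h =>
      cases h with
      | L1 k => exact ⟨⟨1, k⟩, (toFree_rel_one P ξ r k).trans (sub_zero _).symm⟩
      | L2 k => exact ⟨⟨2, k⟩, toFree_rel_two P ξ r k⟩
      | L3 k => exact ⟨⟨3, k⟩, (toFree_rel_three P ξ r k).trans (sub_zero _).symm⟩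
  · rintro ⟨⟨L, k⟩, rfl⟩
    fin_cases L
    · have hk : k = 0 := Fin.fin_one_eq_zero k
      subst hk
      exact ⟨_, _, .radius, toFree_rel_zero P ξ r⟩
    · exact ⟨_, _, .cov (.L1 k), (toFree_rel_one P ξ r k).trans (sub_zero _).symm⟩
    · exact ⟨_, _, .cov (.L2 k), toFree_rel_two P ξ r k⟩
    · exact ⟨_, _, .cov (.L3 k), (toFree_rel_three P ξ r k).trans (sub_zero _).symm⟩

lemma hw_zero : hw P ξ r 0 = P.q⁻¹ • e2 0 4 - P.t⁻¹ • e2 1 3 - e2 2 2 + P.t • e2 3 1 +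
    P.q • e2 4 0 - r • e0 := by
  rw [eq_sum (hw P ξ r 0)]
  simp [hw, hwv, Fin.sum_univ_five]
  module

lemma hw_one : hw P ξ r 1 = P.k1 • e2 0 3 - (P.q * P.k2) • e2 1 2 - (P.q ^ 2 * P.k2) • e2 2 1 +
    (P.q ^ 3 * P.k1) • e2 3 0 := by
  rw [eq_sum (hw P ξ r 1)]
  simp [hw, hwv, Fin.sum_univ_five]
  module

lemma hw_two : hw P ξ r 2 = -P.k1 • e2 0 2 + (P.t ^ 3 * P.k2) • e2 1 1 +
    (P.q ^ 3 * P.k1) • e2 2 0 - ξ • e1 0 := by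
  rw [eq_sum (hw P ξ r 2)]
  simp [hw, hwv, Fin.sum_univ_five]
  module

lemma hw_three : hw P ξ r 3 = -e2 0 1 + P.q ^ 2 • e2 1 0 := by
  rw [eq_sum (hw P ξ r 3)]
  simp [hw, hwv, Fin.sum_univ_five]

lemma proj_hw (L : Fin 4) : proj L (hw P ξ r L) = hw P ξ r L := by
  fin_cases L
  · simp [hw_zero, proj_e2, proj_e0]
  · simp [hw_one, proj_e2, proj_e0]
  · simp [hw_two, proj_e2, proj_e1]
  · simp [hw_three, proj_e2, proj_e0]

lemma grade_hw (L : Fin 4) : grade (hw P ξ r L) = sg L • hw P ξ r L := by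
  fin_cases L
  · simp [hw_zero, grade_e2, grade_e0, sg]; module
  · simp [hw_one, grade_e2, grade_e0, sg]; module
  · simp [hw_two, grade_e2, grade_e1, sg]
  · simp [hw_three, grade_e2, grade_e0, sg]; module

lemma act_vp_hw (L : Fin 4) : act P .vp (hw P ξ r L) = 0 := by
  rw [act_apply, hw_fst, hwv_highest]
  have : (rep2 P (ugen P .vp)).mulVec (hw P ξ r L).2.1 = 0 := by
    rw [rep2_vp]
    fin_cases L <;> simp [hw, Matrix.mulVec_smul]
  rw [this]; rfl

lemma proj_rel (L : Fin 4) (k : ℕ) :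
    proj ((L : ℕ) - k) (rel P ξ r L k) = rel P ξ r L k := by
  induction k with
  | zero => simpa [rel] using proj_hw P ξ r L
  | succ k ih =>
    rw [rel_succ]
    have := proj_act P (.inr rfl : UGen.vm = .vp ∨ UGen.vm = .vm) ((L : ℕ) - k) (rel P ξ r L k)
    rw [ih] at this
    rw [← this]
    congr 1
    simp only [shift]; push_cast; ring_nf

lemma proj_rel_eq (n : ℤ) (L : Fin 4) (k : ℕ) :
    proj n (rel P ξ r L k) = if ((L : ℕ) - k : ℤ) = n then rel P ξ r L k else 0 := by
  rw [← proj_rel, proj_proj, proj_rel]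

lemma grade_rel (L : Fin 4) (k : ℕ) : grade (rel P ξ r L k) = sg (L + k) • rel P ξ r L k := by
  induction k with
  | zero => exact grade_hw P ξ r L
  | succ k ih =>
    rw [rel_succ, grade_act P (.inr rfl), ih, map_smul, ← add_assoc, sg_add _ 1, sg_one, mul_neg_one,
      neg_smul]

/-- The coefficients of the action of `v₊`. -/
def cup (L : ℕ) : ℕ → ℂ
  | 0 => 0
  | k + 1 => cartan P (L - k) - cup L k

/-- Along a v₋-string v₊v₋ equals the anticommutator, which is a scalar on weight vectors, minus
v₋v₊, which is known from the preceding step. -/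
lemma act_vp_rel_succ (L : Fin 4) (k : ℕ) :
    act P .vp (rel P ξ r L (k + 1)) = cup P L (k + 1) • rel P ξ r L k := by
  have key : ∀ k, act P .vm (act P .vp (rel P ξ r L k)) = cup P L k • rel P ξ r L k →
      act P .vp (rel P ξ r L (k + 1)) = cup P L (k + 1) • rel P ξ r L k := by
    intro k h
    have := act_anticomm P (proj_rel P ξ r L k)
    rw [h] at this
    rw [rel_succ, cup, sub_smul, ← this, add_sub_cancel_right]
  induction k with
  | zero =>
    apply key
    rw [rel, Function.iterate_zero_apply, act_vp_hw, map_zero, cup, zero_smul]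
  | succ k ih =>
    apply key
    rw [ih, map_smul, ← rel_succ]

/-- The coefficients are alternating sums of the scalars `cartan`, hence of powers of q; the factor
q + 1 makes the sums telescope. -/
lemma cup_eq (L k : ℕ) : cup P L k * ((P.q ^ 4 - (P.q ^ 4)⁻¹) * (P.q + 1)) =
    -P.q ^ (L - k + 1 : ℤ) + P.q ^ (k - L : ℤ) + (-1) ^ k * (P.q ^ (L + 1 : ℤ) - P.q ^ (-L : ℤ)) := by
  have ht := P.t_ne
  have hq : P.q ≠ 0 := pow_ne_zero _ ht
  have hD : P.q ^ 4 - (P.q ^ 4)⁻¹ ≠ 0 := by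
    intro h
    apply P.t_pow_ne 16 (by norm_num)
    field_simp at h
    rw [Param.q] at h
    linear_combination h
  induction k with
  | zero => simp [cup]
  | succ k ih =>
    have e1 : ∀ n : ℤ, P.t ^ (2 * n) = P.q ^ n := fun n => by rw [Param.q, zpow_mul]; rfl
    have e2 : ∀ n : ℤ, P.t ^ (-(2 * n)) = P.q ^ (-n) := fun n => by rw [← e1]; congr 1; ring
    rw [cup, sub_mul, ih, cartan, e1, e2]
    have e3 : (L - (k + 1 : ℕ) + 1 : ℤ) = L - k := by push_cast; ring
    have e4 : ((k + 1 : ℕ) - L : ℤ) = -(L - k) + 1 := by push_cast; ring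
    have e5 : (k - L : ℤ) = -(L - k) := by ring
    have e6 : -(P.q ^ 4 - (P.q ^ 4)⁻¹)⁻¹ * (P.q ^ (L - k : ℤ) - P.q ^ (-(L - k) : ℤ)) *
        ((P.q ^ 4 - (P.q ^ 4)⁻¹) * (P.q + 1)) =
        -((P.q ^ (L - k : ℤ) - P.q ^ (-(L - k) : ℤ)) * (P.q + 1)) := by
      linear_combination (-(P.q ^ (L - k : ℤ) - P.q ^ (-(L - k) : ℤ)) * (P.q + 1)) *
        inv_mul_cancel₀ hD
    rw [e6, e3, e4, e5, zpow_add₀ hq, zpow_add₀ hq (-(L - k : ℤ)), zpow_one, pow_succ (-1 : ℂ)]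
    ring

/-- Up to units the closed form factors as (q^k - 1)(1 + q^(2L+1-k)) for even k and as (q^k + 1)(1 -
q^(2L+1-k)) for odd k. Both exponents are positive in the given range. -/
lemma cup_ne (L k : ℕ) (hk : 0 < k) (hL : k ≤ 2 * L) : cup P L k ≠ 0 := by
  intro h
  have hq : P.q ≠ 0 := pow_ne_zero _ P.t_ne
  have := cup_eq P L k
  rw [h, zero_mul] at this
  obtain ⟨m, hm⟩ : ∃ m, 2 * L + 1 = k + (m + 1) := ⟨2 * L - k, by omega⟩
  have e1 : (L - k + 1 : ℤ) = -L + (m + 1 : ℕ) := by push_cast; omega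
  have e2 : (k - L : ℤ) = -L + (k : ℕ) := by ring
  have e3 : (L + 1 : ℤ) = -L + ((m + 1 : ℕ) + (k : ℕ)) := by push_cast; omega
  rw [e1, e2, e3, zpow_add₀ hq, zpow_add₀ hq, zpow_add₀ hq, zpow_add₀ hq, zpow_natCast,
    zpow_natCast] at this
  have hL : P.q ^ (-L : ℤ) ≠ 0 := zpow_ne_zero _ hq
  rcases Nat.even_or_odd k with hk' | hk'
  · rw [hk'.neg_one_pow] at this
    have h2 : P.q ^ (-L : ℤ) * ((P.q ^ k - 1) * (1 + P.q ^ (m + 1))) = 0 := by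
      linear_combination -this
    rcases mul_eq_zero.1 ((mul_eq_zero.1 h2).resolve_left hL) with h3 | h3
    · rw [Param.q, ← pow_mul] at h3
      exact P.t_pow_ne _ (by omega) h3
    · rw [Param.q, ← pow_mul] at h3
      exact P.t_pow_add_one_ne (n := 2 * (m + 1)) (by omega) (by linear_combination h3)
  · rw [hk'.neg_one_pow] at this
    have h2 : P.q ^ (-L : ℤ) * ((P.q ^ k + 1) * (1 - P.q ^ (m + 1))) = 0 := by
      linear_combination -this
    rcases mul_eq_zero.1 ((mul_eq_zero.1 h2).resolve_left hL) with h3 | h3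
    · rw [Param.q, ← pow_mul] at h3
      exact P.t_pow_add_one_ne (by omega) h3
    · rw [Param.q, ← pow_mul] at h3
      exact P.t_pow_ne (2 * (m + 1)) (by omega) (by linear_combination -h3)

end Deg2
end QSphere

namespace QSphere
open SuperAlg

/-! ### The regrouped relations and the action of v₋ on them -/

namespace Deg2
variable (P : Param) (ξ r : ℂ)

/-- The commutation relations as polynomials of degree two. -/
def commRel₂ : Fin 10 → Deg2 :=
  let q := P.q
  let t := P.t
  let χ := chi P ξ
  ![e2 1 0 - (q⁻¹ ^ 2) • e2 0 1,
    e2 2 0 - (q⁻¹ ^ 4) • e2 0 2 - (χ * P.k1 ^ 2 * (q + 1)) • e1 0,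
    e2 3 0 - (q⁻¹ ^ 6) • e2 0 3 - (χ * P.k3 * (q + 1) * q⁻¹) • e1 1,
    e2 4 0 + ((q ^ 5 - q - 1) * q⁻¹ ^ 4) • e2 0 4
      - ((q ^ 5 - 1) * (q + 1) * t⁻¹ ^ 9) • e2 1 3
      - (χ * (q ^ 2 - q + 1) * (q + 1) ^ 2 * q⁻¹ ^ 2) • e1 2,
    e2 2 1 - (q⁻¹ ^ 2) • e2 1 2 - (χ * (q + 1)) • e1 1,
    e2 3 1 + q⁻¹ • e2 1 3 - ((q ^ 2 - 1) * t⁻¹ ^ 3) • e2 2 2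
      + (χ * (q + 1) * t) • e1 2,
    e2 4 1 - (q⁻¹ ^ 6) • e2 1 4 - (χ * P.k3 * (q + 1) * q⁻¹) • e1 3,
    e2 3 2 - (q⁻¹ ^ 2) • e2 2 3 - (χ * (q + 1)) • e1 3,
    e2 4 2 - (q⁻¹ ^ 4) • e2 2 4 - (χ * P.k1 ^ 2 * (q + 1)) • e1 4,
    e2 4 3 - (q⁻¹ ^ 2) • e2 3 4]

/-- The relations for the squares of the odd coordinates as polynomials of degree two. -/
def sqRel₂ : Fin 2 → Deg2 :=
  let q := P.q
  let t := P.t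
  let χ := chi P ξ
  ![e2 1 1 - (P.k1 / P.k2 * (q - 1) * t⁻¹ ^ 5) • e2 0 2 + (P.k1 / P.k2 * χ * t⁻¹) • e1 0,
    e2 3 3 - (P.k1 / P.k2 * (q - 1) * t⁻¹ ^ 5) • e2 2 4 + (P.k1 / P.k2 * χ * t⁻¹) • e1 4]

/-- The constraints as polynomials of degree two. -/
def constrRel₂ : Fin 3 → Deg2 :=
  let q := P.q
  let t := P.t
  let χ := chi P ξ
  ![e2 1 2 - (P.k3 * q⁻¹) • e2 0 3 - χ • e1 1,
    e2 2 2 - (P.k1 ^ 2) • e2 0 4 + ((q ^ 3 + q ^ 2 + 1) * t⁻¹ ^ 5) • e2 1 3 - χ • e1 2,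
    e2 2 3 - (P.k3 * q⁻¹) • e2 1 4 - χ • e1 3]

lemma toFree_commRel₂ (i : Fin 10) : toFree (commRel₂ P ξ i) = commRel P ξ i := by
  fin_cases i <;>
    simp only [commRel₂, commRel, Fin.reduceFinMk, Matrix.cons_val, map_sub, map_add, map_smul, toFree_e2, toFree_e1]

lemma toFree_sqRel₂ (i : Fin 2) : toFree (sqRel₂ P ξ i) = sqRel P ξ i := by
  fin_cases i <;>
    simp only [sqRel₂, sqRel, Fin.reduceFinMk, Matrix.cons_val, map_sub, map_add, map_smul, toFree_e2, toFree_e1]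

lemma toFree_constrRel₂ (i : Fin 3) : toFree (constrRel₂ P ξ i) = constrRel P ξ i := by
  fin_cases i <;>
    simp only [constrRel₂, constrRel, Fin.reduceFinMk, Matrix.cons_val, map_sub, map_add, map_smul, toFree_e2, toFree_e1]

/-- Each regrouped relation has a leading monomial: a wrongly ordered product, the square of an odd
coordinate, or the left-hand side of a constraint. In this and the following identities the
coefficients are those of the leading monomials in the image under v₋; for the constraints, the
contributions of the commutation relations have been subtracted first. -/
lemma act_vm_commRel₂_0 : act P .vm (commRel₂ P ξ 0) =
      (P.nu * P.t * ((-P.k2 * P.t⁻¹ ^ 2))) • commRel₂ P ξ 1 +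
        (P.nu * P.t * ((-(P.t * P.k1)) + -(P.q⁻¹ ^ 2) * (P.k1 * P.t⁻¹))) • sqRel₂ P ξ 0 := by
  simp only [commRel₂, sqRel₂, constrRel₂, Matrix.cons_val, map_sub, map_add, map_smul, act_e2,
    act_e1, Fin.sum_univ_five, rep2_vm, kap, kapi, sg]
  simp [Param.q, Param.k3]
  have h0 := P.t_ne
  have h1 := P.k1_sq'
  have h2 := P.k2_sq'
  have h3 := P.k2_ne
  match_scalars <;> field_simp <;> grind

lemma act_vm_commRel₂_1 : act P .vm (commRel₂ P ξ 1) =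
      (P.nu * P.t * ((P.k2 * P.t⁻¹ ^ 2))) • commRel₂ P ξ 2 +
        (P.nu * P.t * ((P.k1))) • commRel₂ P ξ 4 +
        (P.nu * P.t * (-(P.q⁻¹ ^ 4) * P.k1 + ((P.q⁻¹ ^ 2)) * ((P.k1)))) • constrRel₂ P ξ 0 := by
  simp only [commRel₂, sqRel₂, constrRel₂, Matrix.cons_val, map_sub, map_add, map_smul, act_e2,
    act_e1, Fin.sum_univ_five, rep2_vm, kap, kapi, sg]
  simp [Param.q, Param.k3]
  have h0 := P.t_ne
  have h1 := P.k1_sq'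
  have h2 := P.k2_sq'
  have h3 := P.k2_ne
  match_scalars <;> field_simp <;> grind

lemma act_vm_commRel₂_2 : act P .vm (commRel₂ P ξ 2) =
      (P.nu * P.t * ((-P.k1 * P.t⁻¹ ^ 2))) • commRel₂ P ξ 3 +
        (P.nu * P.t * ((-(P.t⁻¹ * P.k1)))) • commRel₂ P ξ 5 +
        (P.nu * P.t * ((((P.q ^ 2 - 1) * P.t⁻¹ ^ 3)) * ((-(P.t⁻¹ * P.k1))))) • constrRel₂ P ξ 1 := by
  simp only [commRel₂, sqRel₂, constrRel₂, Matrix.cons_val, map_sub, map_add, map_smul, act_e2,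
    act_e1, Fin.sum_univ_five, rep2_vm, kap, kapi, sg]
  simp [Param.q, Param.k3]
  have h0 := P.t_ne
  have h1 := P.k1_sq'
  have h2 := P.k2_sq'
  have h3 := P.k2_ne
  match_scalars <;> field_simp <;> grind

lemma act_vm_commRel₂_3 : act P .vm (commRel₂ P ξ 3) =
      (P.nu * P.t * ((P.t⁻¹ ^ 2 * P.k1))) • commRel₂ P ξ 6 +
        (P.nu * P.t * (-((P.q ^ 5 - 1) * (P.q + 1) * P.t⁻¹ ^ 9) * (-P.k2 * P.t))) • constrRel₂ P ξ 2 := by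
  simp only [commRel₂, sqRel₂, constrRel₂, Matrix.cons_val, map_sub, map_add, map_smul, act_e2,
    act_e1, Fin.sum_univ_five, rep2_vm, kap, kapi, sg]
  simp [Param.q, Param.k3]
  have h0 := P.t_ne
  have h1 := P.k1_sq'
  have h2 := P.k2_sq'
  have h3 := P.k2_ne
  match_scalars <;> field_simp <;> grind

lemma act_vm_commRel₂_4 : act P .vm (commRel₂ P ξ 4) =
      (P.nu * P.t * ((P.k2 * P.t⁻¹))) • commRel₂ P ξ 5 +
        (P.nu * P.t * ((-(P.k2)) + -(P.q⁻¹ ^ 2) * (-P.k2) + (((P.q ^ 2 - 1) * P.t⁻¹ ^ 3)) * ((P.k2 * P.t⁻¹)))) • constrRel₂ P ξ 1 := by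
  simp only [commRel₂, sqRel₂, constrRel₂, Matrix.cons_val, map_sub, map_add, map_smul, act_e2,
    act_e1, Fin.sum_univ_five, rep2_vm, kap, kapi, sg]
  simp [Param.q, Param.k3]
  have h0 := P.t_ne
  have h1 := P.k1_sq'
  have h2 := P.k2_sq'
  have h3 := P.k2_ne
  match_scalars <;> field_simp <;> grind

lemma act_vm_commRel₂_5 : act P .vm (commRel₂ P ξ 5) =
      (P.nu * P.t * ((-P.k1 * P.t⁻¹))) • commRel₂ P ξ 6 +
        (P.nu * P.t * ((P.t⁻¹ * P.k2) + -((P.q ^ 2 - 1) * P.t⁻¹ ^ 3) * P.k2)) • commRel₂ P ξ 7 +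
        (P.nu * P.t * (P.q⁻¹ * (-P.k2 * P.t) + -((P.q ^ 2 - 1) * P.t⁻¹ ^ 3) * (P.k2) + ((P.q⁻¹ ^ 2)) * ((P.t⁻¹ * P.k2) + -((P.q ^ 2 - 1) * P.t⁻¹ ^ 3) * P.k2))) • constrRel₂ P ξ 2 := by
  simp only [commRel₂, sqRel₂, constrRel₂, Matrix.cons_val, map_sub, map_add, map_smul, act_e2,
    act_e1, Fin.sum_univ_five, rep2_vm, kap, kapi, sg]
  simp [Param.q, Param.k3]
  have h0 := P.t_ne
  have h1 := P.k1_sq'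
  have h2 := P.k2_sq'
  have h3 := P.k2_ne
  match_scalars <;> field_simp <;> grind

lemma act_vm_commRel₂_6 : act P .vm (commRel₂ P ξ 6) =
      (P.nu * P.t * ((-(P.t⁻¹ ^ 2 * P.k2)))) • commRel₂ P ξ 8 := by
  simp only [commRel₂, sqRel₂, constrRel₂, Matrix.cons_val, map_sub, map_add, map_smul, act_e2,
    act_e1, Fin.sum_univ_five, rep2_vm, kap, kapi, sg]
  simp [Param.q, Param.k3]
  have h0 := P.t_ne
  have h1 := P.k1_sq'
  have h2 := P.k2_sq'
  have h3 := P.k2_ne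
  match_scalars <;> field_simp <;> grind

lemma act_vm_commRel₂_7 : act P .vm (commRel₂ P ξ 7) =
      (P.nu * P.t * ((-P.k1))) • commRel₂ P ξ 8 +
        (P.nu * P.t * ((-(P.t⁻¹ * P.k2)) + -(P.q⁻¹ ^ 2) * (P.k2 * P.t))) • sqRel₂ P ξ 1 := by
  simp only [commRel₂, sqRel₂, constrRel₂, Matrix.cons_val, map_sub, map_add, map_smul, act_e2,
    act_e1, Fin.sum_univ_five, rep2_vm, kap, kapi, sg]
  simp [Param.q, Param.k3]
  have h0 := P.t_ne
  have h1 := P.k1_sq'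
  have h2 := P.k2_sq'
  have h3 := P.k2_ne
  match_scalars <;> field_simp <;> grind

lemma act_vm_commRel₂_8 : act P .vm (commRel₂ P ξ 8) =
      (P.nu * P.t * ((P.t⁻¹ ^ 2 * P.k2))) • commRel₂ P ξ 9 := by
  simp only [commRel₂, sqRel₂, constrRel₂, Matrix.cons_val, map_sub, map_add, map_smul, act_e2,
    act_e1, Fin.sum_univ_five, rep2_vm, kap, kapi, sg]
  simp [Param.q, Param.k3]
  have h0 := P.t_ne
  have h1 := P.k1_sq'
  have h2 := P.k2_sq'
  have h3 := P.k2_ne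
  match_scalars <;> field_simp <;> grind

lemma act_vm_commRel₂_9 : act P .vm (commRel₂ P ξ 9) =
      0 := by
  simp only [commRel₂, sqRel₂, constrRel₂, Matrix.cons_val, map_sub, map_add, map_smul, act_e2,
    act_e1, Fin.sum_univ_five, rep2_vm, kap, kapi, sg]
  simp [Param.q, Param.k3]
  have h0 := P.t_ne
  have h1 := P.k1_sq'
  have h2 := P.k2_sq'
  have h3 := P.k2_ne
  match_scalars <;> field_simp <;> grind

lemma act_vm_sqRel₂_0 : act P .vm (sqRel₂ P ξ 0) =
      (P.nu * P.t * ((-P.k2 * P.t⁻¹))) • commRel₂ P ξ 4 +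
        (P.nu * P.t * ((P.t * P.k2) + -(P.k1 / P.k2 * (P.q - 1) * P.t⁻¹ ^ 5) * P.k1 + ((P.q⁻¹ ^ 2)) * ((-P.k2 * P.t⁻¹)))) • constrRel₂ P ξ 0 := by
  simp only [commRel₂, sqRel₂, constrRel₂, Matrix.cons_val, map_sub, map_add, map_smul, act_e2,
    act_e1, Fin.sum_univ_five, rep2_vm, kap, kapi, sg]
  simp [Param.q, Param.k3]
  have h0 := P.t_ne
  have h1 := P.k1_sq'
  have h2 := P.k2_sq'
  have h3 := P.k2_ne
  match_scalars <;> field_simp <;> grind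

lemma act_vm_sqRel₂_1 : act P .vm (sqRel₂ P ξ 1) =
      (P.nu * P.t * ((-P.k1 * P.t))) • commRel₂ P ξ 9 := by
  simp only [commRel₂, sqRel₂, constrRel₂, Matrix.cons_val, map_sub, map_add, map_smul, act_e2,
    act_e1, Fin.sum_univ_five, rep2_vm, kap, kapi, sg]
  simp [Param.q, Param.k3]
  have h0 := P.t_ne
  have h1 := P.k1_sq'
  have h2 := P.k2_sq'
  have h3 := P.k2_ne
  match_scalars <;> field_simp <;> grind

lemma act_vm_constrRel₂_0 : act P .vm (constrRel₂ P ξ 0) =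
      (P.nu * P.t * ((-P.k2))) • constrRel₂ P ξ 1 := by
  simp only [commRel₂, sqRel₂, constrRel₂, Matrix.cons_val, map_sub, map_add, map_smul, act_e2,
    act_e1, Fin.sum_univ_five, rep2_vm, kap, kapi, sg]
  simp [Param.q, Param.k3]
  have h0 := P.t_ne
  have h1 := P.k1_sq'
  have h2 := P.k2_sq'
  have h3 := P.k2_ne
  match_scalars <;> field_simp <;> grind

lemma act_vm_constrRel₂_1 : act P .vm (constrRel₂ P ξ 1) =
      (P.nu * P.t * (P.k2)) • commRel₂ P ξ 7 +
        (P.nu * P.t * ((P.k2) + ((P.q ^ 3 + P.q ^ 2 + 1) * P.t⁻¹ ^ 5) * (-P.k2 * P.t) + ((P.q⁻¹ ^ 2)) * (P.k2))) • constrRel₂ P ξ 2 := by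
  simp only [commRel₂, sqRel₂, constrRel₂, Matrix.cons_val, map_sub, map_add, map_smul, act_e2,
    act_e1, Fin.sum_univ_five, rep2_vm, kap, kapi, sg]
  simp [Param.q, Param.k3]
  have h0 := P.t_ne
  have h1 := P.k1_sq'
  have h2 := P.k2_sq'
  have h3 := P.k2_ne
  match_scalars <;> field_simp <;> grind

lemma act_vm_constrRel₂_2 : act P .vm (constrRel₂ P ξ 2) =
      (P.nu * P.t * ((P.k2 * P.t))) • sqRel₂ P ξ 1 := by
  simp only [commRel₂, sqRel₂, constrRel₂, Matrix.cons_val, map_sub, map_add, map_smul, act_e2,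
    act_e1, Fin.sum_univ_five, rep2_vm, kap, kapi, sg]
  simp [Param.q, Param.k3]
  have h0 := P.t_ne
  have h1 := P.k1_sq'
  have h2 := P.k2_sq'
  have h3 := P.k2_ne
  match_scalars <;> field_simp <;> grind

end Deg2
end QSphere

namespace QSphere
open SuperAlg

/-! ### Independence of the relations and comparison of the two spans -/

namespace Deg2
variable (P : Param) (ξ r : ℂ)

lemma act_vp_pow_of_lt (L : Fin 4) {j k : ℕ} (h : k < j) :
    (act P .vp ^ j) (rel P ξ r L k) = 0 := by
  induction j generalizing k with
  | zero => omega
  | succ j ih =>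
    rw [pow_succ, Module.End.mul_apply]
    cases k with
    | zero => rw [rel, Function.iterate_zero_apply, act_vp_hw, map_zero]
    | succ k => rw [act_vp_rel_succ, map_smul, ih (by omega), smul_zero]

lemma act_vp_pow_of_le (L : Fin 4) {j k : ℕ} (h : j ≤ k) (hk : k ≤ 2 * L) :
    ∃ d : ℂ, d ≠ 0 ∧ (act P .vp ^ j) (rel P ξ r L k) = d • rel P ξ r L (k - j) := by
  induction j generalizing k with
  | zero => exact ⟨1, one_ne_zero, by simp⟩
  | succ j ih =>
    obtain ⟨k, rfl⟩ : ∃ k', k = k' + 1 := ⟨k - 1, by omega⟩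
    obtain ⟨d, hd, hd'⟩ := ih (k := k) (by omega) (by omega)
    refine ⟨cup P L (k + 1) * d, mul_ne_zero (cup_ne P _ _ (by omega) hk) hd, ?_⟩
    rw [pow_succ, Module.End.mul_apply, act_vp_rel_succ, map_smul, hd', smul_smul,
      Nat.add_sub_add_right]

lemma hw_ne (L : Fin 4) : hw P ξ r L ≠ 0 := by
  intro h
  have h1 : hwv P L = 0 := by rw [← hw_fst P ξ r, h]; rfl
  have hk := P.k1_ne
  fin_cases L
  · simpa [hwv] using congrFun (congrFun h1 2) 2
  · simpa [hwv, hk] using congrFun (congrFun h1 0) 3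
  · simpa [hwv, hk] using congrFun (congrFun h1 0) 2
  · simpa [hwv] using congrFun (congrFun h1 0) 1

/-- Descending induction on L. Once the coefficients of the larger components vanish, apply v₊^k and
project to weight L. A term (L', k') with L' ≤ L survives only if k' ≥ k and L' - k' + k = L, that
is, for (L, k) itself, where it is a nonzero multiple of the highest weight vector. -/
theorem linearIndependent_rel :
    LinearIndependent ℂ fun p : RelIdx => rel P ξ r p.1 p.2 := by
  rw [Fintype.linearIndependent_iff]
  intro a ha
  have key : ∀ p : RelIdx, (∀ p' : RelIdx, p.1 < p'.1 → a p' = 0) → a p = 0 := by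
    intro p hp
    have h := congrArg (fun x => proj (p.1 : ℕ) ((act P .vp ^ (p.2 : ℕ)) x)) ha
    simp only [map_sum, map_smul, map_zero] at h
    obtain ⟨d, hd, hd'⟩ := act_vp_pow_of_le P ξ r p.1 le_rfl (by omega : (p.2 : ℕ) ≤ 2 * p.1)
    rw [Finset.sum_eq_single p, hd', Nat.sub_self, map_smul] at h
    · rw [rel, Function.iterate_zero_apply, proj_hw, smul_smul] at h
      exact (mul_eq_zero.1 ((smul_eq_zero.1 h).resolve_right (hw_ne P ξ r _))).resolve_right hd
    · rintro ⟨L, k⟩ - hne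
      rcases lt_or_ge p.1 L with hL | hL
      · rw [hp _ hL, zero_smul]
      · rcases lt_or_ge (k : ℕ) p.2 with hk | hk
        · rw [act_vp_pow_of_lt P ξ r L hk, map_zero, smul_zero]
        · obtain ⟨d', -, h'⟩ := act_vp_pow_of_le P ξ r L hk (by omega)
          rw [h', map_smul, proj_rel_eq, if_neg, smul_zero, smul_zero]
          intro h2
          apply hne
          obtain ⟨L', k'⟩ := p
          have hLL : (L' : ℕ) ≥ L := hL
          simp only at hk h2 hLL
          have : L = L' := by ext; omega
          subst this
          congr 1
          ext
          omega
    · intro h; exact absurd (Finset.mem_univ _) h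
  have h3 : ∀ k, a ⟨3, k⟩ = 0 := fun k => key _ fun p' h => absurd h (not_lt.2 (Fin.le_last _))
  have h2 : ∀ k, a ⟨2, k⟩ = 0 := fun k => key _ (by
    rintro ⟨L, k⟩ h; fin_cases L <;> first | exact h3 k | (have h' := Fin.lt_def.1 h; simp at h'))
  have h1 : ∀ k, a ⟨1, k⟩ = 0 := fun k => key _ (by
    rintro ⟨L, k⟩ h; fin_cases L <;> first | exact h3 k | exact h2 k | (have h' := Fin.lt_def.1 h; simp at h'))
  have h0 : ∀ k, a ⟨0, k⟩ = 0 := fun k => key _ (by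
    rintro ⟨L, k⟩ h
    fin_cases L <;> first | exact h3 k | exact h2 k | exact h1 k | (have h' := Fin.lt_def.1 h; simp at h'))
  rintro ⟨L, k⟩
  fin_cases L
  exacts [h0 k, h1 k, h2 k, h3 k]

/-- The regrouped relations. -/
def nice : Fin 10 ⊕ Fin 2 ⊕ Fin 3 ⊕ Unit → Deg2 :=
  Sum.elim (commRel₂ P ξ) (Sum.elim (sqRel₂ P ξ) (Sum.elim (constrRel₂ P ξ) fun _ => hw P ξ r 0))

lemma act_vm_hw_zero : act P .vm (hw P ξ r 0) = 0 := by
  rw [hw_zero]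
  simp only [map_sub, map_add, map_smul, act_e2, act_e0, Fin.sum_univ_five, rep2_vm, kap, kapi, sg]
  simp [Param.q]
  have h0 := P.t_ne
  match_scalars <;> field_simp <;> ring

lemma comm_mem (i) : commRel₂ P ξ i ∈ Submodule.span ℂ (Set.range (nice P ξ r)) :=
  Submodule.subset_span ⟨.inl i, rfl⟩

lemma sq_mem (i) : sqRel₂ P ξ i ∈ Submodule.span ℂ (Set.range (nice P ξ r)) :=
  Submodule.subset_span ⟨.inr (.inl i), rfl⟩

lemma constr_mem (i) : constrRel₂ P ξ i ∈ Submodule.span ℂ (Set.range (nice P ξ r)) :=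
  Submodule.subset_span ⟨.inr (.inr (.inl i)), rfl⟩

lemma act_vm_mem_nice {x : Deg2} (hx : x ∈ Submodule.span ℂ (Set.range (nice P ξ r))) :
    act P .vm x ∈ Submodule.span ℂ (Set.range (nice P ξ r)) := by
  have h : Submodule.span ℂ (Set.range (nice P ξ r)) ≤
      (Submodule.span ℂ (Set.range (nice P ξ r))).comap (act P .vm) := by
    refine Submodule.span_le.2 ?_
    have hc := comm_mem P ξ r
    have hs := sq_mem P ξ r
    have hk := constr_mem P ξ r
    have hC : ∀ i, act P .vm (commRel₂ P ξ i) ∈ Submodule.span ℂ (Set.range (nice P ξ r)) := by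
      intro i
      fin_cases i
      · change act P .vm (commRel₂ P ξ 0) ∈ Submodule.span ℂ (Set.range (nice P ξ r))
        rw [act_vm_commRel₂_0]
        repeat' first
          | exact Submodule.smul_mem _ _ (hc _)
          | exact Submodule.smul_mem _ _ (hs _)
          | exact Submodule.smul_mem _ _ (hk _)
          | apply Submodule.add_mem
      · change act P .vm (commRel₂ P ξ 1) ∈ Submodule.span ℂ (Set.range (nice P ξ r))
        rw [act_vm_commRel₂_1]
        repeat' first
          | exact Submodule.smul_mem _ _ (hc _)
          | exact Submodule.smul_mem _ _ (hs _)
          | exact Submodule.smul_mem _ _ (hk _)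
          | apply Submodule.add_mem
      · change act P .vm (commRel₂ P ξ 2) ∈ Submodule.span ℂ (Set.range (nice P ξ r))
        rw [act_vm_commRel₂_2]
        repeat' first
          | exact Submodule.smul_mem _ _ (hc _)
          | exact Submodule.smul_mem _ _ (hs _)
          | exact Submodule.smul_mem _ _ (hk _)
          | apply Submodule.add_mem
      · change act P .vm (commRel₂ P ξ 3) ∈ Submodule.span ℂ (Set.range (nice P ξ r))
        rw [act_vm_commRel₂_3]
        repeat' first
          | exact Submodule.smul_mem _ _ (hc _)
          | exact Submodule.smul_mem _ _ (hs _)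
          | exact Submodule.smul_mem _ _ (hk _)
          | apply Submodule.add_mem
      · change act P .vm (commRel₂ P ξ 4) ∈ Submodule.span ℂ (Set.range (nice P ξ r))
        rw [act_vm_commRel₂_4]
        repeat' first
          | exact Submodule.smul_mem _ _ (hc _)
          | exact Submodule.smul_mem _ _ (hs _)
          | exact Submodule.smul_mem _ _ (hk _)
          | apply Submodule.add_mem
      · change act P .vm (commRel₂ P ξ 5) ∈ Submodule.span ℂ (Set.range (nice P ξ r))
        rw [act_vm_commRel₂_5]
        repeat' first
          | exact Submodule.smul_mem _ _ (hc _)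
          | exact Submodule.smul_mem _ _ (hs _)
          | exact Submodule.smul_mem _ _ (hk _)
          | apply Submodule.add_mem
      · change act P .vm (commRel₂ P ξ 6) ∈ Submodule.span ℂ (Set.range (nice P ξ r))
        rw [act_vm_commRel₂_6]
        repeat' first
          | exact Submodule.smul_mem _ _ (hc _)
          | exact Submodule.smul_mem _ _ (hs _)
          | exact Submodule.smul_mem _ _ (hk _)
          | apply Submodule.add_mem
      · change act P .vm (commRel₂ P ξ 7) ∈ Submodule.span ℂ (Set.range (nice P ξ r))
        rw [act_vm_commRel₂_7]
        repeat' first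
          | exact Submodule.smul_mem _ _ (hc _)
          | exact Submodule.smul_mem _ _ (hs _)
          | exact Submodule.smul_mem _ _ (hk _)
          | apply Submodule.add_mem
      · change act P .vm (commRel₂ P ξ 8) ∈ Submodule.span ℂ (Set.range (nice P ξ r))
        rw [act_vm_commRel₂_8]
        repeat' first
          | exact Submodule.smul_mem _ _ (hc _)
          | exact Submodule.smul_mem _ _ (hs _)
          | exact Submodule.smul_mem _ _ (hk _)
          | apply Submodule.add_mem
      · change act P .vm (commRel₂ P ξ 9) ∈ Submodule.span ℂ (Set.range (nice P ξ r))
        rw [act_vm_commRel₂_9]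
        exact Submodule.zero_mem _
    have hS : ∀ i, act P .vm (sqRel₂ P ξ i) ∈ Submodule.span ℂ (Set.range (nice P ξ r)) := by
      intro i
      fin_cases i
      · change act P .vm (sqRel₂ P ξ 0) ∈ Submodule.span ℂ (Set.range (nice P ξ r))
        rw [act_vm_sqRel₂_0]
        repeat' first
          | exact Submodule.smul_mem _ _ (hc _)
          | exact Submodule.smul_mem _ _ (hs _)
          | exact Submodule.smul_mem _ _ (hk _)
          | apply Submodule.add_mem
      · change act P .vm (sqRel₂ P ξ 1) ∈ Submodule.span ℂ (Set.range (nice P ξ r))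
        rw [act_vm_sqRel₂_1]
        repeat' first
          | exact Submodule.smul_mem _ _ (hc _)
          | exact Submodule.smul_mem _ _ (hs _)
          | exact Submodule.smul_mem _ _ (hk _)
          | apply Submodule.add_mem
    have hK : ∀ i, act P .vm (constrRel₂ P ξ i) ∈ Submodule.span ℂ (Set.range (nice P ξ r)) := by
      intro i
      fin_cases i
      · change act P .vm (constrRel₂ P ξ 0) ∈ Submodule.span ℂ (Set.range (nice P ξ r))
        rw [act_vm_constrRel₂_0]
        repeat' first
          | exact Submodule.smul_mem _ _ (hc _)
          | exact Submodule.smul_mem _ _ (hs _)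
          | exact Submodule.smul_mem _ _ (hk _)
          | apply Submodule.add_mem
      · change act P .vm (constrRel₂ P ξ 1) ∈ Submodule.span ℂ (Set.range (nice P ξ r))
        rw [act_vm_constrRel₂_1]
        repeat' first
          | exact Submodule.smul_mem _ _ (hc _)
          | exact Submodule.smul_mem _ _ (hs _)
          | exact Submodule.smul_mem _ _ (hk _)
          | apply Submodule.add_mem
      · change act P .vm (constrRel₂ P ξ 2) ∈ Submodule.span ℂ (Set.range (nice P ξ r))
        rw [act_vm_constrRel₂_2]
        repeat' first
          | exact Submodule.smul_mem _ _ (hc _)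
          | exact Submodule.smul_mem _ _ (hs _)
          | exact Submodule.smul_mem _ _ (hk _)
          | apply Submodule.add_mem
    rintro _ ⟨i | i | i | i, rfl⟩
    · exact hC i
    · exact hS i
    · exact hK i
    · change act P .vm (hw P ξ r 0) ∈ Submodule.span ℂ (Set.range (nice P ξ r))
      rw [act_vm_hw_zero]
      exact Submodule.zero_mem _
  exact h hx

/-- Each highest weight vector combines regrouped relations of its own weight, with coefficients
read off at the leading monomials. The factor relating ξ and χ is needed only for L = 2. -/
lemma hw_mem_nice (L : Fin 4) : hw P ξ r L ∈ Submodule.span ℂ (Set.range (nice P ξ r)) := by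
  have h0 := P.t_ne
  have h1 := P.k1_sq'
  have h2 := P.k2_sq'
  have h3 := P.k2_ne
  have h4 := P.k1_ne
  have h5 : P.q ^ 2 + P.q + 1 ≠ 0 := by
    intro h
    apply P.t_pow_ne 6 (by norm_num)
    rw [Param.q] at h
    linear_combination (P.t ^ 2 - 1) * h
  have hχ : ξ = chi P ξ * (P.k1 * P.q ^ 2 * (P.q ^ 2 + P.q + 1)) := by
    have hq : P.q ≠ 0 := pow_ne_zero _ h0
    rw [chi, div_mul_cancel₀]
    exact mul_ne_zero (mul_ne_zero h4 (pow_ne_zero _ hq)) h5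
  have hc := comm_mem P ξ r
  have hs := sq_mem P ξ r
  have hk := constr_mem P ξ r
  fin_cases L
  · exact Submodule.subset_span ⟨.inr (.inr (.inr ())), rfl⟩
  · have : hw P ξ r 1 = (P.q ^ 3 * P.k1) • commRel₂ P ξ 2 - (P.q ^ 2 * P.k2) • commRel₂ P ξ 4 -
        (P.q * P.k2 + P.k2) • constrRel₂ P ξ 0 := by
      rw [hw_one]
      simp [commRel₂, constrRel₂, Param.q, Param.k3]
      match_scalars <;> field_simp <;> grind
    exact this.symm ▸ Submodule.sub_mem _ (Submodule.sub_mem _ (Submodule.smul_mem _ _ (hc _))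
      (Submodule.smul_mem _ _ (hc _))) (Submodule.smul_mem _ _ (hk _))
  · have : hw P ξ r 2 = (P.q ^ 3 * P.k1) • commRel₂ P ξ 1 + (P.t ^ 3 * P.k2) • sqRel₂ P ξ 0 := by
      rw [hw_two]
      simp only [commRel₂, sqRel₂, Matrix.cons_val]
      generalize chi P ξ = χ at hχ ⊢
      rw [hχ]
      simp [Param.q]
      match_scalars <;> field_simp <;> grind
    exact this.symm ▸ Submodule.add_mem _ (Submodule.smul_mem _ _ (hc _))
      (Submodule.smul_mem _ _ (hs _))
  · have : hw P ξ r 3 = P.q ^ 2 • commRel₂ P ξ 0 := by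
      rw [hw_three]
      simp [commRel₂, Param.q]
      match_scalars <;> field_simp
    exact this.symm ▸ Submodule.smul_mem _ _ (hc _)

lemma rel_mem_nice (L : Fin 4) (k : ℕ) :
    rel P ξ r L k ∈ Submodule.span ℂ (Set.range (nice P ξ r)) := by
  induction k with
  | zero => exact hw_mem_nice P ξ r L
  | succ k ih => rw [rel_succ]; exact act_vm_mem_nice P ξ r ih

lemma finrank_relations :
    Module.finrank ℂ (Submodule.span ℂ (Set.range fun p : RelIdx => rel P ξ r p.1 p.2)) = 16 := by
  rw [finrank_span_eq_card (linearIndependent_rel P ξ r)]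
  decide

/-- The span of the regrouped relations contains the highest weight vectors and is stable under v₋,
so it contains all strings. These give sixteen independent vectors, while the larger space has only
10 + 2 + 3 + 1 generators. -/
theorem span_relations : Submodule.span ℂ (Set.range fun p : RelIdx => rel P ξ r p.1 p.2) =
    Submodule.span ℂ (Set.range (nice P ξ r)) := by
  refine Submodule.eq_of_le_of_finrank_le (Submodule.span_le.2 ?_) ?_
  · rintro _ ⟨p, rfl⟩
    exact rel_mem_nice P ξ r _ _
  · rw [finrank_relations]
    exact (finrank_range_le_card _).trans (by simp)

/-- The space of relations. -/
def relations : Submodule ℂ Deg2 := Submodule.span ℂ (Set.range fun p : RelIdx => rel P ξ r p.1 p.2)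

lemma rel_mem (L : Fin 4) (k : ℕ) : rel P ξ r L k ∈ relations P ξ r := by
  rw [relations, span_relations]
  exact rel_mem_nice P ξ r L k

lemma map_mem_relations {f : Deg2 →ₗ[ℂ] Deg2} (h : ∀ L k, f (rel P ξ r L k) ∈ relations P ξ r)
    {x : Deg2} (hx : x ∈ relations P ξ r) : f x ∈ relations P ξ r := by
  have : relations P ξ r ≤ (relations P ξ r).comap f := by
    conv_lhs => rw [relations]
    rw [Submodule.span_le]
    rintro _ ⟨p, rfl⟩
    exact h _ _
  exact this hx

end Deg2
end QSphere

namespace QSphere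
open SuperAlg

/-! ### Passage to the free algebra and the coaction on the covariant algebra -/

namespace Deg2
variable (P : Param) (ξ r : ℂ)

/-- The words of length at most two are distinct elements of the free monoid, whose elements form a
basis of the free algebra. -/
lemma toFree_injective : Function.Injective toFree := by
  classical
  let b := FreeAlgebra.basisFreeMonoid ℂ (Fin 5)
  have hb : ∀ w, b w = FreeAlgebra.equivMonoidAlgebraFreeMonoid.symm
      (MonoidAlgebra.of ℂ (FreeMonoid (Fin 5)) w) := fun w => rfl
  have h1 : ∀ i, FreeAlgebra.equivMonoidAlgebraFreeMonoid (fy i) =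
      MonoidAlgebra.of ℂ (FreeMonoid (Fin 5)) (FreeMonoid.of i) := by
    intro i
    simp [FreeAlgebra.equivMonoidAlgebraFreeMonoid, fy]
  have f1 : ∀ i, fy i = b (FreeMonoid.of i) := by
    intro i; rw [hb, ← h1, AlgEquiv.symm_apply_apply]
  have f2 : ∀ i j, fy i * fy j = b (FreeMonoid.of i * FreeMonoid.of j) := by
    intro i j
    rw [hb, map_mul, ← h1, ← h1, ← map_mul, AlgEquiv.symm_apply_apply]
  have f0 : (1 : FreeY) = b 1 := by rw [hb, map_one, map_one]
  have e2 : ∀ i j k l : Fin 5, FreeMonoid.of i * FreeMonoid.of j = FreeMonoid.of k * FreeMonoid.of l ↔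
      i = k ∧ j = l := by
    intro i j k l
    refine ⟨fun h => ?_, fun h => by rw [h.1, h.2]⟩
    have : [i, j] = [k, l] := h
    simpa using this
  have e21 : ∀ i j k : Fin 5, FreeMonoid.of i * FreeMonoid.of j ≠ FreeMonoid.of k := by
    intro i j k h
    have : [i, j] = [k] := h
    simp at this
  have e20 : ∀ i j : Fin 5, FreeMonoid.of i * FreeMonoid.of j ≠ 1 := by
    intro i j h
    have : [i, j] = [] := h
    simp at this
  have e10 : ∀ i : Fin 5, FreeMonoid.of i ≠ 1 := by
    intro i h
    have : [i] = [] := h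
    simp at this
  rw [injective_iff_map_eq_zero]
  intro x hx
  have hr := congrArg b.repr hx
  rw [toFree_apply, quad, lin] at hr
  simp only [map_add, map_sum, map_smul, f2, f0, map_zero] at hr
  simp only [f1, b.repr_self] at hr
  have hw := fun w => DFunLike.congr_fun hr w
  simp only [Finsupp.add_apply, Finsupp.finset_sum_apply, Finsupp.smul_apply, smul_eq_mul,
    Finsupp.single_apply, Finsupp.zero_apply, mul_ite, mul_one, mul_zero] at hw
  refine Prod.ext ?_ (Prod.ext ?_ ?_)
  · ext i j
    have := hw (FreeMonoid.of i * FreeMonoid.of j)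
    simpa [e2, (e21 _ _ _).symm, (e20 _ _).symm, ite_and] using this
  · ext i
    have := hw (FreeMonoid.of i)
    simpa [e21, (e10 _).symm, FreeMonoid.of_injective.eq_iff] using this
  · have := hw 1
    simpa [e20, e10] using this

theorem span_regrouped :
    Submodule.span ℂ {z : FreeY | ∃ x y, SphereRel P ξ r x y ∧ z = x - y} =
      Submodule.span ℂ ({radiusRel P r} ∪ Set.range (commRel P ξ) ∪ Set.range (sqRel P ξ) ∪
        Set.range (constrRel P ξ)) := by
  have h : ({radiusRel P r} ∪ Set.range (commRel P ξ) ∪ Set.range (sqRel P ξ) ∪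
        Set.range (constrRel P ξ)) = toFree '' Set.range (nice P ξ r) := by
    rw [nice, Set.Sum.elim_range, Set.Sum.elim_range, Set.Sum.elim_range, Set.range_const,
      Set.image_union, Set.image_union, Set.image_union, Set.image_singleton, ← toFree_rel_zero P ξ r]
    simp only [← Set.range_comp]
    rw [show toFree ∘ commRel₂ P ξ = commRel P ξ from funext (toFree_commRel₂ P ξ),
      show toFree ∘ sqRel₂ P ξ = sqRel P ξ from funext (toFree_sqRel₂ P ξ),
      show toFree ∘ constrRel₂ P ξ = constrRel P ξ from funext (toFree_constrRel₂ P ξ)]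
    ext z
    simp only [Set.mem_union, rel, Function.iterate_zero_apply]
    tauto
  have h2 : (Set.range fun p : RelIdx => toFree (rel P ξ r p.1 p.2)) =
      toFree '' Set.range fun p : RelIdx => rel P ξ r p.1 p.2 := by
    rw [← Set.range_comp]; rfl
  rw [relations_eq, h, h2, Submodule.span_image, Submodule.span_image, span_relations]

theorem finrank_span_relations :
    Module.finrank ℂ (Submodule.span ℂ {z : FreeY | ∃ x y, SphereRel P ξ r x y ∧ z = x - y}) =
      16 := by
  have h2 : (Set.range fun p : RelIdx => toFree (rel P ξ r p.1 p.2)) =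
      toFree '' Set.range fun p : RelIdx => rel P ξ r p.1 p.2 := by
    rw [← Set.range_comp]; rfl
  rw [relations_eq, h2, Submodule.span_image, ← finrank_relations P ξ r]
  exact (LinearEquiv.finrank_eq (Submodule.equivMapOfInjective _ toFree_injective _)).symm

lemma sphereMk_rel (L : Fin 4) (k : ℕ) : sphereMk P ξ r (rel P ξ r L k) = 0 := by
  have : relations P ξ r ≤ LinearMap.ker (sphereMk P ξ r) := by
    rw [relations, Submodule.span_le]
    rintro _ ⟨p, rfl⟩
    have hp : toFree (rel P ξ r p.1 p.2) ∈
        {z : FreeY | ∃ x y, SphereRel P ξ r x y ∧ z = x - y} := by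
      rw [relations_eq]; exact ⟨p, rfl⟩
    obtain ⟨x, y, h, hxy⟩ := hp
    change RingQuot.mkAlgHom ℂ _ (toFree _) = 0
    rw [hxy, map_sub, RingQuot.mkAlgHom_rel ℂ h, sub_self]
  exact this (rel_mem P ξ r L k)

lemma sphereMk_relations {x : Deg2} (hx : x ∈ relations P ξ r) : sphereMk P ξ r x = 0 := by
  have : relations P ξ r ≤ LinearMap.ker (sphereMk P ξ r) := by
    rw [relations, Submodule.span_le]
    rintro _ ⟨p, rfl⟩
    exact sphereMk_rel P ξ r _ _
  exact this hx

/-- The space of relations is spanned by strings of parity-homogeneous weight vectors, on which v₋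
moves down, v₊ moves up and the top vectors are killed by v₊. It is therefore stable, and the
descent argument applies. -/
lemma rTensor_coact_relations {x : Deg2} (hx : x ∈ relations P ξ r) :
    LinearMap.rTensor (OSp P) (sphereMk P ξ r) (coact P x) = 0 := by
  have hm : ∀ {L k} (c : ℂ), c • rel P ξ r L k ∈ relations P ξ r :=
    fun c => Submodule.smul_mem _ _ (rel_mem P ξ r _ _)
  refine rTensor_coact_eq_zero P (G := relations P ξ r) ?_ ?_ ?_ ?_ _
    (fun y hy => sphereMk_relations P ξ r hy) hx
  · exact fun x => map_mem_relations P ξ r fun L k => by rw [grade_rel]; exact hm _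
  · refine fun x => map_mem_relations P ξ r fun L k => ?_
    cases k with
    | zero => rw [rel, Function.iterate_zero_apply, act_vp_hw]; exact Submodule.zero_mem _
    | succ k => rw [act_vp_rel_succ]; exact hm _
  · exact fun x => map_mem_relations P ξ r fun L k => by rw [← rel_succ]; exact rel_mem P ξ r _ _
  · refine fun n x => map_mem_relations P ξ r fun L k => ?_
    rw [proj_rel_eq]
    split_ifs
    · exact rel_mem P ξ r _ _
    · exact Submodule.zero_mem _

end Deg2

/-- The coaction of `OSp_q(1|2)` on the covariant algebra. -/
def sphereCo (P : Param) (ξ r : ℂ) : Sphere P ξ r →ₐ[ℂ] (gr (Sphere P ξ r) ᵍ⊗[ℂ] gr (OSp P)) :=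
  RingQuot.liftAlgHom ℂ ⟨FreeAlgebra.lift ℂ (coY P ξ r), by
    intro x y h
    have hp : x - y ∈ {z : FreeY | ∃ x y, SphereRel P ξ r x y ∧ z = x - y} := ⟨x, y, h, rfl⟩
    rw [Deg2.relations_eq] at hp
    obtain ⟨p, hp⟩ := hp
    rw [← sub_eq_zero, ← map_sub, ← hp, lift_coY, Deg2.rTensor_coact_relations, map_zero]
    exact Deg2.rel_mem P ξ r _ _⟩

lemma sphereCo_Y (P : Param) (ξ r : ℂ) (i : Fin 5) : sphereCo P ξ r (Y P ξ r i) =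
    ∑ m, Y P ξ r m ᵍ⊗ₜ[ℂ] T2 P m i := by
  rw [sphereCo, Y, RingQuot.liftAlgHom_mkAlgHom_apply, fy, FreeAlgebra.lift_ι_apply, coY]

end QSphere

namespace QSphere
open SuperAlg

/-! ### Reordering rules and the deviation of the radius from its consistent value -/

namespace Deg2

/-- The value of a polynomial of degree at most two. -/
def eval {A : Type} [Ring A] [Algebra ℂ A] (y : Fin 5 → A) : Deg2 →ₗ[ℂ] A :=
  extend (fun i j => y i * y j) y 1

section
variable {A : Type} [Ring A] [Algebra ℂ A] (y : Fin 5 → A)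

lemma eval_e2 (i j : Fin 5) : eval y (e2 i j) = y i * y j := extend_e2 _ _ _ _ _
lemma eval_e1 (i : Fin 5) : eval y (e1 i) = y i := extend_e1 _ _ _ _
lemma eval_e0 : eval y e0 = 1 := extend_e0 _ _ _

lemma eval_eq (x : Deg2) : eval y x = FreeAlgebra.lift ℂ y (toFree x) := by
  have : eval y = (FreeAlgebra.lift ℂ y).toLinearMap ∘ₗ toFree := by
    refine ext_hom (fun i j => ?_) (fun i => ?_) ?_
    · simp [eval_e2, toFree_e2, fy]
    · simp [eval_e1, toFree_e1, fy]
    · simp [eval_e0, toFree_e0]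
  rw [this]; rfl

end
end Deg2

namespace Param
variable (P : Param)

lemma q_ne : P.q ≠ 0 := pow_ne_zero _ P.t_ne

/-- `q² - q + 1 = q² κ₂²`. -/
def dd : ℂ := P.q ^ 2 - P.q + 1

lemma dd_eq : P.dd = P.q ^ 2 * P.k2 ^ 2 := by
  have := P.k2_sq'
  rw [dd, q]; linear_combination -this

lemma dd_ne : P.dd ≠ 0 := by
  rw [dd_eq]; exact mul_ne_zero (pow_ne_zero _ P.q_ne) (pow_ne_zero _ P.k2_ne)

lemma q_sub_one_ne : P.q - 1 ≠ 0 := P.t_pow_ne 2 (by norm_num)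

/-- A scalar of the reordering rules. -/
def lam : ℂ := P.t⁻¹ ^ 3 * (P.q - 1)

/-- The scale of the even coordinates of extremal weight. -/
def scl : ℂ := P.k1 / P.k2 * P.t⁻¹ ^ 5 * (P.q - 1)

lemma scl_ne : P.scl ≠ 0 :=
  mul_ne_zero (mul_ne_zero (div_ne_zero P.k1_ne P.k2_ne) (pow_ne_zero _ (inv_ne_zero P.t_ne)))
    P.q_sub_one_ne

lemma q_sq_add_one_ne : P.q ^ 2 + 1 ≠ 0 := by
  rw [q, ← pow_mul]; exact P.t4_add

lemma q_sq_add_q_add_one_ne : P.q ^ 2 + P.q + 1 ≠ 0 := by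
  intro h
  apply P.t_pow_ne 6 (by norm_num)
  rw [q] at h
  linear_combination (P.t ^ 2 - 1) * h

/-- The shift that makes `Y₀` normalize the other coordinates. -/
def theta (ξ : ℂ) : ℂ := P.q ^ 2 * chi P ξ / (P.q - 1)

end Param

lemma Param.xi_eq (P : Param) (ξ : ℂ) :
    ξ = P.theta ξ * (P.q - 1) * P.k1 * (P.q ^ 2 + P.q + 1) := by
  have h1 := P.q_sq_add_q_add_one_ne
  have h2 := P.q_ne
  have h3 := P.k1_ne
  have h4 := P.q_sub_one_ne
  rw [theta, chi, div_mul_cancel₀ _ h4, mul_div_assoc', div_mul_eq_mul_div, div_mul_eq_mul_div,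
    eq_div_iff (mul_ne_zero (mul_ne_zero h3 (pow_ne_zero _ h2)) h1)]
  ring

/-- In terms of the shift θ the factors q² + 1 and q² + q + 1 disappear, since q² κ₁² = q² + 1. -/
lemma radiusOf_eq (P : Param) (ξ : ℂ) : radiusOf P ξ = P.theta ξ ^ 2 * (P.q - 1) ^ 2 / P.q := by
  have h1 := P.q_sq_add_q_add_one_ne
  have h2 := P.q_ne
  have h3 : P.q ^ 2 * P.k1 ^ 2 = P.q ^ 2 + 1 := by
    have := P.k1_sq'; rw [Param.q]; linear_combination this
  have h4 := P.q_sq_add_one_ne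
  rw [radiusOf, div_eq_div_iff (mul_ne_zero h4 (pow_ne_zero _ h1)) h2]
  conv_lhs => rw [P.xi_eq ξ]
  linear_combination (P.theta ξ ^ 2 * (P.q - 1) ^ 2 * (P.q ^ 2 + P.q + 1) ^ 2) * h3

/-- The relations of the covariant algebra in terms of rescaled and shifted coordinates, where `W`
is the difference between the invariant of degree two and its consistent value. -/
structure Reorder (P : Param) (θ : ℂ) {A : Type} [Ring A] [Algebra ℂ A] (a b u c d W : A) :
    Prop where
  bb : b * b = a * u
  cc : c * c = u * d
  ua : u * a = (P.q⁻¹ ^ 4) • (a * u)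
  ub : u * b = (P.q⁻¹ ^ 2) • (b * u)
  cu : c * u = (P.q⁻¹ ^ 2) • (u * c)
  du : d * u = (P.q⁻¹ ^ 4) • (u * d)
  ba : b * a = (P.q⁻¹ ^ 2) • (a * b)
  dc : d * c = (P.q⁻¹ ^ 2) • (c * d)
  ac : a * c = (P.lam * P.q ^ 2 / P.dd) • (b * u) + (P.lam * θ) • b
  bd : b * d = (P.lam * P.q ^ 2 / P.dd) • (u * c) + (P.lam * θ) • c
  ca : c * a = (P.lam * P.q⁻¹ ^ 4 / P.dd) • (b * u) + (P.lam * P.q⁻¹ ^ 2 * θ) • b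
  db : d * b = (P.lam * P.q⁻¹ ^ 4 / P.dd) • (u * c) + (P.lam * P.q⁻¹ ^ 2 * θ) • c
  bc : b * c = (P.lam * P.q ^ 4 / P.dd) • (u * u) + (P.lam * P.q ^ 2 * θ) • u +
    (P.t ^ 3 / P.dd) • W
  cb : c * b = (P.lam / P.dd) • (u * u) + (P.lam * θ) • u - (P.t / P.dd) • W
  ad : a * d = (P.lam ^ 2 * P.q ^ 4 / P.dd ^ 2) • (u * u) +
    (P.lam ^ 2 * (P.q ^ 2 + 1) / P.dd * θ) • u + (P.lam ^ 2 * P.q⁻¹ ^ 2 * θ ^ 2) • 1 +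
    ((P.q - 1) ^ 2 * (P.q ^ 3 + P.q ^ 2 + 1) * P.q⁻¹ ^ 4 / P.dd ^ 2) • W
  da : d * a = (P.lam ^ 2 * P.q⁻¹ ^ 4 / P.dd ^ 2) • (u * u) +
    (P.lam ^ 2 * (P.q ^ 2 + 1) * P.q⁻¹ ^ 4 / P.dd * θ) • u + (P.lam ^ 2 * P.q⁻¹ ^ 2 * θ ^ 2) • 1 +
    ((P.q - 1) ^ 2 * (P.q ^ 3 + P.q + 1) * P.q⁻¹ ^ 5 / P.dd ^ 2) • W

set_option maxHeartbeats 1000000 in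
/-- The regrouped relations imply the reordering rules. -/
lemma reorder_of_relations (P : Param) (ξ : ℂ) {A : Type} [Ring A] [Algebra ℂ A] (y : Fin 5 → A)
    (hC : ∀ i, Deg2.eval y (Deg2.commRel₂ P ξ i) = 0)
    (hS : ∀ i, Deg2.eval y (Deg2.sqRel₂ P ξ i) = 0)
    (hK : ∀ i, Deg2.eval y (Deg2.constrRel₂ P ξ i) = 0) :
    Reorder P (P.theta ξ) (P.scl • y 0) (y 1) (y 2 - P.theta ξ • 1) (y 3) (P.scl • y 4)
      (Deg2.eval y (Deg2.hw P 0 (radiusOf P ξ) 0)) := by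
  have h0 := P.t_ne
  have h1 := P.k1_sq'
  have h2 := P.k2_sq'
  have h3 := P.k2_ne
  have h4 := P.k1_ne
  have h5 : P.t ^ 2 - 1 ≠ 0 := P.q_sub_one_ne
  have hd : P.dd = P.t ^ 4 * P.k2 ^ 2 := by rw [Param.dd_eq, Param.q]; ring
  have hθ : chi P ξ = P.theta ξ * (P.t ^ 2 - 1) / P.t ^ 4 := by
    rw [Param.theta, Param.q]; field_simp
  have hr : radiusOf P ξ = P.theta ξ ^ 2 * (P.t ^ 2 - 1) ^ 2 / P.t ^ 2 := by
    rw [radiusOf_eq, Param.q]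
  generalize P.theta ξ = θ at *
  have c0 := hC 0
  have c1 := hC 1
  have c2 := hC 2
  have c3 := hC 3
  have c4 := hC 4
  have c5 := hC 5
  have c6 := hC 6
  have c7 := hC 7
  have c8 := hC 8
  have c9 := hC 9
  have s0 := hS 0
  have s1 := hS 1
  have k0 := hK 0
  have k1 := hK 1
  have k2 := hK 2
  simp only [Deg2.commRel₂, Deg2.sqRel₂, Deg2.constrRel₂, Matrix.cons_val, map_sub, map_add,
    map_smul, Deg2.eval_e2, Deg2.eval_e1, hθ, Param.q, Param.k3] at c0 c1 c2 c3 c4 c5 c6 c7 c8 c9 s0 s1 k0 k1 k2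
  constructor
  · simp only [Param.scl, Param.q, Param.lam, hd, smul_mul_assoc, mul_smul_comm, mul_sub, sub_mul,
      mul_one, one_mul, smul_sub]
    linear_combination (norm := skip) s0
    clear c0 c1 c2 c3 c4 c5 c6 c7 c8 c9 s0 s1 k0 k1 k2 hθ hr hd hC hS hK
    match_scalars <;> field_simp <;> grind
  · simp only [Param.scl, Param.q, Param.lam, hd, smul_mul_assoc, mul_smul_comm, mul_sub, sub_mul,
      mul_one, one_mul, smul_sub]
    linear_combination (norm := skip) s1
    clear c0 c1 c2 c3 c4 c5 c6 c7 c8 c9 s0 s1 k0 k1 k2 hθ hr hd hC hS hK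
    match_scalars <;> field_simp <;> grind
  · simp only [Param.scl, Param.q, Param.lam, hd, smul_mul_assoc, mul_smul_comm, mul_sub, sub_mul,
      mul_one, one_mul, smul_sub]
    linear_combination (norm := skip) (P.k1 / P.k2 * P.t⁻¹ ^ 5 * (P.t ^ 2 - 1)) • c1
    clear c0 c1 c2 c3 c4 c5 c6 c7 c8 c9 s0 s1 k0 k1 k2 hθ hr hd hC hS hK
    match_scalars <;> field_simp <;> grind
  · simp only [Param.scl, Param.q, Param.lam, hd, smul_mul_assoc, mul_smul_comm, mul_sub, sub_mul,
      mul_one, one_mul, smul_sub]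
    linear_combination (norm := skip) c4
    clear c0 c1 c2 c3 c4 c5 c6 c7 c8 c9 s0 s1 k0 k1 k2 hθ hr hd hC hS hK
    match_scalars <;> field_simp <;> grind
  · simp only [Param.scl, Param.q, Param.lam, hd, smul_mul_assoc, mul_smul_comm, mul_sub, sub_mul,
      mul_one, one_mul, smul_sub]
    linear_combination (norm := skip) c7
    clear c0 c1 c2 c3 c4 c5 c6 c7 c8 c9 s0 s1 k0 k1 k2 hθ hr hd hC hS hK
    match_scalars <;> field_simp <;> grind
  · simp only [Param.scl, Param.q, Param.lam, hd, smul_mul_assoc, mul_smul_comm, mul_sub, sub_mul,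
      mul_one, one_mul, smul_sub]
    linear_combination (norm := skip) (P.k1 / P.k2 * P.t⁻¹ ^ 5 * (P.t ^ 2 - 1)) • c8
    clear c0 c1 c2 c3 c4 c5 c6 c7 c8 c9 s0 s1 k0 k1 k2 hθ hr hd hC hS hK
    match_scalars <;> field_simp <;> grind
  · simp only [Param.scl, Param.q, Param.lam, hd, smul_mul_assoc, mul_smul_comm, mul_sub, sub_mul,
      mul_one, one_mul, smul_sub]
    linear_combination (norm := skip) (P.k1 / P.k2 * P.t⁻¹ ^ 5 * (P.t ^ 2 - 1)) • c0
    clear c0 c1 c2 c3 c4 c5 c6 c7 c8 c9 s0 s1 k0 k1 k2 hθ hr hd hC hS hK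
    match_scalars <;> field_simp <;> grind
  · simp only [Param.scl, Param.q, Param.lam, hd, smul_mul_assoc, mul_smul_comm, mul_sub, sub_mul,
      mul_one, one_mul, smul_sub]
    linear_combination (norm := skip) (P.k1 / P.k2 * P.t⁻¹ ^ 5 * (P.t ^ 2 - 1)) • c9
    clear c0 c1 c2 c3 c4 c5 c6 c7 c8 c9 s0 s1 k0 k1 k2 hθ hr hd hC hS hK
    match_scalars <;> field_simp <;> grind
  · simp only [Param.scl, Param.q, Param.lam, hd, smul_mul_assoc, mul_smul_comm, mul_sub, sub_mul,
      mul_one, one_mul, smul_sub]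
    linear_combination (norm := skip) (-((P.k1 / P.k2 * P.t⁻¹ ^ 5 * (P.t ^ 2 - 1)) * P.t ^ 2 / (P.k1 * P.k2))) • k0
    clear c0 c1 c2 c3 c4 c5 c6 c7 c8 c9 s0 s1 k0 k1 k2 hθ hr hd hC hS hK
    match_scalars <;> field_simp <;> grind
  · simp only [Param.scl, Param.q, Param.lam, hd, smul_mul_assoc, mul_smul_comm, mul_sub, sub_mul,
      mul_one, one_mul, smul_sub]
    linear_combination (norm := skip) (-((P.k1 / P.k2 * P.t⁻¹ ^ 5 * (P.t ^ 2 - 1)) * P.t ^ 2 / (P.k1 * P.k2))) • k2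
    clear c0 c1 c2 c3 c4 c5 c6 c7 c8 c9 s0 s1 k0 k1 k2 hθ hr hd hC hS hK
    match_scalars <;> field_simp <;> grind
  · simp only [Param.scl, Param.q, Param.lam, hd, smul_mul_assoc, mul_smul_comm, mul_sub, sub_mul,
      mul_one, one_mul, smul_sub]
    linear_combination (norm := skip) (P.k1 / P.k2 * P.t⁻¹ ^ 5 * (P.t ^ 2 - 1)) • c2 - (P.t⁻¹ ^ 12 * ((P.k1 / P.k2 * P.t⁻¹ ^ 5 * (P.t ^ 2 - 1)) * P.t ^ 2 / (P.k1 * P.k2))) • k0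
    clear c0 c1 c2 c3 c4 c5 c6 c7 c8 c9 s0 s1 k0 k1 k2 hθ hr hd hC hS hK
    match_scalars <;> field_simp <;> grind
  · simp only [Param.scl, Param.q, Param.lam, hd, smul_mul_assoc, mul_smul_comm, mul_sub, sub_mul,
      mul_one, one_mul, smul_sub]
    linear_combination (norm := skip) (P.k1 / P.k2 * P.t⁻¹ ^ 5 * (P.t ^ 2 - 1)) • c6 - (P.t⁻¹ ^ 12 * ((P.k1 / P.k2 * P.t⁻¹ ^ 5 * (P.t ^ 2 - 1)) * P.t ^ 2 / (P.k1 * P.k2))) • k2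
    clear c0 c1 c2 c3 c4 c5 c6 c7 c8 c9 s0 s1 k0 k1 k2 hθ hr hd hC hS hK
    match_scalars <;> field_simp <;> grind
  -- Weight zero: there are five quadratic monomials and three relations `c3`, `c5`, `k1`, so
  -- everything can be expressed through u², u, 1 and W. The coefficients here and in the next three
  -- cases solve this linear system.
  · simp only [Deg2.hw_zero, map_sub, map_add, map_smul, Deg2.eval_e2, Deg2.eval_e0, hr, Param.scl,
      Param.q, Param.lam, hd, smul_mul_assoc, mul_smul_comm, mul_sub, sub_mul, mul_one, one_mul,
      smul_sub]
    linear_combination (norm := skip) (-P.t ^ 4 / (P.t ^ 4 * P.k2 ^ 2)) • c5 + (-P.t ^ 5 / (P.t ^ 4 * P.k2 ^ 2)) • c3 +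
      (((P.t - P.t ^ 5 * ((P.t ^ 10 - P.t ^ 2 - 1) * P.t⁻¹ ^ 8)) / (P.t ^ 4 * P.k2 ^ 2)) / P.k1 ^ 2) • k1
    clear c0 c1 c2 c3 c4 c5 c6 c7 c8 c9 s0 s1 k0 k1 k2 hθ hr hd hC hS hK
    match_scalars <;> field_simp <;> grind
  · simp only [Deg2.hw_zero, map_sub, map_add, map_smul, Deg2.eval_e2, Deg2.eval_e0, hr, Param.scl,
      Param.q, Param.lam, hd, smul_mul_assoc, mul_smul_comm, mul_sub, sub_mul, mul_one, one_mul,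
      smul_sub]
    linear_combination (norm := skip) (1 + P.t ^ 2 / (P.t ^ 4 * P.k2 ^ 2)) • c5 + (P.t ^ 3 / (P.t ^ 4 * P.k2 ^ 2)) • c3 +
      (((P.t ^ 3 * ((P.t ^ 10 - P.t ^ 2 - 1) * P.t⁻¹ ^ 8) - P.t⁻¹) / (P.t ^ 4 * P.k2 ^ 2)) / P.k1 ^ 2) • k1
    clear c0 c1 c2 c3 c4 c5 c6 c7 c8 c9 s0 s1 k0 k1 k2 hθ hr hd hC hS hK
    match_scalars <;> field_simp <;> grind
  · simp only [Deg2.hw_zero, map_sub, map_add, map_smul, Deg2.eval_e2, Deg2.eval_e0, hr, Param.scl,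
      Param.q, Param.lam, hd, smul_mul_assoc, mul_smul_comm, mul_sub, sub_mul, mul_one, one_mul,
      smul_sub]
    linear_combination (norm := skip) (-((P.t ^ 2 - 1) ^ 2 * (P.t ^ 6 + P.t ^ 4 + 1) * P.t⁻¹ ^ 8 / (P.t ^ 4 * P.k2 ^ 2) ^ 2) * P.t) • c5 + (-((P.t ^ 2 - 1) ^ 2 * (P.t ^ 6 + P.t ^ 4 + 1) * P.t⁻¹ ^ 8 / (P.t ^ 4 * P.k2 ^ 2) ^ 2) * P.t ^ 2) • c3 +
      ((-(P.k1 / P.k2 * P.t⁻¹ ^ 5 * (P.t ^ 2 - 1)) ^ 2 + ((P.t ^ 2 - 1) ^ 2 * (P.t ^ 6 + P.t ^ 4 + 1) * P.t⁻¹ ^ 8 / (P.t ^ 4 * P.k2 ^ 2) ^ 2) * P.t⁻¹ ^ 2 - ((P.t ^ 2 - 1) ^ 2 * (P.t ^ 6 + P.t ^ 4 + 1) * P.t⁻¹ ^ 8 / (P.t ^ 4 * P.k2 ^ 2) ^ 2) * P.t ^ 2 * ((P.t ^ 10 - P.t ^ 2 - 1) * P.t⁻¹ ^ 8)) / P.k1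 ^ 2) • k1
    clear c0 c1 c2 c3 c4 c5 c6 c7 c8 c9 s0 s1 k0 k1 k2 hθ hr hd hC hS hK
    match_scalars <;> field_simp <;> grind
  · simp only [Deg2.hw_zero, map_sub, map_add, map_smul, Deg2.eval_e2, Deg2.eval_e0, hr, Param.scl,
      Param.q, Param.lam, hd, smul_mul_assoc, mul_smul_comm, mul_sub, sub_mul, mul_one, one_mul,
      smul_sub]
    linear_combination (norm := skip) (-((P.t ^ 2 - 1) ^ 2 * (P.t ^ 6 + P.t ^ 2 + 1) * P.t⁻¹ ^ 10 / (P.t ^ 4 * P.k2 ^ 2) ^ 2) * P.t) • c5 + ((P.k1 / P.k2 * P.t⁻¹ ^ 5 * (P.t ^ 2 - 1)) ^ 2 - ((P.t ^ 2 - 1) ^ 2 * (P.t ^ 6 + P.t ^ 2 + 1) * P.t⁻¹ ^ 10 / (P.t ^ 4 * P.k2 ^ 2) ^ 2) * P.t ^ 2) • c3 +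
      ((((P.k1 / P.k2 * P.t⁻¹ ^ 5 * (P.t ^ 2 - 1)) ^ 2 - ((P.t ^ 2 - 1) ^ 2 * (P.t ^ 6 + P.t ^ 2 + 1) * P.t⁻¹ ^ 10 / (P.t ^ 4 * P.k2 ^ 2) ^ 2) * P.t ^ 2) * ((P.t ^ 10 - P.t ^ 2 - 1) * P.t⁻¹ ^ 8) + ((P.t ^ 2 - 1) ^ 2 * (P.t ^ 6 + P.t ^ 2 + 1) * P.t⁻¹ ^ 10 / (P.t ^ 4 * P.k2 ^ 2) ^ 2) * P.t⁻¹ ^ 2) / P.k1 ^ 2) • k1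
    clear c0 c1 c2 c3 c4 c5 c6 c7 c8 c9 s0 s1 k0 k1 k2 hθ hr hd hC hS hK
    match_scalars <;> field_simp <;> grind

end QSphere

namespace QSphere
open SuperAlg

namespace Reorder
variable {P : Param} {θ : ℂ} {A : Type} [Ring A] [Algebra ℂ A] {a b u c d W : A}

lemma au (h : Reorder P θ a b u c d W) : a * u = (P.q ^ 4) • (u * a) := by
  rw [h.ua, smul_smul, ← mul_pow, mul_inv_cancel₀ P.q_ne, one_pow, one_smul]

lemma bu (h : Reorder P θ a b u c d W) : b * u = (P.q ^ 2) • (u * b) := by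
  rw [h.ub, smul_smul, ← mul_pow, mul_inv_cancel₀ P.q_ne, one_pow, one_smul]

lemma uc (h : Reorder P θ a b u c d W) : u * c = (P.q ^ 2) • (c * u) := by
  rw [h.cu, smul_smul, ← mul_pow, mul_inv_cancel₀ P.q_ne, one_pow, one_smul]

lemma ab (h : Reorder P θ a b u c d W) : a * b = (P.q ^ 2) • (b * a) := by
  rw [h.ba, smul_smul, ← mul_pow, mul_inv_cancel₀ P.q_ne, one_pow, one_smul]

lemma cd (h : Reorder P θ a b u c d W) : c * d = (P.q ^ 2) • (d * c) := by
  rw [h.dc, smul_smul, ← mul_pow, mul_inv_cancel₀ P.q_ne, one_pow, one_smul]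

lemma smul_cancel {s : ℂ} (hs : s ≠ 0) {x : A} (hx : s • x = 0) : x = 0 :=
  (smul_eq_zero.1 hx).resolve_left hs

lemma t3_ne (P : Param) : P.t ^ 3 / P.dd ≠ 0 := div_ne_zero (pow_ne_zero _ P.t_ne) P.dd_ne

/-- A triple product is evaluated in two ways, here b b c. The terms without W agree, and a nonzero
multiple of b W remains. The following lemmas use the words b c c, a b c, b c d, b c b, c b c, u b
c, b c a and d b c in the same way. -/
lemma bW (h : Reorder P θ a b u c d W) : b * W = 0 := by
  have e : b * (b * c) = b * b * c := (mul_assoc _ _ _).symm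
  rw [h.bc, h.bb, mul_assoc a u c, h.uc, mul_smul_comm, ← mul_assoc a c u, h.ac] at e
  simp only [mul_add, add_mul, mul_smul_comm, smul_mul_assoc, mul_assoc] at e
  refine smul_cancel (t3_ne P) ?_
  linear_combination (norm := module) e

lemma Wc (h : Reorder P θ a b u c d W) : W * c = 0 := by
  have e : b * c * c = b * (c * c) := mul_assoc _ _ _
  rw [h.bc, h.cc, ← mul_assoc b u d, h.bu, smul_mul_assoc, mul_assoc u b d, h.bd] at e
  simp only [mul_add, add_mul, mul_smul_comm, smul_mul_assoc, mul_assoc] at e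
  refine smul_cancel (t3_ne P) ?_
  linear_combination (norm := module) e

lemma aW (h : Reorder P θ a b u c d W) : a * W = 0 := by
  have e : a * (b * c) = a * b * c := (mul_assoc _ _ _).symm
  rw [h.bc, h.ab, smul_mul_assoc, mul_assoc b a c, h.ac] at e
  simp only [mul_add, add_mul, mul_smul_comm, smul_mul_assoc, ← mul_assoc, h.bb] at e
  refine smul_cancel (t3_ne P) ?_
  linear_combination (norm := module) e

lemma Wd (h : Reorder P θ a b u c d W) : W * d = 0 := by
  have e : b * c * d = b * (c * d) := mul_assoc _ _ _
  rw [h.bc, h.cd, mul_smul_comm, ← mul_assoc b d c, h.bd] at e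
  simp only [mul_add, add_mul, mul_smul_comm, smul_mul_assoc, mul_assoc, h.cc] at e
  refine smul_cancel (t3_ne P) ?_
  linear_combination (norm := module) e

lemma Wb (h : Reorder P θ a b u c d W) : W * b = 0 := by
  have e : b * c * b = b * (c * b) := mul_assoc _ _ _
  rw [h.bc, h.cb, mul_sub, mul_smul_comm _ _ W, h.bW] at e
  simp only [mul_add, add_mul, mul_smul_comm, smul_mul_assoc, mul_assoc, h.ub] at e
  simp only [← mul_assoc, h.ub, smul_mul_assoc] at e
  refine smul_cancel (t3_ne P) ?_
  have hq := P.q_ne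
  linear_combination (norm := skip) e
  match_scalars <;> field_simp <;> ring

lemma cW (h : Reorder P θ a b u c d W) : c * W = 0 := by
  have e : c * (b * c) = c * b * c := (mul_assoc _ _ _).symm
  rw [h.bc, h.cb, sub_mul, smul_mul_assoc _ W, h.Wc] at e
  simp only [mul_add, add_mul, mul_smul_comm, smul_mul_assoc, ← mul_assoc, h.cu] at e
  simp only [mul_assoc, h.cu, mul_smul_comm] at e
  refine smul_cancel (t3_ne P) ?_
  have hq := P.q_ne
  linear_combination (norm := skip) e
  match_scalars <;> field_simp <;> ring

lemma Wu (h : Reorder P θ a b u c d W) : W * u = u * W := by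
  have e : u * (b * c) = b * c * u := by
    rw [← mul_assoc, h.ub, smul_mul_assoc, mul_assoc b u c, h.uc, mul_smul_comm, smul_smul,
      ← mul_pow, inv_mul_cancel₀ P.q_ne, one_pow, one_smul, mul_assoc]
  rw [h.bc] at e
  simp only [mul_add, add_mul, mul_smul_comm, smul_mul_assoc, ← mul_assoc] at e
  rw [← sub_eq_zero]
  refine smul_cancel (t3_ne P) ?_
  linear_combination (norm := module) -e

lemma Wa (h : Reorder P θ a b u c d W) : W * a = 0 := by
  have e : b * c * a = b * (c * a) := mul_assoc _ _ _
  rw [h.bc, h.ca] at e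
  simp only [mul_add, add_mul, mul_smul_comm, smul_mul_assoc, mul_assoc, h.ua] at e
  simp only [← mul_assoc, h.ua, h.bb, smul_mul_assoc] at e
  refine smul_cancel (t3_ne P) ?_
  have hq := P.q_ne
  linear_combination (norm := skip) e
  match_scalars <;> field_simp <;> ring

lemma dW (h : Reorder P θ a b u c d W) : d * W = 0 := by
  have e : d * (b * c) = d * b * c := (mul_assoc _ _ _).symm
  rw [h.bc, h.db] at e
  simp only [mul_add, add_mul, mul_smul_comm, smul_mul_assoc, ← mul_assoc, h.du] at e
  simp only [mul_assoc, h.du, h.cc, mul_smul_comm] at e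
  refine smul_cancel (t3_ne P) ?_
  have hq := P.q_ne
  linear_combination (norm := skip) e
  match_scalars <;> field_simp <;> ring

end Reorder

/-- In an algebra satisfying the relations of degree two apart from the radius relation, the
difference between the invariant and its consistent value is central, and it is annihilated by the
coordinates of nonzero weight. -/
lemma commute_invariant (P : Param) (ξ : ℂ) {A : Type} [Ring A] [Algebra ℂ A] (y : Fin 5 → A)
    (hC : ∀ i, Deg2.eval y (Deg2.commRel₂ P ξ i) = 0)
    (hS : ∀ i, Deg2.eval y (Deg2.sqRel₂ P ξ i) = 0)
    (hK : ∀ i, Deg2.eval y (Deg2.constrRel₂ P ξ i) = 0) (m : Fin 5) :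
    Commute (Deg2.eval y (Deg2.hw P 0 (radiusOf P ξ) 0)) (y m) := by
  have h := reorder_of_relations P ξ y hC hS hK
  have hs := P.scl_ne
  generalize Deg2.eval y (Deg2.hw P 0 (radiusOf P ξ) 0) = W at h ⊢
  have ha := h.Wa
  have ha' := h.aW
  have hd := h.Wd
  have hd' := h.dW
  have hu := h.Wu
  simp only [mul_smul_comm, smul_mul_assoc, smul_eq_zero, hs, false_or] at ha ha' hd hd'
  rw [mul_sub, sub_mul, mul_smul_comm, smul_mul_assoc, mul_one, one_mul] at hu
  fin_cases m
  · exact ha.trans ha'.symm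
  · exact h.Wb.trans h.bW.symm
  · exact sub_left_injective hu
  · exact h.Wc.trans h.cW.symm
  · exact hd.trans hd'.symm
end QSphere

namespace QSphere
open SuperAlg

/-! ### Reduction of products to ordered products -/

section Adjoin
variable {A : Type} [Ring A] [Algebra ℂ A] {u x : A} {s : ℂ}

lemma self_mem_adjoin (u : A) : u ∈ Algebra.adjoin ℂ {u} := Algebra.subset_adjoin rfl

lemma adjoin_mul_swap (h : u * x = s • (x * u)) {p : A} (hp : p ∈ Algebra.adjoin ℂ {u}) :
    ∃ p' ∈ Algebra.adjoin ℂ {u}, p * x = x * p' := by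
  induction hp using Algebra.adjoin_induction with
  | mem y hy =>
    rw [Set.mem_singleton_iff.1 hy]
    exact ⟨s • u, Subalgebra.smul_mem _ (self_mem_adjoin u) s, by rw [h, mul_smul_comm]⟩
  | algebraMap r => exact ⟨_, Subalgebra.algebraMap_mem _ r, Algebra.commutes r x⟩
  | add y z _ _ hy hz =>
    obtain ⟨y', hy1, hy2⟩ := hy
    obtain ⟨z', hz1, hz2⟩ := hz
    exact ⟨y' + z', add_mem hy1 hz1, by rw [add_mul, hy2, hz2, mul_add]⟩
  | mul y z _ _ hy hz =>
    obtain ⟨y', hy1, hy2⟩ := hy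
    obtain ⟨z', hz1, hz2⟩ := hz
    exact ⟨y' * z', mul_mem hy1 hz1, by rw [mul_assoc, hz2, ← mul_assoc, hy2, mul_assoc]⟩

lemma mul_adjoin_swap (h : x * u = s • (u * x)) {p : A} (hp : p ∈ Algebra.adjoin ℂ {u}) :
    ∃ p' ∈ Algebra.adjoin ℂ {u}, x * p = p' * x := by
  induction hp using Algebra.adjoin_induction with
  | mem y hy =>
    rw [Set.mem_singleton_iff.1 hy]
    exact ⟨s • u, Subalgebra.smul_mem _ (self_mem_adjoin u) s, by rw [h, smul_mul_assoc]⟩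
  | algebraMap r => exact ⟨_, Subalgebra.algebraMap_mem _ r, (Algebra.commutes r x).symm⟩
  | add y z _ _ hy hz =>
    obtain ⟨y', hy1, hy2⟩ := hy
    obtain ⟨z', hz1, hz2⟩ := hz
    exact ⟨y' + z', add_mem hy1 hz1, by rw [mul_add, hy2, hz2, add_mul]⟩
  | mul y z _ _ hy hz =>
    obtain ⟨y', hy1, hy2⟩ := hy
    obtain ⟨z', hz1, hz2⟩ := hz
    exact ⟨y' * z', mul_mem hy1 hz1, by rw [← mul_assoc, hy2, mul_assoc, hz2, ← mul_assoc]⟩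

end Adjoin

/-- The span of the ordered products `aⁱ bᵉ p` and `p cᵉ dⁱ`, where `p` is a polynomial in `u`. -/
def ordered {A : Type} [Ring A] [Algebra ℂ A] (a b u c d : A) : Submodule ℂ A :=
  Submodule.span ℂ ({x | ∃ i e : ℕ, ∃ p ∈ Algebra.adjoin ℂ {u}, x = a ^ i * b ^ e * p} ∪
    {x | ∃ i e : ℕ, ∃ p ∈ Algebra.adjoin ℂ {u}, x = p * (c ^ e * d ^ i)})

section Ordered
variable {A : Type} [Ring A] [Algebra ℂ A] {a b u c d : A}

lemma left_mem_ordered (i e : ℕ) {p : A} (hp : p ∈ Algebra.adjoin ℂ {u}) :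
    a ^ i * b ^ e * p ∈ ordered a b u c d :=
  Submodule.subset_span (.inl ⟨i, e, p, hp, rfl⟩)

lemma right_mem_ordered (i e : ℕ) {p : A} (hp : p ∈ Algebra.adjoin ℂ {u}) :
    p * (c ^ e * d ^ i) ∈ ordered a b u c d :=
  Submodule.subset_span (.inr ⟨i, e, p, hp, rfl⟩)

lemma map_ordered {N : Submodule ℂ A} (L : A →ₗ[ℂ] A)
    (h1 : ∀ i e : ℕ, ∀ p ∈ Algebra.adjoin ℂ {u}, L (a ^ i * b ^ e * p) ∈ N)
    (h2 : ∀ i e : ℕ, ∀ p ∈ Algebra.adjoin ℂ {u}, L (p * (c ^ e * d ^ i)) ∈ N)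
    {f : A} (hf : f ∈ ordered a b u c d) : L f ∈ N := by
  have : ordered a b u c d ≤ N.comap L := by
    rw [ordered, Submodule.span_le]
    rintro _ (⟨i, e, p, hp, rfl⟩ | ⟨i, e, p, hp, rfl⟩)
    · exact h1 i e p hp
    · exact h2 i e p hp
  exact this hf

end Ordered

namespace Reorder
variable {P : Param} {θ : ℂ} {A : Type} [Ring A] [Algebra ℂ A] {a b u c d W : A}

lemma swap_left (h : Reorder P θ a b u c d W) (i e : ℕ) {p : A} (hp : p ∈ Algebra.adjoin ℂ {u}) :
    ∃ p' ∈ Algebra.adjoin ℂ {u}, p * (a ^ i * b ^ e) = a ^ i * b ^ e * p' := by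
  obtain ⟨p1, hp1, e1⟩ := adjoin_mul_swap (qcomm_pow_right h.ua i) hp
  obtain ⟨p2, hp2, e2⟩ := adjoin_mul_swap (qcomm_pow_right h.ub e) hp1
  exact ⟨p2, hp2, by rw [← mul_assoc, e1, mul_assoc, e2, mul_assoc]⟩

lemma swap_right (h : Reorder P θ a b u c d W) (i e : ℕ) {p : A} (hp : p ∈ Algebra.adjoin ℂ {u}) :
    ∃ p' ∈ Algebra.adjoin ℂ {u}, c ^ e * d ^ i * p = p' * (c ^ e * d ^ i) := by
  obtain ⟨p1, hp1, e1⟩ := mul_adjoin_swap (qcomm_pow_left h.du i) hp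
  obtain ⟨p2, hp2, e2⟩ := mul_adjoin_swap (qcomm_pow_left h.cu e) hp1
  exact ⟨p2, hp2, by rw [mul_assoc, e1, ← mul_assoc, e2, mul_assoc]⟩

lemma adjoin_mul_ordered (h : Reorder P θ a b u c d W) {p f : A} (hp : p ∈ Algebra.adjoin ℂ {u})
    (hf : f ∈ ordered a b u c d) : p * f ∈ ordered a b u c d := by
  refine map_ordered (LinearMap.mulLeft ℂ p) (fun i e p' hp' => ?_) (fun i e p' hp' => ?_) hf
  · obtain ⟨p2, hp2, e2⟩ := h.swap_left i e hp
    rw [LinearMap.mulLeft_apply, ← mul_assoc, e2, mul_assoc]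
    exact left_mem_ordered _ _ (mul_mem hp2 hp')
  · rw [LinearMap.mulLeft_apply, ← mul_assoc]
    exact right_mem_ordered _ _ (mul_mem hp hp')

lemma ordered_mul_adjoin (h : Reorder P θ a b u c d W) {p f : A} (hp : p ∈ Algebra.adjoin ℂ {u})
    (hf : f ∈ ordered a b u c d) : f * p ∈ ordered a b u c d := by
  refine map_ordered (LinearMap.mulRight ℂ p) (fun i e p' hp' => ?_) (fun i e p' hp' => ?_) hf
  · rw [LinearMap.mulRight_apply, mul_assoc]
    exact left_mem_ordered _ _ (mul_mem hp' hp)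
  · obtain ⟨p2, hp2, e2⟩ := h.swap_right i e hp
    rw [LinearMap.mulRight_apply, mul_assoc, e2, ← mul_assoc]
    exact right_mem_ordered _ _ (mul_mem hp' hp2)

/-- Only the shape of the rules matters from here on: a product of a letter of positive weight with
one of negative weight is a polynomial in u, possibly times a single odd letter. -/
lemma ac' (h : Reorder P θ a b u c d W) : ∃ p ∈ Algebra.adjoin ℂ {u}, a * c = p * b :=
  ⟨(P.lam * P.q ^ 2 / P.dd * P.q ^ 2) • u + (P.lam * θ) • 1,
    add_mem (Subalgebra.smul_mem _ (self_mem_adjoin u) _) (Subalgebra.smul_mem _ (one_mem _) _),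
    by rw [h.ac, h.bu, add_mul, smul_smul, smul_mul_assoc, smul_mul_assoc, one_mul]⟩

lemma ca' (h : Reorder P θ a b u c d W) : ∃ p ∈ Algebra.adjoin ℂ {u}, c * a = p * b :=
  ⟨(P.lam * P.q⁻¹ ^ 4 / P.dd * P.q ^ 2) • u + (P.lam * P.q⁻¹ ^ 2 * θ) • 1,
    add_mem (Subalgebra.smul_mem _ (self_mem_adjoin u) _) (Subalgebra.smul_mem _ (one_mem _) _),
    by rw [h.ca, h.bu, add_mul, smul_smul, smul_mul_assoc, smul_mul_assoc, one_mul]⟩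

lemma bd' (h : Reorder P θ a b u c d W) : ∃ p ∈ Algebra.adjoin ℂ {u}, b * d = p * c :=
  ⟨(P.lam * P.q ^ 2 / P.dd) • u + (P.lam * θ) • 1,
    add_mem (Subalgebra.smul_mem _ (self_mem_adjoin u) _) (Subalgebra.smul_mem _ (one_mem _) _),
    by rw [h.bd, add_mul, smul_mul_assoc, smul_mul_assoc, one_mul]⟩

lemma db' (h : Reorder P θ a b u c d W) : ∃ p ∈ Algebra.adjoin ℂ {u}, d * b = p * c :=
  ⟨(P.lam * P.q⁻¹ ^ 4 / P.dd) • u + (P.lam * P.q⁻¹ ^ 2 * θ) • 1,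
    add_mem (Subalgebra.smul_mem _ (self_mem_adjoin u) _) (Subalgebra.smul_mem _ (one_mem _) _),
    by rw [h.db, add_mul, smul_mul_assoc, smul_mul_assoc, one_mul]⟩

lemma quadratic_mem (u : A) (x y z : ℂ) :
    x • (u * u) + y • u + z • 1 ∈ Algebra.adjoin ℂ {u} :=
  add_mem (add_mem (Subalgebra.smul_mem _ (mul_mem (self_mem_adjoin u) (self_mem_adjoin u)) _)
    (Subalgebra.smul_mem _ (self_mem_adjoin u) _)) (Subalgebra.smul_mem _ (one_mem _) _)

lemma bc' (h : Reorder P θ a b u c d 0) : b * c ∈ Algebra.adjoin ℂ {u} := by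
  have := quadratic_mem u (P.lam * P.q ^ 4 / P.dd) (P.lam * P.q ^ 2 * θ) 0
  rwa [h.bc, smul_zero, ← zero_smul ℂ (1 : A)]

lemma cb' (h : Reorder P θ a b u c d 0) : c * b ∈ Algebra.adjoin ℂ {u} := by
  have := quadratic_mem u (P.lam / P.dd) (P.lam * θ) 0
  rwa [h.cb, smul_zero, sub_zero, ← add_zero (_ + _), ← zero_smul ℂ (1 : A)]

lemma ad' (h : Reorder P θ a b u c d 0) : a * d ∈ Algebra.adjoin ℂ {u} := by
  rw [h.ad, smul_zero, add_zero]; exact quadratic_mem u _ _ _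

lemma da' (h : Reorder P θ a b u c d 0) : d * a ∈ Algebra.adjoin ℂ {u} := by
  rw [h.da, smul_zero, add_zero]; exact quadratic_mem u _ _ _

lemma b_mul_right (h : Reorder P θ a b u c d 0) (e i : ℕ) :
    b * (c ^ e * d ^ i) ∈ ordered a b u c d := by
  rcases e with _ | e
  · rcases i with _ | i
    · simpa using left_mem_ordered (a := a) (b := b) (c := c) (d := d) 0 1 (one_mem (Algebra.adjoin ℂ {u}))
    · obtain ⟨p, hp, hbd⟩ := h.bd'
      rw [pow_zero, one_mul, pow_succ', ← mul_assoc, hbd, mul_assoc]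
      simpa using right_mem_ordered (a := a) (b := b) (c := c) (d := d) i 1 hp
  · rw [pow_succ', mul_assoc, ← mul_assoc]
    exact right_mem_ordered _ _ h.bc'

lemma a_mul_right (h : Reorder P θ a b u c d 0) (e i : ℕ) :
    a * (c ^ e * d ^ i) ∈ ordered a b u c d := by
  rcases e with _ | e
  · rcases i with _ | i
    · simpa using left_mem_ordered (a := a) (b := b) (c := c) (d := d) 1 0 (one_mem (Algebra.adjoin ℂ {u}))
    · rw [pow_zero, one_mul, pow_succ', ← mul_assoc]
      simpa using right_mem_ordered (a := a) (b := b) (c := c) (d := d) i 0 h.ad'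
  · obtain ⟨p, hp, hac⟩ := h.ac'
    rw [pow_succ', mul_assoc, ← mul_assoc, hac, mul_assoc]
    exact h.adjoin_mul_ordered hp (h.b_mul_right _ _)

lemma ba_pow (h : Reorder P θ a b u c d W) (i e : ℕ) :
    b * (a ^ i * b ^ e) = (P.q⁻¹ ^ 2) ^ i • (a ^ i * b ^ (e + 1)) := by
  rw [← mul_assoc, qcomm_pow_right h.ba, smul_mul_assoc, mul_assoc, pow_succ' b]

lemma dc_pow (h : Reorder P θ a b u c d W) (i e : ℕ) :
    d * (c ^ e * d ^ i) = (P.q⁻¹ ^ 2) ^ e • (c ^ e * d ^ (i + 1)) := by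
  rw [← mul_assoc, qcomm_pow_right h.dc, smul_mul_assoc, mul_assoc, pow_succ' d]

lemma left_mem_ordered' (i e : ℕ) : a ^ i * b ^ e ∈ ordered a b u c d := by
  simpa using left_mem_ordered (a := a) (b := b) (c := c) (d := d) i e
    (one_mem (Algebra.adjoin ℂ {u}))

lemma right_mem_ordered' (i e : ℕ) : c ^ e * d ^ i ∈ ordered a b u c d := by
  simpa using right_mem_ordered (a := a) (b := b) (c := c) (d := d) i e
    (one_mem (Algebra.adjoin ℂ {u}))

lemma c_mul_left (h : Reorder P θ a b u c d 0) (i e : ℕ) :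
    c * (a ^ i * b ^ e) ∈ ordered a b u c d := by
  rcases i with _ | i
  · rcases e with _ | e
    · simpa using right_mem_ordered' (a := a) (b := b) (u := u) (c := c) (d := d) 0 1
    · rw [pow_zero, one_mul, pow_succ', ← mul_assoc]
      refine h.adjoin_mul_ordered h.cb' ?_
      simpa using left_mem_ordered' (a := a) (b := b) (u := u) (c := c) (d := d) 0 e
  · obtain ⟨p, hp, hca⟩ := h.ca'
    rw [pow_succ', mul_assoc, ← mul_assoc, hca, mul_assoc, h.ba_pow]
    exact h.adjoin_mul_ordered hp (Submodule.smul_mem _ _ (left_mem_ordered' _ _))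

lemma d_mul_left (h : Reorder P θ a b u c d 0) (i e : ℕ) :
    d * (a ^ i * b ^ e) ∈ ordered a b u c d := by
  rcases i with _ | i
  · rcases e with _ | e
    · simpa using right_mem_ordered' (a := a) (b := b) (u := u) (c := c) (d := d) 1 0
    · obtain ⟨p, hp, hdb⟩ := h.db'
      rw [pow_zero, one_mul, pow_succ', ← mul_assoc, hdb, mul_assoc]
      have := h.c_mul_left 0 e
      rw [pow_zero, one_mul] at this
      exact h.adjoin_mul_ordered hp this
  · rw [pow_succ', mul_assoc, ← mul_assoc]
    exact h.adjoin_mul_ordered h.da' (left_mem_ordered' _ _)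

/-- Polynomials in u can be moved through all ordered products. A letter multiplied from the left
either joins the block of its own sign or meets the first letter of the opposite block, where one
reordering rule shortens the product. The hypothesis W = 0 makes the weight-zero products
polynomials in u. -/
lemma mul_ordered (h : Reorder P θ a b u c d 0) {x f : A}
    (hx : x = a ∨ x = b ∨ x = u ∨ x = c ∨ x = d) (hf : f ∈ ordered a b u c d) :
    x * f ∈ ordered a b u c d := by
  have right : ∀ {y : A} {s : ℂ}, y * u = s • (u * y) →
      (∀ e i : ℕ, y * (c ^ e * d ^ i) ∈ ordered a b u c d) →
      ∀ i e : ℕ, ∀ p ∈ Algebra.adjoin ℂ {u}, LinearMap.mulLeft ℂ y (p * (c ^ e * d ^ i)) ∈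
        ordered a b u c d := by
    intro y s hy hy2 i e p hp
    obtain ⟨p', hp', e'⟩ := mul_adjoin_swap hy hp
    rw [LinearMap.mulLeft_apply, ← mul_assoc, e', mul_assoc]
    exact h.adjoin_mul_ordered hp' (hy2 _ _)
  have left : ∀ {y : A}, (∀ i e : ℕ, y * (a ^ i * b ^ e) ∈ ordered a b u c d) →
      ∀ i e : ℕ, ∀ p ∈ Algebra.adjoin ℂ {u}, LinearMap.mulLeft ℂ y (a ^ i * b ^ e * p) ∈
        ordered a b u c d := by
    intro y hy2 i e p hp
    rw [LinearMap.mulLeft_apply, ← mul_assoc]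
    exact h.ordered_mul_adjoin hp (hy2 _ _)
  rcases hx with rfl | rfl | rfl | rfl | rfl
  · refine map_ordered (LinearMap.mulLeft ℂ x) (left fun i e => ?_) (right h.au h.a_mul_right) hf
    rw [← mul_assoc, ← pow_succ']
    exact left_mem_ordered' _ _
  · refine map_ordered (LinearMap.mulLeft ℂ x) (left fun i e => ?_) (right h.bu h.b_mul_right) hf
    rw [h.ba_pow]
    exact Submodule.smul_mem _ _ (left_mem_ordered' _ _)
  · exact h.adjoin_mul_ordered (self_mem_adjoin x) hf
  · refine map_ordered (LinearMap.mulLeft ℂ x) (left h.c_mul_left) (right h.cu fun e i => ?_) hf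
    rw [← mul_assoc, ← pow_succ']
    exact right_mem_ordered' _ _
  · refine map_ordered (LinearMap.mulLeft ℂ x) (left h.d_mul_left) (right h.du fun e i => ?_) hf
    rw [h.dc_pow]
    exact Submodule.smul_mem _ _ (right_mem_ordered' _ _)

/-- A subspace that contains the ordered products without repeated odd factors contains all the
ordered products. -/
lemma ordered_le (h : Reorder P θ a b u c d W) {N : Submodule ℂ A}
    (h1 : ∀ i e : ℕ, e < 2 → ∀ p ∈ Algebra.adjoin ℂ {u}, a ^ i * b ^ e * p ∈ N)
    (h2 : ∀ i e : ℕ, e < 2 → ∀ p ∈ Algebra.adjoin ℂ {u}, p * (c ^ e * d ^ i) ∈ N) :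
    ordered a b u c d ≤ N := by
  have g1 : ∀ e i : ℕ, ∀ p ∈ Algebra.adjoin ℂ {u}, a ^ i * b ^ e * p ∈ N := by
    intro e
    induction e using Nat.twoStepInduction with
    | zero => exact fun i => h1 i 0 (by norm_num)
    | one => exact fun i => h1 i 1 (by norm_num)
    | more e ih _ =>
      intro i p hp
      -- The rule b² = a u replaces two odd factors by one a; the new u is moved to the right past
      -- the remaining powers of b.
      obtain ⟨p1, hp1, e1⟩ := adjoin_mul_swap (qcomm_pow_right h.ub e)
        (self_mem_adjoin u)
      rw [pow_add, mul_assoc, mul_assoc, ← mul_assoc (b ^ e), ← pow_add, add_comm e 2, pow_add, pow_two, h.bb, mul_assoc a, e1]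
      have := ih (i + 1) (p1 * p) (mul_mem hp1 hp)
      rw [pow_succ] at this
      simpa only [mul_assoc] using this
  have g2 : ∀ e i : ℕ, ∀ p ∈ Algebra.adjoin ℂ {u}, p * (c ^ e * d ^ i) ∈ N := by
    intro e
    induction e using Nat.twoStepInduction with
    | zero => exact fun i => h2 i 0 (by norm_num)
    | one => exact fun i => h2 i 1 (by norm_num)
    | more e ih _ =>
      intro i p hp
      obtain ⟨p1, hp1, e1⟩ := mul_adjoin_swap (qcomm_pow_left h.cu e)
        (self_mem_adjoin u)
      rw [pow_add, pow_two, h.cc, ← mul_assoc (c ^ e), e1]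
      have := ih (i + 1) (p * p1) (mul_mem hp hp1)
      rw [pow_succ'] at this
      simpa only [mul_assoc] using this
  rw [ordered, Submodule.span_le]
  rintro _ (⟨i, e, p, hp, rfl⟩ | ⟨i, e, p, hp, rfl⟩)
  · exact g1 e i p hp
  · exact g2 e i p hp

end Reorder
end QSphere

namespace QSphere
open SuperAlg

/-! ### Centrality of the radius, its consistent value, and spanning by normally ordered monomials
-/

namespace Deg2
variable (P : Param) (ξ r : ℂ)

lemma eval_mk (R : FreeY → FreeY → Prop) (x : Deg2) :
    eval (fun i => RingQuot.mkAlgHom ℂ R (fy i)) x = RingQuot.mkAlgHom ℂ R (toFree x) := by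
  rw [eval_eq]
  congr 1
  apply FreeAlgebra.hom_ext
  funext i
  exact FreeAlgebra.lift_ι_apply _ _

lemma eval_Y (x : Deg2) : eval (Y P ξ r) x = sphereMk P ξ r x := eval_mk _ x

lemma commRel₂_mem (i) : commRel₂ P ξ i ∈ relations P ξ r := by
  rw [relations, span_relations]; exact comm_mem P ξ r i

lemma sqRel₂_mem (i) : sqRel₂ P ξ i ∈ relations P ξ r := by
  rw [relations, span_relations]; exact sq_mem P ξ r i

lemma constrRel₂_mem (i) : constrRel₂ P ξ i ∈ relations P ξ r := by
  rw [relations, span_relations]; exact constr_mem P ξ r i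

lemma hw_zero_eq (r' : ℂ) : hw P 0 r' 0 = hw P ξ r 0 + (r - r') • e0 := by
  rw [hw_zero, hw_zero]; module

/-- An element without constant term of the span of the relations vanishes as soon as the relations
of degree two other than the radius relation hold. -/
lemma eval_eq_zero {A : Type} [Ring A] [Algebra ℂ A] (y : Fin 5 → A)
    (h : ∀ L : Fin 4, ∀ k < 2 * (L : ℕ) + 1, L ≠ 0 → eval y (rel P ξ 1 L k) = 0) {x : Deg2} (hx : x ∈ relations P ξ 1)
    (hx0 : x.2.2 = 0) : eval y x = 0 := by
  -- The radius is set to 1 so that the constant term l detects the radius relation: l is -1 on it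
  -- and 0 on the other relations. Adding l times the value of the radius relation therefore gives a
  -- map that vanishes on all sixteen relations.
  let l : Deg2 →ₗ[ℂ] ℂ := LinearMap.snd ℂ _ _ ∘ₗ LinearMap.snd ℂ _ _
  have : relations P ξ 1 ≤ LinearMap.ker (eval y + l.smulRight (eval y (hw P ξ 1 0))) := by
    rw [relations, Submodule.span_le]
    rintro _ ⟨⟨L, k⟩, rfl⟩
    have hl : l (rel P ξ 1 L k) = if (k : ℕ) = 0 then (hw P ξ 1 L).2.2 else 0 := by
      rw [rel_eq]; rfl
    by_cases hL : L = 0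
    · subst hL
      have hk : k = 0 := Subsingleton.elim (α := Fin 1) _ _
      subst hk
      change eval y (hw P ξ 1 0) + (-1 : ℂ) • eval y (hw P ξ 1 0) = 0
      module
    · have : l (rel P ξ 1 L k) = 0 := by
        rw [hl]
        have : (hw P ξ 1 L).2.2 = 0 := by
          fin_cases L
          · exact absurd rfl hL
          all_goals rfl
        rw [this, ite_self]
      change eval y (rel P ξ 1 L k) + l (rel P ξ 1 L k) • eval y (hw P ξ 1 0) = 0
      rw [this, h L k k.2 hL, zero_smul, add_zero]
  have := this hx
  change eval y x + x.2.2 • eval y (hw P ξ 1 0) = 0 at this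
  rwa [hx0, zero_smul, add_zero] at this

lemma commRel₂_const (i) : (commRel₂ P ξ i).2.2 = 0 := by
  fin_cases i <;> simp [commRel₂, e2, e1]

lemma sqRel₂_const (i) : (sqRel₂ P ξ i).2.2 = 0 := by
  fin_cases i <;> simp [sqRel₂, e2, e1]

lemma constrRel₂_const (i) : (constrRel₂ P ξ i).2.2 = 0 := by
  fin_cases i <;> simp [constrRel₂, e2, e1]

lemma mk_rel {L : Fin 4} (hL : L ≠ 0) {k : ℕ} (hk : k < 2 * (L : ℕ) + 1) :
    RingQuot.mkAlgHom ℂ (CovRel P ξ) (toFree (rel P ξ 1 L k)) = 0 := by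
  fin_cases L
  · exact absurd rfl hL
  · change RingQuot.mkAlgHom ℂ (CovRel P ξ) (toFree (rel P ξ 1 1 k)) = 0
    rw [toFree_rel_one]
    exact (RingQuot.mkAlgHom_rel ℂ (CovRel.L1 ⟨k, hk⟩)).trans (map_zero _)
  · change RingQuot.mkAlgHom ℂ (CovRel P ξ) (toFree (rel P ξ 1 2 k)) = 0
    rw [toFree_rel_two, map_sub, sub_eq_zero]
    exact RingQuot.mkAlgHom_rel ℂ (CovRel.L2 ⟨k, hk⟩)
  · change RingQuot.mkAlgHom ℂ (CovRel P ξ) (toFree (rel P ξ 1 3 k)) = 0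
    rw [toFree_rel_three]
    exact (RingQuot.mkAlgHom_rel ℂ (CovRel.L3 ⟨k, hk⟩)).trans (map_zero _)

end Deg2

/-- The invariant of degree two commutes with the coordinates. -/
theorem commute_radius (P : Param) (ξ : ℂ) (m : Fin 5) :
    Commute (RingQuot.mkAlgHom ℂ (CovRel P ξ) (EL P 0 0))
      (RingQuot.mkAlgHom ℂ (CovRel P ξ) (fy m)) := by
  have hrel : ∀ L : Fin 4, ∀ k < 2 * (L : ℕ) + 1, L ≠ 0 → Deg2.eval (fun i => RingQuot.mkAlgHom ℂ (CovRel P ξ) (fy i))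
      (Deg2.rel P ξ 1 L k) = 0 := fun L k hk hL => by
    rw [Deg2.eval_mk, Deg2.mk_rel P ξ hL hk]
  have h := commute_invariant P ξ (fun i => RingQuot.mkAlgHom ℂ (CovRel P ξ) (fy i))
    (fun i => Deg2.eval_eq_zero P ξ _ hrel (Deg2.commRel₂_mem P ξ 1 i) (Deg2.commRel₂_const P ξ i))
    (fun i => Deg2.eval_eq_zero P ξ _ hrel (Deg2.sqRel₂_mem P ξ 1 i) (Deg2.sqRel₂_const P ξ i))
    (fun i => Deg2.eval_eq_zero P ξ _ hrel (Deg2.constrRel₂_mem P ξ 1 i)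
      (Deg2.constrRel₂_const P ξ i)) m
  have e : Deg2.eval (fun i => RingQuot.mkAlgHom ℂ (CovRel P ξ) (fy i))
      (Deg2.hw P 0 (radiusOf P ξ) 0) =
      RingQuot.mkAlgHom ℂ (CovRel P ξ) (EL P 0 0) - algebraMap ℂ _ (radiusOf P ξ) := by
    have : Deg2.toFree (Deg2.hw P 0 (radiusOf P ξ) 0) = radiusRel P (radiusOf P ξ) :=
      Deg2.toFree_rel_zero P 0 _
    rw [Deg2.eval_mk, this, radiusRel, map_sub, map_smul, map_one, Algebra.algebraMap_eq_smul_one]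
  rw [e] at h
  have := h.add_left (Algebra.commutes (radiusOf P ξ) (RingQuot.mkAlgHom ℂ (CovRel P ξ) (fy m)))
  rwa [sub_add_cancel] at this

section Sphere
variable (P : Param) (ξ r : ℂ)

/-- Imposing E⁰₀ = r turns the deviation W into the scalar r - r(ξ). -/
lemma reorder_sphere : Reorder P (P.theta ξ) (P.scl • Y P ξ r 0) (Y P ξ r 1)
    (Y P ξ r 2 - P.theta ξ • 1) (Y P ξ r 3) (P.scl • Y P ξ r 4)
    ((r - radiusOf P ξ) • (1 : Sphere P ξ r)) := by
  have h := reorder_of_relations P ξ (Y P ξ r)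
    (fun i => by rw [Deg2.eval_Y, Deg2.sphereMk_relations]; exact Deg2.commRel₂_mem P ξ r i)
    (fun i => by rw [Deg2.eval_Y, Deg2.sphereMk_relations]; exact Deg2.sqRel₂_mem P ξ r i)
    (fun i => by rw [Deg2.eval_Y, Deg2.sphereMk_relations]; exact Deg2.constrRel₂_mem P ξ r i)
  have e := Deg2.sphereMk_rel P ξ r 0 0
  rw [← Deg2.eval_Y, Deg2.rel, Function.iterate_zero_apply] at e
  rwa [Deg2.hw_zero_eq P ξ r, map_add, map_smul, Deg2.eval_e0, e, zero_add] at h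

/-- Y₂ annihilates the scalar r - r(ξ), and Y₂, the normally ordered monomial with index (2, 0), is
nonzero by independence. -/
lemma radius_of_linearIndependent (h : LinearIndependent ℂ (normalMon P ξ r)) :
    r = radiusOf P ξ := by
  have h1 := (reorder_sphere P ξ r).aW
  rw [smul_mul_smul_comm, mul_one, smul_eq_zero] at h1
  have h2 : Y P ξ r 0 ≠ 0 := by
    have := h.ne_zero ((2, 0) : ℤ × ℕ)
    simpa [normalMon] using this
  have := h1.resolve_right h2
  exact sub_eq_zero.1 ((mul_eq_zero.1 this).resolve_left P.scl_ne)

/-- At the consistent value of the radius, every element is a combination of normally ordered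
monomials. -/
theorem span_normalMon :
    Submodule.span ℂ (Set.range (normalMon P ξ (radiusOf P ξ))) = ⊤ := by
  have h := reorder_sphere P ξ (radiusOf P ξ)
  rw [sub_self, zero_smul] at h
  set N := Submodule.span ℂ (Set.range (normalMon P ξ (radiusOf P ξ))) with hN
  have hs := P.scl_ne
  -- Polynomials in the shifted coordinate are polynomials in Y₀, so ordered products expand into
  -- normally ordered monomials.
  have hz : ∀ p ∈ Algebra.adjoin ℂ {Y P ξ (radiusOf P ξ) 2 - P.theta ξ • 1},
      ∃ f : Polynomial ℂ, p = Polynomial.aeval (Y P ξ (radiusOf P ξ) 2) f := by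
    intro p hp
    have : Algebra.adjoin ℂ {Y P ξ (radiusOf P ξ) 2 - P.theta ξ • 1} ≤
        (Polynomial.aeval (R := ℂ) (Y P ξ (radiusOf P ξ) 2)).range := by
      refine Algebra.adjoin_le ?_
      rintro _ rfl
      exact ⟨Polynomial.X - Polynomial.C (P.theta ξ), by
        simp [Algebra.algebraMap_eq_smul_one]⟩
    obtain ⟨f, hf⟩ := this hp
    exact ⟨f, hf.symm⟩
  have key : ordered (P.scl • Y P ξ (radiusOf P ξ) 0) (Y P ξ _ 1)
      (Y P ξ _ 2 - P.theta ξ • 1) (Y P ξ _ 3) (P.scl • Y P ξ _ 4) ≤ N := by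
    refine h.ordered_le (fun i e he p hp => ?_) (fun i e he p hp => ?_)
    · obtain ⟨f, rfl⟩ := hz p hp
      rw [Polynomial.aeval_eq_sum_range, Finset.mul_sum]
      refine Submodule.sum_mem _ fun k _ => ?_
      rw [smul_pow, smul_mul_assoc, smul_mul_smul_comm]
      refine Submodule.smul_mem _ _ (Submodule.subset_span ⟨((2 * i + e : ℕ), k), ?_⟩)
      have e1 : (2 * i + e) / 2 = i := by omega
      have e2 : (2 * i + e) % 2 = e := by omega
      simp only [normalMon, Int.toNat_natCast, e1, e2, Int.toNat_neg_natCast]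
      simp
    · obtain ⟨f, rfl⟩ := hz p hp
      rw [Polynomial.aeval_eq_sum_range, Finset.sum_mul]
      refine Submodule.sum_mem _ fun k _ => ?_
      rw [smul_pow, mul_smul_comm, smul_mul_smul_comm]
      refine Submodule.smul_mem _ _ (Submodule.subset_span ⟨(-(2 * i + e : ℕ), k), ?_⟩)
      have e1 : (2 * i + e) / 2 = i := by omega
      have e2 : (2 * i + e) % 2 = e := by omega
      simp only [normalMon, neg_neg, Int.toNat_natCast, e1, e2, Int.toNat_neg_natCast]
      simp [mul_assoc]
  have h1 : (1 : Sphere P ξ (radiusOf P ξ)) ∈ ordered (P.scl • Y P ξ (radiusOf P ξ) 0) (Y P ξ _ 1)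
      (Y P ξ _ 2 - P.theta ξ • 1) (Y P ξ _ 3) (P.scl • Y P ξ _ 4) := by
    simpa using Reorder.left_mem_ordered' (a := P.scl • Y P ξ (radiusOf P ξ) 0)
      (b := Y P ξ _ 1) (u := Y P ξ _ 2 - P.theta ξ • 1) (c := Y P ξ _ 3)
      (d := P.scl • Y P ξ _ 4) 0 0
  rw [eq_top_iff]
  rintro x -
  refine key ?_
  obtain ⟨x, rfl⟩ := RingQuot.mkAlgHom_surjective ℂ _ x
  suffices hx : ∀ f ∈ ordered (P.scl • Y P ξ (radiusOf P ξ) 0) (Y P ξ _ 1)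
      (Y P ξ _ 2 - P.theta ξ • 1) (Y P ξ _ 3) (P.scl • Y P ξ _ 4),
      RingQuot.mkAlgHom ℂ _ x * f ∈ ordered (P.scl • Y P ξ (radiusOf P ξ) 0) (Y P ξ _ 1)
      (Y P ξ _ 2 - P.theta ξ • 1) (Y P ξ _ 3) (P.scl • Y P ξ _ 4) by
    simpa using hx 1 h1
  induction x using FreeAlgebra.induction with
  | grade0 s =>
    intro f hf
    rw [AlgHom.commutes, ← Algebra.smul_def]
    exact Submodule.smul_mem _ _ hf
  | grade1 i =>
    intro f hf
    change Y P ξ (radiusOf P ξ) i * f ∈ _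
    fin_cases i
    · have := h.mul_ordered (.inl rfl) hf
      rw [smul_mul_assoc] at this
      exact (Submodule.smul_mem_iff _ hs).1 this
    · exact h.mul_ordered (.inr (.inl rfl)) hf
    · have := h.mul_ordered (.inr (.inr (.inl rfl))) hf
      rw [sub_mul, smul_mul_assoc, one_mul] at this
      exact (Submodule.sub_mem_iff_left _ (Submodule.smul_mem _ _ hf)).1 this
    · exact h.mul_ordered (.inr (.inr (.inr (.inl rfl)))) hf
    · have := h.mul_ordered (.inr (.inr (.inr (.inr rfl)))) hf
      rw [smul_mul_assoc] at this
      exact (Submodule.smul_mem_iff _ hs).1 this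
  | mul x y hx hy =>
    intro f hf
    rw [map_mul, mul_assoc]
    exact hx _ (hy _ hf)
  | add x y hx hy =>
    intro f hf
    rw [map_add, add_mul]
    exact Submodule.add_mem _ (hx _ hf) (hy _ hf)

end Sphere
end QSphere

namespace QSphere
open SuperAlg

/-! ### Homomorphisms out of the covariant algebra -/

section Lift
variable {P : Param} {ξ r : ℂ} {A : Type} [Ring A] [Algebra ℂ A]

/-- The homomorphism out of the covariant algebra defined by a solution of its relations. -/
def sphereLift (y : Fin 5 → A) (h : ∀ i, Deg2.eval y (Deg2.nice P ξ r i) = 0) :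
    Sphere P ξ r →ₐ[ℂ] A :=
  RingQuot.liftAlgHom ℂ ⟨FreeAlgebra.lift ℂ y, by
    intro x x' hx
    have hp : x - x' ∈ {z : FreeY | ∃ x y, SphereRel P ξ r x y ∧ z = x - y} := ⟨x, x', hx, rfl⟩
    rw [Deg2.relations_eq] at hp
    obtain ⟨p, hp⟩ := hp
    rw [← sub_eq_zero, ← map_sub, ← hp, ← Deg2.eval_eq]
    have : Submodule.span ℂ (Set.range (Deg2.nice P ξ r)) ≤ LinearMap.ker (Deg2.eval y) := by
      rw [Submodule.span_le]
      rintro _ ⟨i, rfl⟩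
      exact h i
    exact this (Deg2.rel_mem_nice P ξ r _ _)⟩

lemma sphereLift_Y (y : Fin 5 → A) (h : ∀ i, Deg2.eval y (Deg2.nice P ξ r i) = 0) (i : Fin 5) :
    sphereLift y h (Y P ξ r i) = y i := by
  rw [sphereLift, Y, RingQuot.liftAlgHom_mkAlgHom_apply, fy, FreeAlgebra.lift_ι_apply]

lemma sphere_induction {p : Sphere P ξ r → Prop} (hs : ∀ c, p (algebraMap ℂ _ c))
    (hY : ∀ i, p (Y P ξ r i)) (hmul : ∀ x y, p x → p y → p (x * y))
    (hadd : ∀ x y, p x → p y → p (x + y)) (x : Sphere P ξ r) : p x := by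
  obtain ⟨x, rfl⟩ := RingQuot.mkAlgHom_surjective ℂ _ x
  induction x using FreeAlgebra.induction with
  | grade0 s => rw [AlgHom.commutes]; exact hs s
  | grade1 i => exact hY i
  | mul x y hx hy => rw [map_mul]; exact hmul _ _ hx hy
  | add x y hx hy => rw [map_add]; exact hadd _ _ hx hy

end Lift

/-! ### Classical points and their orbit maps -/

section Point
variable (P : Param) (s₁ s₃ : ℂ)

/-- The coordinates of a classical point of the supersphere. -/
def pointY : Fin 5 → ℂ := ![s₁ ^ 2, 0, -(P.k1 / P.k2 * s₁ * s₃), 0, s₃ ^ 2]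

lemma chi_xiOf : chi P (xiOf P s₁ s₃) = P.k1 / P.k2 * s₁ * s₃ * (1 - P.q) / P.q ^ 2 := by
  have h1 := P.q_sq_add_q_add_one_ne
  have h2 := P.q_ne
  have h3 := P.k1_ne
  have h4 := P.k2_ne
  rw [chi, xiOf, div_eq_div_iff (mul_ne_zero (mul_ne_zero h3 (pow_ne_zero _ h2)) h1)
    (pow_ne_zero _ h2)]
  field_simp
  ring

/-- The shift θ is the value of Y₀ at the classical point. So the shifted coordinate vanishes there,
as do the odd ones, which makes the relations compatible with commuting values. -/
lemma theta_xiOf : P.theta (xiOf P s₁ s₃) = -(P.k1 / P.k2 * s₁ * s₃) := by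
  have h1 := P.q_sub_one_ne
  have h2 := P.q_ne
  rw [Param.theta, chi_xiOf]
  field_simp
  ring

lemma eval_pointY (i) : Deg2.eval (pointY P s₁ s₃)
    (Deg2.nice P (xiOf P s₁ s₃) (radiusOf P (xiOf P s₁ s₃)) i) = 0 := by
  have h0 := P.t_ne
  have h1 := P.k1_sq'
  have h2 := P.k2_sq'
  have h3 := P.k2_ne
  have h4 := P.k1_ne
  have hχ := chi_xiOf P s₁ s₃
  have hr := radiusOf_eq P (xiOf P s₁ s₃)
  rw [theta_xiOf] at hr
  rcases i with i | i | i | i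
  · change Deg2.eval _ (Deg2.commRel₂ P _ i) = 0
    fin_cases i <;> simp [Deg2.commRel₂, Deg2.eval_e2, Deg2.eval_e1, pointY, hχ, Param.q] <;>
      field_simp <;> grind
  · change Deg2.eval _ (Deg2.sqRel₂ P _ i) = 0
    fin_cases i <;> simp [Deg2.sqRel₂, Deg2.eval_e2, Deg2.eval_e1, pointY, hχ, Param.q] <;>
      field_simp <;> grind
  · change Deg2.eval _ (Deg2.constrRel₂ P _ i) = 0
    fin_cases i <;> simp [Deg2.constrRel₂, Deg2.eval_e2, Deg2.eval_e1, pointY, hχ, Param.q] <;>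
      field_simp <;> grind
  · change Deg2.eval _ (Deg2.hw P (xiOf P s₁ s₃) _ 0) = 0
    rw [Deg2.hw_zero]
    simp [Deg2.eval_e2, Deg2.eval_e0, pointY, hr, Param.q]
    field_simp
    grind

/-- The character of the covariant algebra at a classical point. -/
def character : Sphere P (xiOf P s₁ s₃) (radiusOf P (xiOf P s₁ s₃)) →ₐ[ℂ] ℂ :=
  sphereLift (pointY P s₁ s₃) (eval_pointY P s₁ s₃)

/-- The odd coordinates are sent to zero, so the character vanishes on odd elements. It can
therefore be applied to the left factor of the graded tensor product without signs. -/
lemma character_par (x : Sphere P (xiOf P s₁ s₃) (radiusOf P (xiOf P s₁ s₃))) :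
    character P s₁ s₃ (par x) = character P s₁ s₃ x := by
  induction x using sphere_induction with
  | hs c => rw [AlgHom.commutes]
  | hY i =>
    rw [par_Y, map_smul, character, sphereLift_Y]
    fin_cases i <;> simp [pointY, sg, Even.neg_one_pow (n := 4) (by decide)]
  | hmul x y hx hy => rw [map_mul, map_mul, map_mul, hx, hy]
  | hadd x y hx hy => rw [map_add, map_add, map_add, hx, hy]

/-- The orbit map of a classical point. -/
def orbit : Sphere P (xiOf P s₁ s₃) (radiusOf P (xiOf P s₁ s₃)) →ₐ[ℂ] OSp P :=
  (GradedTensorProduct.lift (gr _) (gr (OSp P))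
    ((Algebra.ofId ℂ (OSp P)).comp (character P s₁ s₃)) (AlgHom.id ℂ (OSp P)) (by
      intro i j a b
      obtain ⟨a, ha⟩ := a
      change algebraMap ℂ _ (character P s₁ s₃ a) * (b : OSp P) =
        (-1 : ℤˣ) ^ (j * i) • ((b : OSp P) * algebraMap ℂ _ (character P s₁ s₃ a))
      fin_cases i
      · rw [Algebra.commutes]
        change _ = (-1 : ℤˣ) ^ (j * (0 : ZMod 2)) • _
        rw [mul_zero, uzpow_zero, one_smul]
      · have h1 := mem_gr_one.1 ha
        have h2 := character_par P s₁ s₃ a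
        rw [h1, map_neg] at h2
        have h3 : character P s₁ s₃ a = 0 := self_eq_neg.1 h2.symm
        rw [h3, map_zero, zero_mul, mul_zero]
        exact (smul_zero ((-1 : ℤˣ) ^ (j * (1 : ZMod 2)))).symm)).comp (sphereCo P _ _)

lemma orbit_Y (k : Fin 5) : orbit P s₁ s₃ (Y P _ _ k) = coordX P s₁ s₃ k := by
  rw [orbit, AlgHom.comp_apply, sphereCo_Y, map_sum, Fin.sum_univ_five]
  simp only [GradedTensorProduct.lift_tmul, AlgHom.comp_apply, character, sphereLift_Y, pointY]
  simp [coordX, Algebra.ofId_apply, Algebra.algebraMap_eq_smul_one]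
  module

end Point

/-! ### Invariance of the image of the orbit map -/

section Characterization
variable (P : Param) (s₁ s₃ : ℂ)

lemma actPR_mul (f g : OSp P) :
    actPR P s₁ s₃ (f * g) = actPR P s₁ s₃ f * tau P g + sig P f * actPR P s₁ s₃ g :=
  odot_mul P _ _ f g

lemma actPR_one : actPR P s₁ s₃ 1 = 0 := odot_one P _ _

lemma actPR_mul_eq_zero {f g : OSp P} (hf : actPR P s₁ s₃ f = 0) (hg : actPR P s₁ s₃ g = 0) :
    actPR P s₁ s₃ (f * g) = 0 := by
  rw [actPR_mul, hf, hg, zero_mul, mul_zero, add_zero]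

/-- Only the rows of weight ±1 appear in the result. In each of them the contribution of the
extremal row cancels that of the middle row, which is what the coefficient κ₁/κ₂ is chosen for. -/
lemma actPR_coordX (k : Fin 5) : actPR P s₁ s₃ (coordX P s₁ s₃ k) = 0 := by
  have h := P.k2_ne
  rw [coordX, actPR, map_add, map_sub, map_smul, map_smul, map_smul, odot_T2, odot_T2, odot_T2,
    rep2_oddPrim]
  simp only [Fin.sum_univ_five]
  simp
  match_scalars <;> field_simp <;> ring

lemma rowFlip_T2 (i j : Fin 5) : rowFlip P (T2 P i j) = sg i • T2 P i j := by
  have h : ∀ N : Fin 5, sg ((lead N).1 + 1) * sg ((lead N).2 + 1) = sg N := by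
    intro N; fin_cases N <;> norm_num [lead, sg]
  simp only [T2_eq, map_smul, map_sum, map_TT, rowFlip_T1]
  have e : ∀ k l i j, TT (fun i j => sg (i + 1) • T1 P i j) k l i j =
      (sg (k + 1) * sg (l + 1)) • TT (T1 P) k l i j := by
    intro k l i j
    simp only [TT, smul_mul_smul_comm, smul_smul]
    congr 1
    ring
  simp only [e, h, Finset.smul_sum, smul_smul]
  refine Finset.sum_congr rfl fun k _ => Finset.sum_congr rfl fun l _ => ?_
  congr 1
  ring

lemma rowFlip_coordX (k : Fin 5) : rowFlip P (coordX P s₁ s₃ k) = coordX P s₁ s₃ k := by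
  rw [coordX, map_add, map_sub, map_smul, map_smul, map_smul, rowFlip_T2, rowFlip_T2, rowFlip_T2]
  norm_num [sg]

lemma orbit_invariant (x : Sphere P (xiOf P s₁ s₃) (radiusOf P (xiOf P s₁ s₃))) :
    actPR P s₁ s₃ (orbit P s₁ s₃ x) = 0 ∧ rowFlip P (orbit P s₁ s₃ x) = orbit P s₁ s₃ x := by
  induction x using sphere_induction with
  | hs c =>
    rw [AlgHom.commutes, AlgHom.commutes, Algebra.algebraMap_eq_smul_one, map_smul, actPR_one,
      smul_zero]
    exact ⟨rfl, rfl⟩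
  | hY i => rw [orbit_Y]; exact ⟨actPR_coordX P s₁ s₃ i, rowFlip_coordX P s₁ s₃ i⟩
  | hmul x y hx hy =>
    rw [map_mul, map_mul (rowFlip P), hx.2, hy.2]
    exact ⟨actPR_mul_eq_zero P s₁ s₃ hx.1 hy.1, rfl⟩
  | hadd x y hx hy =>
    rw [map_add, map_add, map_add, hx.2, hy.2, hx.1, hy.1]
    exact ⟨add_zero _, rfl⟩

/-- Every value of the parameter occurs in the realization. -/
lemma exists_xiOf (ξ : ℂ) : ∃ s₁ s₃ : ℂ, s₁ ≠ 0 ∧ xiOf P s₁ s₃ = ξ := by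
  have h1 := P.k1_ne
  have h2 := P.k2_ne
  have h3 : 1 - P.q ^ 3 ≠ 0 := by
    have := P.t_pow_ne 6 (by norm_num)
    rw [Param.q, ← pow_mul]
    exact fun h => this (by linear_combination -h)
  refine ⟨1, ξ * P.k2 / (P.k1 ^ 2 * (1 - P.q ^ 3)), one_ne_zero, ?_⟩
  rw [xiOf]
  field_simp

end Characterization
end QSphere

namespace QSphere
open SuperAlg

/-! ### Top components of normally ordered monomials and their independence -/

/-- The normally ordered monomials in five elements. -/
def ordMon {A : Type} [Ring A] (y : Fin 5 → A) (p : ℤ × ℕ) : A :=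
  y 0 ^ (p.1.toNat / 2) * y 1 ^ (p.1.toNat % 2) * y 2 ^ p.2 *
    y 3 ^ ((-p.1).toNat % 2) * y 4 ^ ((-p.1).toNat / 2)

lemma normalMon_eq (P : Param) (ξ r : ℂ) : normalMon P ξ r = ordMon (Y P ξ r) := rfl

lemma map_ordMon {A B : Type} [Ring A] [Algebra ℂ A] [Ring B] [Algebra ℂ B] (F : A →ₐ[ℂ] B)
    (y : Fin 5 → A) (p : ℤ × ℕ) : F (ordMon y p) = ordMon (fun i => F (y i)) p := by
  simp only [ordMon, map_mul, map_pow]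

/-- The degree of a normally ordered monomial. -/
def monDeg (p : ℤ × ℕ) : ℕ :=
  p.1.toNat / 2 + p.1.toNat % 2 + p.2 + (-p.1).toNat % 2 + (-p.1).toNat / 2

/-- The order of a normally ordered monomial. -/
def monOrd (p : ℤ × ℕ) : ℕ :=
  p.1.toNat % 2 + 2 * p.2 + 3 * ((-p.1).toNat % 2) + 4 * ((-p.1).toNat / 2)

/-- The weight is 2 `monDeg p` - `monOrd p`, and together with the degree it determines the exponent
of Y₀. -/
lemma mon_ext {p p' : ℤ × ℕ} (h1 : monDeg p = monDeg p') (h2 : monOrd p = monOrd p') : p = p' := by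
  obtain ⟨w, b⟩ := p
  obtain ⟨w', b'⟩ := p'
  simp only [monDeg, monOrd] at h1 h2
  rw [Prod.mk.injEq]
  omega

/-- In degree n the orders fill the whole range 0, …, 4n, which is what `mem_span_of_highest`
requires in weight 2n. -/
lemma exists_mon {n k : ℕ} (h : k ≤ 4 * n) : ∃ p, monDeg p = n ∧ monOrd p = k := by
  -- The weight has to be w = 2n - k. The factors other than Y₀ number |w|/2 rounded up, and the
  -- rest of the degree is the exponent of Y₀.
  refine ⟨(2 * n - k, n - ((2 * n - k : ℤ).natAbs + 1) / 2), ?_, ?_⟩ <;>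
    simp only [monDeg, monOrd] <;> omega

section Top
variable {P : Param}

/-- The highest weight component has weight `N` and order `k`. -/
def HasTop (f : OSp P) (N k : ℕ) : Prop :=
  (∀ m : ℤ, N < m → comp P m f = 0) ∧ HasOrder (comp P N f) k

lemma comp_T2_mul (m j : Fin 5) (n : ℤ) (f : OSp P) :
    comp P n (T2 P m j * f) = T2 P m j * comp P (n - 2 + (m : ℕ)) f := by
  have h := comp_map (P := P) (L := LinearMap.mulLeft ℂ (T2 P m j)) (s := 2 - (m : ℕ))
    (fun n f hf => by
      have := mul_mem_wt (T2_mem_wt P m j) hf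
      rwa [add_comm] at this) (n - 2 + (m : ℕ)) f
  rw [LinearMap.mulLeft_apply, LinearMap.mulLeft_apply] at h
  rw [← h]
  congr 2
  ring

lemma comp_coordX_mul (s₁ s₃ : ℂ) (j : Fin 5) (n : ℤ) (f : OSp P) :
    comp P n (coordX P s₁ s₃ j * f) = s₁ ^ 2 • (T2 P 0 j * comp P (n - 2) f) -
      (P.k1 / P.k2 * s₁ * s₃) • (T2 P 2 j * comp P n f) +
      s₃ ^ 2 • (T2 P 4 j * comp P (n + 2) f) := by
  rw [coordX, add_mul, sub_mul, smul_mul_assoc, smul_mul_assoc, smul_mul_assoc, map_add, map_sub,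
    map_smul, map_smul, map_smul, comp_T2_mul, comp_T2_mul, comp_T2_mul]
  congr 4
  · norm_num
  · norm_num
  · norm_num; ring_nf

/-- The top row of the adjoint matrix consists of nonzero multiples of products of two entries of
the first row of `T1`, each of which raises the order by its column index. -/
lemma HasOrder.T2_mul {f : OSp P} {k : ℕ} (h : HasOrder f k) (j : Fin 5) :
    HasOrder (T2 P 0 j * f) (k + j) := by
  have h1 := P.k1_ne
  have h3 := P.k3_ne
  have key : ∀ i l : Fin 3, HasOrder (T1 P 0 i * T1 P 0 l * f) (k + l + i) := fun i l => by
    rw [mul_assoc]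
    exact (h.mul_zero l).mul_zero i
  fin_cases j
  · exact key 0 0
  · have := (key 0 1).smul h1
    rwa [← smul_mul_assoc] at this
  · have := (key 0 2).smul h3
    rwa [← smul_mul_assoc] at this
  · have := (key 1 2).smul h1
    rwa [← smul_mul_assoc] at this
  · exact key 2 2

lemma hasTop_one : HasTop (1 : OSp P) 0 0 := by
  refine ⟨fun m hm => comp_of_mem_ne one_mem_wt (by simpa using hm.ne), ?_⟩
  rw [Nat.cast_zero, comp_of_mem one_mem_wt]
  exact hasOrder_one

/-- Only the summand of X_j from the row of weight 2 reaches weight N + 2. Its coefficient is g₁,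
whence the hypothesis on s₁. -/
lemma HasTop.coordX_mul {s₁ : ℂ} (hs : s₁ ≠ 0) (s₃ : ℂ) (j : Fin 5) {f : OSp P} {N k : ℕ}
    (h : HasTop f N k) : HasTop (coordX P s₁ s₃ j * f) (N + 2) (k + j) := by
  have e : ((N + 2 : ℕ) : ℤ) = N + 2 := by push_cast; rfl
  refine ⟨fun m hm => ?_, ?_⟩
  · rw [e] at hm
    rw [comp_coordX_mul, h.1 _ (by omega), h.1 _ (by omega), h.1 _ (by omega)]
    simp
  · rw [e, comp_coordX_mul, add_sub_cancel_right, h.1 (N + 2) (by omega),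
      h.1 (N + 2 + 2) (by omega), mul_zero, mul_zero, smul_zero, smul_zero, sub_zero, add_zero]
    exact (h.2.T2_mul j).smul (pow_ne_zero 2 hs)

lemma HasTop.coordX_pow_mul {s₁ : ℂ} (hs : s₁ ≠ 0) (s₃ : ℂ) (j : Fin 5) {f : OSp P} {N k : ℕ}
    (h : HasTop f N k) (i : ℕ) :
    HasTop (coordX P s₁ s₃ j ^ i * f) (N + 2 * i) (k + j * i) := by
  induction i with
  | zero => simpa using h
  | succ i ih =>
    have := ih.coordX_mul hs s₃ j
    rw [← mul_assoc, ← pow_succ'] at this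
    rwa [show N + 2 * (i + 1) = N + 2 * i + 2 by ring,
      show k + (j : ℕ) * (i + 1) = k + j * i + j by ring]

lemma hasTop_ordMon {s₁ : ℂ} (hs : s₁ ≠ 0) (s₃ : ℂ) (p : ℤ × ℕ) :
    HasTop (ordMon (coordX P s₁ s₃) p) (2 * monDeg p) (monOrd p) := by
  have h := ((((hasTop_one (P := P).coordX_pow_mul hs s₃ 4 ((-p.1).toNat / 2)).coordX_pow_mul hs s₃ 3
    ((-p.1).toNat % 2)).coordX_pow_mul hs s₃ 2 p.2).coordX_pow_mul hs s₃ 1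
    (p.1.toNat % 2)).coordX_pow_mul hs s₃ 0 (p.1.toNat / 2)
  simp only [← mul_assoc, mul_one] at h
  have e1 : 2 * monDeg p = 0 + 2 * ((-p.1).toNat / 2) + 2 * ((-p.1).toNat % 2) + 2 * p.2 +
      2 * (p.1.toNat % 2) + 2 * (p.1.toNat / 2) := by simp only [monDeg]; ring
  have e2 : monOrd p = 0 + 4 * ((-p.1).toNat / 2) + 3 * ((-p.1).toNat % 2) + 2 * p.2 +
      1 * (p.1.toNat % 2) + 0 * (p.1.toNat / 2) := by simp only [monOrd]; ring
  rw [e1, e2]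
  exact h

/-- The images of the normally ordered monomials are linearly independent. -/
theorem linearIndependent_ordMon (s₁ s₃ : ℂ) (hs : s₁ ≠ 0) :
    LinearIndependent ℂ (ordMon (coordX P s₁ s₃)) := by
  classical
  rw [linearIndependent_iff']
  intro s g hg
  by_contra hne
  push Not at hne
  obtain ⟨p, hp, hp0⟩ := hne
  -- Take a monomial of maximal degree among those with nonzero coefficient. In the component of
  -- weight twice this degree only monomials of the same degree survive, and the functional attached
  -- to the order of p isolates p among them.
  obtain ⟨p, hp, hmax⟩ := (s.filter fun p => g p ≠ 0).exists_max_image monDeg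
    ⟨p, Finset.mem_filter.2 ⟨hp, hp0⟩⟩
  rw [Finset.mem_filter] at hp
  have h := congrArg (fun f => phi P (monOrd p) (comp P ((2 * monDeg p : ℕ) : ℤ) f)) hg
  simp only [map_sum, map_smul, map_zero] at h
  rw [Finset.sum_eq_single p] at h
  · have := ((hasTop_ordMon (P := P) hs s₃ p).2.2 (monOrd p)).2 rfl
    exact hp.2 ((smul_eq_zero.1 h).resolve_right this)
  · intro p' hp' hne
    by_cases hg0 : g p' = 0
    · rw [hg0, zero_smul]
    have hle := hmax p' (Finset.mem_filter.2 ⟨hp', hg0⟩)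
    have ht := hasTop_ordMon (P := P) hs s₃ p'
    rcases hle.lt_or_eq with hlt | heq
    · rw [ht.1 _ (by exact_mod_cast (by omega : 2 * monDeg p' < 2 * monDeg p)), map_zero, smul_zero]
    · rw [← heq]
      have : monOrd p ≠ monOrd p' := fun e => hne (mon_ext heq e.symm)
      rw [not_not.1 (mt (ht.2.2 (monOrd p)).1 this), smul_zero]
  · exact fun h => absurd hp.1 h

end Top
end QSphere

namespace QSphere
open SuperAlg

/-! ### The invariants are spanned by the ordered monomials -/

section Invariants
variable {P : Param}

lemma exists_top {f : OSp P} (hf : f ≠ 0) :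
    ∃ n, comp P n f ≠ 0 ∧ ∀ m, n < m → comp P m f = 0 := by
  classical
  have h1 : ∀ n, comp P n f ≠ 0 → n ∈ (DirectSum.decompose (wt P) f).support := by
    intro n hn
    rw [DFinsupp.mem_support_iff]
    intro h
    exact hn (by rw [comp_apply, h]; rfl)
  have h2 : ∃ n, comp P n f ≠ 0 := by
    by_contra h
    push Not at h
    exact hf (eq_zero_of_comp h)
  obtain ⟨n, hn⟩ := h2
  obtain ⟨n, hn, hmax⟩ := ((DirectSum.decompose (wt P) f).support.filter
    fun n => comp P n f ≠ 0).exists_max_image id ⟨n, Finset.mem_filter.2 ⟨h1 n hn, hn⟩⟩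
  refine ⟨n, (Finset.mem_filter.1 hn).2, fun m hm => ?_⟩
  by_contra h
  exact absurd (hmax m (Finset.mem_filter.2 ⟨h1 m h, h⟩)) (not_le.2 hm)

/-- An entry of row i has weight 1 - i and is multiplied by (-1)^(i+1), so ρ is the sign of the row
weight. Invariance under ρ thus means that only even weights occur. -/
lemma rowFlip_comp (n : ℤ) (f : OSp P) : rowFlip P (comp P n f) = (-1 : ℂ) ^ n • comp P n f := by
  let M : Submodule ℂ (OSp P) := ⨅ n : ℤ, LinearMap.ker
    ((rowFlip P).toLinearMap ∘ₗ comp P n - (-1 : ℂ) ^ n • comp P n)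
  have hM : ∀ f, f ∈ M ↔ ∀ n : ℤ, rowFlip P (comp P n f) = (-1 : ℂ) ^ n • comp P n f := by
    intro f; simp [M, sub_eq_zero]
  refine (hM f).1 (OSp.submodule_induction ?_ ?_ f) n
  · rw [hM]
    intro n
    rcases eq_or_ne n 0 with rfl | hn
    · rw [comp_of_mem one_mem_wt, map_one, zpow_zero, one_smul]
    · rw [comp_of_mem_ne one_mem_wt hn.symm, map_zero, smul_zero]
  · intro i j f hf
    rw [hM] at *
    intro n
    have h := comp_map (P := P) (L := LinearMap.mulLeft ℂ (T1 P i j)) (s := 1 - (i : ℕ))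
      (fun n f hf => by
        have := mul_mem_wt (T1_mem_wt i j) hf
        rwa [add_comm] at this) (n - 1 + (i : ℕ)) f
    rw [show n - 1 + (i : ℕ) + (1 - (i : ℕ)) = n by ring] at h
    simp only [LinearMap.mulLeft_apply] at h
    rw [h, map_mul, rowFlip_T1, hf, smul_mul_smul_comm]
    congr 1
    have h1 : ((-1 : ℂ)) ≠ 0 := by norm_num
    rw [sg, ← zpow_natCast, ← zpow_add₀ h1,
      show (((i : ℕ) + 1 : ℕ) : ℤ) + (n - 1 + (i : ℕ)) = n + 2 * (i : ℕ) by push_cast; ring,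
      zpow_add₀ h1, zpow_mul]
    norm_num

/-- Compare components of weight n + 1 in s₁ v₋f = s₃ v₊f: the right-hand side comes from the
component of weight n + 2 of f, which is zero. -/
lemma Dm_top {s₁ s₃ : ℂ} (hs : s₁ ≠ 0) {f : OSp P} (hf : actPR P s₁ s₃ f = 0) {n : ℤ}
    (hn : ∀ m, n < m → comp P m f = 0) : Dm P (comp P n f) = 0 := by
  have h1 := comp_map (P := P) (L := Dm P) (s := 1) (fun n f hf => Dm_mem_wt hf) n f
  have h2 := comp_map (P := P) (L := Dp P) (s := -1) (fun n f hf => Dp_mem_wt hf) (n + 2) f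
  rw [show n + 2 + -1 = n + 1 by ring, hn (n + 2) (by omega), map_zero] at h2
  have h := congrArg (comp P (n + 1)) hf
  rw [actPR_eq, map_sub, map_smul, map_smul, h1, h2, smul_zero, sub_zero, map_zero] at h
  exact (smul_eq_zero.1 h).resolve_left hs

lemma ordMon_invariant (s₁ s₃ : ℂ) (p : ℤ × ℕ) :
    actPR P s₁ s₃ (ordMon (coordX P s₁ s₃) p) = 0 ∧
      rowFlip P (ordMon (coordX P s₁ s₃) p) = ordMon (coordX P s₁ s₃) p := by
  have := orbit_invariant P s₁ s₃ (normalMon P _ _ p)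
  rw [normalMon_eq, map_ordMon] at this
  simpa only [orbit_Y] using this

/-- The invariants of bounded degree are combinations of the images of the normally ordered
monomials. -/
lemma mem_span_ordMon {s₁ : ℂ} (hs : s₁ ≠ 0) (s₃ : ℂ) (n : ℕ) {f : OSp P}
    (hf : actPR P s₁ s₃ f = 0) (hf' : rowFlip P f = f) (hn : ∀ m : ℤ, n ≤ m → comp P m f = 0) :
    f ∈ Submodule.span ℂ (Set.range (ordMon (coordX P s₁ s₃))) := by
  induction n generalizing f with
  | zero =>
    by_cases h0 : f = 0
    · rw [h0]; exact zero_mem _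
    -- The top component would be a highest weight vector, hence of nonnegative weight, while no
    -- such component is present.
    · obtain ⟨m, hm, hm'⟩ := exists_top h0
      have := (highest_weight (comp_mem m f) (Dm_top hs hf hm') hm).1
      exact absurd (hn m (by simpa using this)) hm
  | succ n ih =>
    have hn1 : ∀ m : ℤ, (n : ℤ) < m → comp P m f = 0 := fun m hm => hn m (by push_cast; omega)
    by_cases h0 : comp P n f = 0
    · refine ih hf hf' fun m hm => ?_
      rcases hm.lt_or_eq with h | rfl
      · exact hn1 m h
      · exact h0
    have hrow : rowFlip P (comp P n f) = comp P n f := by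
      have hc := comp_map (P := P) (L := (rowFlip P).toLinearMap) (s := 0) (fun n g hg => by
        have := rowFlip_comp (P := P) n g
        rw [comp_of_mem hg] at this
        rw [add_zero, AlgHom.toLinearMap_apply, this]
        exact Submodule.smul_mem _ _ hg) n f
      rw [add_zero, AlgHom.toLinearMap_apply, AlgHom.toLinearMap_apply, hf'] at hc
      exact hc.symm
    -- For odd n the component would equal its own negative, as ρ fixes it and acts on it by (-1)^n.
    have heven : Even n := by
      by_contra hodd
      have h := rowFlip_comp (P := P) n f
      rw [hrow, zpow_natCast, (Nat.not_even_iff_odd.1 hodd).neg_one_pow] at h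
      have h2 : (2 : ℂ) • comp P n f = 0 := by
        rw [two_smul]; nth_rewrite 1 [h]; module
      exact h0 ((smul_eq_zero.1 h2).resolve_left two_ne_zero)
    obtain ⟨p, rfl⟩ := heven.two_dvd
    -- The monomials of degree p supply one highest weight vector of weight 2p for every order 0, …,
    -- 4p, so their top components span all highest weight vectors of this weight.
    choose mon hmon using fun k : Fin (2 * (2 * p) + 1) =>
      exists_mon (n := p) (k := k) (by have := k.2; omega)
    have htop : ∀ k, HasTop (ordMon (coordX P s₁ s₃) (mon k)) (2 * p) k := by
      intro k
      have := hasTop_ordMon (P := P) hs s₃ (mon k)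
      rwa [(hmon k).1, (hmon k).2] at this
    have hspan := mem_span_of_highest (comp_mem (P := P) ((2 * p : ℕ) : ℤ) f)
      (Dm_top hs hf hn1)
      (fun k => comp P ((2 * p : ℕ) : ℤ) (ordMon (coordX P s₁ s₃) (mon k)))
      (fun k => comp_mem _ _)
      (fun k => Dm_top hs (ordMon_invariant s₁ s₃ (mon k)).1 (htop k).1) (fun k => (htop k).2)
    obtain ⟨c, hc⟩ := (Submodule.mem_span_range_iff_exists_fun ℂ).1 hspan
    have hg : ∑ k, c k • ordMon (coordX P s₁ s₃) (mon k) ∈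
        Submodule.span ℂ (Set.range (ordMon (coordX P s₁ s₃))) :=
      Submodule.sum_mem _ fun k _ => Submodule.smul_mem _ _ (Submodule.subset_span ⟨_, rfl⟩)
    -- Subtracting the combination with the same top component leaves an invariant with a smaller
    -- top weight.
    rw [← sub_add_cancel f (∑ k, c k • ordMon (coordX P s₁ s₃) (mon k))]
    refine add_mem (ih ?_ ?_ fun m hm => ?_) hg
    · rw [map_sub, map_sum, hf, zero_sub, neg_eq_zero]
      exact Finset.sum_eq_zero fun k _ => by
        rw [map_smul, (ordMon_invariant s₁ s₃ _).1, smul_zero]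
    · rw [map_sub, map_sum, hf']
      simp only [map_smul, (ordMon_invariant s₁ s₃ _).2]
    · rw [map_sub, map_sum]
      simp only [map_smul]
      rcases hm.lt_or_eq with h | rfl
      · rw [hn1 m h, zero_sub, neg_eq_zero]
        exact Finset.sum_eq_zero fun k _ => by rw [(htop k).1 m h, smul_zero]
      · rw [hc, sub_self]

theorem span_ordMon {s₁ : ℂ} (hs : s₁ ≠ 0) (s₃ : ℂ) {f : OSp P} (hf : actPR P s₁ s₃ f = 0)
    (hf' : rowFlip P f = f) : f ∈ Submodule.span ℂ (Set.range (ordMon (coordX P s₁ s₃))) := by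
  by_cases h0 : f = 0
  · rw [h0]; exact zero_mem _
  obtain ⟨m, hm, hm'⟩ := exists_top h0
  obtain ⟨n, rfl⟩ := Int.eq_ofNat_of_zero_le
    (highest_weight (comp_mem m f) (Dm_top hs hf hm') hm).1
  exact mem_span_ordMon hs s₃ (n + 1) hf hf' fun m hm => hm' m (by push_cast at hm; omega)

lemma range_orbit_le (s₁ s₃ : ℂ) {f : OSp P}
    (hf : f ∈ Submodule.span ℂ (Set.range (ordMon (coordX P s₁ s₃)))) :
    f ∈ (orbit P s₁ s₃).range := by
  have : Submodule.span ℂ (Set.range (ordMon (coordX P s₁ s₃))) ≤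
      Subalgebra.toSubmodule (orbit P s₁ s₃).range := by
    rw [Submodule.span_le]
    rintro _ ⟨p, rfl⟩
    refine ⟨normalMon P _ _ p, ?_⟩
    rw [normalMon_eq]
    simp only [AlgHom.toRingHom_eq_coe, RingHom.coe_coe, map_ordMon, orbit_Y]
  exact this hf

lemma orbit_injective (s₁ s₃ : ℂ) (h : LinearIndependent ℂ (ordMon (coordX P s₁ s₃))) :
    Function.Injective (orbit P s₁ s₃) := by
  rw [injective_iff_map_eq_zero]
  intro x hx
  have hx' : x ∈ Submodule.span ℂ (Set.range (normalMon P _ _)) := by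
    rw [span_normalMon]; trivial
  rw [Finsupp.mem_span_range_iff_exists_finsupp] at hx'
  obtain ⟨c, rfl⟩ := hx'
  rw [map_finsuppSum] at hx
  simp only [map_smul, normalMon_eq, map_ordMon, orbit_Y] at hx
  rw [linearIndependent_iff.1 h c hx, Finsupp.sum_zero_index]

/-- Every ξ is realized at a point with s₁ ≠ 0, and there the images under the orbit map are already
independent. -/
lemma linearIndependent_normalMon (P : Param) (ξ : ℂ) :
    LinearIndependent ℂ (normalMon P ξ (radiusOf P ξ)) := by
  obtain ⟨s₁, s₃, hs, rfl⟩ := exists_xiOf P ξ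
  have e : ⇑(orbit P s₁ s₃).toLinearMap ∘ normalMon P _ _ = ordMon (coordX P s₁ s₃) := by
    funext p
    simp only [Function.comp_apply, AlgHom.toLinearMap_apply, normalMon_eq, map_ordMon, orbit_Y]
  refine LinearIndependent.of_comp (orbit P s₁ s₃).toLinearMap ?_
  rw [e]
  exact linearIndependent_ordMon s₁ s₃ hs

theorem consistent_iff (P : Param) (ξ r : ℂ) : Consistent P ξ r ↔ r = radiusOf P ξ := by
  refine ⟨fun h => radius_of_linearIndependent P ξ r h.1, ?_⟩
  rintro rfl
  exact ⟨linearIndependent_normalMon P ξ, span_normalMon P ξ⟩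

end Invariants
end QSphere

namespace QSphere
open SuperAlg MulOpposite

/-! ### The half-turn of the fundamental corepresentation -/

lemma sg_congr {m n : ℕ} (h : (m + n) % 2 = 0) : sg m = sg n := by
  have h1 : sg m * sg n = 1 := by
    rw [← sg_add, sg, (Nat.even_iff.2 h).neg_one_pow]
  have h2 := sg_mul_self n
  calc sg m = sg m * (sg n * sg n) := by rw [h2, mul_one]
    _ = sg n := by rw [← mul_assoc, h1, one_mul]

lemma sum_rev {G : Type} [AddCommMonoid G] (F : Fin 3 → Fin 3 → G) :
    ∑ i, ∑ j, F (Fin.rev j) (Fin.rev i) = ∑ i, ∑ j, F i j := by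
  rw [Finset.sum_comm, ← Equiv.sum_comp Fin.revPerm]
  refine Finset.sum_congr rfl fun i _ => ?_
  rw [← Equiv.sum_comp Fin.revPerm]
  simp

section Turn
variable (P : Param)

lemma cg0_rev (i j : Fin 3) : cg0 P j.rev i.rev = cg0 P i j := by
  fin_cases i <;> fin_cases j <;> simp [cg0, Fin.rev]

lemma cg0_parity (i j : Fin 3) : cg0 P i j = 0 ∨ (i + j : ℕ) % 2 = 0 := by
  fin_cases i <;> fin_cases j <;> simp [cg0]

lemma cg1_rev (M i j : Fin 3) : cg1 P M.rev j.rev i.rev = sg (M + 1) * cg1 P M i j := by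
  fin_cases M <;> fin_cases i <;> fin_cases j <;> norm_num [cg1, Fin.rev, sg]

lemma cg1_parity (M i j : Fin 3) : cg1 P M i j = 0 ∨ (i + j + 1 + M : ℕ) % 2 = 0 := by
  fin_cases M <;> fin_cases i <;> fin_cases j <;> simp [cg1]

lemma rev_mul_parity : ∀ i j : Fin 3,
    (((j.rev : Fin 3) * (i.rev : Fin 3) : ℕ) + (i * j : ℕ)) % 2 = 0 := by decide

lemma cg0'_rev (i j : Fin 3) : cg0' P j.rev i.rev = cg0' P i j := by
  rw [cg0', cg0', cg0_rev, sg_congr (rev_mul_parity i j)]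

lemma cg1'_rev (M i j : Fin 3) : cg1' P M.rev j.rev i.rev = sg (M + 1) * cg1' P M i j := by
  have e : ∀ M i j : Fin 3, (((j.rev : Fin 3) * (i.rev : Fin 3) + (M.rev : Fin 3) : ℕ) +
    (i * j + M : ℕ)) % 2 = 0 := by decide
  rw [cg1', cg1', cg1_rev, sg_congr (e M i j), mul_left_comm]

/-- The matrix obtained by a half-turn of the fundamental corepresentation matrix, with entries in
the opposite algebra. -/
def turnT (i j : Fin 3) : (OSp P)ᵐᵒᵖ := op (sg (i * (j + 1)) • T1 P i.rev j.rev)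

lemma TT_turnT (k l i j : Fin 3) : TT (turnT P) k l i j =
    op (sg ((i + j + 1) * (k + l)) • TT (T1 P) l.rev k.rev j.rev i.rev) := by
  have e : ∀ k l i j : Fin 3, ((((k + i) * l + k * (i + 1) + l * (j + 1) : ℕ)) +
      ((i + j + 1) * (k + l) +
        ((l.rev : Fin 3) + (j.rev : Fin 3)) * (k.rev : Fin 3) : ℕ)) % 2 = 0 := by decide
  have h := sg_congr (e k l i j)
  simp only [sg_add] at h
  simp only [TT, turnT, ← op_mul, ← op_smul, smul_mul_smul_comm, smul_smul]
  rw [← h]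
  congr 2
  ring

/-- Reversing all three index values and exchanging the two tensor factors preserves the coupling
coefficients up to signs. These coefficients are supported on index pairs of fixed parity, so every
sign can be rewritten in terms of the outer indices. The equations for the half-turned matrix are
then the original ones read backwards. -/
lemma turnT_law : ProductLaw P (turnT P) := by
  have T := T1_law P
  constructor
  · intro k l
    have e : ∀ i j, cg0 P i j • TT (turnT P) k l i j =
        op (sg (k + l) • (cg0 P j.rev i.rev • TT (T1 P) l.rev k.rev j.rev i.rev)) := by
      intro i j
      rw [TT_turnT, cg0_rev, smul_comm, op_smul, op_smul, op_smul, smul_smul, smul_smul]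
      congr 1
      rcases cg0_parity P i j with h | h
      · rw [h, zero_mul, zero_mul]
      · rw [sg_congr (show ((i + j + 1) * (k + l) + (k + l) : ℕ) % 2 = 0 by
          rw [← Nat.succ_mul, show (i + j + 1 : ℕ).succ = i + j + 2 by omega]
          exact Nat.even_iff.1 ((Nat.even_iff.2 (by omega)).mul_right _)), mul_comm]
    simp only [e, ← Finset.op_sum, ← Finset.smul_sum]
    rw [sum_rev fun i j => cg0 P i j • TT (T1 P) l.rev k.rev i j, T.col0, cg0_rev, smul_smul,
      cg0_hom]
    rfl
  · intro i j
    have e : ∀ k l, cg0' P k l • TT (turnT P) k l i j =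
        op (cg0' P l.rev k.rev • TT (T1 P) l.rev k.rev j.rev i.rev) := by
      intro k l
      rw [TT_turnT, cg0'_rev, op_smul, op_smul, smul_smul]
      congr 1
      rw [cg0']
      rcases cg0_parity P k l with h | h
      · rw [h, mul_zero, zero_mul]
      · rw [sg_congr (m := (i + j + 1) * (k + l)) (n := 0) (by
          rw [add_zero]; exact Nat.even_iff.1 ((Nat.even_iff.2 h).mul_left _)), sg_zero, mul_one]
    simp only [e, ← Finset.op_sum]
    rw [sum_rev fun k l => cg0' P k l • TT (T1 P) k l j.rev i.rev, T.row0, cg0'_rev]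
    rfl
  · intro k l M
    have e : ∀ i j, cg1 P M i j • TT (turnT P) k l i j =
        op ((sg (M * (k + l)) * sg (M + 1)) •
          (cg1 P M.rev j.rev i.rev • TT (T1 P) l.rev k.rev j.rev i.rev)) := by
      intro i j
      rw [TT_turnT, cg1_rev, op_smul, op_smul, op_smul, smul_smul, smul_smul]
      congr 1
      rcases cg1_parity P M i j with h | h
      · rw [h]; ring
      · have : sg ((i + j + 1) * (k + l)) = sg (M * (k + l)) :=
          sg_congr (by rw [← add_mul]; exact Nat.even_iff.1 ((Nat.even_iff.2 h).mul_right _))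
        rw [this]
        linear_combination (-cg1 P M i j * sg (M * (k + l))) * sg_mul_self (M + 1)
    simp only [e, ← Finset.op_sum, ← Finset.smul_sum]
    rw [sum_rev fun i j => cg1 P M.rev i j • TT (T1 P) l.rev k.rev i j, T.col1,
      ← Equiv.sum_comp Fin.revPerm]
    simp only [Fin.revPerm_apply, Finset.smul_sum, Finset.op_sum]
    refine Finset.sum_congr rfl fun N _ => ?_
    rw [turnT, cg1_rev]
    simp only [op_smul, smul_smul]
    congr 1
    rcases cg1_parity P N k l with h | h
    · rw [h]; ring
    · have e1 : ∀ M N k l : Fin 3, (k + l + 1 + N : ℕ) % 2 = 0 →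
        (((M * (k + l) + (M + 1) + (N + 1) + ((N.rev : Fin 3) + (M.rev : Fin 3)) : ℕ)) +
          (N + M + N * (M + 1) : ℕ)) % 2 = 0 := by decide
      have := sg_congr (e1 M N k l h)
      simp only [sg_add] at this ⊢
      linear_combination (cg1 P N k l) * this
  · intro i j M
    have e : ∀ k l, cg1' P M k l • TT (turnT P) k l i j =
        op ((sg ((i + j + 1) * (M + 1)) * sg (M + 1)) •
          (cg1' P M.rev l.rev k.rev • TT (T1 P) l.rev k.rev j.rev i.rev)) := by
      intro k l
      rw [TT_turnT, cg1'_rev, op_smul, op_smul, op_smul, smul_smul, smul_smul]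
      congr 1
      rw [cg1']
      rcases cg1_parity P M k l with h | h
      · rw [h]; ring
      · have : sg ((i + j + 1) * (k + l)) = sg ((i + j + 1) * (M + 1)) :=
          sg_congr (by
            rw [← mul_add]
            exact Nat.even_iff.1 ((Nat.even_iff.2 (by omega)).mul_left _))
        rw [this]
        linear_combination (-(sg (k * l + M) * cg1 P M k l) * sg ((i + j + 1) * (M + 1))) * sg_mul_self (M + 1)
    simp only [e, ← Finset.op_sum, ← Finset.smul_sum]
    rw [sum_rev fun k l => cg1' P M.rev k l • TT (T1 P) k l j.rev i.rev, T.row1,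
      ← Equiv.sum_comp Fin.revPerm]
    simp only [Fin.revPerm_apply, Finset.smul_sum, Finset.op_sum]
    refine Finset.sum_congr rfl fun N _ => ?_
    rw [turnT, cg1'_rev]
    simp only [op_smul, smul_smul]
    congr 1
    rw [cg1']
    rcases cg1_parity P N i j with h | h
    · rw [h]; ring
    · have e1 : ∀ M N i j : Fin 3, (i + j + 1 + N : ℕ) % 2 = 0 →
        ((((i + j + 1) * (M + 1) + (M + 1) + (N + 1) + ((M.rev : Fin 3) + (N.rev : Fin 3)) : ℕ)) +
          (M + N + M * (N + 1) : ℕ)) % 2 = 0 := by decide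
      have := sg_congr (e1 M N i j h)
      simp only [sg_add] at this ⊢
      linear_combination (sg (i * j) * sg N * cg1 P N i j) * this

end Turn
end QSphere

namespace QSphere
open SuperAlg MulOpposite

/-! ### The half-turn anti-automorphism and the case of vanishing √g₁ -/

section Turn
variable (P : Param)

/-- The anti-automorphism induced by the half-turn of the fundamental corepresentation matrix. -/
def turn : OSp P →ₗ[ℂ] OSp P :=
  (MulOpposite.opLinearEquiv ℂ).symm.toLinearMap ∘ₗ
    (OSp.lift (turnT P) (turnT_law P)).toLinearMap

lemma turn_one : turn P 1 = 1 := by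
  change unop (OSp.lift (turnT P) (turnT_law P) 1) = 1
  rw [map_one, unop_one]

lemma turn_mul (f g : OSp P) : turn P (f * g) = turn P g * turn P f := by
  change unop (OSp.lift (turnT P) (turnT_law P) (f * g)) = _
  rw [map_mul, unop_mul]
  rfl

lemma turn_pow (f : OSp P) (n : ℕ) : turn P (f ^ n) = turn P f ^ n := by
  change unop (OSp.lift (turnT P) (turnT_law P) (f ^ n)) = _
  rw [map_pow, unop_pow]
  rfl

lemma turn_T1 (i j : Fin 3) : turn P (T1 P i j) = sg (i * (j + 1)) • T1 P i.rev j.rev := by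
  change unop (OSp.lift (turnT P) (turnT_law P) (T1 P i j)) = _
  rw [OSp.lift_T1]
  rfl

lemma turn_turn (f : OSp P) : turn P (turn P f) = f := by
  refine (LinearMap.mem_ker.1 ?_ : (turn P ∘ₗ turn P - LinearMap.id : OSp P →ₗ[ℂ] OSp P) f = 0) |> sub_eq_zero.1
  refine OSp.submodule_induction ?_ ?_ f
  · simp [turn_one]
  · intro i j f hf
    rw [LinearMap.mem_ker, LinearMap.sub_apply, sub_eq_zero] at *
    simp only [LinearMap.comp_apply, LinearMap.id_apply] at *
    rw [turn_mul, turn_mul, hf, turn_T1, map_smul, turn_T1, smul_smul]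
    have e : ∀ i j : Fin 3, ((i * (j + 1) : ℕ) + ((i.rev : Fin 3) * ((j.rev : Fin 3) + 1) : ℕ)) % 2 = 0 := by
      decide
    rw [← sg_congr (e i j), sg_mul_self, one_smul, Fin.rev_rev, Fin.rev_rev]

lemma algHom_turn {F G : OSp P →ₐ[ℂ] OSp P}
    (h : ∀ i j, F (turn P (T1 P i j)) = turn P (G (T1 P i j))) (f : OSp P) :
    F (turn P f) = turn P (G f) := by
  refine (LinearMap.mem_ker.1 ?_ : (F.toLinearMap ∘ₗ turn P - turn P ∘ₗ G.toLinearMap) f = 0) |>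
    sub_eq_zero.1
  refine OSp.submodule_induction ?_ ?_ f
  · simp [turn_one]
  · intro i j f hf
    rw [LinearMap.mem_ker, LinearMap.sub_apply, sub_eq_zero] at *
    simp only [LinearMap.comp_apply, AlgHom.toLinearMap_apply] at *
    rw [turn_mul, map_mul, map_mul, turn_mul, hf, h]

lemma sg_rev (i : Fin 3) : sg (i.rev : Fin 3) = sg i := by
  have e : ∀ i : Fin 3, ((i.rev : Fin 3) + i : ℕ) % 2 = 0 := by decide
  exact sg_congr (e i)

lemma rowFlip_turn (f : OSp P) : rowFlip P (turn P f) = turn P (rowFlip P f) := by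
  refine algHom_turn P (fun i j => ?_) f
  rw [turn_T1, map_smul, rowFlip_T1, rowFlip_T1, map_smul, turn_T1, smul_comm, sg_add, sg_rev,
    sg_add (i : ℕ)]

/-- Reversing the row index exchanges t and t⁻¹, hence `sig` and `tau` up to the parity contained in
the latter. -/
lemma turn_tau (f : OSp P) : turn P (tau P f) = par (sig P (turn P f)) := by
  refine ((algHom_turn P (F := (par (A := OSp P)).comp (sig P)) (G := tau P) (fun i j => ?_) f).symm)
  have h0 := P.t_ne
  rw [turn_T1, AlgHom.comp_apply, map_smul, map_smul, sig_T1, map_smul, par_T1, tau_T1, map_smul,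
    turn_T1, smul_smul, smul_smul, smul_smul, sg_add, sg_rev, sg_rev, sg_add (i : ℕ)]
  congr 1
  fin_cases i <;> simp [Fin.rev] <;> ring

lemma turn_sig (f : OSp P) : turn P (sig P f) = par (tau P (turn P f)) := by
  refine ((algHom_turn P (F := (par (A := OSp P)).comp (tau P)) (G := sig P) (fun i j => ?_) f).symm)
  have h0 := P.t_ne
  rw [turn_T1, AlgHom.comp_apply, map_smul, map_smul, tau_T1, map_smul, par_T1, sig_T1, map_smul,
    turn_T1, smul_smul, smul_smul, smul_smul, sg_add, sg_rev, sg_rev]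
  congr 1
  have h1 := sg_mul_self i
  have h2 := sg_mul_self j
  have e : sg (i : ℕ) * sg (j : ℕ) * (sg (i : ℕ) * sg (j : ℕ)) = 1 := by
    linear_combination (sg (j : ℕ) * sg (j : ℕ)) * h1 + h2
  have e' : ![P.t⁻¹, 1, P.t] i.rev = ![P.t, 1, P.t⁻¹] i := by fin_cases i <;> rfl
  rw [e']
  linear_combination (sg (i * (j + 1)) * ![P.t, 1, P.t⁻¹] i) * e

/-- The half-turn reverses products and exchanges the twists up to parity, so it carries the Leibniz
rule of v₊ to that of v₋. On the entries it reverses the rows, along which v₊ and v₋ move in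
opposite directions. -/
lemma Dm_turn (f : OSp P) : Dm P (turn P f) = -par (turn P (Dp P f)) := by
  refine (LinearMap.mem_ker.1 ?_ : (Dm P ∘ₗ turn P + (par (A := OSp P)).toLinearMap ∘ₗ turn P ∘ₗ Dp P) f = 0) |>
    eq_neg_of_add_eq_zero_left
  refine OSp.submodule_induction ?_ ?_ f
  · simp [turn_one, Dm_one, Dp_one]
  · intro i j f hf
    have hT : Dm P (turn P (T1 P i j)) + par (turn P (Dp P (T1 P i j))) = 0 := by
      have h1 := sg_mul_self j
      have h2 := sg_rev j
      fin_cases i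
      · change Dm P (turn P (T1 P 0 j)) + par (turn P (Dp P (T1 P 0 j))) = 0
        rw [turn_T1, Dp_T1_zero, map_smul, map_smul, map_smul, turn_T1, map_smul]
        change _ • Dm P (T1 P 2 j.rev) + _ • _ • par (T1 P 1 j.rev) = 0
        rw [Dm_T1_two, par_T1, smul_smul, smul_smul, smul_smul, ← add_smul]
        refine (congrArg (· • _) ?_).trans (zero_smul ℂ _)
        rw [sg_add _ (j.rev : ℕ), h2]
        simp [sg_add, sg_one, sg_zero]
        linear_combination (sg j * P.nu) * h1
      · change Dm P (turn P (T1 P 1 j)) + par (turn P (Dp P (T1 P 1 j))) = 0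
        rw [turn_T1, Dp_T1_one, map_smul, map_smul, map_smul, turn_T1, map_smul]
        change _ • Dm P (T1 P 1 j.rev) + _ • _ • par (T1 P 0 j.rev) = 0
        rw [Dm_T1_one, par_T1, smul_smul, smul_smul, smul_smul, ← add_smul]
        refine (congrArg (· • _) ?_).trans (zero_smul ℂ _)
        rw [sg_add _ (j.rev : ℕ), h2]
        simp [sg_add, sg_one, sg_two_mul, sg_zero]
        ring
      · change Dm P (turn P (T1 P 2 j)) + par (turn P (Dp P (T1 P 2 j))) = 0
        rw [turn_T1, Dp_T1_two, map_smul]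
        change _ • Dm P (T1 P 0 j.rev) + _ = 0
        rw [Dm_T1_zero]
        simp
    rw [LinearMap.mem_ker, LinearMap.add_apply] at *
    simp only [LinearMap.comp_apply, AlgHom.toLinearMap_apply] at *
    rw [turn_mul, Dm_mul, Dp_mul, map_add, turn_mul, turn_mul, turn_tau, turn_sig, map_add, map_mul,
      map_mul, par_par, par_par]
    calc _ = (Dm P (turn P f) + par (turn P (Dp P f))) * tau P (turn P (T1 P i j)) +
          sig P (turn P f) * (Dm P (turn P (T1 P i j)) + par (turn P (Dp P (T1 P i j)))) := by
          rw [add_mul, mul_add]; abel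
      _ = 0 := by rw [hf, hT, zero_mul, mul_zero, add_zero]

lemma turn_T2 (j : Fin 5) : turn P (T2 P 0 j) = T2 P 4 j.rev := by
  fin_cases j <;> simp [T2, turn_mul, turn_T1, sg, Fin.rev]

lemma turn_coordX (j : Fin 5) {s₃ : ℂ} (hs : s₃ ≠ 0) :
    turn P (coordX P 1 0 j) = (s₃ ^ 2)⁻¹ • coordX P 0 s₃ j.rev := by
  have h : coordX P 1 0 j = T2 P 0 j := by simp [coordX]
  have h' : coordX P 0 s₃ j.rev = s₃ ^ 2 • T2 P 4 j.rev := by simp [coordX]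
  rw [h, h', turn_T2, smul_smul, inv_mul_cancel₀ (pow_ne_zero 2 hs), one_smul]

/-- The reversal of products and the exchange of Y_m with Y_{-m} together preserve normal ordering:
a monomial goes to the one of opposite weight with the same power of Y₀. Each factor contributes one
rescaling by g₃⁻¹, so the exponent is the degree. -/
lemma turn_ordMon {s₃ : ℂ} (hs : s₃ ≠ 0) (p : ℤ × ℕ) :
    turn P (ordMon (coordX P 1 0) p) =
      (s₃ ^ 2)⁻¹ ^ monDeg p • ordMon (coordX P 0 s₃) (-p.1, p.2) := by
  simp only [ordMon, turn_mul, turn_pow, turn_coordX P _ hs, smul_pow, neg_neg]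
  simp only [smul_mul_smul_comm, ← mul_assoc]
  simp only [monDeg]
  rw [← pow_add, ← pow_add, ← pow_add, ← pow_add]
  congr 2
  omega

lemma linearIndependent_ordMon_zero {s₃ : ℂ} (hs : s₃ ≠ 0) :
    LinearIndependent ℂ (ordMon (coordX P 0 s₃)) := by
  have h := (linearIndependent_ordMon (P := P) 1 0 one_ne_zero).map' (turn P)
    (LinearMap.ker_eq_bot_of_inverse (g := turn P) (LinearMap.ext (turn_turn P)))
  have hc : ∀ p, (s₃ ^ 2) ^ monDeg p ≠ 0 := fun p => pow_ne_zero _ (pow_ne_zero _ hs)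
  have h' := h.units_smul fun p => Units.mk0 _ (hc p)
  let e : ℤ × ℕ ≃ ℤ × ℕ := (Equiv.neg ℤ).prodCongr (Equiv.refl ℕ)
  refine (linearIndependent_equiv e).1 ?_
  have he : ordMon (coordX P 0 s₃) ∘ e =
      (fun p => Units.mk0 _ (hc p)) • (⇑(turn P) ∘ ordMon (coordX P 1 0)) := by
    funext p
    rw [Pi.smul_apply', Function.comp_apply, Function.comp_apply, turn_ordMon P hs, Units.smul_def,
      Units.val_mk0, smul_smul, ← mul_pow, mul_inv_cancel₀ (pow_ne_zero 2 hs), one_pow, one_smul]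
    rfl
  rw [he]
  exact h'

/-- For s₁ = 0 invariance means that v₊ kills f. Then v₋ kills the half-turn of f, which is the case
(s₁, s₃) = (1, 0); turning back gives the claim because the half-turn is an involution. -/
lemma span_ordMon_zero {s₃ : ℂ} (hs : s₃ ≠ 0) {f : OSp P} (hf : actPR P 0 s₃ f = 0)
    (hf' : rowFlip P f = f) : f ∈ Submodule.span ℂ (Set.range (ordMon (coordX P 0 s₃))) := by
  have h1 : Dp P f = 0 := by
    rw [actPR_eq, zero_smul, zero_sub, neg_eq_zero] at hf
    exact (smul_eq_zero.1 hf).resolve_left hs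
  have h2 : turn P f ∈ Submodule.span ℂ (Set.range (ordMon (coordX P 1 0))) := by
    refine span_ordMon one_ne_zero 0 ?_ (by rw [rowFlip_turn, hf'])
    rw [actPR_eq, Dm_turn, h1, map_zero, map_zero, neg_zero, smul_zero, zero_smul, sub_zero]
  rw [← turn_turn P f]
  have : Submodule.span ℂ (Set.range (ordMon (coordX P 1 0))) ≤
      (Submodule.span ℂ (Set.range (ordMon (coordX P 0 s₃)))).comap (turn P) := by
    rw [Submodule.span_le]
    rintro _ ⟨p, rfl⟩
    rw [SetLike.mem_coe, Submodule.mem_comap, turn_ordMon P hs]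
    exact Submodule.smul_mem _ _ (Submodule.subset_span ⟨_, rfl⟩)
  exact this h2

theorem orbit_injective_of_ne {s₁ s₃ : ℂ} (hs : s₁ ≠ 0 ∨ s₃ ≠ 0) :
    Function.Injective (orbit P s₁ s₃) := by
  refine orbit_injective s₁ s₃ ?_
  by_cases h : s₁ = 0
  · subst h
    exact linearIndependent_ordMon_zero P (hs.resolve_left fun h => h rfl)
  · exact linearIndependent_ordMon s₁ s₃ h

theorem mem_range_orbit {s₁ s₃ : ℂ} (hs : s₁ ≠ 0 ∨ s₃ ≠ 0) (f : OSp P) :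
    f ∈ (orbit P s₁ s₃).range ↔ actPR P s₁ s₃ f = 0 ∧ rowFlip P f = f := by
  constructor
  · rintro ⟨x, rfl⟩
    exact orbit_invariant P s₁ s₃ x
  · rintro ⟨hf, hf'⟩
    refine range_orbit_le s₁ s₃ ?_
    by_cases h : s₁ = 0
    · subst h
      exact span_ordMon_zero P (hs.resolve_left fun h => h rfl) hf hf'
    · exact span_ordMon h s₃ hf hf'

end Turn
end QSphere

end

theorem mainTheorem4 (P : Param) :
    -- `T⁽²⁾(0)` is a corepresentation matrix, dual to the adjoint representation
    ((∀ i j : Fin 5, coprod P (T2 P i j) = ∑ k, T2 P i k ᵍ⊗ₜ[ℂ] T2 P k j) ∧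
      (∀ i j : Fin 5, counit P (T2 P i j) = if i = j then 1 else 0) ∧
      (∀ (x y : ℂ) (i j : Fin 5), pairHom P x y (T2 P i j) =
        !![rep2 P (ugen P .K) i j, sg i * rep2 P (oddPrim P x y) i j;
          0, rep2 P (ugen P .Kinv) i j])) ∧
    -- covariance under the right coaction through `T⁽²⁾(0)`
    (∀ ξ r : ℂ, ∃ φ : Sphere P ξ r →ₐ[ℂ] (gr (Sphere P ξ r) ᵍ⊗[ℂ] gr (OSp P)),
      ∀ m, φ (Y P ξ r m) = ∑ n, Y P ξ r n ᵍ⊗ₜ[ℂ] T2 P n m) ∧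
    -- the sixteen relations, regrouped by linear combinations
    (∀ ξ r : ℂ,
      Submodule.span ℂ {z : FreeY | ∃ x y, SphereRel P ξ r x y ∧ z = x - y} =
          Submodule.span ℂ ({radiusRel P r} ∪ Set.range (commRel P ξ) ∪ Set.range (sqRel P ξ) ∪
            Set.range (constrRel P ξ)) ∧
        Module.finrank ℂ
          (Submodule.span ℂ {z : FreeY | ∃ x y, SphereRel P ξ r x y ∧ z = x - y}) = 16) ∧
    -- consistency (a): the radius commutes with the coordinates
    (∀ (ξ : ℂ) (m : Fin 5),
      Commute (RingQuot.mkAlgHom ℂ (CovRel P ξ) (EL P 0 0))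
        (RingQuot.mkAlgHom ℂ (CovRel P ξ) (fy m))) ∧
    -- consistency (b): unique normal ordering
    (∀ ξ r : ℂ, Consistent P ξ r ↔ r = radiusOf P ξ) ∧
    -- the realization in `OSp_q(1|2)` and its infinitesimal characterization
    (∀ s₁ s₃ : ℂ, (s₁ ≠ 0 ∨ s₃ ≠ 0) →
      (∀ k, actPR P s₁ s₃ (coordX P s₁ s₃ k) = 0) ∧
      actPR P s₁ s₃ 1 = 0 ∧
      (∀ a b, actPR P s₁ s₃ a = 0 → actPR P s₁ s₃ b = 0 → actPR P s₁ s₃ (a * b) = 0) ∧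
      ∃ Φ : Sphere P (xiOf P s₁ s₃) (radiusOf P (xiOf P s₁ s₃)) →ₐ[ℂ] OSp P,
        (∀ k, Φ (Y P _ _ k) = coordX P s₁ s₃ k) ∧
        Function.Injective Φ ∧
        ∀ a : OSp P, a ∈ Φ.range ↔ actPR P s₁ s₃ a = 0 ∧ rowFlip P a = a) ∧
    -- every value of the parameter occurs in the realization
    (∀ ξ : ℂ, ∃ s₁ s₃ : ℂ, (s₁ ≠ 0 ∨ s₃ ≠ 0) ∧ xiOf P s₁ s₃ = ξ) := by
  exact ⟨⟨coprod_T2 P, counit_T2 P, pairHom_T2 P⟩, fun ξ r => ⟨sphereCo P ξ r, sphereCo_Y P ξ r⟩,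
    fun ξ r => ⟨Deg2.span_regrouped P ξ r, Deg2.finrank_span_relations P ξ r⟩,
    commute_radius P, consistent_iff P,
    fun s₁ s₃ hs => ⟨actPR_coordX P s₁ s₃, actPR_one P s₁ s₃,
      fun _ _ => actPR_mul_eq_zero P s₁ s₃,
      orbit P s₁ s₃, orbit_Y P s₁ s₃, orbit_injective_of_ne P hs, mem_range_orbit P hs⟩,
    fun ξ => (exists_xiOf P ξ).imp fun _ h => h.imp fun _ h => ⟨.inl h.1, h.2⟩⟩
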